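/- A finite Markov decision process (MDP) is $\mathcal M=(S,A,\delta)$ with finite sets $S$ (states), $A$ (actions) and a partial function $\delta$ from $S\times A$ to the rational probability distributions on $S$, such that in every state some action is available. It carries either weights $w\colon A\to\mathbb Z$ or priorities $p\colon S\to\{0,\dots,d\}$ with $d\le|S|+1$. Strategies map histories $s_0a_0\cdots a_{n-1}s_n$ to rational distributions on the actions available in $s_n$; a strategy has $K$-memory if it is given by a Mealy machine with $K$ memory states (with an initial distribution on the memory states, a randomized next-action function and a deterministic memory update). A strategy $\sigma$ and a state $s$ induce a probability measure $\mathbb P^\sigma_{\mathcal M,s}$ on the runs $\rho=s_0a_0s_1a_1\cdots$ with $s_0=s$. For an integer $\lambda>0$, a run is in $\mathsf{GW}_{\mathsf{mp}}(\lambda)$ if $\frac1{l+1}\sum_{i=0}^{l}w(a_i)\ge0$ for some $l<\lambda$, and in $\mathsf{GW}_{\mathsf{par}}(\lambda)$ if, for some $l<\lambda$, $p(s_l)$ is even and $p(s_l)<p(s_k)$ for all $k<l$. For $\Omega\in\{\mathsf{mp},\mathsf{par}\}$, the fixed window objective $\mathsf{FW}_\Omega(\lambda)$ consists of the runs for which there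 is an $i$ such that, for all $j\ge i$, the suffix starting at the $j$-th state is in $\mathsf{GW}_\Omega(\lambda)$; the bounded window objective is $\mathsf{BW}_\Omega=\bigcup_{\lambda>0}\mathsf{FW}_\Omega(\lambda)$. The threshold probability problem asks, given an MDP with weights or priorities, an initial state $s$, a rational threshold $\alpha\in[0,1]$ and an objective $E$, whether there is a strategy $\sigma$ with $\mathbb P^\sigma_{\mathcal M,s}[E]\ge\alpha$. Probabilities, $\alpha$ and weights are encoded in binary, priorities and (for fixed window objectives) $\lambda$ in unary. Hardness is with respect to logarithmic-space many-one reductions. The mean-payoff game problem asks, given a finite two-player game graph without deadlocks with binary-encoded integer edge weights and an initial vertex, whether player 1 has a strategy such that every consistent play has $\liminf$ mean-payoff at least $0$. **Theorem.** The threshold probability problem is (a) $\mathsf P$-hard for fixed window parity objectives and for fixed window mean-payoff objectives; and in both cases polynomial-memory strategies are in general necessary: there is an integer $k$ such that there are instances of arbitrarily large encoding size $N$ in which the threshold is achieved by some strategy with at most $N^k$ memory states, while every finite-memory strategy that achieves the threshold has at least $N^{1/k}$ memory states; (b) $\mathsf P$-hard for bounded window parity objectives; (c) as hard as mean-payoff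 games for bounded window mean-payoff objectives, i.e. the mean-payoff game problem reduces to it by a logarithmic-space (hence polynomial-time) many-one reduction. -/

import Mathlib

open MeasureTheory ProbabilityTheory Filter
open scoped ENNReal NNReal BigOperators

namespace WindowMDP

/-! ## Rational distributions, Markov decision processes, strategies -/

/-- A rational probability distribution on a finite type. -/
structure RatDist (X : Type) [Fintype X] where
  prob : X → ℚ≥0
  sum_prob : ∑ x, prob x = 1

theorem RatDist.sum_ennreal {X : Type} [Fintype X] (d : RatDist X) :
    ∑ x, (((d.prob x : ℝ≥0) : ℝ≥0∞)) = 1 := by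
  have h : ∑ x, ((d.prob x : ℝ≥0)) = 1 := by exact_mod_cast d.sum_prob
  exact_mod_cast congrArg (fun r : ℝ≥0 => (r : ℝ≥0∞)) h

noncomputable def RatDist.toPMF {X : Type} [Fintype X] (d : RatDist X) : PMF X :=
  PMF.ofFintype (fun x => ((d.prob x : ℝ≥0) : ℝ≥0∞)) d.sum_ennreal

/-- A finite MDP with state space `S` and action space `A`. The transition function is partial
(`none` where an action is not available), and there are no deadlocks. -/
structure MDP (S A : Type) [Fintype S] where
  trans : S → A → Option (RatDist S)
  deadlock_free : ∀ s, ∃ a, (trans s a).isSome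

section
variable {S A : Type} [Fintype S] [Fintype A]

/-- The set `A(s)` of actions that are available in `s`. -/
def MDP.avail (M : MDP S A) (s : S) : Set A := {a | (M.trans s a).isSome}

/-- `δ(s, a, t)`, with value `0` if `a` is not available in `s`. -/
def MDP.prob (M : MDP S A) (s : S) (a : A) (t : S) : ℚ≥0 :=
  match M.trans s a with
  | some d => d.prob t
  | none => 0

/-- The distribution of the successor state. Strategies only use available actions, so the value
for an action that is not available plays no role. -/
noncomputable def MDP.next (M : MDP S A) (s : S) (a : A) : PMF S :=
  match M.trans s a with
  | some d => d.toPMF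
  | none => PMF.pure s

/-- Infinite sequences of state-action pairs `s₀ a₀ s₁ a₁ …`. -/
abbrev Path (S A : Type) := ℕ → S × A

/-- The runs of `M`. -/
def MDP.Runs (M : MDP S A) : Set (Path S A) :=
  {ρ | ∀ i, 0 < M.prob (ρ i).1 (ρ i).2 (ρ (i + 1)).1}

/-- A (randomized, history-dependent) strategy. The history `s₀ a₀ … aₙ₋₁ sₙ` is given as the list
`[(s₀, a₀), …, (sₙ₋₁, aₙ₋₁)]` together with its last state `sₙ`. -/
structure Strategy (M : MDP S A) where
  act : List (S × A) → S → RatDist A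
  act_avail : ∀ h s a, 0 < (act h s).prob a → a ∈ M.avail s

/-- A finite-memory strategy, as a Mealy machine with finite set `Q` of memory states: an initial
distribution on `Q`, a (randomized) next-action function, and a memory update function. -/
structure Mealy (M : MDP S A) (Q : Type) [Fintype Q] where
  init : RatDist Q
  act : S → Q → RatDist A
  update : A → S → Q → Q
  act_avail : ∀ s q a, 0 < (act s q).prob a → a ∈ M.avail s

/-- The strategy played by a Mealy machine once its initial memory state is drawn. -/
def Mealy.strategy {M : MDP S A} {Q : Type} [Fintype Q] (σ : Mealy M Q) (q₀ : Q) :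
    Strategy M where
  act h s := σ.act s (h.foldl (fun q sa => σ.update sa.2 sa.1 q) q₀)
  act_avail _ s a := σ.act_avail s _ a

/-! ## The probability measure induced by a strategy -/

/-- The list `[x 0, …, x n]`. -/
def prefixList {n : ℕ} (x : (_ : Finset.Iic n) → S × A) : List (S × A) :=
  List.ofFn fun i : Fin (n + 1) => x ⟨i, Finset.mem_Iic.2 (Nat.le_of_lt_succ i.2)⟩

/-- The law of `(sₙ₊₁, aₙ₊₁)` given `s₀ a₀ … sₙ aₙ`. -/
noncomputable def stepPMF (M : MDP S A) (σ : Strategy M) (n : ℕ)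
    (x : (_ : Finset.Iic n) → S × A) : PMF (S × A) :=
  (M.next (x ⟨n, Finset.mem_Iic.2 le_rfl⟩).1 (x ⟨n, Finset.mem_Iic.2 le_rfl⟩).2).bind
    fun t => (σ.act (prefixList x) t).toPMF.map fun a => (t, a)

variable [MeasurableSpace S] [MeasurableSingletonClass S]
  [MeasurableSpace A] [MeasurableSingletonClass A]

noncomputable def stepKernel (M : MDP S A) (σ : Strategy M) (n : ℕ) :
    Kernel ((_ : Finset.Iic n) → S × A) (S × A) :=
  Kernel.ofFunOfCountable fun x => (stepPMF M σ n x).toMeasure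

instance (M : MDP S A) (σ : Strategy M) (n : ℕ) : IsMarkovKernel (stepKernel M σ n) :=
  ⟨fun x => by
    change IsProbabilityMeasure (stepPMF M σ n x).toMeasure
    infer_instance⟩

/-- The probability measure on infinite paths of `M` under strategy `σ` from state `s`. -/
noncomputable def law (M : MDP S A) (σ : Strategy M) (s : S) : Measure (Path S A) :=
  Kernel.trajMeasure (X := fun _ => S × A)
    ((σ.act [] s).toPMF.map fun a => (s, a)).toMeasure (stepKernel M σ)

/-- The probability that the run of `M` from `s` under `σ` belongs to `E`. -/
noncomputable def Strategy.prob {M : MDP S A} (σ : Strategy M) (s : S) (E : Set (Path S A)) :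
    ℝ≥0∞ :=
  law M σ s (M.Runs ∩ E)

/-- The same for a Mealy machine, averaging over the initial memory state. -/
noncomputable def Mealy.prob {M : MDP S A} {Q : Type} [Fintype Q] (σ : Mealy M Q) (s : S)
    (E : Set (Path S A)) : ℝ≥0∞ :=
  ∑ q, ((σ.init.prob q : ℝ≥0) : ℝ≥0∞) * (σ.strategy q).prob s E

end

/-! ## Window objectives -/

section
variable {S A : Type}

/-- The suffix of `ρ` from its `i`-th state. -/
def suffix (ρ : Path S A) (i : ℕ) : Path S A := fun j => ρ (i + j)

/-- The mean-payoff of the prefix with `n` actions. -/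
def meanPayoff (w : A → ℤ) (ρ : Path S A) (n : ℕ) : ℚ :=
  (∑ i ∈ Finset.range n, (w (ρ i).2 : ℚ)) / n

/-- Good window mean-payoff objective. -/
def GWmp (w : A → ℤ) (lam : ℕ) : Set (Path S A) :=
  {ρ | ∃ l < lam, 0 ≤ meanPayoff w ρ (l + 1)}

/-- Good window parity objective. -/
def GWpar (p : S → ℕ) (lam : ℕ) : Set (Path S A) :=
  {ρ | ∃ l < lam, Even (p (ρ l).1) ∧ ∀ k < l, p (ρ l).1 < p (ρ k).1}

/-- Direct fixed window objective for a good-window objective. -/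
def DFW (GW : ℕ → Set (Path S A)) (lam : ℕ) : Set (Path S A) :=
  {ρ | ∀ j, suffix ρ j ∈ GW lam}

/-- Fixed window objective. -/
def FW (GW : ℕ → Set (Path S A)) (lam : ℕ) : Set (Path S A) :=
  {ρ | ∃ i, suffix ρ i ∈ DFW GW lam}

/-- Bounded window objective. -/
def BW (GW : ℕ → Set (Path S A)) : Set (Path S A) :=
  {ρ | ∃ lam > 0, ρ ∈ FW GW lam}

end

/-! ## Polynomial time, logarithmic space, hardness -/

/-- `L` is decided in polynomial time by a deterministic single-tape Turing machine with finite
alphabet and finitely many control states: the input letters are written as distinct non-blank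
symbols, and the answer is read off the state in which the machine halts. -/
def InP (L : Language Bool) : Prop :=
  ∃ (Γ Q : Type) (_ : Inhabited Γ) (_ : Inhabited Q) (_ : Finite Γ) (_ : Finite Q)
    (M : Turing.TM0.Machine Γ Q) (e : Bool → Γ) (accept : Set Q) (p : Polynomial ℕ),
    Function.Injective e ∧ (∀ b, e b ≠ default) ∧
    ∀ x : List Bool, ∃ c : Turing.TM0.Cfg Γ Q,
      Nonempty (StateTransition.EvalsToInTime (Turing.TM0.step M) (Turing.TM0.init (x.map e))
        (some c) (p.eval x.length)) ∧
      Turing.TM0.step M c = none ∧ (c.q ∈ accept ↔ x ∈ L)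

/-- What the head reads on the input tape: an end marker or an input letter. -/
inductive InSym (I : Type) where
  | leftEnd : InSym I
  | letter : I → InSym I
  | rightEnd : InSym I

inductive Move where
  | left : Move
  | stay : Move
  | right : Move

/-- Moving a head on a tape that is infinite to the right only. -/
def Move.apply : Move → ℕ → ℕ
  | .left, i => i - 1
  | .stay, i => i
  | .right, i => i + 1

/-- A deterministic Turing machine with a two-way read-only input tape, `k` work tapes and a
write-only output tape. A step reads the symbols under the input head and under the work heads;
either the machine halts (`none`), or it changes its state, moves its input head, writes a
symbol on each work tape and moves the heads there, and possibly writes one output symbol. -/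
structure Transducer (k : ℕ) (I O : Type) where
  Q : Type
  finite_Q : Finite Q
  Γ : Type
  finite_Γ : Finite Γ
  start : Q
  blank : Γ
  trans : Q → InSym I → (Fin k → Γ) → Option (Q × Move × (Fin k → Γ × Move) × Option O)

structure Transducer.Cfg {k : ℕ} {I O : Type} (T : Transducer k I O) where
  state : T.Q
  inPos : ℕ
  pos : Fin k → ℕ
  tape : Fin k → ℕ → T.Γ
  out : List O

/-- The content of cell `i` of the input tape: the end markers are in the cells `0` and
`x.length + 1`, and the input `x` stands between them. -/
def readInput {I : Type} (x : List I) (i : ℕ) : InSym I :=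
  if i = 0 then .leftEnd
  else match x[i - 1]? with
    | some a => .letter a
    | none => .rightEnd

def Transducer.initial {k : ℕ} {I O : Type} (T : Transducer k I O) : T.Cfg where
  state := T.start
  inPos := 0
  pos _ := 0
  tape _ _ := T.blank
  out := []

/-- One step on input `x`; `none` if the machine has halted. The input head never leaves the cells
`0, …, x.length + 1`. -/
def Transducer.step {k : ℕ} {I O : Type} (T : Transducer k I O) (x : List I) (c : T.Cfg) :
    Option T.Cfg :=
  (T.trans c.state (readInput x c.inPos) (fun j => c.tape j (c.pos j))).map fun r =>
    { state := r.1
      inPos := min (r.2.1.apply c.inPos) (x.length + 1)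
      pos := fun j => (r.2.2.1 j).2.apply (c.pos j)
      tape := fun j => Function.update (c.tape j) (c.pos j) (r.2.2.1 j).1
      out := c.out ++ r.2.2.2.toList }

/-- The configuration after `t` steps on input `x` (a halted machine stays where it is). -/
def Transducer.run {k : ℕ} {I O : Type} (T : Transducer k I O) (x : List I) (t : ℕ) : T.Cfg :=
  (fun c => (T.step x c).getD c)^[t] T.initial

/-- The machine computes `code x ↦ f x` in logarithmic space: on input `code x` it halts with
output `f x`, and its work heads stay within the first `O(log |code x|)` cells. -/
def LogspaceComputable {X I O : Type} (code : X → List I) (f : X → List O) : Prop :=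
  ∃ (k : ℕ) (T : Transducer k I O) (C : ℕ), ∀ x : X,
    (∃ t, T.step (code x) (T.run (code x) t) = none ∧ (T.run (code x) t).out = f x) ∧
    ∀ t j, (T.run (code x) t).pos j ≤ C * (Nat.log 2 (code x).length + 1)

/-- A decision problem whose instances are encoded as words over the alphabet `I`. -/
structure DecisionProblem (I : Type) where
  Inst : Type
  code : Inst → List I
  yes : Inst → Prop

/-- Many-one reducibility in logarithmic space. -/
def LogspaceReduces {I O : Type} (P : DecisionProblem I) (R : DecisionProblem O) : Prop :=
  ∃ f : P.Inst → R.Inst, (∀ x, P.yes x ↔ R.yes (f x)) ∧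
    LogspaceComputable P.code fun x => R.code (f x)

def ofLanguage (L : Language Bool) : DecisionProblem Bool where
  Inst := List Bool
  code := id
  yes x := x ∈ L

/-- Hardness for polynomial time under logarithmic-space many-one reductions. -/
def PHard {O : Type} (R : DecisionProblem O) : Prop :=
  ∀ L : Language Bool, InP L → LogspaceReduces (ofLanguage L) R

/-! ## Encodings over the alphabet `{0, 1, #}` -/

/-- The alphabet: `some b` is a bit, `none` is the separator. -/
abbrev Sym := Option Bool

def unaryCode (k : ℕ) : List Sym := List.replicate k (some true) ++ [none]

/-- Binary, least significant bit first. -/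
def natCode (k : ℕ) : List Sym := k.bits.map some ++ [none]

def intCode (z : ℤ) : List Sym := some (decide (z < 0)) :: natCode z.natAbs

def ratCode (q : ℚ≥0) : List Sym := natCode q.num ++ natCode q.den

def optionCode {X : Type} (f : X → List Sym) : Option X → List Sym
  | none => [some false]
  | some x => some true :: f x

/-- The list of the codes of the values of a function on `Fin n`. -/
def tableCode {X : Type} {n : ℕ} (f : X → List Sym) (g : Fin n → X) : List Sym :=
  (List.finRange n).flatMap fun i => f (g i)

/-! ## The threshold probability problem -/

/-- An MDP with `n` states and `m` actions, an initial state and a probability threshold. -/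
structure Query where
  n : ℕ
  m : ℕ
  mdp : MDP (Fin n) (Fin m)
  init : Fin n
  threshold : ℚ≥0
  threshold_le : threshold ≤ 1

def Query.code (q : Query) : List Sym :=
  unaryCode q.n ++ unaryCode q.m ++ unaryCode q.init ++ ratCode q.threshold ++
    tableCode (fun row => tableCode (optionCode fun d => tableCode ratCode d.prob) row) q.mdp.trans

/-- A query together with a priority function. -/
structure ParityQuery extends Query where
  prio : Fin n → ℕ
  prio_le : ∀ s, prio s ≤ n + 1

/-- A query together with a weight function. -/
structure WeightQuery extends Query where
  weight : Fin m → ℤ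

/-- Priorities are written in unary. -/
def ParityQuery.code (q : ParityQuery) : List Sym :=
  q.toQuery.code ++ tableCode unaryCode q.prio

/-- Weights are written in binary. -/
def WeightQuery.code (q : WeightQuery) : List Sym :=
  q.toQuery.code ++ tableCode intCode q.weight

/-- A class of instances of the threshold probability problem: each instance consists of a query
and an objective. -/
structure ThresholdClass where
  Inst : Type
  query : Inst → Query
  objective : (x : Inst) → Set (Path (Fin (query x).n) (Fin (query x).m))
  code : Inst → List Sym

/-- Is there a strategy that satisfies the objective with probability at least the threshold? -/
def ThresholdClass.problem (F : ThresholdClass) : DecisionProblem Sym where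
  Inst := F.Inst
  code := F.code
  yes x := ∃ σ : Strategy (F.query x).mdp,
    (((F.query x).threshold : ℝ≥0) : ℝ≥0∞) ≤ σ.prob (F.query x).init (F.objective x)

/-- Fixed window parity; the window size is written in unary. -/
def fixedWindowParity : ThresholdClass where
  Inst := ParityQuery × ℕ+
  query x := x.1.toQuery
  objective x := FW (GWpar x.1.prio) x.2
  code x := x.1.code ++ unaryCode x.2

/-- Fixed window mean-payoff; the window size is written in unary. -/
def fixedWindowMeanPayoff : ThresholdClass where
  Inst := WeightQuery × ℕ+
  query x := x.1.toQuery
  objective x := FW (GWmp x.1.weight) x.2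
  code x := x.1.code ++ unaryCode x.2

/-- Bounded window parity. -/
def boundedWindowParity : ThresholdClass where
  Inst := ParityQuery
  query x := x.toQuery
  objective x := BW (GWpar x.prio)
  code x := x.code

/-- Bounded window mean-payoff. -/
def boundedWindowMeanPayoff : ThresholdClass where
  Inst := WeightQuery
  query x := x.toQuery
  objective x := BW (GWmp x.weight)
  code x := x.code

/-- The finite-memory strategy `σ` achieves the threshold of the instance `x`. -/
def ThresholdClass.Achieves (F : ThresholdClass) (x : F.Inst) {Q : Type} [Fintype Q]
    (σ : Mealy (F.query x).mdp Q) : Prop :=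
  (((F.query x).threshold : ℝ≥0) : ℝ≥0∞) ≤ σ.prob (F.query x).init (F.objective x)

/-- Polynomial memory is in general necessary: for some exponent `k` there are arbitrarily large
instances such that, with `N` the size of the instance, the threshold is achieved by a strategy
with at most `N ^ k` memory states, but only by finite-memory strategies with at least
`N ^ (1 / k)` memory states. -/
def ThresholdClass.PolyMemoryNecessary (F : ThresholdClass) : Prop :=
  ∃ k : ℕ, ∀ N : ℕ, ∃ x : F.Inst, N ≤ (F.code x).length ∧
    (∃ (Q : Type) (_ : Fintype Q) (σ : Mealy (F.query x).mdp Q),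
      F.Achieves x σ ∧ Fintype.card Q ≤ (F.code x).length ^ k) ∧
    ∀ (Q : Type) (_ : Fintype Q) (σ : Mealy (F.query x).mdp Q),
      F.Achieves x σ → (F.code x).length ≤ Fintype.card Q ^ k

/-! ## Mean-payoff games -/

/-- A finite two-player game graph without deadlocks, with integer weights on the edges and an
initial vertex. Player 1 owns the vertices `v` with `owner v = true`. -/
structure MeanPayoffGame where
  n : ℕ
  owner : Fin n → Bool
  edge : Fin n → Fin n → Option ℤ
  deadlock_free : ∀ u, ∃ v, (edge u v).isSome
  init : Fin n

/-- A strategy of player 1: it chooses the next vertex, given the list of the earlier vertices and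
the current one. -/
structure MeanPayoffGame.Strategy (G : MeanPayoffGame) where
  choose : List (Fin G.n) → Fin G.n → Fin G.n
  choose_edge : ∀ h u, G.owner u = true → (G.edge u (choose h u)).isSome

/-- The plays from the initial vertex that are consistent with `τ`. -/
def MeanPayoffGame.Strategy.Consistent {G : MeanPayoffGame} (τ : G.Strategy) (π : ℕ → Fin G.n) :
    Prop :=
  π 0 = G.init ∧ (∀ i, (G.edge (π i) (π (i + 1))).isSome) ∧
    ∀ i, G.owner (π i) = true → π (i + 1) = τ.choose (List.ofFn fun j : Fin i => π j) (π i)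

/-- The limit inferior mean-payoff of a play (a bounded sequence of averages). -/
noncomputable def MeanPayoffGame.value (G : MeanPayoffGame) (π : ℕ → Fin G.n) : ℝ :=
  liminf (fun k : ℕ =>
    (∑ i ∈ Finset.range k, (((G.edge (π i) (π (i + 1))).getD 0 : ℤ) : ℝ)) / k) atTop

/-- Can player 1 ensure a mean-payoff of at least zero? Weights are written in binary. -/
def meanPayoffGames : DecisionProblem Sym where
  Inst := MeanPayoffGame
  code G := unaryCode G.n ++ unaryCode G.init ++ tableCode (fun b => [some b]) G.owner ++
    tableCode (fun row => tableCode (optionCode intCode) row) G.edge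
  yes G := ∃ τ : G.Strategy, ∀ π, τ.Consistent π → 0 ≤ G.value π

end WindowMDP

open WindowMDP

set_option linter.unusedSectionVars false

namespace WindowMDP

/-! Hardness for polynomial time. A polynomial-time machine becomes a cellular automaton on a ring
of `M` cells, where `M` is polynomial in the input length (`InP.exists_ring`). A state of the Markov
decision process is a claim "cell `i` contains `γ` at time `t`". The strategy justifies the claim by
the contents of three cells at time `t - 1`, and chance selects the one that is examined next. A
true claim can be defended on every run. A false claim has only justifications with a false
component, and chance hits that component with positive probability, level by level, until nothing
remains but to give up. As the threshold is `1`, a positive probability of refutation is enough, so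
that chance is as good as an adversary (`ringMDP_correct`). Defended claims end in a loop of
priority `0` and weight `0`, refuted ones in giving up forever, with priority `1` and weight `-1`.
Windows of size one tell these apart, and one construction serves the fixed and bounded parity
objectives and the fixed mean-payoff objective.

Memory. In each round a number `j` is drawn and the state then forgets it; later a number `k` is
chosen. A debt is met in phase `j` and a payment in phase `n + 1 + k`. The window of size `n + 2`
makes the payment too late if `k > j`, and its amount makes it too small if `k < j`, so the window
closes in time exactly for `k = j` (`tests_parity`, `tests_meanPayoff`). A machine with `n` memory
states wins on every run. With fewer, two numbers lead to the same memory state at the time of the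
choice, so some draw makes the likely answer wrong, and this happens infinitely often almost surely
(`memory_prob_eq_zero`).

Mean-payoff games. Let `F k u` be the least initial energy that suffices for `k` steps from `u`,
truncated at `(n + 1) W` for weights bounded by `W`. The iteration becomes stationary, and by the
pigeonhole principle some interval of length `W` contains none of the `n` final energies
(`exists_split`). Below this gap player 1 can keep the energy nonnegative forever; above it player 2
forces a negative sum within `depth` steps, and is then above the gap again. In the Markov decision
process, player 2 is replaced by a random search through the successors, and the game may be started
anew at random. A potential built from the energies closes all windows within a fixed time if the
initial vertex is below the gap (`exists_strategy`). If it is above, chance follows player 2 for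
arbitrarily long stretches infinitely often, almost surely, so that no fixed window objective has
positive probability (`law_FW_eq_zero`). The probability is therefore `1` or `0` in the two cases
that matter.

The probabilistic tool in both almost-sure arguments is `law_avoid_eq_zero_of_pick`: what chance can
bring about within `L` steps from every history, against likely actions of the strategy, happens
infinitely often almost surely.

Logarithmic space. The reductions are written in a small calculus of number-valued and list-valued
functions (`IsNum`, `IsOut`) with loops of polynomial length. It is compiled to while programs whose
registers are tracks of a single work tape of logarithmic length. Registers are written in base `c +
2`, so that the choice of `c` yields any polynomial range. In the reduction from games the large
factor `K` is a power of two, so that large weights are written by copying digits and inserting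
zeros. -/

/-! ## While programs for a machine with one work tape -/

/-- While programs over a two-way input head, one work tape and an output tape. -/
inductive WP (I O Γ : Type) where
  | act : (InSym I → Γ → Move × Γ × Move × Option O) → WP I O Γ
  | seq : WP I O Γ → WP I O Γ → WP I O Γ
  | ite : (InSym I → Γ → Bool) → WP I O Γ → WP I O Γ → WP I O Γ
  | wh : (InSym I → Γ → Bool) → WP I O Γ → WP I O Γ

/-- The data a while program acts on. -/
@[ext] structure WData (O Γ : Type) where
  inPos : ℕ
  pos : ℕ
  tape : ℕ → Γ
  out : List O

variable {I O Γ : Type}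

def WData.apply (x : List I) (d : WData O Γ) (r : Move × Γ × Move × Option O) : WData O Γ where
  inPos := min (r.1.apply d.inPos) (x.length + 1)
  pos := r.2.2.1.apply d.pos
  tape := Function.update d.tape d.pos r.2.1
  out := d.out ++ r.2.2.2.toList

/-- The value of a function of the two scanned symbols. -/
def WData.read {α : Type*} (x : List I) (d : WData O Γ) (f : InSym I → Γ → α) : α :=
  f (readInput x d.inPos) (d.tape d.pos)

/-- Big-step semantics; the work head stays within the cells `0, …, B`. -/
inductive Exec (x : List I) (B : ℕ) : WP I O Γ → WData O Γ → WData O Γ → Prop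
  | act (f d) : d.pos ≤ B → (d.apply x (d.read x f)).pos ≤ B →
      Exec x B (.act f) d (d.apply x (d.read x f))
  | seq {P Q d d' d''} : Exec x B P d d' → Exec x B Q d' d'' → Exec x B (.seq P Q) d d''
  | ite_true {b P Q d d'} : d.read x b = true → Exec x B P d d' → Exec x B (.ite b P Q) d d'
  | ite_false {b P Q d d'} : d.read x b = false → Exec x B Q d d' → Exec x B (.ite b P Q) d d'
  | wh_false {b P d} : d.pos ≤ B → d.read x b = false → Exec x B (.wh b P) d d
  | wh_true {b P d d' d''} : d.read x b = true → Exec x B P d d' → Exec x B (.wh b P) d' d'' →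
      Exec x B (.wh b P) d d''

theorem Exec.le_left {x : List I} {B : ℕ} {P : WP I O Γ} {d d' : WData O Γ}
    (h : Exec x B P d d') : d.pos ≤ B := by
  induction h <;> assumption

/-- One step of a stack of programs. -/
def stackStep (s : InSym I) (g : Γ) : List (WP I O Γ) →
    Option (List (WP I O Γ) × Move × Γ × Move × Option O)
  | [] => none
  | .act f :: K => some (K, f s g)
  | .seq P Q :: K => some (P :: Q :: K, .stay, g, .stay, none)
  | .ite b P Q :: K => some (if b s g then P :: K else Q :: K, .stay, g, .stay, none)
  | .wh b P :: K => some (if b s g then P :: .wh b P :: K else K, .stay, g, .stay, none)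

/-- The stacks that occur before the program on top of the stack `K` has been executed. -/
def stackSet : WP I O Γ → List (WP I O Γ) → Set (List (WP I O Γ))
  | .act f, K => {.act f :: K}
  | .seq P Q, K => insert (.seq P Q :: K) (stackSet P (Q :: K) ∪ stackSet Q K)
  | .ite b P Q, K => insert (.ite b P Q :: K) (stackSet P K ∪ stackSet Q K)
  | .wh b P, K => insert (.wh b P :: K) (stackSet P (.wh b P :: K))

/-- The stack below a subprogram depends only on the place of that subprogram in the whole program,
also within loops. This makes stacks usable as control states. -/
theorem stackSet_finite (P : WP I O Γ) (K : List (WP I O Γ)) : (stackSet P K).Finite := by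
  induction P generalizing K with
  | act f => exact Set.finite_singleton _
  | seq P Q hP hQ => exact ((hP _).union (hQ _)).insert _
  | ite b P Q hP hQ => exact ((hP _).union (hQ _)).insert _
  | wh b P hP => exact (hP _).insert _

theorem mem_stackSet_self (P : WP I O Γ) (K : List (WP I O Γ)) : P :: K ∈ stackSet P K := by
  cases P <;> simp [stackSet]

/-- The second alternative is the end of `P`. The induction needs it, because the stack under the
first part of `seq`, or under a loop body, again belongs to the enclosing program. -/
theorem stackStep_mem {P : WP I O Γ} {K S : List (WP I O Γ)} (hS : S ∈ stackSet P K)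
    {s : InSym I} {g : Γ} {r} (hr : stackStep s g S = some r) :
    r.1 ∈ stackSet P K ∨ r.1 = K := by
  induction P generalizing K S with
  | act f =>
    obtain rfl : S = _ := hS
    simp only [stackStep, Option.some.injEq] at hr
    subst hr; right; rfl
  | seq P Q hP hQ =>
    rcases hS with rfl | hS | hS
    · simp only [stackStep, Option.some.injEq] at hr
      subst hr; left; right; left; exact mem_stackSet_self _ _
    · rcases hP hS hr with h | h
      · left; right; left; exact h
      · left; right; right; rw [h]; exact mem_stackSet_self _ _
    · rcases hQ hS hr with h | h
      · left; right; right; exact h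
      · right; exact h
  | ite b P Q hP hQ =>
    rcases hS with rfl | hS | hS
    · simp only [stackStep, Option.some.injEq] at hr
      subst hr; left; right
      dsimp only
      split_ifs
      · left; exact mem_stackSet_self _ _
      · right; exact mem_stackSet_self _ _
    · rcases hP hS hr with h | h
      · left; right; left; exact h
      · right; exact h
    · rcases hQ hS hr with h | h
      · left; right; right; exact h
      · right; exact h
  | wh b P hP =>
    rcases hS with rfl | hS
    · simp only [stackStep, Option.some.injEq] at hr
      subst hr
      dsimp only
      split_ifs
      · left; right; exact mem_stackSet_self _ _
      · right; rfl
    · rcases hP hS hr with h | h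
      · left; right; exact h
      · left; left; exact h

/-- The control states of the machine that executes `P`. -/
def ctrl (P : WP I O Γ) : Set (List (WP I O Γ)) := insert [] (stackSet P [])

theorem ctrl_finite (P : WP I O Γ) : (ctrl P).Finite := (stackSet_finite P []).insert _

theorem stackStep_ctrl {P : WP I O Γ} {S : List (WP I O Γ)} (hS : S ∈ ctrl P)
    {s : InSym I} {g : Γ} {r} (hr : stackStep s g S = some r) : r.1 ∈ ctrl P := by
  rcases hS with rfl | hS
  · simp [stackStep] at hr
  · rcases stackStep_mem hS hr with h | h
    · right; exact h
    · left; exact h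

/-- The transducer that executes `P`. -/
def WP.machine [Finite Γ] (P : WP I O Γ) (blank : Γ) : Transducer 1 I O where
  Q := ctrl P
  finite_Q := (ctrl_finite P).to_subtype
  Γ := Γ
  finite_Γ := inferInstance
  start := ⟨[P], Or.inr (mem_stackSet_self P [])⟩
  blank := blank
  trans S s g := (stackStep s (g 0) S.1).pmap
    (fun r hr => (⟨r.1, hr⟩, r.2.1, fun _ => (r.2.2.1, r.2.2.2.1), r.2.2.2.2))
    (fun _ hr => stackStep_ctrl S.2 hr)

def WP.cfg [Finite Γ] (P : WP I O Γ) (blank : Γ) (S : ctrl P) (d : WData O Γ) :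
    (P.machine blank).Cfg where
  state := S
  inPos := d.inPos
  pos _ := d.pos
  tape _ := d.tape
  out := d.out

theorem WP.step_cfg [Finite Γ] (P : WP I O Γ) (blank : Γ) (x : List I) (S : ctrl P)
    (d : WData O Γ) {S' : List (WP I O Γ)} {r}
    (h : stackStep (readInput x d.inPos) (d.tape d.pos) S.1 = some (S', r)) :
    ∃ hS', (P.machine blank).step x (P.cfg blank S d) =
      some (P.cfg blank ⟨S', hS'⟩ (d.apply x r)) := by
  refine ⟨stackStep_ctrl S.2 h, ?_⟩
  have h1 : (P.machine blank).trans S (readInput x d.inPos) (fun _ => d.tape d.pos) =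
      some (⟨S', stackStep_ctrl S.2 h⟩, r.1, fun _ => (r.2.1, r.2.2.1), r.2.2.2) := by
    simp only [WP.machine, Option.pmap_eq_some_iff]
    exact ⟨_, stackStep_ctrl S.2 h, h, rfl⟩
  simp only [Transducer.step, WP.cfg]
  rw [h1]
  rfl

/-- `a` reaches `b` by finitely many steps, with the work head within the cells `0, …, B`. -/
inductive Reach [Finite Γ] (P : WP I O Γ) (blank : Γ) (x : List I) (B : ℕ) :
    List (WP I O Γ) → WData O Γ → List (WP I O Γ) → WData O Γ → Prop
  | refl (S d) : d.pos ≤ B → Reach P blank x B S d S d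
  | head {S d S' r S'' d''} : d.pos ≤ B →
      stackStep (readInput x d.inPos) (d.tape d.pos) S = some (S', r) →
      Reach P blank x B S' (d.apply x r) S'' d'' → Reach P blank x B S d S'' d''

theorem Reach.trans [Finite Γ] {P : WP I O Γ} {blank : Γ} {x : List I} {B : ℕ}
    {S d S' d' S'' d''} (h : Reach P blank x B S d S' d') (h' : Reach P blank x B S' d' S'' d'') :
    Reach P blank x B S d S'' d'' := by
  induction h with
  | refl => exact h'
  | head h1 h2 _ ih => exact .head h1 h2 (ih h')

/-- Unfolding `seq`, `ite` and `wh` costs a step of the machine that must not change the data. The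
bound on the input head is needed because every step clamps it. -/
theorem WData.apply_stay {x : List I} (d : WData O Γ) (hd : d.inPos ≤ x.length + 1) :
    d.apply x (.stay, d.tape d.pos, .stay, none) = d := by
  ext <;> simp [WData.apply, Move.apply, hd]

theorem WData.apply_inPos_le {x : List I} (d : WData O Γ) (r) :
    (d.apply x r).inPos ≤ x.length + 1 := by
  simp [WData.apply]

theorem Exec.inPos_le {x : List I} {B : ℕ} {P : WP I O Γ} {d d' : WData O Γ}
    (h : Exec x B P d d') (hd : d.inPos ≤ x.length + 1) : d'.inPos ≤ x.length + 1 := by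
  induction h with
  | act => exact WData.apply_inPos_le _ _
  | seq _ _ h1 h2 => exact h2 (h1 hd)
  | ite_true _ _ h1 => exact h1 hd
  | ite_false _ _ h1 => exact h1 hd
  | wh_false => exact hd
  | wh_true _ _ _ h1 h2 => exact h2 (h1 hd)

/-- The arbitrary continuation `K` makes the induction work: parts of a program are executed on top
of what is still to be done. -/
theorem Exec.reach [Finite Γ] {P₀ : WP I O Γ} {blank : Γ} {x : List I} {B : ℕ} {P : WP I O Γ}
    {d d' : WData O Γ} (h : Exec x B P d d') (hd : d.inPos ≤ x.length + 1)
    (K : List (WP I O Γ)) : Reach P₀ blank x B (P :: K) d K d' := by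
  induction h generalizing K with
  | act f d h1 h2 => exact .head h1 rfl (.refl _ _ h2)
  | @seq P Q d d' d'' e1 e2 h1 h2 =>
    refine .head e1.le_left rfl ?_
    rw [WData.apply_stay _ hd]
    exact (h1 hd _).trans (h2 (e1.inPos_le hd) _)
  | @ite_true b P Q d d' hb e h1 =>
    refine .head e.le_left rfl ?_
    rw [WData.apply_stay _ hd, if_pos (show b _ _ = true from hb)]
    exact h1 hd _
  | @ite_false b P Q d d' hb e h1 =>
    refine .head e.le_left rfl ?_
    rw [WData.apply_stay _ hd, if_neg (by simpa [WData.read] using hb)]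
    exact h1 hd _
  | @wh_false b P d hB hb =>
    refine .head hB rfl ?_
    rw [WData.apply_stay _ hd, if_neg (by simpa [WData.read] using hb)]
    exact .refl _ _ hB
  | @wh_true b P d d' d'' hb e1 e2 h1 h2 =>
    refine .head e1.le_left rfl ?_
    rw [WData.apply_stay _ hd, if_pos (show b _ _ = true from hb)]
    exact (h1 hd _).trans (h2 (e1.inPos_le hd) _)

theorem Transducer.run_succ' {k : ℕ} (T : Transducer k I O) (x : List I) (t : ℕ) :
    T.run x (t + 1) = (T.step x (T.run x t)).getD (T.run x t) :=
  Function.iterate_succ_apply' _ _ _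

theorem Reach.run [Finite Γ] {P : WP I O Γ} {blank : Γ} {x : List I} {B : ℕ}
    {S d S' d'} (h : Reach P blank x B S d S' d') (hS : S ∈ ctrl P) (t : ℕ)
    (ht : (P.machine blank).run x t = P.cfg blank ⟨S, hS⟩ d) :
    ∃ (hS' : S' ∈ ctrl P) (n : ℕ), (P.machine blank).run x (t + n) = P.cfg blank ⟨S', hS'⟩ d' ∧
      ∀ i ≤ n, ∀ j, ((P.machine blank).run x (t + i)).pos j ≤ B := by
  induction h generalizing t with
  | refl S d hB =>
    refine ⟨hS, 0, ht, fun i hi j => ?_⟩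
    obtain rfl : i = 0 := by omega
    rw [Nat.add_zero, ht]; exact hB
  | @head S d S' r S'' d'' hB hs _ ih =>
    obtain ⟨hS', h1⟩ := P.step_cfg blank x ⟨S, hS⟩ d hs
    have h2 : (P.machine blank).run x (t + 1) = P.cfg blank ⟨S', hS'⟩ (d.apply x r) := by
      rw [Transducer.run_succ', ht, h1]; rfl
    obtain ⟨hS'', n, h3, h4⟩ := ih hS' (t + 1) h2
    refine ⟨hS'', n + 1, by rw [← h3]; congr 1; omega, fun i hi j => ?_⟩
    rcases i with _ | i
    · rw [Nat.add_zero, ht]; exact hB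
    · have := h4 i (by omega) j
      rwa [show t + 1 + i = t + (i + 1) by omega] at this

theorem WP.machine_computes [Finite Γ] (P : WP I O Γ) (blank : Γ) (x : List I) (B : ℕ)
    {d' : WData O Γ} (h : Exec x B P ⟨0, 0, fun _ => blank, []⟩ d') :
    (∃ t, (P.machine blank).step x ((P.machine blank).run x t) = none ∧
      ((P.machine blank).run x t).out = d'.out) ∧
    ∀ t j, ((P.machine blank).run x t).pos j ≤ B := by
  have hr := h.reach (P₀ := P) (blank := blank) (Nat.zero_le _) []
  obtain ⟨hS', n, h1, h2⟩ := hr.run (Or.inr (mem_stackSet_self P [])) 0 rfl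
  rw [Nat.zero_add] at h1
  have hstep : (P.machine blank).step x ((P.machine blank).run x n) = none := by
    rw [h1]; rfl
  -- The space bound concerns all times, including those after halting.
  have hconst : ∀ m, (P.machine blank).run x (n + m) = (P.machine blank).run x n := by
    intro m
    induction m with
    | zero => rfl
    | succ m ih => rw [← Nat.add_assoc, Transducer.run_succ', ih, hstep]; rfl
  refine ⟨⟨n, hstep, by rw [h1]; rfl⟩, fun t j => ?_⟩
  rcases le_total t n with ht | ht
  · have := h2 t ht j
    rwa [Nat.zero_add] at this
  · obtain ⟨m, rfl⟩ := Nat.exists_eq_add_of_le ht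
    rw [hconst]
    have := h2 n le_rfl j
    rwa [Nat.zero_add] at this

/-! ## Registers in base `β` on the tracks of the work tape -/

/-- The number with the digits `f 0, …, f (W - 1)`, least significant digit first. -/
def digitSum (β W : ℕ) (f : ℕ → ℕ) : ℕ := ∑ j ∈ Finset.range W, f j * β ^ j

theorem digitSum_succ (β W : ℕ) (f : ℕ → ℕ) :
    digitSum β (W + 1) f = digitSum β W f + f W * β ^ W := Finset.sum_range_succ _ _

theorem digitSum_congr {β W : ℕ} {f g : ℕ → ℕ} (h : ∀ j < W, f j = g j) :
    digitSum β W f = digitSum β W g :=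
  Finset.sum_congr rfl fun j hj => by rw [h j (Finset.mem_range.1 hj)]

theorem digitSum_lt {β W : ℕ} {f : ℕ → ℕ} (h : ∀ j < W, f j < β) :
    digitSum β W f < β ^ W := by
  induction W with
  | zero => simp [digitSum]
  | succ W ih =>
    rw [digitSum_succ, pow_succ]
    have h1 := ih fun j hj => h j (by omega)
    have h2 : (f W + 1) * β ^ W ≤ β * β ^ W := Nat.mul_le_mul_right _ (h W (by omega))
    nlinarith

theorem digitSum_max {β W : ℕ} (hβ : 0 < β) : digitSum β W (fun _ => β - 1) + 1 = β ^ W := by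
  induction W with
  | zero => simp [digitSum]
  | succ W ih =>
    rw [digitSum_succ, pow_succ, add_right_comm, ih]
    obtain ⟨b, rfl⟩ : ∃ b, β = b + 1 := ⟨β - 1, by omega⟩
    simp only [Nat.add_sub_cancel]
    ring

theorem digitSum_split {β W j : ℕ} (hj : j ≤ W) (f : ℕ → ℕ) :
    digitSum β W f = digitSum β j f + ∑ i ∈ Finset.Ico j W, f i * β ^ i := by
  rw [digitSum, digitSum, Finset.sum_range_add_sum_Ico _ hj]

theorem digitSum_zero {β W : ℕ} {f : ℕ → ℕ} (h : ∀ j < W, f j = 0) : digitSum β W f = 0 :=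
  Finset.sum_eq_zero fun j hj => by rw [h j (Finset.mem_range.1 hj), zero_mul]

/-- If the digits below `j` are maximal in `f` and zero in `g`, the digit of `g` at `j` is one more
than that of `f`, and the other digits agree, then `g` is the successor of `f`. -/
theorem digitSum_carry {β W j : ℕ} (hβ : 0 < β) (hj : j < W) {f g : ℕ → ℕ}
    (h1 : ∀ i < j, f i = β - 1) (h2 : ∀ i < j, g i = 0) (h3 : g j = f j + 1)
    (h4 : ∀ i, j < i → g i = f i) : digitSum β W g = digitSum β W f + 1 := by
  rw [digitSum_split (Nat.succ_le_of_lt hj) f, digitSum_split (Nat.succ_le_of_lt hj) g,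
    Nat.succ_eq_add_one, digitSum_succ, digitSum_succ, digitSum_zero h2, digitSum_congr h1, h3,
    Finset.sum_congr rfl fun i hi => by rw [h4 i (by simp at hi; omega)]]
  have := digitSum_max (W := j) hβ
  rw [add_mul, one_mul, ← this]
  ring

/-- The digits below `j` contribute less than `β ^ j`, so the highest difference decides. -/
theorem digitSum_lt_iff {β W j : ℕ} (hj : j < W) {f g : ℕ → ℕ}
    (hf : ∀ i < W, f i < β) (hg : ∀ i < W, g i < β) (h : ∀ i, j < i → i < W → f i = g i)
    (hne : f j ≠ g j) : digitSum β W f < digitSum β W g ↔ f j < g j := by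
  rw [digitSum_split (Nat.succ_le_of_lt hj) f, digitSum_split (Nat.succ_le_of_lt hj) g,
    Finset.sum_congr rfl fun i hi => by rw [h i (by simp at hi; omega) (by simp at hi; omega)],
    Nat.succ_eq_add_one, digitSum_succ, digitSum_succ]
  have h1 := digitSum_lt (W := j) fun i hi => hf i (by omega)
  have h2 := digitSum_lt (W := j) fun i hi => hg i (by omega)
  rcases lt_or_gt_of_ne hne with h3 | h3
  · have : (f j + 1) * β ^ j ≤ g j * β ^ j := Nat.mul_le_mul_right _ h3
    exact ⟨fun _ => h3, fun _ => by nlinarith⟩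
  · have : (g j + 1) * β ^ j ≤ f j * β ^ j := Nat.mul_le_mul_right _ h3
    exact ⟨fun _ => by nlinarith, fun _ => by omega⟩

theorem digitSum_eq_zero_iff {β W : ℕ} (hβ : 0 < β) {f : ℕ → ℕ} :
    digitSum β W f = 0 ↔ ∀ j < W, f j = 0 := by
  rw [digitSum, Finset.sum_eq_zero_iff]
  simp [hβ.ne']

/-- The Boolean in the home mark is a flag; tests leave their result there, for conditionals and
loops to branch on. -/
inductive Kind where
  | blank : Kind
  | cell : Kind
  | home : Bool → Kind
  deriving DecidableEq

instance : Finite Kind :=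
  Finite.of_injective (fun | .blank => (0 : Fin 4) | .cell => 1 | .home true => 2 | .home false => 3)
    (by rintro (_ | _ | (_ | _)) (_ | _ | (_ | _)) h <;> simp_all)

/-- Tape symbols: a digit for each of `k` registers; the cell `0` carries a flag instead. -/
abbrev TSym (k c : ℕ) := Kind × (Fin k → Fin (c + 2))

variable {k c : ℕ} {I O : Type}

def dig (g : TSym k c) (r : ℕ) : ℕ := if h : r < k then g.2 ⟨r, h⟩ else 0

def setDig (r v : ℕ) (g : TSym k c) : TSym k c :=
  (g.1, fun i => if i.val = r then Fin.ofNat (c + 2) v else g.2 i)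

theorem dig_lt (g : TSym k c) (r : ℕ) : dig g r < c + 2 := by
  unfold dig; split
  · exact Fin.is_lt _
  · omega

theorem dig_setDig_self {r v : ℕ} (hr : r < k) (hv : v < c + 2) (g : TSym k c) :
    dig (setDig r v g) r = v := by
  simp [dig, setDig, hr, Nat.mod_eq_of_lt hv]

theorem dig_setDig_ne {r v s : ℕ} (hs : s ≠ r) (g : TSym k c) :
    dig (setDig r v g) s = dig g s := by
  simp [dig, setDig, hs]

@[simp] theorem setDig_fst {r v : ℕ} (g : TSym k c) : (setDig r v g).1 = g.1 := rfl

def isCell (g : TSym k c) : Bool := decide (g.1 = .cell)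
def isHome (g : TSym k c) : Bool := match g.1 with | .home _ => true | _ => false
def flagOf (g : TSym k c) : Bool := match g.1 with | .home b => b | _ => false

/-- The tape has its home cell at `0` and register cells at `1, …, W`. -/
structure Shape (W : ℕ) (τ : ℕ → TSym k c) : Prop where
  home : isHome (τ 0) = true
  cell : ∀ j < W, (τ (j + 1)).1 = .cell
  blank : ∀ j, W ≤ j → τ (j + 1) = (.blank, fun _ => 0)

/-- The value of the register `r`. -/
def regVal (β W : ℕ) (τ : ℕ → TSym k c) (r : ℕ) : ℕ := digitSum β W fun j => dig (τ (j + 1)) r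

theorem Shape.not_home {W : ℕ} {τ : ℕ → TSym k c} (h : Shape W τ) (j : ℕ) :
    isHome (τ (j + 1)) = false := by
  rcases lt_or_ge j W with hj | hj
  · simp [isHome, h.cell j hj]
  · simp [isHome, h.blank j hj]

theorem Shape.isCell_iff {W : ℕ} {τ : ℕ → TSym k c} (h : Shape W τ) (j : ℕ) :
    isCell (τ (j + 1)) = true ↔ j < W := by
  rcases lt_or_ge j W with hj | hj
  · simp [isCell, h.cell j hj, hj]
  · simp [isCell, h.blank j hj, hj]

/-! ### Programs on the work tape -/

def WP.put (f : TSym k c → TSym k c) (m : Move) : WP I O (TSym k c) :=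
  .act fun _ g => (.stay, f g, m, none)

def WP.loop (b : TSym k c → Bool) (P : WP I O (TSym k c)) : WP I O (TSym k c) :=
  .wh (fun _ g => b g) P

def WP.cond (b : TSym k c → Bool) (P Q : WP I O (TSym k c)) : WP I O (TSym k c) :=
  .ite (fun _ g => b g) P Q

variable {x : List I} {B W : ℕ}

theorem exec_put (f : TSym k c → TSym k c) (m : Move) {i p : ℕ} {τ τ' : ℕ → TSym k c} {o : List O}
    {p' : ℕ} (hi : i ≤ x.length + 1) (hp : p ≤ B) (hp' : p' ≤ B) (hm : m.apply p = p')
    (hτ : Function.update τ p (f (τ p)) = τ') :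
    Exec x B (.put f m) ⟨i, p, τ, o⟩ ⟨i, p', τ', o⟩ := by
  have h := Exec.act (x := x) (B := B) (fun (_ : InSym I) (g : TSym k c) => ((.stay : Move), f g, m, (none : Option O)))
    ⟨i, p, τ, o⟩ hp (by simpa [WData.apply, WData.read, hm] using hp')
  have h' : (WData.mk i p τ o).apply x ((WData.mk i p τ o).read x fun (_ : InSym I) g =>
      ((.stay : Move), f g, m, (none : Option O))) = ⟨i, p', τ', o⟩ := by
    have hs : Move.stay.apply i = i := rfl
    simp [WData.apply, WData.read, hs, hi, hm, hτ]
  rw [h'] at h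
  exact h

theorem exec_loop_true {b : TSym k c → Bool} {P : WP I O (TSym k c)}
    {d d' d'' : WData O (TSym k c)} (hb : b (d.tape d.pos) = true) (h1 : Exec x B P d d')
    (h2 : Exec x B (.loop b P) d' d'') : Exec x B (.loop b P) d d'' := .wh_true hb h1 h2

theorem exec_loop_false {b : TSym k c → Bool} {P : WP I O (TSym k c)}
    {d : WData O (TSym k c)} (hd : d.pos ≤ B) (hb : b (d.tape d.pos) = false) :
    Exec x B (.loop b P) d d := .wh_false hd hb

theorem exec_skip_move (m : Move) {i p p' : ℕ} {τ : ℕ → TSym k c} {o : List O}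
    (hi : i ≤ x.length + 1) (hp : p ≤ B) (hp' : p' ≤ B) (hm : m.apply p = p') :
    Exec x B (.put id m) ⟨i, p, τ, o⟩ ⟨i, p', τ, o⟩ :=
  exec_put id m hi hp hp' hm (by simp)

def WP.goHome : WP I O (TSym k c) := .loop (fun g => !isHome g) (.put id .left)

theorem exec_goHome {i p : ℕ} {τ : ℕ → TSym k c} {o : List O} (h : Shape W τ)
    (hi : i ≤ x.length + 1) (hp : p ≤ B) : Exec x B .goHome ⟨i, p, τ, o⟩ ⟨i, 0, τ, o⟩ := by
  induction p with
  | zero => exact exec_loop_false (Nat.zero_le _) (by simp [h.home])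
  | succ p ih =>
    exact exec_loop_true (by simp [h.not_home p])
      (exec_skip_move .left hi hp (p' := p) (by omega) rfl) (ih (by omega))

/-- Apply `f` to the register cells. -/
def WP.mapCells (f : TSym k c → TSym k c) : WP I O (TSym k c) :=
  .seq (.put id .right) (.seq (.loop isCell (.put f .right)) .goHome)

theorem exec_map_loop (f : TSym k c → TSym k c) {i : ℕ} {o : List O} (hi : i ≤ x.length + 1)
    (hB : W + 1 ≤ B) (n : ℕ) : ∀ (j : ℕ) (τ : ℕ → TSym k c), j + n = W → Shape W τ →
    (∀ g : TSym k c, (f g).1 = g.1) →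
    Exec x B (.loop isCell (.put f .right)) ⟨i, j + 1, τ, o⟩
      ⟨i, W + 1, fun l => if j < l ∧ l ≤ W then f (τ l) else τ l, o⟩ := by
  induction n with
  | zero =>
    intro j τ hj h hf
    have hjW : j = W := by omega
    subst hjW
    have : (fun l => if j < l ∧ l ≤ j then f (τ l) else τ l) = τ := by
      funext l; rw [if_neg (by omega)]
    rw [this]
    exact exec_loop_false hB (by
      have := (h.isCell_iff j).not.2 (lt_irrefl _)
      simpa using this)
  | succ n ih =>
    intro j τ hj h hf
    have hjW : j < W := by omega
    have h' : Shape W (Function.update τ (j + 1) (f (τ (j + 1)))) := by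
      refine ⟨?_, fun l hl => ?_, fun l hl => ?_⟩
      · rw [Function.update_of_ne (by omega)]; exact h.home
      · by_cases hlj : l = j
        · subst hlj; rw [Function.update_self, hf, h.cell _ hl]
        · rw [Function.update_of_ne (by omega), h.cell _ hl]
      · rw [Function.update_of_ne (by omega), h.blank _ hl]
    refine exec_loop_true (by simp [(h.isCell_iff j).2 hjW])
      (exec_put f .right hi (by omega) (p' := j + 2) (by omega) rfl rfl) ?_
    have := ih (j + 1) _ (by omega) h' hf
    convert this using 2
    funext l
    by_cases hl : l = j + 1
    · subst hl
      rw [if_pos (by omega), if_neg (by omega), Function.update_self]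
    · simp only [Function.update_of_ne hl]
      congr 1
      apply propext; omega

theorem exec_mapCells (f : TSym k c → TSym k c) {i : ℕ} {o : List O} (hi : i ≤ x.length + 1)
    (hB : W + 1 ≤ B) {τ : ℕ → TSym k c} (h : Shape W τ) (hf : ∀ g : TSym k c, (f g).1 = g.1) :
    ∃ τ', Exec x B (.mapCells f) ⟨i, 0, τ, o⟩ ⟨i, 0, τ', o⟩ ∧ Shape W τ' ∧ τ' 0 = τ 0 ∧
      ∀ j < W, τ' (j + 1) = f (τ (j + 1)) := by
  have h1 := exec_map_loop (x := x) (o := o) f hi hB W 0 τ (by omega) h hf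
  have h2 : Shape W (fun l => if 0 < l ∧ l ≤ W then f (τ l) else τ l) := by
    refine ⟨?_, fun l hl => ?_, fun l hl => ?_⟩
    · simpa using h.home
    · rw [if_pos (by omega), hf, h.cell _ hl]
    · rw [if_neg (by omega), h.blank _ hl]
  refine ⟨_, .seq (exec_skip_move .right hi (Nat.zero_le _) (p' := 1) (by omega) rfl)
    (.seq h1 (exec_goHome h2 hi hB)), h2, by simp, fun j hj => ?_⟩
  rw [if_pos (by omega)]

/-- The digits of the register `r` that are maximal from the least significant one on are set to
zero; then `f` is applied to the next cell. -/
def WP.carry (β r : ℕ) (f : TSym k c → TSym k c) : WP I O (TSym k c) :=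
  .seq (.put id .right) (.seq (.loop (fun g => isCell g && decide (dig g r = β - 1))
    (.put (setDig r 0) .right)) (.seq (.put f .stay) .goHome))

/-- The head stops at the first digit that is not maximal, or, with `j' = W`, on the blank cell
behind the register when all digits from `j` on are maximal. The digit `j` stands in the cell `j +
1`. -/
theorem exec_carry_loop {β r : ℕ} {i : ℕ} {o : List O} (hi : i ≤ x.length + 1)
    (hB : W + 1 ≤ B) (n : ℕ) : ∀ (j : ℕ) (τ : ℕ → TSym k c), j + n = W → Shape W τ →
    ∃ j' ≤ W, j ≤ j' ∧
    Exec x B (.loop (fun g => isCell g && decide (dig g r = β - 1)) (.put (setDig r 0) .right))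
      ⟨i, j + 1, τ, o⟩
      ⟨i, j' + 1, fun l => if j < l ∧ l ≤ j' then setDig r 0 (τ l) else τ l, o⟩ ∧
    (∀ l, j ≤ l → l < j' → dig (τ (l + 1)) r = β - 1) ∧
    (j' < W → dig (τ (j' + 1)) r ≠ β - 1) := by
  induction n with
  | zero =>
    intro j τ hj h
    have hjW : j = W := by omega
    subst hjW
    have : (fun l => if j < l ∧ l ≤ j then setDig r 0 (τ l) else τ l) = τ := by
      funext l; rw [if_neg (by omega)]
    refine ⟨j, le_rfl, le_rfl, ?_, fun l _ _ => by omega, fun _ => by omega⟩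
    rw [this]
    exact exec_loop_false hB (by
      have := (h.isCell_iff j).not.2 (lt_irrefl _)
      simp at this
      simp [this])
  | succ n ih =>
    intro j τ hj h
    have hjW : j < W := by omega
    by_cases hd : dig (τ (j + 1)) r = β - 1
    · have h' : Shape W (Function.update τ (j + 1) (setDig r 0 (τ (j + 1)))) := by
        refine ⟨?_, fun l hl => ?_, fun l hl => ?_⟩
        · rw [Function.update_of_ne (by omega)]; exact h.home
        · by_cases hlj : l = j
          · subst hlj; rw [Function.update_self, setDig_fst, h.cell _ hl]
          · rw [Function.update_of_ne (by omega), h.cell _ hl]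
        · rw [Function.update_of_ne (by omega), h.blank _ hl]
      obtain ⟨j', h1, h2, h3, h4, h5⟩ := ih (j + 1) _ (by omega) h'
      refine ⟨j', h1, by omega, ?_, fun l hl hl' => ?_, fun hl => ?_⟩
      · refine exec_loop_true (by simp [(h.isCell_iff j).2 hjW, hd])
          (exec_put _ .right hi (by omega) (p' := j + 2) (by omega) rfl rfl) ?_
        convert h3 using 2
        funext l
        by_cases hl : l = j + 1
        · subst hl
          rw [if_pos (by omega), if_neg (by omega), Function.update_self]
        · simp only [Function.update_of_ne hl]
          congr 1
          apply propext; omega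
      · by_cases hlj : l = j
        · rw [hlj, hd]
        · rw [← h4 l (by omega) hl', Function.update_of_ne (by omega)]
      · rw [Function.update_of_ne (by omega)] at h5; exact h5 hl
    · have : (fun l => if j < l ∧ l ≤ j then setDig r 0 (τ l) else τ l) = τ := by
        funext l; rw [if_neg (by omega)]
      refine ⟨j, by omega, le_rfl, ?_, fun l _ _ => by omega, fun _ => hd⟩
      rw [this]
      exact exec_loop_false (by show j + 1 ≤ B; omega) (by simp [hd])

/-- Increment the register `r`, modulo `β ^ W`. -/
def WP.inc (β r : ℕ) : WP I O (TSym k c) :=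
  .carry β r fun g => if isCell g then setDig r (dig g r + 1) g else g

theorem exec_inc {β r : ℕ} (hr : r < k) (hβ : 0 < β) (hβc : β ≤ c + 2) {i : ℕ} {o : List O}
    (hi : i ≤ x.length + 1) (hB : W + 1 ≤ B) {τ : ℕ → TSym k c} (h : Shape W τ)
    (hd : ∀ j, dig (τ (j + 1)) r < β) :
    ∃ τ', Exec x B (.inc β r) ⟨i, 0, τ, o⟩ ⟨i, 0, τ', o⟩ ∧ Shape W τ' ∧ τ' 0 = τ 0 ∧
      (∀ j, dig (τ' (j + 1)) r < β) ∧
      (∀ s ≠ r, ∀ j, dig (τ' (j + 1)) s = dig (τ (j + 1)) s) ∧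
      regVal β W τ' r = (regVal β W τ r + 1) % β ^ W := by
  obtain ⟨j, hjW, -, h1, h2, h3⟩ :=
    exec_carry_loop (x := x) (B := B) (β := β) (r := r) (o := o) hi hB W 0 τ (by omega) h
  set τ₁ : ℕ → TSym k c := fun l => if 0 < l ∧ l ≤ j then setDig r 0 (τ l) else τ l with hτ₁
  have s1 : Shape W τ₁ := by
    refine ⟨?_, fun l hl => ?_, fun l hl => ?_⟩
    · simpa [hτ₁] using h.home
    · simp only [hτ₁]; split_ifs <;> simp [h.cell _ hl]
    · simp only [hτ₁]; rw [if_neg (by omega), h.blank _ hl]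
  set τ₂ := Function.update τ₁ (j + 1)
    (if isCell (τ₁ (j + 1)) then setDig r (dig (τ₁ (j + 1)) r + 1) (τ₁ (j + 1)) else τ₁ (j + 1))
    with hτ₂
  have s2 : Shape W τ₂ := by
    refine ⟨?_, fun l hl => ?_, fun l hl => ?_⟩
    · rw [hτ₂, Function.update_of_ne (by omega)]; exact s1.home
    · by_cases hlj : l = j
      · subst hlj; rw [hτ₂, Function.update_self]; split_ifs <;> simp [s1.cell _ hl]
      · rw [hτ₂, Function.update_of_ne (by omega), s1.cell _ hl]
    · by_cases hlj : l = j
      · subst hlj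
        rw [hτ₂, Function.update_self, if_neg (by rw [s1.isCell_iff]; omega), s1.blank _ hl]
      · rw [hτ₂, Function.update_of_ne (by omega), s1.blank _ hl]
  have hlow : ∀ l < j, dig (τ₂ (l + 1)) r = 0 := by
    intro l hl
    rw [hτ₂, Function.update_of_ne (by omega)]
    simp only [hτ₁]
    rw [if_pos (by omega), dig_setDig_self hr (by omega)]
  have hhigh : ∀ l, j < l → τ₂ (l + 1) = τ (l + 1) := by
    intro l hl
    rw [hτ₂, Function.update_of_ne (by omega)]
    simp only [hτ₁]
    rw [if_neg (by omega)]
  have hmid : τ₁ (j + 1) = τ (j + 1) := by simp only [hτ₁]; rw [if_neg (by omega)]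
  have hmid' : j < W → dig (τ₂ (j + 1)) r = dig (τ (j + 1)) r + 1 := by
    intro hj
    have := h3 hj
    have := hd j
    rw [hτ₂, Function.update_self, if_pos ((s1.isCell_iff j).2 hj), hmid,
      dig_setDig_self hr (by omega)]
  have hmid'' : ¬ j < W → τ₂ (j + 1) = τ (j + 1) := by
    intro hj
    rw [hτ₂, Function.update_self, if_neg (by rw [s1.isCell_iff]; omega), hmid]
  refine ⟨τ₂, .seq (exec_skip_move .right hi (Nat.zero_le _) (p' := 1) (by omega) rfl)
    (.seq h1 (.seq (exec_put _ .stay hi (by omega) (p' := j + 1) (by omega) rfl rfl)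
      (exec_goHome s2 hi (by omega)))), s2, ?_, fun l => ?_, fun s hs l => ?_, ?_⟩
  · rw [hτ₂, Function.update_of_ne (by omega)]; simp [hτ₁]
  · rcases lt_trichotomy l j with hl | hl | hl
    · rw [hlow l hl]; exact hβ
    · subst hl
      by_cases hj : l < W
      · have := h3 hj
        have := hd l
        rw [hmid' hj]; omega
      · rw [hmid'' hj]; exact hd l
    · rw [hhigh l hl]; exact hd l
  · by_cases hl : l = j
    · subst hl
      rw [hτ₂, Function.update_self, hmid]
      split_ifs
      · rw [dig_setDig_ne hs]
      · rfl
    · rw [hτ₂, Function.update_of_ne (by omega)]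
      simp only [hτ₁]
      split_ifs
      · rw [dig_setDig_ne hs]
      · rfl
  · unfold regVal
    by_cases hj : j < W
    · have h5 := digitSum_carry (W := W) (f := fun l => dig (τ (l + 1)) r)
        (g := fun l => dig (τ₂ (l + 1)) r) hβ hj (fun l hl => h2 l (Nat.zero_le _) hl) hlow
        (hmid' hj) (fun l hl => by rw [hhigh l hl])
      have h6 : digitSum β W (fun l => dig (τ₂ (l + 1)) r) < β ^ W := by
        refine digitSum_lt fun l hl => ?_
        rcases lt_trichotomy l j with hl | hl | hl
        · rw [hlow l hl]; exact hβ
        · subst hl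
          have := h3 hj
          have := hd l
          rw [hmid' hj]; omega
        · rw [hhigh l hl]; exact hd l
      rw [← h5, Nat.mod_eq_of_lt h6]
    -- Overflow: all digits were maximal and are now zero, and the blank cell behind them was left
    -- alone. The value has wrapped to zero.
    · have hj' : j = W := by omega
      rw [digitSum_zero (f := fun l => dig (τ₂ (l + 1)) r) (fun l hl => hlow l (by omega)),
        digitSum_congr (f := fun l => dig (τ (l + 1)) r) (g := fun _ => β - 1)
          (fun l hl => h2 l (Nat.zero_le _) (by omega)), digitSum_max hβ, Nat.mod_self]

variable {k c : ℕ} {I O : Type} {x : List I} {B W : ℕ}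

/-! ### Triples -/

/-- The work head is at home, the registers have the values `e`, the flag is `b`. -/
def St (W i : ℕ) (e : ℕ → ℕ) (b : Bool) (o : List O) (d : WData O (TSym k c)) : Prop :=
  ∃ τ, d = ⟨i, 0, τ, o⟩ ∧ Shape W τ ∧ (τ 0).1 = .home b ∧ ∀ r < k, regVal (c + 2) W τ r = e r

/-- Total correctness of `P` between two exactly described states. -/
def Does (x : List I) (B W : ℕ) (P : WP I O (TSym k c)) (i : ℕ) (e : ℕ → ℕ) (b : Bool)
    (o : List O) (i' : ℕ) (e' : ℕ → ℕ) (b' : Bool) (o' : List O) : Prop :=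
  ∀ d, St W i e b o d → ∃ d', Exec x B P d d' ∧ St W i' e' b' o' d'

theorem Does.seq {P Q : WP I O (TSym k c)} {i e b o i' e' b' o' i'' e'' b'' o''}
    (h1 : Does x B W P i e b o i' e' b' o') (h2 : Does x B W Q i' e' b' o' i'' e'' b'' o'') :
    Does x B W (.seq P Q) i e b o i'' e'' b'' o'' := by
  intro d hd
  obtain ⟨d', e1, hd'⟩ := h1 d hd
  obtain ⟨d'', e2, hd''⟩ := h2 d' hd'
  exact ⟨d'', .seq e1 e2, hd''⟩

theorem flagOf_of_home {g : TSym k c} {b : Bool} (h : g.1 = .home b) : flagOf g = b := by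
  simp [flagOf, h]

theorem Does.cond_true {P Q : WP I O (TSym k c)} {i e o i' e' b' o'}
    (h : Does x B W P i e true o i' e' b' o') :
    Does x B W (.cond flagOf P Q) i e true o i' e' b' o' := by
  rintro d hd
  obtain ⟨d', e1, hd'⟩ := h d hd
  obtain ⟨τ, rfl, -, h1, -⟩ := hd
  exact ⟨d', .ite_true (flagOf_of_home h1) e1, hd'⟩

theorem Does.cond_false {P Q : WP I O (TSym k c)} {i e o i' e' b' o'}
    (h : Does x B W Q i e false o i' e' b' o') :
    Does x B W (.cond flagOf P Q) i e false o i' e' b' o' := by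
  rintro d hd
  obtain ⟨d', e1, hd'⟩ := h d hd
  obtain ⟨τ, rfl, -, h1, -⟩ := hd
  exact ⟨d', .ite_false (flagOf_of_home h1) e1, hd'⟩

theorem Does.loop_false (P : WP I O (TSym k c)) (i e) (o : List O) :
    Does x B W (.loop flagOf P) i e false o i e false o := by
  rintro d hd
  refine ⟨d, ?_, hd⟩
  obtain ⟨τ, rfl, -, h1, -⟩ := hd
  exact exec_loop_false (Nat.zero_le _) (flagOf_of_home h1)

theorem Does.loop_true {P : WP I O (TSym k c)} {i e o i' e' b' o' i'' e'' b'' o''}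
    (h1 : Does x B W P i e true o i' e' b' o')
    (h2 : Does x B W (.loop flagOf P) i' e' b' o' i'' e'' b'' o'') :
    Does x B W (.loop flagOf P) i e true o i'' e'' b'' o'' := by
  rintro d hd
  obtain ⟨d', e1, hd'⟩ := h1 d hd
  obtain ⟨d'', e2, hd''⟩ := h2 d' hd'
  obtain ⟨τ, rfl, -, h1, -⟩ := hd
  exact ⟨d'', exec_loop_true (flagOf_of_home h1) e1 e2, hd''⟩

theorem does_inc {r : ℕ} (hr : r < k) {i e b} {o : List O} (hi : i ≤ x.length + 1)
    (hB : W + 1 ≤ B) :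
    Does x B W (.inc (c + 2) r : WP I O (TSym k c)) i e b o i
      (Function.update e r ((e r + 1) % (c + 2) ^ W)) b o := by
  rintro d ⟨τ, rfl, hs, hb, he⟩
  obtain ⟨τ', h1, h2, h3, -, h4, h5⟩ := exec_inc (o := o) (β := c + 2) hr (by omega) le_rfl hi hB hs
    fun j => dig_lt _ _
  refine ⟨_, h1, τ', rfl, h2, by rw [h3, hb], fun s hs => ?_⟩
  by_cases hsr : s = r
  · subst hsr; rw [h5, he s hs, Function.update_self]
  · rw [Function.update_of_ne hsr, ← he s hs]
    exact digitSum_congr fun j _ => h4 s hsr j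

def WP.zero (r : ℕ) : WP I O (TSym k c) := .mapCells (setDig r 0)

theorem does_zero {r : ℕ} (hr : r < k) {i e b} {o : List O} (hi : i ≤ x.length + 1)
    (hB : W + 1 ≤ B) :
    Does x B W (.zero r : WP I O (TSym k c)) i e b o i (Function.update e r 0) b o := by
  rintro d ⟨τ, rfl, hs, hb, he⟩
  obtain ⟨τ', h1, h2, h3, h4⟩ := exec_mapCells (o := o) (setDig r 0) hi hB hs fun _ => rfl
  refine ⟨_, h1, τ', rfl, h2, by rw [h3, hb], fun s hs => ?_⟩
  by_cases hsr : s = r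
  · subst hsr
    rw [Function.update_self]
    exact digitSum_zero fun j hj => by rw [h4 j hj, dig_setDig_self hr (by omega)]
  · rw [Function.update_of_ne hsr, ← he s hs]
    exact digitSum_congr fun j hj => by rw [h4 j hj, dig_setDig_ne hsr]

/-- Copy the register `r` to the register `s`. -/
def WP.copy (r s : ℕ) : WP I O (TSym k c) := .mapCells fun g => setDig s (dig g r) g

theorem does_copy {r s : ℕ} (hr : r < k) (hs : s < k) {i e b} {o : List O}
    (hi : i ≤ x.length + 1) (hB : W + 1 ≤ B) :
    Does x B W (.copy r s : WP I O (TSym k c)) i e b o i (Function.update e s (e r)) b o := by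
  rintro d ⟨τ, rfl, hsh, hb, he⟩
  obtain ⟨τ', h1, h2, h3, h4⟩ :=
    exec_mapCells (o := o) (fun g => setDig s (dig g r) g) hi hB hsh fun _ => rfl
  refine ⟨_, h1, τ', rfl, h2, by rw [h3, hb], fun t ht => ?_⟩
  by_cases hst : t = s
  · subst hst
    rw [Function.update_self, ← he r hr]
    exact digitSum_congr fun j hj => by rw [h4 j hj, dig_setDig_self hs (dig_lt _ _)]
  · rw [Function.update_of_ne hst, ← he t ht]
    exact digitSum_congr fun j hj => by rw [h4 j hj, dig_setDig_ne hst]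

def WP.setFlag (b : Bool) : WP I O (TSym k c) := .put (fun g => (.home b, g.2)) .stay

theorem does_setFlag (b' : Bool) {i e b} {o : List O} (hi : i ≤ x.length + 1) :
    Does x B W (.setFlag b' : WP I O (TSym k c)) i e b o i e b' o := by
  rintro d ⟨τ, rfl, hs, hb, he⟩
  refine ⟨_, exec_put _ .stay hi (Nat.zero_le _) (Nat.zero_le _) rfl rfl, _, rfl,
    ⟨?_, fun j hj => ?_, fun j hj => ?_⟩, ?_, fun r hr => ?_⟩
  · simp [isHome]
  · rw [Function.update_of_ne (by omega)]; exact hs.cell j hj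
  · rw [Function.update_of_ne (by omega)]; exact hs.blank j hj
  · simp
  · rw [← he r hr]
    exact digitSum_congr fun j hj => by rw [Function.update_of_ne (by omega)]

theorem exec_search (b : TSym k c → Bool) {i : ℕ} {τ : ℕ → TSym k c} {o : List O} (h : Shape W τ)
    (hi : i ≤ x.length + 1) (hB : W + 1 ≤ B) (n : ℕ) : ∀ j, j + n = W →
    ∃ j' ≤ W, j ≤ j' ∧ Exec x B (.loop (fun g => isCell g && b g) (.put id .right))
      ⟨i, j + 1, τ, o⟩ ⟨i, j' + 1, τ, o⟩ ∧ (∀ l, j ≤ l → l < j' → b (τ (l + 1)) = true) ∧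
      (j' < W → b (τ (j' + 1)) = false) := by
  induction n with
  | zero =>
    intro j hj
    refine ⟨j, by omega, le_rfl, exec_loop_false (by show j + 1 ≤ B; omega) ?_,
      fun l _ _ => by omega, fun _ => by omega⟩
    have : isCell (τ (j + 1)) = false := by
      rw [← Bool.not_eq_true, h.isCell_iff]; omega
    simp [this]
  | succ n ih =>
    intro j hj
    by_cases hb : b (τ (j + 1)) = true
    · obtain ⟨j', h1, h2, h3, h4, h5⟩ := ih (j + 1) (by omega)
      refine ⟨j', h1, by omega, exec_loop_true ?_
        (exec_skip_move .right hi (by omega) (p' := j + 2) (by omega) rfl) h3,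
        fun l hl hl' => ?_, h5⟩
      · simp [hb, (h.isCell_iff j).2 (by omega)]
      · by_cases hlj : l = j
        · rw [hlj, hb]
        · exact h4 l (by omega) hl'
    · refine ⟨j, by omega, le_rfl, exec_loop_false (by show j + 1 ≤ B; omega) ?_,
        fun l _ _ => by omega, fun _ => by simpa using hb⟩
      simp only [Bool.not_eq_true] at hb
      simp [hb]

/-- Set the flag to the truth of `register r ≠ 0`. -/
def WP.nzFlag (r : ℕ) : WP I O (TSym k c) :=
  .seq (.put id .right) (.seq (.loop (fun g => isCell g && decide (dig g r = 0)) (.put id .right))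
    (.cond isCell (.seq .goHome (.setFlag true)) (.seq .goHome (.setFlag false))))

theorem does_nzFlag {r : ℕ} (hr : r < k) {i e b} {o : List O} (hi : i ≤ x.length + 1)
    (hB : W + 1 ≤ B) :
    Does x B W (.nzFlag r : WP I O (TSym k c)) i e b o i e (decide (e r ≠ 0)) o := by
  rintro d ⟨τ, rfl, hs, hb, he⟩
  obtain ⟨j, hj, -, h1, h2, h3⟩ :=
    exec_search (x := x) (B := B) (o := o) (fun g => decide (dig g r = 0)) hs hi hB W 0 (by omega)
  have hz : e r ≠ 0 ↔ j < W := by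
    rw [← he r hr, regVal, Ne, digitSum_eq_zero_iff (by omega)]
    constructor
    · intro hne
      by_contra hjW
      exact hne fun l hl => by simpa using h2 l (Nat.zero_le _) (by omega)
    · intro hjW hall
      have := h3 hjW
      simp only [decide_eq_false_iff_not] at this
      exact this (hall j hjW)
  have h0 := exec_skip_move (x := x) (B := B) (τ := τ) (o := o) .right hi (Nat.zero_le _) (p' := 1)
    (by omega) rfl
  have hh := exec_goHome (p := j + 1) (o := o) hs hi (B := B) (by omega)
  by_cases hjW : j < W
  · obtain ⟨d', h4, h5⟩ := does_setFlag (x := x) (B := B) (W := W) true hi ⟨i, 0, τ, o⟩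
      ⟨τ, rfl, hs, hb, he⟩
    rw [decide_eq_true (hz.2 hjW)]
    exact ⟨d', .seq h0 (.seq h1 (.ite_true ((hs.isCell_iff j).2 hjW) (.seq hh h4))), h5⟩
  · obtain ⟨d', h4, h5⟩ := does_setFlag (x := x) (B := B) (W := W) false hi ⟨i, 0, τ, o⟩
      ⟨τ, rfl, hs, hb, he⟩
    rw [decide_eq_false (hz.not.2 hjW)]
    refine ⟨d', .seq h0 (.seq h1 (.ite_false ?_ (.seq hh h4))), h5⟩
    have : isCell (τ (j + 1)) = false := by rw [← Bool.not_eq_true, hs.isCell_iff]; exact hjW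
    exact this

theorem exec_search_left (b : TSym k c → Bool) {i : ℕ} {τ : ℕ → TSym k c} {o : List O}
    (h : Shape W τ) (hi : i ≤ x.length + 1) (j : ℕ) (hj : j ≤ B) :
    ∃ j' ≤ j, Exec x B (.loop (fun g => !isHome g && b g) (.put id .left))
      ⟨i, j, τ, o⟩ ⟨i, j', τ, o⟩ ∧ (∀ l, j' ≤ l → l < j → b (τ (l + 1)) = true) ∧
      (∀ l, j' = l + 1 → b (τ j') = false) := by
  induction j with
  | zero =>
    refine ⟨0, le_rfl, exec_loop_false (Nat.zero_le _) ?_, fun l _ _ => by omega,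
      fun l _ => by omega⟩
    simp [h.home]
  | succ j ih =>
    by_cases hb : b (τ (j + 1)) = true
    · obtain ⟨j', h1, h2, h3, h4⟩ := ih (by omega)
      refine ⟨j', by omega, exec_loop_true ?_
        (exec_skip_move .left hi hj (p' := j) (by omega) rfl) h2, fun l hl hl' => ?_, h4⟩
      · simp [hb, h.not_home]
      · by_cases hlj : l = j
        · rw [hlj, hb]
        · exact h3 l hl (by omega)
    · refine ⟨j + 1, le_rfl, exec_loop_false hj ?_, fun l _ _ => by omega,
        fun l _ => by simpa using hb⟩
      simp only [Bool.not_eq_true] at hb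
      simp [hb]

/-- Set the flag to the truth of `register a < register b`. -/
def WP.ltFlag (a b : ℕ) : WP I O (TSym k c) :=
  .seq (.put id .right) (.seq (.loop (fun g => isCell g && true) (.put id .right))
    (.seq (.put id .left)
      (.seq (.loop (fun g => !isHome g && decide (dig g a = dig g b)) (.put id .left))
        (.cond (fun g => !isHome g && decide (dig g a < dig g b))
          (.seq .goHome (.setFlag true)) (.seq .goHome (.setFlag false))))))

/-- The head runs to the far end of the registers and comes back to the most significant digit at
which they differ. If it reaches the home cell, the values are equal. -/
theorem does_ltFlag {a b' : ℕ} (ha : a < k) (hb' : b' < k) {i e b} {o : List O}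
    (hi : i ≤ x.length + 1) (hB : W + 1 ≤ B) :
    Does x B W (.ltFlag a b' : WP I O (TSym k c)) i e b o i e (decide (e a < e b')) o := by
  rintro d ⟨τ, rfl, hs, hb, he⟩
  obtain ⟨j0, hj0, -, h1, -, h1'⟩ :=
    exec_search (x := x) (B := B) (o := o) (fun _ => true) hs hi hB W 0 (by omega)
  have hj0 : j0 = W := by
    by_contra hne
    have := h1' (by omega)
    simp at this
  subst hj0
  obtain ⟨j, hj, h2, h3, h4⟩ := exec_search_left (x := x) (B := B) (o := o)
    (fun g => decide (dig g a = dig g b')) hs hi j0 (by omega)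
  have h0 := exec_skip_move (x := x) (B := B) (τ := τ) (o := o) .right hi (Nat.zero_le _) (p' := 1)
    (by omega) rfl
  have hl := exec_skip_move (x := x) (B := B) (τ := τ) (o := o) .left hi (p := j0 + 1) (p' := j0)
    (by omega) (by omega) rfl
  have hh := exec_goHome (p := j) (o := o) hs hi (B := B) (by omega)
  have key : e a < e b' ↔ (!isHome (τ j) && decide (dig (τ j) a < dig (τ j) b')) = true := by
    rw [← he a ha, ← he b' hb']
    rcases j with _ | j
    · simp only [hs.home, Bool.not_true, Bool.false_and, Bool.false_eq_true, iff_false, not_lt]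
      refine (digitSum_congr fun l hl => ?_).le
      have := h3 l (Nat.zero_le _) hl
      simp only [decide_eq_true_eq] at this
      exact this.symm
    · have h5 := h4 j rfl
      simp only [decide_eq_false_iff_not] at h5
      simp only [hs.not_home, Bool.not_false, Bool.true_and, decide_eq_true_eq]
      exact digitSum_lt_iff (by omega) (fun _ _ => dig_lt _ _) (fun _ _ => dig_lt _ _)
        (fun l hl hl' => by simpa using h3 l (by omega) hl') h5
  by_cases hlt : e a < e b'
  · obtain ⟨d', h4, h5⟩ := does_setFlag (x := x) (B := B) (W := j0) true hi ⟨i, 0, τ, o⟩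
      ⟨τ, rfl, hs, hb, he⟩
    rw [decide_eq_true hlt]
    exact ⟨d', .seq h0 (.seq h1 (.seq hl (.seq h2 (.ite_true (key.1 hlt) (.seq hh h4))))), h5⟩
  · obtain ⟨d', h4, h5⟩ := does_setFlag (x := x) (B := B) (W := j0) false hi ⟨i, 0, τ, o⟩
      ⟨τ, rfl, hs, hb, he⟩
    rw [decide_eq_false hlt]
    refine ⟨d', .seq h0 (.seq h1 (.seq hl (.seq h2 (.ite_false ?_ (.seq hh h4))))), h5⟩
    exact Bool.eq_false_iff.2 (key.not.1 hlt)

/-! ### Input and output -/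

def WP.emit (s : O) : WP I O (TSym k c) := .act fun _ g => (.stay, g, .stay, some s)

theorem does_emit (s : O) {i e b} {o : List O} (hi : i ≤ x.length + 1) :
    Does x B W (.emit s : WP I O (TSym k c)) i e b o i e b (o ++ [s]) := by
  rintro d ⟨τ, rfl, hs, hb, he⟩
  refine ⟨_, .act _ _ (Nat.zero_le _) (Nat.zero_le _), τ, ?_, hs, hb, he⟩
  have h1 : Move.stay.apply i = i := rfl
  have h2 : Move.stay.apply 0 = 0 := rfl
  simp [WData.apply, WData.read, h1, h2, hi]

def WP.inRight : WP I O (TSym k c) := .act fun _ g => (.right, g, .stay, none)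

theorem does_inRight {i e b} {o : List O} :
    Does x B W (.inRight : WP I O (TSym k c)) i e b o (min (i + 1) (x.length + 1)) e b o := by
  rintro d ⟨τ, rfl, hs, hb, he⟩
  refine ⟨_, .act _ _ (Nat.zero_le _) (Nat.zero_le _), τ, ?_, hs, hb, he⟩
  have h1 : Move.right.apply i = i + 1 := rfl
  have h2 : Move.stay.apply 0 = 0 := rfl
  simp [WData.apply, WData.read, h1, h2]

/-- Rewind the input head. -/
def WP.rewind {Γ : Type} : WP I O Γ :=
  .wh (fun s _ => match s with | .leftEnd => false | _ => true) (.act fun _ g => (.left, g, .stay, none))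

theorem exec_rewind {Γ : Type} {x : List I} {p : ℕ} (hp : p ≤ B) {τ : ℕ → Γ} {o : List O}
    (i : ℕ) (hi : i ≤ x.length + 1) : Exec x B .rewind ⟨i, p, τ, o⟩ ⟨0, p, τ, o⟩ := by
  induction i with
  | zero => exact .wh_false hp (by simp [WData.read, readInput])
  | succ i ih =>
    have h2 : Move.stay.apply p = p := rfl
    have h1 : Move.left.apply (i + 1) = i := rfl
    refine .wh_true ?_ (.act _ _ hp ?_) ?_
    · simp only [WData.read, readInput]
      rw [if_neg (by omega)]
      cases x[i + 1 - 1]? <;> rfl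
    · simpa [WData.apply, WData.read, h2] using hp
    · have : (WData.mk (i + 1) p τ o).apply x ((WData.mk (i + 1) p τ o).read x
          fun (_ : InSym I) (g : Γ) => (Move.left, g, Move.stay, (none : Option O))) =
          ⟨i, p, τ, o⟩ := by
        simp [WData.apply, WData.read, h1, h2]; omega
      rw [this]
      exact ih (by omega)

theorem does_rewind {i e b} {o : List O} (hi : i ≤ x.length + 1) :
    Does x B W (.rewind : WP I O (TSym k c)) i e b o 0 e b o := by
  rintro d ⟨τ, rfl, hs, hb, he⟩
  exact ⟨_, exec_rewind (Nat.zero_le _) i hi, τ, rfl, hs, hb, he⟩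

/-- Set the flag according to the scanned input symbol. -/
def WP.symFlag (p : InSym I → Bool) : WP I O (TSym k c) :=
  .act fun s g => (.stay, (.home (p s), g.2), .stay, none)

theorem does_symFlag (p : InSym I → Bool) {i e b} {o : List O} (hi : i ≤ x.length + 1) :
    Does x B W (.symFlag p : WP I O (TSym k c)) i e b o i e (p (readInput x i)) o := by
  rintro d ⟨τ, rfl, hs, hb, he⟩
  have h1 : Move.stay.apply i = i := rfl
  have h2 : Move.stay.apply 0 = 0 := rfl
  refine ⟨_, .act _ _ (Nat.zero_le _) (Nat.zero_le _),
    Function.update τ 0 (.home (p (readInput x i)), (τ 0).2), ?_,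
    ⟨?_, fun j hj => ?_, fun j hj => ?_⟩, ?_, fun r hr => ?_⟩
  · simp [WData.apply, WData.read, h1, h2, hi]
  · simp [isHome]
  · rw [Function.update_of_ne (by omega)]; exact hs.cell j hj
  · rw [Function.update_of_ne (by omega)]; exact hs.blank j hj
  · simp
  · rw [← he r hr]
    exact digitSum_congr fun j hj => by rw [Function.update_of_ne (by omega)]

/-- All positions beyond the input read as the right end marker, so clamping the head cannot be
observed, and any register value is admissible as an input position. -/
theorem readInput_min (x : List I) (i : ℕ) : readInput x (min i (x.length + 1)) = readInput x i := by
  rcases le_total i (x.length + 1) with h | h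
  · rw [min_eq_left h]
  · rw [min_eq_right h]
    have h1 : x[x.length + 1 - 1]? = none := by simp
    have h2 : x[i - 1]? = none := by rw [List.getElem?_eq_none_iff]; omega
    simp only [readInput, h1, h2]
    rw [if_neg (by omega), if_neg (by omega)]

/-- Set the register `t` to the truth of `p` for the input symbol at the position in register `a`. -/
def WP.symAt (p : InSym I → Bool) (a t : ℕ) : WP I O (TSym k c) :=
  .seq (.zero t) (.seq (.ltFlag t a) (.seq (.loop flagOf (.seq (.inc (c + 2) t) (.seq .inRight
    (.ltFlag t a)))) (.seq (.symFlag p) (.seq .rewind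
      (.seq (.zero t) (.cond flagOf (.inc (c + 2) t) (.zero t)))))))

/-- The register `t` serves twice: it counts the moves of the input head up to the value of `a`, and
is then overwritten with the answer, which the flag has kept during the rewinding. -/
theorem does_symAt (p : InSym I → Bool) {a t : ℕ} (ha : a < k) (ht : t < k) (hat : a ≠ t) {e b}
    {o : List O} (hB : W + 1 ≤ B) (hW : 1 < (c + 2) ^ W) (hea : e a < (c + 2) ^ W) :
    ∃ b', Does x B W (.symAt p a t : WP I O (TSym k c)) 0 e b o 0
      (Function.update e t (if p (readInput x (e a)) then 1 else 0)) b' o := by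
  have loop : ∀ n m : ℕ, m + n = e a →
      Does x B W (.loop flagOf (.seq (.inc (c + 2) t) (.seq .inRight (.ltFlag t a))) :
        WP I O (TSym k c)) (min m (x.length + 1)) (Function.update e t m) (decide (m < e a)) o
        (min (e a) (x.length + 1)) (Function.update e t (e a)) false o := by
    intro n
    induction n with
    | zero =>
      intro m hm
      obtain rfl : m = e a := by omega
      rw [decide_eq_false (lt_irrefl _)]
      exact .loop_false _ _ _ _
    | succ n ih =>
      intro m hm
      rw [decide_eq_true (by omega : m < e a)]
      have h1 := does_inc (x := x) (B := B) (W := W) (c := c) ht (i := min m (x.length + 1))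
        (e := Function.update e t m) (b := true) (o := o) (by omega) hB
      rw [Function.update_self, Function.update_idem, Nat.mod_eq_of_lt (by omega)] at h1
      have h2 := does_inRight (x := x) (B := B) (W := W) (k := k) (c := c)
        (i := min m (x.length + 1)) (e := Function.update e t (m + 1)) (b := true) (o := o)
      have h3 := does_ltFlag (x := x) (B := B) (W := W) (c := c) ht ha
        (i := min (min m (x.length + 1) + 1) (x.length + 1)) (e := Function.update e t (m + 1))
        (b := true) (o := o) (by omega) hB
      rw [Function.update_self, Function.update_of_ne hat] at h3
      have h4 := ih (m + 1) (by omega)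
      rw [show min (min m (x.length + 1) + 1) (x.length + 1) = min (m + 1) (x.length + 1) by omega]
        at h2 h3
      exact .loop_true (h1.seq (h2.seq h3)) h4
  have h1 := does_zero (x := x) (B := B) (W := W) (c := c) ht (i := 0) (e := e) (b := b) (o := o)
    (by omega) hB
  have h2 := does_ltFlag (x := x) (B := B) (W := W) (c := c) ht ha (i := 0)
    (e := Function.update e t 0) (b := b) (o := o) (by omega) hB
  rw [Function.update_self, Function.update_of_ne hat] at h2
  have h3 := loop (e a) 0 (by omega)
  rw [Nat.zero_min] at h3
  have h4 := does_symFlag (x := x) (B := B) (W := W) (k := k) (c := c) p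
    (i := min (e a) (x.length + 1)) (e := Function.update e t (e a)) (b := false) (o := o) (by omega)
  rw [readInput_min] at h4
  have h5 := does_rewind (x := x) (B := B) (W := W) (k := k) (c := c)
    (i := min (e a) (x.length + 1)) (e := Function.update e t (e a))
    (b := p (readInput x (e a))) (o := o) (by omega)
  have h6 := does_zero (x := x) (B := B) (W := W) (c := c) ht (i := 0)
    (e := Function.update e t (e a)) (b := p (readInput x (e a))) (o := o) (by omega) hB
  rw [Function.update_idem] at h6
  refine ⟨p (readInput x (e a)),
    h1.seq (h2.seq (h3.seq (h4.seq (h5.seq (h6.seq ?_)))))⟩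
  cases hp : p (readInput x (e a)) with
  | true =>
    refine .cond_true ?_
    have := does_inc (x := x) (B := B) (W := W) (c := c) ht (i := 0)
      (e := Function.update e t 0) (b := true) (o := o) (by omega) hB
    rw [Function.update_self, Function.update_idem, Nat.mod_eq_of_lt (by omega)] at this
    exact this
  | false =>
    refine .cond_false ?_
    have := does_zero (x := x) (B := B) (W := W) (c := c) ht (i := 0)
      (e := Function.update e t 0) (b := false) (o := o) (by omega) hB
    rw [Function.update_idem] at this
    exact this

/-! ### Setting up the work tape -/

def blankSym : TSym k c := (.blank, fun _ => 0)

/-- Write the home mark, and count the symbols of the input tape in binary in register `0`. -/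
def WP.count : WP I O (TSym k c) :=
  .seq (.put (fun g => (.home false, g.2)) .stay)
    (.seq (.wh (fun s _ => match s with | .rightEnd => false | _ => true)
      (.seq (.carry 2 0 fun g => (.cell, (setDig 0 1 g).2)) .inRight))
    (.seq .rewind (.zero 0)))

/-- Counting in base `2`, whatever `c` is. A new cell is marked only when all bits are one, so the
number of cells remains the binary length of the counter. -/
theorem exec_carry_grow (hk : 0 < k) {i n : ℕ} {o : List O} (hi : i ≤ x.length + 1)
    (hB : W + 1 ≤ B) {τ : ℕ → TSym k c} (h : Shape W τ) (h0 : (τ 0).1 = .home false)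
    (hd : ∀ j, dig (τ (j + 1)) 0 < 2) (hz : ∀ s ≠ 0, ∀ j, dig (τ (j + 1)) s = 0)
    (hn : regVal 2 W τ 0 = n) (hW : 2 ^ W ≤ 2 * n ∨ W = 0) :
    ∃ W' τ', Exec x B (.carry 2 0 fun g => (.cell, (setDig 0 1 g).2)) ⟨i, 0, τ, o⟩ ⟨i, 0, τ', o⟩ ∧
      Shape W' τ' ∧ (τ' 0).1 = .home false ∧ (∀ j, dig (τ' (j + 1)) 0 < 2) ∧
      (∀ s ≠ 0, ∀ j, dig (τ' (j + 1)) s = 0) ∧ regVal 2 W' τ' 0 = n + 1 ∧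
      2 ^ W' ≤ 2 * (n + 1) := by
  obtain ⟨j, hjW, -, h1, h2, h3⟩ :=
    exec_carry_loop (x := x) (B := B) (β := 2) (r := 0) (o := o) hi hB W 0 τ (by omega) h
  set τ₁ : ℕ → TSym k c := fun l => if 0 < l ∧ l ≤ j then setDig 0 0 (τ l) else τ l with hτ₁
  set τ₂ := Function.update τ₁ (j + 1) (.cell, (setDig 0 1 (τ₁ (j + 1))).2) with hτ₂
  have s1 : Shape W τ₁ := by
    refine ⟨?_, fun l hl => ?_, fun l hl => ?_⟩
    · simpa [hτ₁] using h.home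
    · simp only [hτ₁]; split_ifs <;> simp [h.cell _ hl]
    · simp only [hτ₁]; rw [if_neg (by omega), h.blank _ hl]
  have hmid : τ₁ (j + 1) = τ (j + 1) := by simp only [hτ₁]; rw [if_neg (by omega)]
  have hlow : ∀ l < j, dig (τ₂ (l + 1)) 0 = 0 := by
    intro l hl
    rw [hτ₂, Function.update_of_ne (by omega)]
    simp only [hτ₁]
    rw [if_pos (by omega), dig_setDig_self hk (by omega)]
  have hhigh : ∀ l, j < l → τ₂ (l + 1) = τ (l + 1) := by
    intro l hl
    rw [hτ₂, Function.update_of_ne (by omega)]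
    simp only [hτ₁]
    rw [if_neg (by omega)]
  have hmid2 : dig (τ₂ (j + 1)) 0 = 1 := by
    rw [hτ₂, Function.update_self]
    exact dig_setDig_self hk (by omega) (τ₁ (j + 1))
  have s2 : Shape (max W (j + 1)) τ₂ := by
    refine ⟨?_, fun l hl => ?_, fun l hl => ?_⟩
    · rw [hτ₂, Function.update_of_ne (by omega)]; exact s1.home
    · by_cases hlj : l = j
      · subst hlj; rw [hτ₂, Function.update_self]
      · rw [hτ₂, Function.update_of_ne (by omega), s1.cell _ (by omega)]
    · rw [hτ₂, Function.update_of_ne (by omega), s1.blank _ (by omega)]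
  have hex : Exec x B (.carry 2 0 fun g => (.cell, (setDig 0 1 g).2)) ⟨i, 0, τ, o⟩
      ⟨i, 0, τ₂, o⟩ :=
    .seq (exec_skip_move .right hi (Nat.zero_le _) (p' := 1) (by omega) rfl)
      (.seq h1 (.seq (exec_put _ .stay hi (by omega) (p' := j + 1) (by omega) rfl rfl)
        (exec_goHome s2 hi (by omega))))
  have hsum : ∀ W' , j < W' → (∀ l, W' ≤ l → dig (τ (l + 1)) 0 = 0) → W ≤ W' →
      regVal 2 W' τ₂ 0 = n + 1 := by
    intro W' hjW' hz' hWW'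
    have h4 := digitSum_carry (β := 2) (W := W') (f := fun l => dig (τ (l + 1)) 0)
      (g := fun l => dig (τ₂ (l + 1)) 0) (by omega) hjW' (fun l hl => h2 l (Nat.zero_le _) hl) hlow
      (by
        rw [hmid2]
        rcases lt_or_ge j W with hj | hj
        · have := h3 hj
          have := hd j
          omega
        · rw [h.blank j hj]; simp [dig]) (fun l hl => by rw [hhigh l hl])
    have h5 : digitSum 2 W' (fun l => dig (τ (l + 1)) 0) = n := by
      rw [digitSum_split hWW', ← hn, Finset.sum_eq_zero, add_zero]; rfl
      intro l hl
      simp only [Finset.mem_Ico] at hl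
      rw [h.blank l hl.1]; simp [dig]
    rw [regVal, h4, h5]
  refine ⟨max W (j + 1), τ₂, hex, s2, ?_, fun l => ?_, fun s hs l => ?_,
    hsum _ (by omega) (fun l hl => by rw [h.blank l (by omega)]; simp [dig]) (by omega), ?_⟩
  · rw [hτ₂, Function.update_of_ne (by omega)]; simpa [hτ₁] using h0
  · rcases lt_trichotomy l j with hl | hl | hl
    · rw [hlow l hl]; omega
    · subst hl; rw [hmid2]; omega
    · rw [hhigh l hl]; exact hd l
  · have hset : ∀ (v : ℕ) (g : TSym k c), dig (Kind.cell, (setDig 0 v g).2) s = dig g s := by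
      intro v g
      exact dig_setDig_ne hs g
    by_cases hl : l = j
    · subst hl
      rw [hτ₂, Function.update_self, hset, hmid]; exact hz s hs l
    · rw [hτ₂, Function.update_of_ne (by omega)]
      simp only [hτ₁]
      split_ifs
      · rw [dig_setDig_ne hs]; exact hz s hs l
      · exact hz s hs l
  · rcases lt_or_ge j W with hj | hj
    · rw [max_eq_left (by omega)]
      rcases hW with hW | hW <;> omega
    · have hjW : j = W := by omega
      have h6 : n + 1 = 2 ^ W := by
        rw [← hn, regVal, ← digitSum_max (β := 2) (W := W) (by omega)]
        congr 1
        exact digitSum_congr fun l hl => h2 l (Nat.zero_le _) (by omega)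
      rw [max_eq_right (by omega), hjW, pow_succ, h6, mul_comm]

theorem readInput_ne_rightEnd (x : List I) (i : ℕ) (hi : i < x.length + 1) :
    (match readInput x i with | .rightEnd => false | _ => true) = true := by
  rcases i with _ | i
  · simp [readInput]
  · simp only [readInput, Nat.add_sub_cancel]
    rw [if_neg (by omega), List.getElem?_eq_getElem (by omega)]

theorem exec_count_loop (hk : 0 < k) {o : List O} (n : ℕ) : ∀ (i W : ℕ) (τ : ℕ → TSym k c),
    i + n = x.length + 1 → Shape W τ → (τ 0).1 = .home false →
    (∀ j, dig (τ (j + 1)) 0 < 2) → (∀ s ≠ 0, ∀ j, dig (τ (j + 1)) s = 0) →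
    regVal 2 W τ 0 = i → (2 ^ W ≤ 2 * i ∨ W = 0) → (x.length + 1).size + 1 ≤ B →
    ∃ W' τ', Exec x B (.wh (fun s _ => match s with | .rightEnd => false | _ => true)
      (.seq (.carry 2 0 fun g => (.cell, (setDig 0 1 g).2)) .inRight))
      ⟨i, 0, τ, o⟩ ⟨x.length + 1, 0, τ', o⟩ ∧ Shape W' τ' ∧ (τ' 0).1 = .home false ∧
      (∀ s ≠ 0, ∀ j, dig (τ' (j + 1)) s = 0) ∧
      x.length + 1 < 2 ^ W' ∧ (2 ^ W' ≤ 2 * (x.length + 1) ∨ W' = 0) := by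
  induction n with
  | zero =>
    intro i W τ hi hs h0 hd hz hv hW hB
    obtain rfl : i = x.length + 1 := by omega
    refine ⟨W, τ, .wh_false (Nat.zero_le _) ?_, hs, h0, hz, ?_, hW⟩
    · simp [WData.read, readInput]
    · rw [← hv]
      exact digitSum_lt fun j _ => hd j
  | succ n ih =>
    intro i W τ hi hs h0 hd hz hv hW hB
    have hWB : W + 1 ≤ B := by
      refine le_trans (Nat.succ_le_succ ?_) hB
      by_contra hlt
      push Not at hlt
      have h1 : x.length + 1 < 2 ^ (x.length + 1).size := Nat.lt_size_self _
      have h2 : 2 ^ ((x.length + 1).size + 1) ≤ 2 ^ W := Nat.pow_le_pow_right (by omega) hlt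
      rw [pow_succ] at h2
      rcases hW with hW | hW <;> omega
    obtain ⟨W', τ', h1, h2, h3, h4, h5, h6, h7⟩ :=
      exec_carry_grow (x := x) (B := B) (o := o) hk (by omega : i ≤ x.length + 1) hWB hs h0 hd hz hv hW
    obtain ⟨W'', τ'', g1, g2⟩ := ih (i + 1) W' τ' (by omega) h2 h3 h4 h5 h6 (Or.inl h7) hB
    refine ⟨W'', τ'', .wh_true ?_ (.seq h1 (.act _ _ (Nat.zero_le _) (Nat.zero_le _))) ?_, g2⟩
    · exact readInput_ne_rightEnd x i (by omega)
    · have e1 : Move.right.apply i = i + 1 := rfl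
      have e2 : Move.stay.apply 0 = 0 := rfl
      have : (WData.mk i 0 τ' o).apply x ((WData.mk i 0 τ' o).read x
          fun (_ : InSym I) (g : TSym k c) => (Move.right, g, Move.stay, (none : Option O))) =
          ⟨i + 1, 0, τ', o⟩ := by
        simp [WData.apply, WData.read, e1, e2]; omega
      rw [this]; exact g1

/-- The counter ends at the position of the right end marker, so its width is exactly the binary
length of that position. From then on all registers use this width in base `c + 2`, which gives the
range `bnd`. -/
theorem exec_count (hk : 0 < k) (hB : (x.length + 1).size + 1 ≤ B) :
    ∃ d' : WData O (TSym k c), Exec x B .count ⟨0, 0, fun _ => blankSym, []⟩ d' ∧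
      St (x.length + 1).size 0 (fun _ => 0) false [] d' := by
  set τ₀ : ℕ → TSym k c := Function.update (fun _ => blankSym) 0 (.home false, fun _ => 0) with hτ₀
  have hblank : ∀ j, τ₀ (j + 1) = blankSym := fun j => by
    rw [hτ₀, Function.update_of_ne (by omega)]
  have h0 : Shape 0 τ₀ := ⟨by simp [hτ₀, isHome], fun j hj => by omega, fun j _ => hblank j⟩
  have hdig : ∀ s j, dig (τ₀ (j + 1)) s = 0 := fun s j => by
    rw [hblank]; simp [dig, blankSym]
  obtain ⟨W', τ', h1, h2, h3, h4, h5, h6⟩ := exec_count_loop (x := x) (B := B) (o := ([] : List O)) hk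
    (x.length + 1) 0 0 τ₀ (by omega) h0 (by simp [hτ₀]) (fun j => by rw [hdig]; omega)
    (fun s _ j => hdig s j) (by simp [regVal, digitSum]) (Or.inr rfl) hB
  have hW : W' = (x.length + 1).size := by
    apply le_antisymm
    · by_contra hlt
      push Not at hlt
      have g1 : x.length + 1 < 2 ^ (x.length + 1).size := Nat.lt_size_self _
      have g2 : 2 ^ ((x.length + 1).size + 1) ≤ 2 ^ W' := Nat.pow_le_pow_right (by omega) hlt
      rw [pow_succ] at g2
      rcases h6 with h6 | h6 <;> omega
    · exact Nat.size_le.2 h5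
  subst hW
  obtain ⟨τ'', g1, g2, g3, g4⟩ := exec_mapCells (x := x) (B := B) (o := ([] : List O)) (setDig 0 0)
    (Nat.zero_le _ : 0 ≤ x.length + 1) hB h2 fun _ => rfl
  refine ⟨_, .seq (exec_put _ .stay (Nat.zero_le _) (Nat.zero_le _) (Nat.zero_le _) rfl rfl)
    (.seq h1 (.seq (exec_rewind (Nat.zero_le _) _ le_rfl) g1)), τ'', rfl, g2, by rw [g3, h3],
    fun r hr => digitSum_zero fun j hj => ?_⟩
  rw [g4 j hj]
  by_cases hr0 : r = 0
  · subst hr0; exact dig_setDig_self hk (by omega) _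
  · rw [dig_setDig_ne hr0]; exact h4 r hr0 j

/-! ## A calculus of logarithmic space functions -/

/-- Apply `f 0, …, f (n - 1)` in this order. -/
def iterNum (f : ℕ → ℕ → ℕ) : ℕ → ℕ → ℕ
  | 0, r => r
  | n + 1, r => f n (iterNum f n r)

section
variable {X I O : Type} (code : X → List I) (c : ℕ)

/-- The bound for the values of the variables. -/
def bnd (x : X) : ℕ := (c + 2) ^ ((code x).length + 1).size

/-- Number-valued functions of the instance `x` and of an assignment to the variables below `d`. -/
inductive IsNum : ℕ → (X → (ℕ → ℕ) → ℕ) → Prop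
  | var {d a} : a < d → IsNum d fun _ e => e a
  | zero {d} : IsNum d fun _ _ => 0
  | succ {d g} : IsNum d g → IsNum d fun x e => (g x e + 1) % bnd code c x
  | ltVar {d a b} : a < d → b < d → IsNum d fun _ e => if e a < e b then 1 else 0
  | symVar {d a} (p : InSym I → Bool) : a < d →
      IsNum d fun x e => if p (readInput (code x) (e a)) then 1 else 0
  | ite {d f g h} : IsNum d f → IsNum d g → IsNum d h →
      IsNum d fun x e => if f x e ≠ 0 then g x e else h x e
  | iter {d g h} : IsNum d g → IsNum (d + 2) h → IsNum d fun x e =>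
      iterNum (fun i r => h x (Function.update (Function.update e d r) (d + 1) i))
        (bnd code c x) (g x e)
  | bind {d g h} : IsNum d g → IsNum (d + 1) h →
      IsNum d fun x e => h x (Function.update e d (g x e))
  -- Only assignments that fit into the registers count. This is what allows arithmetic modulo the
  -- bound to be replaced by exact arithmetic where nothing overflows.
  | congr {d g g'} : IsNum d g →
      (∀ x e, (∀ i, e i < bnd code c x) → g x e = g' x e) → IsNum d g'

/-- List-valued functions of the instance `x` and of an assignment to the variables below `d`. -/
inductive IsOut : ℕ → (X → (ℕ → ℕ) → List O) → Prop
  | nil {d} : IsOut d fun _ _ => []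
  | emit {d} (s : O) : IsOut d fun _ _ => [s]
  | append {d F G} : IsOut d F → IsOut d G → IsOut d fun x e => F x e ++ G x e
  | ite {d f F G} : IsNum code c d f → IsOut d F → IsOut d G →
      IsOut d fun x e => if f x e ≠ 0 then F x e else G x e
  | range {d F} : IsOut (d + 1) F → IsOut d fun x e =>
      (List.range (bnd code c x)).flatMap fun i => F x (Function.update e d i)
  | bind {d g F} : IsNum code c d g → IsOut (d + 1) F →
      IsOut d fun x e => F x (Function.update e d (g x e))
  | congr {d F F'} : IsOut d F →
      (∀ x e, (∀ i, e i < bnd code c x) → F x e = F' x e) → IsOut d F'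

variable {code c}

theorem two_le_bnd (x : X) : 2 ≤ bnd code c x := by
  have h1 : ((code x).length + 1).size ≠ 0 := by
    intro h
    have := Nat.size_eq_zero.1 h
    omega
  calc 2 ≤ c + 2 := by omega
    _ = (c + 2) ^ 1 := (pow_one _).symm
    _ ≤ _ := Nat.pow_le_pow_right (by omega) (by omega)

theorem length_lt_bnd (x : X) : (code x).length + 1 < bnd code c x :=
  lt_of_lt_of_le (Nat.lt_size_self _) (Nat.pow_le_pow_left (by omega) _)

theorem update_bounded {M : ℕ} {e : ℕ → ℕ} (he : ∀ i, e i < M) (d : ℕ) {v : ℕ} (hv : v < M) :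
    ∀ i, Function.update e d v i < M := by
  intro i
  by_cases h : i = d
  · subst h; rwa [Function.update_self]
  · rw [Function.update_of_ne h]; exact he i

theorem iterNum_lt {M : ℕ} {f : ℕ → ℕ → ℕ} {n r : ℕ} (hr : r < M) (hn : n ≤ M)
    (hf : ∀ i < M, ∀ r < M, f i r < M) : iterNum f n r < M := by
  induction n with
  | zero => exact hr
  | succ n ih => exact hf n (by omega) _ (ih (by omega))

theorem IsNum.lt_bnd {d g} (h : IsNum code c d g) (x : X) {e : ℕ → ℕ}
    (he : ∀ i, e i < bnd code c x) : g x e < bnd code c x := by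
  have h2 := two_le_bnd (code := code) (c := c) x
  induction h generalizing e with
  | var h => exact he _
  | zero => exact (by omega : 0 < bnd code c x)
  | succ _ _ => exact Nat.mod_lt _ (by omega)
  | ltVar _ _ => dsimp only; split_ifs <;> omega
  | symVar p _ => dsimp only; split_ifs <;> omega
  | ite _ _ _ _ ih2 ih3 =>
    dsimp only
    split_ifs
    · exact ih2 he
    · exact ih3 he
  | iter _ _ ih1 ih2 =>
    exact iterNum_lt (ih1 he) le_rfl
      fun i hi r hr => ih2 (update_bounded (update_bounded he _ hr) _ hi)
  | bind _ _ ih1 ih2 => exact ih2 (update_bounded he _ (ih1 he))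
  | congr _ h ih => rw [← h x e he]; exact ih he

theorem update_agree {e e' : ℕ → ℕ} {d : ℕ} (h : ∀ i < d, e i = e' i) (v : ℕ) :
    ∀ i < d + 1, Function.update e d v i = Function.update e' d v i := by
  intro i hi
  by_cases hd : i = d
  · subst hd; simp
  · rw [Function.update_of_ne hd, Function.update_of_ne hd, h i (by omega)]

theorem iterNum_congr {M : ℕ} {f f' : ℕ → ℕ → ℕ} {n r : ℕ} (hr : r < M) (hn : n ≤ M)
    (hf : ∀ i < M, ∀ r < M, f i r < M) (h : ∀ i < M, ∀ r < M, f i r = f' i r) :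
    iterNum f n r = iterNum f' n r := by
  induction n with
  | zero => rfl
  | succ n ih =>
    have h1 := ih (by omega)
    have h2 := iterNum_lt (n := n) hr (by omega) hf
    simp only [iterNum]
    rw [h n (by omega) _ h2, h1]

/-- Registers from `d` on are scratch space of the compiled programs and may contain anything; the
value must not depend on them. -/
theorem IsNum.local_eq {d g} (h : IsNum code c d g) (x : X) {e e' : ℕ → ℕ}
    (he : ∀ i, e i < bnd code c x) (he' : ∀ i, e' i < bnd code c x) (hee : ∀ i < d, e i = e' i) :
    g x e = g x e' := by
  induction h generalizing e e' with
  | var h => exact hee _ h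
  | zero => rfl
  | succ _ ih => dsimp only; rw [ih he he' hee]
  | ltVar ha hb => dsimp only; rw [hee _ ha, hee _ hb]
  | symVar p ha => dsimp only; rw [hee _ ha]
  | ite _ _ _ ih1 ih2 ih3 => dsimp only; rw [ih1 he he' hee, ih2 he he' hee, ih3 he he' hee]
  | iter h1 h2 ih1 ih2 =>
    dsimp only
    rw [← ih1 he he' hee]
    exact iterNum_congr (h1.lt_bnd x he) le_rfl
      (fun i hi r hr => h2.lt_bnd x (update_bounded (update_bounded he _ hr) _ hi))
      fun i hi r hr => ih2 (update_bounded (update_bounded he _ hr) _ hi)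
        (update_bounded (update_bounded he' _ hr) _ hi) (update_agree (update_agree hee r) i)
  | bind h1 _ ih1 ih2 =>
    dsimp only
    rw [← ih1 he he' hee]
    exact ih2 (update_bounded he _ (h1.lt_bnd x he)) (update_bounded he' _ (h1.lt_bnd x he))
      (update_agree hee _)
  | congr _ h ih => rw [← h x e he, ← h x e' he']; exact ih he he' hee

theorem update_comp_shift {ρ : ℕ → ℕ} {d d' : ℕ} (h1 : ∀ i < d, ρ i < d')
    (h2 : ∀ j, ρ (d + j) = d' + j) (e : ℕ → ℕ) (v : ℕ) :
    (Function.update e d' v) ∘ ρ = Function.update (e ∘ ρ) d v := by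
  funext i
  rcases lt_trichotomy i d with h | h | h
  · have := h1 i h
    simp only [Function.comp]
    rw [Function.update_of_ne (by omega), Function.update_of_ne (by omega)]; rfl
  · subst h
    have := h2 0
    simp only [Nat.add_zero] at this
    simp [this]
  · obtain ⟨j, rfl⟩ := Nat.exists_eq_add_of_lt h
    have := h2 (j + 1)
    simp only [Function.comp]
    rw [Function.update_of_ne (by rw [Nat.add_assoc, this]; omega),
      Function.update_of_ne (by omega)]; rfl

/-- Renaming of variables. -/
theorem IsNum.rename {d g} (h : IsNum code c d g) {d' : ℕ} {ρ : ℕ → ℕ} (h1 : ∀ i < d, ρ i < d')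
    (h2 : ∀ j, ρ (d + j) = d' + j) : IsNum code c d' fun x e => g x (e ∘ ρ) := by
  have lift1 : ∀ {d d'}, (∀ i < d, ρ i < d') → (∀ j, ρ (d + j) = d' + j) →
      (∀ i < d + 1, ρ i < d' + 1) ∧ (∀ j, ρ (d + 1 + j) = d' + 1 + j) := by
    intro d d' h1 h2
    refine ⟨fun i hi => ?_, fun j => ?_⟩
    · by_cases hid : i = d
      · have := h2 0; rw [hid]; simp at this; omega
      · have := h1 i (by omega); omega
    · rw [Nat.add_assoc, h2]; omega
  induction h generalizing d' with
  | var h => exact .var (h1 _ h)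
  | zero => exact .zero
  | succ _ ih => exact .succ (ih h1 h2)
  | ltVar ha hb => exact .ltVar (h1 _ ha) (h1 _ hb)
  | symVar p ha => exact .symVar p (h1 _ ha)
  | ite _ _ _ ih1 ih2 ih3 => exact .ite (ih1 h1 h2) (ih2 h1 h2) (ih3 h1 h2)
  | @iter d g h _ _ ih1 ih2 =>
    have l1 := lift1 h1 h2
    have l2 := lift1 l1.1 l1.2
    have := IsNum.iter (ih1 h1 h2) (ih2 l2.1 l2.2)
    simpa only [update_comp_shift l1.1 l1.2, update_comp_shift h1 h2] using this
  | bind _ _ ih1 ih2 =>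
    have l1 := lift1 h1 h2
    have := IsNum.bind (ih1 h1 h2) (ih2 l1.1 l1.2)
    simpa only [update_comp_shift h1 h2] using this
  | congr _ h ih => exact .congr (ih h1 h2) fun x e he => h x _ fun i => he _

/-- The rules `iter` and `bind` name their bound variables after the arity, so a larger arity means
shifting all of them. This is a renaming that leaves a gap at `d`. -/
theorem IsNum.weaken {d g} (h : IsNum code c d g) : IsNum code c (d + 1) g := by
  have hr := h.rename (d' := d + 1) (ρ := fun i => if i < d then i else i + 1)
    (fun i hi => by simp [hi]; omega) (fun j => by simp; omega)
  refine hr.congr fun x e he => h.local_eq x (fun i => he _) he fun i hi => ?_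
  simp [hi]

/-! ### Compilation -/

/-- `P` computes `g` in register `d`. -/
def Computes {k : ℕ} (code : X → List I) (d : ℕ) (g : X → (ℕ → ℕ) → ℕ)
    (P : WP I O (TSym k c)) : Prop :=
  ∀ x B, ((code x).length + 1).size + 1 ≤ B → ∀ (e : ℕ → ℕ) (b : Bool) (o : List O),
    (∀ i, e i < bnd code c x) → ∃ e' b', (∀ i, e' i < bnd code c x) ∧ (∀ i < d, e' i = e i) ∧
      e' d = g x e ∧ Does (code x) B ((code x).length + 1).size P 0 e b o 0 e' b' o

/-- `P` writes `F`, and changes only registers from `d` on. -/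
def Writes {k : ℕ} (code : X → List I) (d : ℕ) (F : X → (ℕ → ℕ) → List O)
    (P : WP I O (TSym k c)) : Prop :=
  ∀ x B, ((code x).length + 1).size + 1 ≤ B → ∀ (e : ℕ → ℕ) (b : Bool) (o : List O),
    (∀ i, e i < bnd code c x) → ∃ e' b', (∀ i, e' i < bnd code c x) ∧ (∀ i < d, e' i = e i) ∧
      Does (code x) B ((code x).length + 1).size P 0 e b o 0 e' b' (o ++ F x e)

theorem does_flag_to_reg {k W B : ℕ} {x : List I} {d : ℕ} (hd : d < k) {e : ℕ → ℕ} {b : Bool}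
    {o : List O} (hB : W + 1 ≤ B) (hW : 1 < (c + 2) ^ W) :
    Does x B W (.seq (.zero d) (.cond flagOf (.inc (c + 2) d) (.zero d)) : WP I O (TSym k c))
      0 e b o 0 (Function.update e d (if b then 1 else 0)) b o := by
  refine (does_zero hd (Nat.zero_le _) hB).seq ?_
  cases b with
  | true =>
    refine .cond_true ?_
    have := does_inc (x := x) (B := B) (W := W) (c := c) hd (i := 0)
      (e := Function.update e d 0) (b := true) (o := o) (by omega) hB
    rwa [Function.update_self, Function.update_idem, Nat.mod_eq_of_lt (by omega)] at this
  | false =>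
    refine .cond_false ?_
    have := does_zero (x := x) (B := B) (W := W) (c := c) hd (i := 0)
      (e := Function.update e d 0) (b := false) (o := o) (by omega) hB
    rwa [Function.update_idem] at this

/-- The number `k` of registers is left open above `k0`, because all parts of a program have to be
compiled for the same tape alphabet. -/
theorem IsNum.compile {d g} (h : IsNum code c d g) :
    ∃ k0, d < k0 ∧ ∀ k ≥ k0, ∃ P : WP I O (TSym k c), Computes code d g P := by
  induction h with
  | @var d a ha =>
    refine ⟨d + 1, by omega, fun k hk => ⟨.copy a d, fun x B hB e b o he => ⟨_, _,
      update_bounded he d (he a), fun i hi => Function.update_of_ne (by omega) _ _,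
      Function.update_self _ _ _, does_copy (by omega) (by omega) (Nat.zero_le _) hB⟩⟩⟩
  | @zero d =>
    refine ⟨d + 1, by omega, fun k hk => ⟨.zero d, fun x B hB e b o he => ⟨_, _,
      update_bounded he d (v := 0) (by have := two_le_bnd (code := code) (c := c) x; omega),
      fun i hi => Function.update_of_ne (by omega) _ _,
      Function.update_self _ _ _, does_zero (by omega) (Nat.zero_le _) hB⟩⟩⟩
  | @succ d g hg ih =>
    obtain ⟨k0, hk0, ih⟩ := ih
    refine ⟨k0, hk0, fun k hk => ?_⟩
    obtain ⟨P, hP⟩ := ih k hk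
    refine ⟨.seq P (.inc (c + 2) d), fun x B hB e b o he => ?_⟩
    obtain ⟨e', b', h1, h2, h3, h4⟩ := hP x B hB e b o he
    refine ⟨_, _, update_bounded h1 d (v := (e' d + 1) % bnd code c x) (Nat.mod_lt _ ?_),
      fun i hi => ?_, ?_, h4.seq (does_inc (by omega) (Nat.zero_le _) hB)⟩
    · have := two_le_bnd (code := code) (c := c) x; omega
    · rw [Function.update_of_ne (by omega), h2 i hi]
    · rw [Function.update_self, h3]
  | @ltVar d a b' ha hb =>
    refine ⟨d + 1, by omega, fun k hk => ⟨.seq (.ltFlag a b') (.seq (.zero d)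
      (.cond flagOf (.inc (c + 2) d) (.zero d))), fun x B hB e b o he => ?_⟩⟩
    have h2 := two_le_bnd (code := code) (c := c) x
    refine ⟨_, _, update_bounded he d (v := if decide (e a < e b') then 1 else 0) ?_,
      fun i hi => Function.update_of_ne (by omega) _ _, ?_,
      (does_ltFlag (by omega) (by omega) (Nat.zero_le _) hB).seq
        (does_flag_to_reg (by omega) hB (by unfold bnd at h2; omega))⟩
    · split_ifs <;> omega
    · simp
  | @symVar d a p ha =>
    refine ⟨d + 1, by omega, fun k hk => ⟨.symAt p a d, fun x B hB e b o he => ?_⟩⟩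
    have h2 := two_le_bnd (code := code) (c := c) x
    obtain ⟨b', h3⟩ := does_symAt (k := k) (x := code x) (B := B) (b := b) (o := o) p (by omega)
      (by omega) (by omega : a ≠ d) hB (by unfold bnd at h2; omega) (he a)
    refine ⟨_, _, update_bounded he d (v := if p (readInput (code x) (e a)) then 1 else 0) ?_,
      fun i hi => Function.update_of_ne (by omega) _ _, Function.update_self _ _ _, h3⟩
    split_ifs <;> omega
  | @ite d f g h hf hg hh ih1 ih2 ih3 =>
    obtain ⟨k1, hk1, ih1⟩ := ih1
    obtain ⟨k2, hk2, ih2⟩ := ih2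
    obtain ⟨k3, hk3, ih3⟩ := ih3
    refine ⟨max k1 (max k2 k3), by omega, fun k hk => ?_⟩
    obtain ⟨P1, hP1⟩ := ih1 k (by omega)
    obtain ⟨P2, hP2⟩ := ih2 k (by omega)
    obtain ⟨P3, hP3⟩ := ih3 k (by omega)
    refine ⟨.seq P1 (.seq (.nzFlag d) (.cond flagOf P2 P3)), fun x B hB e b o he => ?_⟩
    obtain ⟨e1, b1, a1, a2, a3, a4⟩ := hP1 x B hB e b o he
    have a5 := a4.seq (does_nzFlag (r := d) (by omega) (Nat.zero_le _) hB)
    rw [a3] at a5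
    by_cases hz : f x e ≠ 0
    · obtain ⟨e2, b2, c1, c2, c3, c4⟩ := hP2 x B hB e1 true o a1
      refine ⟨e2, b2, c1, fun i hi => by rw [c2 i hi, a2 i hi], ?_, a4.seq
        ((does_nzFlag (r := d) (by omega) (Nat.zero_le _) hB).seq ?_)⟩
      · dsimp only; rw [c3, if_pos hz, hg.local_eq x a1 he a2]
      · rw [a3, decide_eq_true hz]; exact .cond_true c4
    · obtain ⟨e2, b2, c1, c2, c3, c4⟩ := hP3 x B hB e1 false o a1
      refine ⟨e2, b2, c1, fun i hi => by rw [c2 i hi, a2 i hi], ?_, a4.seq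
        ((does_nzFlag (r := d) (by omega) (Nat.zero_le _) hB).seq ?_)⟩
      · dsimp only; rw [c3, if_neg hz, hh.local_eq x a1 he a2]
      · rw [a3, decide_eq_false hz]; exact .cond_false c4
  | @bind d g h hg hh ih1 ih2 =>
    obtain ⟨k1, hk1, ih1⟩ := ih1
    obtain ⟨k2, hk2, ih2⟩ := ih2
    refine ⟨max k1 k2, by omega, fun k hk => ?_⟩
    obtain ⟨P1, hP1⟩ := ih1 k (by omega)
    obtain ⟨P2, hP2⟩ := ih2 k (by omega)
    refine ⟨.seq P1 (.seq P2 (.copy (d + 1) d)), fun x B hB e b o he => ?_⟩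
    obtain ⟨e1, b1, a1, a2, a3, a4⟩ := hP1 x B hB e b o he
    obtain ⟨e2, b2, c1, c2, c3, c4⟩ := hP2 x B hB e1 b1 o a1
    refine ⟨_, _, update_bounded c1 d (c1 (d + 1)), fun i hi => ?_, ?_,
      a4.seq (c4.seq (does_copy (by omega) (by omega) (Nat.zero_le _) hB))⟩
    · rw [Function.update_of_ne (by omega), c2 i (by omega), a2 i hi]
    · rw [Function.update_self, c3]
      refine hh.local_eq x a1 (update_bounded he _ (hg.lt_bnd x he)) fun i hi => ?_
      by_cases hid : i = d
      · subst hid; rw [a3, Function.update_self]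
      · rw [Function.update_of_ne hid, a2 i (by omega)]
  | @iter d g h hg hh ih1 ih2 =>
    obtain ⟨k1, hk1, ih1⟩ := ih1
    obtain ⟨k2, hk2, ih2⟩ := ih2
    refine ⟨max k1 k2, by omega, fun k hk => ?_⟩
    obtain ⟨P1, hP1⟩ := ih1 k (by omega)
    obtain ⟨P2, hP2⟩ := ih2 k (by omega)
    set body : WP I O (TSym k c) :=
      .seq P2 (.seq (.copy (d + 2) d) (.seq (.inc (c + 2) (d + 1)) (.nzFlag (d + 1)))) with hbody
    -- The counter runs through all values of a register, and the return to zero ends the loop. As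
    -- it also starts at zero, the body is executed once in advance.
    refine ⟨.seq P1 (.seq (.zero (d + 1)) (.seq body (.loop flagOf body))),
      fun x B hB e b o he => ?_⟩
    have h2 := two_le_bnd (code := code) (c := c) x
    set M := bnd code c x with hM
    set F : ℕ → ℕ → ℕ := fun i r => h x (Function.update (Function.update e d r) (d + 1) i) with hF
    have hFlt : ∀ i < M, ∀ r < M, F i r < M := fun i hi r hr =>
      hh.lt_bnd x (update_bounded (update_bounded he _ hr) _ hi)
    have step : ∀ (e1 : ℕ → ℕ) (b1 : Bool), (∀ i, e1 i < M) → (∀ i < d, e1 i = e i) →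
        ∃ e2, (∀ i, e2 i < M) ∧ (∀ i < d, e2 i = e i) ∧ e2 d = F (e1 (d + 1)) (e1 d) ∧
          e2 (d + 1) = (e1 (d + 1) + 1) % M ∧
          Does (code x) B ((code x).length + 1).size body 0 e1 b1 o 0 e2
            (decide (e2 (d + 1) ≠ 0)) o := by
      intro e1 b1 he1 hag
      obtain ⟨e2, b2, c1, c2, c3, c4⟩ := hP2 x B hB e1 b1 o he1
      have v1 := update_bounded c1 d (c1 (d + 2))
      refine ⟨Function.update (Function.update e2 d (e2 (d + 2))) (d + 1)
        ((Function.update e2 d (e2 (d + 2)) (d + 1) + 1) % M),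
        update_bounded v1 _ (Nat.mod_lt _ (by omega)), fun i hi => ?_, ?_, ?_,
        c4.seq ((does_copy (by omega) (by omega) (Nat.zero_le _) hB).seq
          ((does_inc (by omega) (Nat.zero_le _) hB).seq
            (does_nzFlag (by omega) (Nat.zero_le _) hB)))⟩
      · rw [Function.update_of_ne (by omega), Function.update_of_ne (by omega), c2 i (by omega),
          hag i hi]
      · rw [Function.update_of_ne (by omega), Function.update_self, c3]
        refine hh.local_eq x he1 (update_bounded (update_bounded he _ (he1 d)) _ (he1 (d + 1)))
          fun i hi => ?_
        by_cases hid : i = d + 1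
        · subst hid; rw [Function.update_self]
        · rw [Function.update_of_ne hid]
          by_cases hid' : i = d
          · subst hid'; rw [Function.update_self]
          · rw [Function.update_of_ne hid', hag i (by omega)]
      · rw [Function.update_self, Function.update_of_ne (by omega), c2 (d + 1) (by omega)]
    obtain ⟨e1, b1, a1, a2, a3, a4⟩ := hP1 x B hB e b o he
    have loop : ∀ n m : ℕ, m + n = M → 0 < m → ∀ (e1 : ℕ → ℕ), (∀ i, e1 i < M) →
        (∀ i < d, e1 i = e i) → e1 d = iterNum F m (g x e) → e1 (d + 1) = m % M →
        ∃ e2 b2, (∀ i, e2 i < M) ∧ (∀ i < d, e2 i = e i) ∧ e2 d = iterNum F M (g x e) ∧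
          Does (code x) B ((code x).length + 1).size (.loop flagOf body) 0 e1
            (decide (e1 (d + 1) ≠ 0)) o 0 e2 b2 o := by
      intro n
      induction n with
      | zero =>
        intro m hm hm0 e1 g1 g2 g3 g4
        obtain rfl : m = M := by omega
        rw [Nat.mod_self] at g4
        refine ⟨e1, false, g1, g2, g3, ?_⟩
        rw [g4]
        exact .loop_false _ _ _ _
      | succ n ih =>
        intro m hm hm0 e1 g1 g2 g3 g4
        rw [Nat.mod_eq_of_lt (by omega)] at g4
        obtain ⟨e2, f1, f2, f3, f4, f5⟩ := step e1 true g1 g2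
        obtain ⟨e3, b3, k1, k2, k3, k4⟩ := ih (m + 1) (by omega) (by omega) e2 f1 f2
          (by rw [f3, g3, g4]; rfl) (by rw [f4, g4])
        refine ⟨e3, b3, k1, k2, k3, ?_⟩
        rw [g4, decide_eq_true (by omega)]
        exact .loop_true f5 k4
    have z1 := does_zero (k := k) (c := c) (r := d + 1) (x := code x) (B := B) (W := ((code x).length + 1).size)
      (i := 0) (e := e1) (b := b1) (o := o) (by omega) (Nat.zero_le _) hB
    obtain ⟨e2, f1, f2, f3, f4, f5⟩ := step (Function.update e1 (d + 1) 0) b1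
      (update_bounded a1 _ (by omega)) (fun i hi => by
        rw [Function.update_of_ne (by omega), a2 i hi])
    rw [Function.update_self, Function.update_of_ne (by omega), a3] at f3
    rw [Function.update_self] at f4
    obtain ⟨e3, b3, k1, k2, k3, k4⟩ := loop (M - 1) 1 (by omega) (by omega) e2 f1 f2
      (by rw [f3]; rfl) (by rw [f4])
    exact ⟨e3, b3, k1, k2, k3, a4.seq (z1.seq (f5.seq k4))⟩
  | congr _ h ih =>
    obtain ⟨k0, hk0, ih⟩ := ih
    refine ⟨k0, hk0, fun k hk => ?_⟩
    obtain ⟨P, hP⟩ := ih k hk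
    refine ⟨P, fun x B hB e b o he => ?_⟩
    rw [← h x e he]
    exact hP x B hB e b o he

theorem IsOut.local_eq {d} {F : X → (ℕ → ℕ) → List O} (h : IsOut code c d F) (x : X)
    {e e' : ℕ → ℕ} (he : ∀ i, e i < bnd code c x) (he' : ∀ i, e' i < bnd code c x)
    (hee : ∀ i < d, e i = e' i) : F x e = F x e' := by
  induction h generalizing e e' with
  | nil => rfl
  | emit => rfl
  | append _ _ ih1 ih2 => dsimp only; rw [ih1 he he' hee, ih2 he he' hee]
  | ite h _ _ ih1 ih2 => dsimp only; rw [ih1 he he' hee, ih2 he he' hee, h.local_eq x he he' hee]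
  | range _ ih =>
    refine List.flatMap_congr fun i hi => ?_
    rw [List.mem_range] at hi
    exact ih (update_bounded he _ hi) (update_bounded he' _ hi) (update_agree hee i)
  | bind h1 _ ih =>
    dsimp only
    rw [← h1.local_eq x he he' hee]
    exact ih (update_bounded he _ (h1.lt_bnd x he)) (update_bounded he' _ (h1.lt_bnd x he))
      (update_agree hee _)
  | congr _ h ih => rw [← h x e he, ← h x e' he']; exact ih he he' hee

theorem IsOut.compile {d} {F : X → (ℕ → ℕ) → List O} (h : IsOut code c d F) :
    ∃ k0, d < k0 ∧ ∀ k ≥ k0, ∃ P : WP I O (TSym k c), Writes code d F P := by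
  induction h with
  | @nil d =>
    refine ⟨d + 1, by omega, fun k hk => ⟨.setFlag true, fun x B hB e b o he => ⟨e, true, he,
      fun _ _ => rfl, ?_⟩⟩⟩
    rw [List.append_nil]
    exact does_setFlag true (Nat.zero_le _)
  | @emit d s =>
    exact ⟨d + 1, by omega, fun k hk => ⟨.emit s, fun x B hB e b o he => ⟨e, b, he,
      fun _ _ => rfl, does_emit s (Nat.zero_le _)⟩⟩⟩
  | @append d F G hF hG ih1 ih2 =>
    obtain ⟨k1, hk1, ih1⟩ := ih1
    obtain ⟨k2, hk2, ih2⟩ := ih2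
    refine ⟨max k1 k2, by omega, fun k hk => ?_⟩
    obtain ⟨P1, hP1⟩ := ih1 k (by omega)
    obtain ⟨P2, hP2⟩ := ih2 k (by omega)
    refine ⟨.seq P1 P2, fun x B hB e b o he => ?_⟩
    obtain ⟨e1, b1, a1, a2, a3⟩ := hP1 x B hB e b o he
    obtain ⟨e2, b2, c1, c2, c3⟩ := hP2 x B hB e1 b1 (o ++ F x e) a1
    refine ⟨e2, b2, c1, fun i hi => by rw [c2 i hi, a2 i hi], ?_⟩
    dsimp only
    rw [← List.append_assoc, ← hG.local_eq x a1 he a2]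
    exact a3.seq c3
  | @ite d f F G hf hF hG ih2 ih3 =>
    obtain ⟨k1, hk1, ih1⟩ := hf.compile (O := O)
    obtain ⟨k2, hk2, ih2⟩ := ih2
    obtain ⟨k3, hk3, ih3⟩ := ih3
    refine ⟨max k1 (max k2 k3), by omega, fun k hk => ?_⟩
    obtain ⟨P1, hP1⟩ := ih1 k (by omega)
    obtain ⟨P2, hP2⟩ := ih2 k (by omega)
    obtain ⟨P3, hP3⟩ := ih3 k (by omega)
    refine ⟨.seq P1 (.seq (.nzFlag d) (.cond flagOf P2 P3)), fun x B hB e b o he => ?_⟩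
    obtain ⟨e1, b1, a1, a2, a3, a4⟩ := hP1 x B hB e b o he
    by_cases hz : f x e ≠ 0
    · obtain ⟨e2, b2, c1, c2, c4⟩ := hP2 x B hB e1 true o a1
      refine ⟨e2, b2, c1, fun i hi => by rw [c2 i hi, a2 i hi], a4.seq
        ((does_nzFlag (r := d) (by omega) (Nat.zero_le _) hB).seq ?_)⟩
      dsimp only
      rw [a3, decide_eq_true hz, if_pos hz, ← hF.local_eq x a1 he a2]; exact .cond_true c4
    · obtain ⟨e2, b2, c1, c2, c4⟩ := hP3 x B hB e1 false o a1
      refine ⟨e2, b2, c1, fun i hi => by rw [c2 i hi, a2 i hi], a4.seq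
        ((does_nzFlag (r := d) (by omega) (Nat.zero_le _) hB).seq ?_)⟩
      dsimp only
      rw [a3, decide_eq_false hz, if_neg hz, ← hG.local_eq x a1 he a2]; exact .cond_false c4
  | @bind d g F hg hF ih2 =>
    obtain ⟨k1, hk1, ih1⟩ := hg.compile (O := O)
    obtain ⟨k2, hk2, ih2⟩ := ih2
    refine ⟨max k1 k2, by omega, fun k hk => ?_⟩
    obtain ⟨P1, hP1⟩ := ih1 k (by omega)
    obtain ⟨P2, hP2⟩ := ih2 k (by omega)
    refine ⟨.seq P1 P2, fun x B hB e b o he => ?_⟩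
    obtain ⟨e1, b1, a1, a2, a3, a4⟩ := hP1 x B hB e b o he
    obtain ⟨e2, b2, c1, c2, c4⟩ := hP2 x B hB e1 b1 o a1
    refine ⟨e2, b2, c1, fun i hi => by rw [c2 i (by omega), a2 i hi], ?_⟩
    dsimp only
    rw [← hF.local_eq x a1 (update_bounded he _ (hg.lt_bnd x he)) fun i hi => ?_]
    · exact a4.seq c4
    · by_cases hid : i = d
      · subst hid; rw [a3, Function.update_self]
      · rw [Function.update_of_ne hid, a2 i (by omega)]
  | @range d F hF ih2 =>
    obtain ⟨k2, hk2, ih2⟩ := ih2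
    refine ⟨k2, by omega, fun k hk => ?_⟩
    obtain ⟨P2, hP2⟩ := ih2 k (by omega)
    set body : WP I O (TSym k c) := .seq P2 (.seq (.inc (c + 2) d) (.nzFlag d)) with hbody
    refine ⟨.seq (.zero d) (.seq body (.loop flagOf body)), fun x B hB e b o he => ?_⟩
    have h2 := two_le_bnd (code := code) (c := c) x
    set M := bnd code c x with hM
    set G : ℕ → List O := fun i => F x (Function.update e d i) with hG
    have step : ∀ (e1 : ℕ → ℕ) (b1 : Bool) (o : List O), (∀ i, e1 i < M) → (∀ i < d, e1 i = e i) →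
        ∃ e2, (∀ i, e2 i < M) ∧ (∀ i < d, e2 i = e i) ∧ e2 d = (e1 d + 1) % M ∧
          Does (code x) B ((code x).length + 1).size body 0 e1 b1 o 0 e2
            (decide (e2 d ≠ 0)) (o ++ G (e1 d)) := by
      intro e1 b1 o he1 hag
      obtain ⟨e2, b2, c1, c2, c4⟩ := hP2 x B hB e1 b1 o he1
      refine ⟨Function.update e2 d ((e2 d + 1) % M),
        update_bounded c1 _ (Nat.mod_lt _ (by omega)), fun i hi => ?_, ?_, ?_⟩
      · rw [Function.update_of_ne (by omega), c2 i (by omega), hag i hi]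
      · rw [Function.update_self, c2 d (by omega)]
      · have : G (e1 d) = F x e1 := by
          refine hF.local_eq x (update_bounded he _ (he1 d)) he1 fun i hi => ?_
          by_cases hid : i = d
          · subst hid; rw [Function.update_self]
          · rw [Function.update_of_ne hid, hag i (by omega)]
        rw [this]
        exact c4.seq ((does_inc (by omega) (Nat.zero_le _) hB).seq
            (does_nzFlag (by omega) (Nat.zero_le _) hB))
    have loop : ∀ n m : ℕ, m + n = M → 0 < m → ∀ (e1 : ℕ → ℕ), (∀ i, e1 i < M) →
        (∀ i < d, e1 i = e i) → e1 d = m % M →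
        ∃ e2 b2, (∀ i, e2 i < M) ∧ (∀ i < d, e2 i = e i) ∧
          Does (code x) B ((code x).length + 1).size (.loop flagOf body) 0 e1
            (decide (e1 d ≠ 0)) (o ++ (List.range m).flatMap G) 0 e2 b2
            (o ++ (List.range M).flatMap G) := by
      intro n
      induction n with
      | zero =>
        intro m hm hm0 e1 g1 g2 g4
        obtain rfl : m = M := by omega
        rw [Nat.mod_self] at g4
        refine ⟨e1, false, g1, g2, ?_⟩
        rw [g4]
        exact .loop_false _ _ _ _
      | succ n ih =>
        intro m hm hm0 e1 g1 g2 g4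
        rw [Nat.mod_eq_of_lt (by omega)] at g4
        obtain ⟨e2, f1, f2, f4, f5⟩ := step e1 true (o ++ (List.range m).flatMap G) g1 g2
        obtain ⟨e3, b3, k1, k2, k4⟩ := ih (m + 1) (by omega) (by omega) e2 f1 f2 (by rw [f4, g4])
        refine ⟨e3, b3, k1, k2, ?_⟩
        rw [g4, decide_eq_true (by omega)]
        refine .loop_true f5 ?_
        rw [g4, List.append_assoc]
        rw [List.range_succ, List.flatMap_append, List.flatMap_singleton] at k4
        exact k4
    have z1 := does_zero (k := k) (c := c) (r := d) (x := code x) (B := B)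
      (W := ((code x).length + 1).size)
      (i := 0) (e := e) (b := b) (o := o) (by omega) (Nat.zero_le _) hB
    obtain ⟨e2, f1, f2, f4, f5⟩ := step (Function.update e d 0) b o
      (update_bounded he _ (by omega)) (fun i hi => by
        rw [Function.update_of_ne (by omega)])
    rw [Function.update_self] at f4 f5
    obtain ⟨e3, b3, k1, k2, k4⟩ := loop (M - 1) 1 (by omega) (by omega) e2 f1 f2 (by rw [f4])
    rw [List.range_one, List.flatMap_singleton] at k4
    exact ⟨e3, b3, k1, k2, z1.seq (f5.seq k4)⟩
  | congr _ h ih =>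
    obtain ⟨k0, hk0, ih⟩ := ih
    refine ⟨k0, hk0, fun k hk => ?_⟩
    obtain ⟨P, hP⟩ := ih k hk
    refine ⟨P, fun x B hB e b o he => ?_⟩
    rw [← h x e he]
    exact hP x B hB e b o he

theorem IsOut.logspaceComputable {F : X → (ℕ → ℕ) → List O} (h : IsOut code c 0 F) {f : X → List O}
    (hf : ∀ x, F x (fun _ => 0) = f x) : LogspaceComputable code f := by
  obtain ⟨k0, hk0, hP⟩ := h.compile
  obtain ⟨P, hP⟩ := hP k0 le_rfl
  -- The head stays within `(length + 1).size + 1` cells, which is at most `log length + 3`; this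
  -- explains the factor `4`.
  refine ⟨1, (WP.seq .count P).machine blankSym, 4, fun x => ?_⟩
  set B := ((code x).length + 1).size + 1 with hB
  have h2 := two_le_bnd (code := code) (c := c) x
  obtain ⟨d1, g1, g2⟩ := exec_count (k := k0) (c := c) (O := O) (x := code x) (B := B) hk0 le_rfl
  obtain ⟨e', b', -, -, h3⟩ := hP x B le_rfl (fun _ => 0) false [] fun _ => by omega
  obtain ⟨d2, g3, τ, rfl, -⟩ := h3 d1 g2
  obtain ⟨h4, h5⟩ := (WP.seq .count P).machine_computes blankSym (code x) B (g1.seq g3)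
  refine ⟨by simpa [hf] using h4, fun t j => (h5 t j).trans ?_⟩
  have h6 : ((code x).length + 1).size ≤ Nat.log 2 (code x).length + 2 := by
    rw [Nat.size_le]
    have := Nat.lt_pow_succ_log_self (b := 2) (by omega) (code x).length
    rw [Nat.succ_eq_add_one, pow_succ] at this
    rw [pow_succ, pow_succ]
    omega
  omega

end

/-! ## Cylinders and the law of the runs -/

section
variable {S A : Type} [Fintype S] [Fintype A]

/-- A nonnegative rational number as an extended nonnegative real number. -/
noncomputable def ennq (q : ℚ≥0) : ℝ≥0∞ := ((q : ℝ≥0) : ℝ≥0∞)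

theorem ennq_pos {q : ℚ≥0} : ennq q ≠ 0 ↔ 0 < q := by
  simp [ennq, pos_iff_ne_zero]

theorem ennq_mono {q r : ℚ≥0} (h : q ≤ r) : ennq q ≤ ennq r := by
  unfold ennq; exact_mod_cast h

theorem MDP.next_apply {M : MDP S A} {s : S} {a : A} (h : a ∈ M.avail s) (t : S) :
    M.next s a t = ennq (M.prob s a t) := by
  unfold MDP.avail at h
  unfold MDP.next MDP.prob
  cases hd : M.trans s a with
  | none => simp [hd] at h
  | some d => rfl

/-- The history `ρ 0, …, ρ (n - 1)`. -/
def hist {α : Type} (ρ : ℕ → α) (n : ℕ) : List α := List.ofFn fun i : Fin n => ρ i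

theorem hist_succ {α : Type} (ρ : ℕ → α) (n : ℕ) : hist ρ (n + 1) = hist ρ n ++ [ρ n] := by
  rw [hist, List.ofFn_succ_last]; rfl

theorem hist_congr {α : Type} {ρ ρ' : ℕ → α} {n : ℕ} (h : ∀ i < n, ρ i = ρ' i) :
    hist ρ n = hist ρ' n := by
  unfold hist; congr 1; funext i; exact h i i.2

theorem prefixList_frestrictLe (ρ : Path S A) (n : ℕ) :
    prefixList (Preorder.frestrictLe (π := fun _ => S × A) n ρ) = hist ρ (n + 1) := rfl

theorem stepPMF_apply (M : MDP S A) (σ : Strategy M) (n : ℕ) (ρ : Path S A) (y : S × A) :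
    stepPMF M σ n (Preorder.frestrictLe (π := fun _ => S × A) n ρ) y =
      M.next (ρ n).1 (ρ n).2 y.1 * ennq ((σ.act (hist ρ (n + 1)) y.1).prob y.2) := by
  classical
  obtain ⟨t, a⟩ := y
  simp only [stepPMF, PMF.bind_apply, PMF.map_apply, prefixList_frestrictLe, Prod.mk.injEq]
  rw [tsum_eq_single t]
  · rw [tsum_eq_single a]
    · rw [if_pos ⟨rfl, rfl⟩]; rfl
    · intro a' ha'; rw [if_neg]; exact fun h => ha' h.2.symm
  · intro t' ht'
    rw [ENNReal.tsum_eq_zero.2, mul_zero]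
    intro a'; rw [if_neg]; exact fun h => ht' h.1.symm

variable [MeasurableSpace S] [MeasurableSingletonClass S]
  [MeasurableSpace A] [MeasurableSingletonClass A]

instance (M : MDP S A) (σ : Strategy M) (s : S) : IsProbabilityMeasure (law M σ s) := by
  unfold law
  have : IsProbabilityMeasure (((σ.act [] s).toPMF.map fun a => (s, a)).toMeasure) := inferInstance
  infer_instance

/-- The paths that agree with `ρ` up to time `n`. -/
def cyl (ρ : Path S A) (n : ℕ) : Set (Path S A) := {ρ' | ∀ i ≤ n, ρ' i = ρ i}

theorem cyl_eq_preimage (ρ : Path S A) (n : ℕ) :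
    cyl ρ n = Preorder.frestrictLe (π := fun _ => S × A) n ⁻¹'
    {Preorder.frestrictLe (π := fun _ => S × A) n ρ} := by
  ext ρ'
  simp only [cyl, Set.mem_ofPred_eq, Set.mem_preimage, Set.mem_singleton_iff]
  constructor
  · intro h; funext i; exact h i.1 (Finset.mem_Iic.1 i.2)
  · intro h i hi
    exact congrFun h ⟨i, Finset.mem_Iic.2 hi⟩

theorem measurableSet_cyl (ρ : Path S A) (n : ℕ) : MeasurableSet (cyl ρ n) := by
  rw [cyl_eq_preimage]
  exact (measurableSet_singleton _).preimage (by fun_prop)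

-- This formula and `law_cyl_succ` are, apart from the total mass, all that is used of the
-- construction of the measure on infinite paths.
open Classical in
theorem law_cyl_zero (M : MDP S A) (σ : Strategy M) (s : S) (ρ : Path S A) :
    law M σ s (cyl ρ 0) = if (ρ 0).1 = s then ennq ((σ.act [] s).prob (ρ 0).2) else 0 := by
  have h0 : MeasurableSet ({ρ 0} : Set (S × A)) := measurableSet_singleton _
  have hcyl : cyl ρ 0 = (fun ρ' : Path S A => ρ' 0) ⁻¹' {ρ 0} := by
    ext ρ'; simp [cyl]
  have hmap : (law M σ s).map (fun ρ' : Path S A => ρ' 0) =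
      ((σ.act [] s).toPMF.map fun a => (s, a)).toMeasure := by
    set μ₀ := ((σ.act [] s).toPMF.map fun a => (s, a)).toMeasure
    have h1 := Kernel.traj_map_frestrictLe (X := fun _ => S × A) (κ := stepKernel M σ) 0 0
    have h2 : (fun ρ' : Path S A => ρ' 0) =
        (MeasurableEquiv.piUnique (fun _ : Finset.Iic 0 => S × A)) ∘ Preorder.frestrictLe (π := fun _ => S × A) 0 := by
      funext ρ'; rfl
    rw [law, Kernel.trajMeasure, h2, ← Measure.map_map (by fun_prop) (by fun_prop),
      Measure.map_comp _ _ (by fun_prop), h1, Kernel.partialTraj_self, Measure.id_comp,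
      Measure.map_map (by fun_prop) (by fun_prop)]
    convert Measure.map_id
    funext x
    simp
  rw [hcyl, ← Measure.map_apply (by fun_prop) h0, hmap, PMF.toMeasure_apply_singleton _ _ h0,
    PMF.map_apply]
  split_ifs with h
  · rw [tsum_eq_single (ρ 0).2]
    · rw [if_pos (by rw [← h])]; rfl
    · intro a ha; rw [if_neg]; intro hh; exact ha (by rw [hh])
  · rw [ENNReal.tsum_eq_zero]
    intro a; rw [if_neg]; intro hh; exact h (by rw [hh])

theorem law_cyl_succ (M : MDP S A) (σ : Strategy M) (s : S) (ρ : Path S A) (n : ℕ) :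
    law M σ s (cyl ρ (n + 1)) = law M σ s (cyl ρ n) *
      (M.next (ρ n).1 (ρ n).2 (ρ (n + 1)).1 *
        ennq ((σ.act (hist ρ (n + 1)) (ρ (n + 1)).1).prob (ρ (n + 1)).2)) := by
  have h := Kernel.map_frestrictLe_trajMeasure_compProd_eq_map_trajMeasure (X := fun _ => S × A)
    (μ₀ := ((σ.act [] s).toPMF.map fun a => (s, a)).toMeasure) (κ := stepKernel M σ) (a := n)
  have h1 : MeasurableSet ({Preorder.frestrictLe (π := fun _ => S × A) n ρ} : Set _) :=
    measurableSet_singleton _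
  have h2 : MeasurableSet ({ρ (n + 1)} : Set (S × A)) := measurableSet_singleton _
  have h3 := congrArg (fun μ => μ ({Preorder.frestrictLe (π := fun _ => S × A) n ρ} ×ˢ
    {ρ (n + 1)})) h
  beta_reduce at h3
  rw [Measure.map_apply (by fun_prop) (h1.prod h2), Measure.compProd_apply_prod h1 h2,
    lintegral_singleton, Measure.map_apply (by fun_prop) h1, ← cyl_eq_preimage] at h3
  have h4 : cyl ρ (n + 1) = (fun x : Path S A => (Preorder.frestrictLe (π := fun _ => S × A) n x, x (n + 1))) ⁻¹'
      ({Preorder.frestrictLe (π := fun _ => S × A) n ρ} ×ˢ {ρ (n + 1)}) := by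
    ext ρ'
    simp only [Set.mem_preimage, Set.mem_prod, Set.mem_singleton_iff]
    have := congrArg (ρ' ∈ ·) (cyl_eq_preimage ρ n)
    simp only [Set.mem_preimage, Set.mem_singleton_iff, eq_iff_iff] at this
    rw [← this]
    constructor
    · exact fun hh => ⟨fun i hi => hh i (by omega), hh _ le_rfl⟩
    · rintro ⟨h5, h6⟩ i hi
      rcases Nat.lt_or_ge i (n + 1) with h7 | h7
      · exact h5 i (by omega)
      · obtain rfl : i = n + 1 := by omega
        exact h6
  rw [h4]
  refine (h3.symm.trans ?_)
  rw [mul_comm]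
  congr 1
  rw [← stepPMF_apply]
  exact PMF.toMeasure_apply_singleton _ _ h2

/-- All steps of `ρ` up to time `n` have positive probability. -/
structure ConsistentUpTo (M : MDP S A) (σ : Strategy M) (s : S) (ρ : Path S A) (n : ℕ) : Prop where
  init : (ρ 0).1 = s
  act : ∀ i ≤ n, 0 < (σ.act (hist ρ i) (ρ i).1).prob (ρ i).2
  trans : ∀ i < n, 0 < M.prob (ρ i).1 (ρ i).2 (ρ (i + 1)).1

theorem law_cyl_ne_zero (M : MDP S A) (σ : Strategy M) (s : S) (ρ : Path S A) (n : ℕ) :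
    law M σ s (cyl ρ n) ≠ 0 ↔ ConsistentUpTo M σ s ρ n := by
  induction n with
  | zero =>
    rw [law_cyl_zero]
    constructor
    · intro h
      split_ifs at h with h0
      · refine ⟨h0, fun i hi => ?_, fun i hi => by omega⟩
        obtain rfl : i = 0 := by omega
        rw [h0]
        exact ennq_pos.1 h
      · exact absurd rfl h
    · intro h
      have := h.act 0 le_rfl
      rw [h.init] at this
      rw [if_pos h.init]
      exact ennq_pos.2 this
  | succ n ih =>
    rw [law_cyl_succ, mul_ne_zero_iff, mul_ne_zero_iff, ih, ennq_pos]
    constructor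
    · rintro ⟨h1, h2, h3⟩
      rw [MDP.next_apply (σ.act_avail _ _ _ (h1.act n le_rfl)), ennq_pos] at h2
      refine ⟨h1.init, fun i hi => ?_, fun i hi => ?_⟩
      · rcases Nat.lt_or_ge i (n + 1) with h | h
        · exact h1.act i (by omega)
        · obtain rfl : i = n + 1 := by omega
          exact h3
      · rcases Nat.lt_or_ge i n with h | h
        · exact h1.trans i h
        · obtain rfl : i = n := by omega
          exact h2
    · intro h
      refine ⟨⟨h.init, fun i hi => h.act i (by omega), fun i hi => h.trans i (by omega)⟩, ?_,
        h.act _ le_rfl⟩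
      rw [MDP.next_apply (σ.act_avail _ _ _ (h.act n (by omega))), ennq_pos]
      exact h.trans n (by omega)

/-- The word `w` as a cylinder. -/
def wordSet {n : ℕ} (w : Fin (n + 1) → S × A) : Set (Path S A) := {ρ | ∀ i : Fin (n + 1), ρ i = w i}

theorem wordSet_eq_cyl {n : ℕ} {w : Fin (n + 1) → S × A} {ρ : Path S A} (h : ρ ∈ wordSet w) :
    wordSet w = cyl ρ n := by
  ext ρ'
  constructor
  · intro h' i hi
    have := (h' ⟨i, by omega⟩).trans (h ⟨i, by omega⟩).symm
    exact this
  · intro h' i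
    exact (h' i (by omega)).trans (h i)

/-- Almost every run is consistent with the strategy. -/
theorem ae_consistent (M : MDP S A) (σ : Strategy M) (s : S) :
    ∀ᵐ ρ ∂(law M σ s), ∀ n, ConsistentUpTo M σ s ρ n := by
  rw [ae_all_iff]
  intro n
  rw [ae_iff]
  refine measure_mono_null (t := ⋃ w : Fin (n + 1) → S × A,
    (wordSet w ∩ {ρ | ¬ ConsistentUpTo M σ s ρ n})) ?_ ?_
  · intro ρ hρ
    exact Set.mem_iUnion.2 ⟨fun i => ρ i, fun _ => rfl, hρ⟩
  · rw [measure_iUnion_null_iff]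
    intro w
    rcases (wordSet w ∩ {ρ | ¬ ConsistentUpTo M σ s ρ n}).eq_empty_or_nonempty with h | ⟨ρ, h1, h2⟩
    · rw [h, measure_empty]
    · refine measure_mono_null Set.inter_subset_left ?_
      rw [wordSet_eq_cyl h1]
      by_contra h3
      exact h2 ((law_cyl_ne_zero M σ s ρ n).1 h3)

/-- The winning strategies in this file win on every consistent run, so no probability has to be
estimated for them. Measurability of `E` plays no role. -/
theorem prob_eq_one (M : MDP S A) (σ : Strategy M) (s : S) (E : Set (Path S A))
    (h : ∀ ρ, (∀ n, ConsistentUpTo M σ s ρ n) → ρ ∈ E) : σ.prob s E = 1 := by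
  have h1 : ∀ᵐ ρ ∂(law M σ s), ρ ∈ M.Runs ∩ E := by
    filter_upwards [ae_consistent M σ s] with ρ hρ
    exact ⟨fun i => (hρ (i + 1)).trans i (by omega), h ρ hρ⟩
  rw [Strategy.prob, ← measure_univ (μ := law M σ s)]
  exact measure_congr (by
    filter_upwards [h1] with ρ hρ
    exact propext ⟨fun _ => trivial, fun _ => hρ⟩)

/-- An objective is missed with positive probability if it is missed by all consistent
continuations of some consistent history. -/
theorem prob_lt_one (M : MDP S A) (σ : Strategy M) (s : S) (E : Set (Path S A)) (ρ : Path S A)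
    (n : ℕ) (hρ : ConsistentUpTo M σ s ρ n)
    (h : ∀ ρ', (∀ i ≤ n, ρ' i = ρ i) → (∀ n, ConsistentUpTo M σ s ρ' n) → ρ' ∉ E) :
    σ.prob s E < 1 := by
  have h0 := (law_cyl_ne_zero M σ s ρ n).2 hρ
  have h1 : law M σ s (M.Runs ∩ E) ≤ law M σ s (cyl ρ n)ᶜ := by
    refine measure_mono_ae ?_
    filter_upwards [ae_consistent M σ s] with ρ' hρ' hE hc
    exact h ρ' hc hρ' hE.2
  refine h1.trans_lt ?_
  rw [prob_compl_eq_one_sub (measurableSet_cyl ρ n)]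
  exact ENNReal.sub_lt_self ENNReal.one_ne_top one_ne_zero h0

theorem measurableSet_wordSet {n : ℕ} (w : Fin (n + 1) → S × A) :
    MeasurableSet (wordSet w) := by
  rcases (wordSet w).eq_empty_or_nonempty with h | ⟨ρ, h⟩
  · rw [h]; exact MeasurableSet.empty
  · rw [wordSet_eq_cyl h]; exact measurableSet_cyl ρ n

theorem wordSet_disjoint {n : ℕ} {w w' : Fin (n + 1) → S × A} (h : w ≠ w') :
    Disjoint (wordSet w) (wordSet w') := by
  rw [Set.disjoint_left]
  intro ρ h1 h2
  exact h (funext fun i => (h1 i).symm.trans (h2 i))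

/-- If from every history of length `i₀ + k L` the event `V` can be brought about within `L` steps
with probability at least `ε`, then almost surely it happens in some block. -/
theorem law_avoid_eq_zero (M : MDP S A) (σ : Strategy M) (s : S) (V : ℕ → Set (Path S A))
    (i₀ L : ℕ) (ε : ℝ≥0∞) (hε : ε ≠ 0)
    (hloc : ∀ n ρ ρ', (∀ i ≤ n + L, ρ i = ρ' i) → ρ ∈ V n → ρ' ∈ V n)
    (hV : ∀ n ρ, ConsistentUpTo M σ s ρ n → ∃ ρ' ∈ V n, (∀ i ≤ n, ρ' i = ρ i) ∧
      ε * law M σ s (cyl ρ n) ≤ law M σ s (cyl ρ' (n + L))) :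
    law M σ s {ρ | ∀ n, i₀ ≤ n → ρ ∉ V n} = 0 := by
  classical
  set μ := law M σ s with hμ
  set Av : ℕ → Set (Path S A) := fun k => {ρ | ∀ j < k, ρ ∉ V (i₀ + j * L)} with hAv
  have hAvloc : ∀ k ρ ρ', (∀ i ≤ i₀ + k * L, ρ i = ρ' i) → ρ ∈ Av k → ρ' ∈ Av k := by
    intro k ρ ρ' h hρ j hj hj'
    refine hρ j hj (hloc _ ρ' ρ (fun i hi => (h i ?_).symm) hj')
    have : (j + 1) * L ≤ k * L := Nat.mul_le_mul_right _ hj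
    rw [add_mul, one_mul] at this
    omega
  -- On each history of the current length, the continuation that brings about `V` takes away at
  -- least the fraction `ε` of the cylinder.
  have step : ∀ k, μ (Av (k + 1)) ≤ (1 - ε) * μ (Av k) := by
    intro k
    set n := i₀ + k * L with hn
    set Wd : Finset (Fin (n + 1) → S × A) :=
      Finset.univ.filter fun w => (wordSet w ∩ Av k).Nonempty with hWd
    -- Avoidance in the first `k` blocks depends on finitely many coordinates, so it is a finite
    -- disjoint union of cylinders.
    have hdec : Av k = ⋃ w ∈ Wd, wordSet w := by
      ext ρ
      simp only [Set.mem_iUnion, exists_prop]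
      constructor
      · intro h
        refine ⟨fun i => ρ i, ?_, fun _ => rfl⟩
        simp only [hWd, Finset.mem_filter, Finset.mem_univ, true_and]
        exact ⟨ρ, fun _ => rfl, h⟩
      · rintro ⟨w, hw, hρ⟩
        simp only [hWd, Finset.mem_filter, Finset.mem_univ, true_and] at hw
        obtain ⟨ρ', h1, h2⟩ := hw
        refine hAvloc k ρ' ρ (fun i hi => ?_) h2
        exact (h1 ⟨i, by omega⟩).trans (hρ ⟨i, by omega⟩).symm
    have hsub : Av (k + 1) ⊆ ⋃ w ∈ Wd, (wordSet w ∩ Av (k + 1)) := by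
      intro ρ h
      have h' : ρ ∈ Av k := fun j hj => h j (by omega)
      rw [hdec] at h'
      simp only [Set.mem_iUnion, exists_prop] at h' ⊢
      obtain ⟨w, hw, hρ⟩ := h'
      exact ⟨w, hw, hρ, h⟩
    calc μ (Av (k + 1)) ≤ μ (⋃ w ∈ Wd, (wordSet w ∩ Av (k + 1))) := measure_mono hsub
      _ ≤ ∑ w ∈ Wd, μ (wordSet w ∩ Av (k + 1)) := measure_biUnion_finset_le _ _
      _ ≤ ∑ w ∈ Wd, (1 - ε) * μ (wordSet w) := by
        refine Finset.sum_le_sum fun w hw => ?_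
        simp only [hWd, Finset.mem_filter, Finset.mem_univ, true_and] at hw
        obtain ⟨ρ, h1, -⟩ := hw
        rw [wordSet_eq_cyl h1]
        by_cases h0 : μ (cyl ρ n) = 0
        · refine le_trans (measure_mono Set.inter_subset_left) ?_
          rw [h0]; exact zero_le
        · obtain ⟨ρ', h2, h3, h4⟩ := hV n ρ ((law_cyl_ne_zero M σ s ρ n).1 h0)
          have h5 : cyl ρ' (n + L) ⊆ cyl ρ n := fun ρ'' h i hi =>
            (h i (by omega)).trans (h3 i hi)
          have h6 : cyl ρ n ∩ Av (k + 1) ⊆ cyl ρ n \ cyl ρ' (n + L) := by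
            rintro ρ'' ⟨h7, h8⟩
            refine ⟨h7, fun h9 => h8 k (by omega) (hloc _ ρ' ρ'' (fun i hi => (h9 i hi).symm) h2)⟩
          calc μ (cyl ρ n ∩ Av (k + 1)) ≤ μ (cyl ρ n \ cyl ρ' (n + L)) := measure_mono h6
            _ = μ (cyl ρ n) - μ (cyl ρ' (n + L)) :=
              measure_sdiff h5 (measurableSet_cyl _ _).nullMeasurableSet (measure_ne_top _ _)
            _ ≤ μ (cyl ρ n) - ε * μ (cyl ρ n) := tsub_le_tsub_left h4 _
            _ = (1 - ε) * μ (cyl ρ n) := by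
              rw [ENNReal.sub_mul fun _ _ => measure_ne_top _ _, one_mul]
      _ = (1 - ε) * ∑ w ∈ Wd, μ (wordSet w) := by rw [Finset.mul_sum]
      _ = (1 - ε) * μ (Av k) := by
        rw [hdec, measure_biUnion_finset (fun w _ w' _ h => wordSet_disjoint h)
          fun w _ => measurableSet_wordSet w]
  have hpow : ∀ k, μ (Av k) ≤ (1 - ε) ^ k := by
    intro k
    induction k with
    | zero => rw [pow_zero]; exact prob_le_one
    | succ k ih =>
      rw [pow_succ']
      exact (step k).trans (mul_le_mul' le_rfl ih)
  have hlim : Tendsto (fun k => (1 - ε) ^ k) atTop (nhds 0) :=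
    ENNReal.tendsto_pow_atTop_nhds_zero_of_lt_one
      (ENNReal.sub_lt_self ENNReal.one_ne_top one_ne_zero hε)
  refine le_antisymm (ge_of_tendsto' hlim fun k => le_trans (measure_mono ?_) (hpow k)) zero_le
  intro ρ hρ j _
  exact hρ _ (by omega)

end

/-! ### Likely continuations -/

section
variable {S A : Type} [Fintype S] [Fintype A]

/-- Some action has probability at least `1 / |A|`. -/
theorem exists_likely (d : RatDist A) : ∃ a, 1 ≤ Fintype.card A * d.prob a := by
  by_contra! h
  have hne : (Finset.univ : Finset A).Nonempty := by
    rw [Finset.univ_nonempty_iff]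
    by_contra hA
    rw [not_nonempty_iff] at hA
    have := d.sum_prob
    simp at this
  have h1 : ∑ a, (Fintype.card A : ℚ≥0) * d.prob a < ∑ _a : A, (1 : ℚ≥0) :=
    Finset.sum_lt_sum_of_nonempty hne fun a _ => h a
  rw [← Finset.mul_sum, d.sum_prob] at h1
  simp at h1

/-- Following likely actions removes the randomness of an arbitrary strategy at a price of at most a
factor `1 / |A|` per step, uniformly in the strategy and the history. -/
noncomputable def likely (d : RatDist A) : A := (exists_likely d).choose

theorem likely_spec (d : RatDist A) : 1 ≤ Fintype.card A * d.prob (likely d) :=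
  (exists_likely d).choose_spec

theorem likely_pos (d : RatDist A) : 0 < d.prob (likely d) := by
  by_contra h
  have := likely_spec d
  rw [not_lt, nonpos_iff_eq_zero] at h
  rw [h, mul_zero] at this
  exact absurd this (by norm_num)

/-- The history `h`, continued for `m` steps by likely actions and by the successors `f`. -/
noncomputable def contList {M : MDP S A} (σ : Strategy M) (f : List (S × A) → S)
    (h : List (S × A)) : ℕ → List (S × A)
  | 0 => h
  | m + 1 => contList σ f h m ++
      [(f (contList σ f h m), likely (σ.act (contList σ f h m) (f (contList σ f h m))))]

theorem contList_length {M : MDP S A} (σ : Strategy M) (f : List (S × A) → S)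
    (h : List (S × A)) (m : ℕ) : (contList σ f h m).length = h.length + m := by
  induction m with
  | zero => rfl
  | succ m ih => simp [contList, ih]; omega

theorem contList_prefix {M : MDP S A} (σ : Strategy M) (f : List (S × A) → S)
    (h : List (S × A)) {m m' : ℕ} (hm : m ≤ m') : contList σ f h m <+: contList σ f h m' := by
  induction m', hm using Nat.le_induction with
  | base => exact List.prefix_rfl
  | succ m' _ ih => exact ih.trans (List.prefix_append _ _)

/-- Every history can be continued by likely actions and by given successors. -/
theorem exists_continuation {M : MDP S A} (σ : Strategy M) (f : List (S × A) → S)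
    (ρ : Path S A) (n : ℕ) : ∃ ρ' : Path S A, (∀ i < n, ρ' i = ρ i) ∧
      ∀ i ≥ n, ρ' i = (f (hist ρ' i), likely (σ.act (hist ρ' i) (f (hist ρ' i)))) := by
  set C := contList σ f (hist ρ n) with hC
  have hlen : ∀ m, (C m).length = n + m := fun m => by
    rw [hC, contList_length]; simp [hist]
  refine ⟨fun i => (C (i + 1))[i]'(by rw [hlen]; omega), ?_⟩
  set ρ' : Path S A := fun i => (C (i + 1))[i]'(by rw [hlen]; omega) with hρ'
  have hget : ∀ m i (hi : i < n + m), (C m)[i]'(by rw [hlen]; exact hi) = ρ' i := by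
    intro m i hi
    rcases le_total m (i + 1) with h | h
    · exact (contList_prefix σ f (hist ρ n) h).getElem _
    · exact ((contList_prefix σ f (hist ρ n) h).getElem (by
        have := hlen (i + 1); rw [hC] at this; rw [this]; omega)).symm
  have hist_eq : ∀ m, hist ρ' (n + m) = C m := by
    intro m
    apply List.ext_getElem
    · rw [hlen]; simp [hist]
    · intro i h1 h2
      rw [hget m i (by rwa [hlen] at h2)]
      simp [hist]
  refine ⟨fun i hi => ?_, fun i hi => ?_⟩
  · rw [← hget 0 i (by omega)]
    simp [hC, contList, hist]
  · obtain ⟨m, rfl⟩ := Nat.exists_eq_add_of_le hi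
    rw [hist_eq, ← hget (m + 1) (n + m) (by omega)]
    simp only [hC, contList]
    rw [List.getElem_append_right (by rw [← hC, hlen])]
    simp

theorem exists_prob_lower_bound (M : MDP S A) :
    ∃ η : ℚ≥0, 0 < η ∧ ∀ s a t, 0 < M.prob s a t → η ≤ M.prob s a t := by
  classical
  set T : Finset (S × A × S) := Finset.univ.filter fun p => 0 < M.prob p.1 p.2.1 p.2.2 with hT
  rcases T.eq_empty_or_nonempty with h | h
  · refine ⟨1, one_pos, fun s a t hp => ?_⟩
    have : (s, a, t) ∈ T := by simp [hT, hp]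
    simp [h] at this
  · obtain ⟨p, hp, hmin⟩ := T.exists_min_image (fun p => M.prob p.1 p.2.1 p.2.2) h
    refine ⟨_, (Finset.mem_filter.1 hp).2, fun s a t hpos => hmin (s, a, t) (by simp [hT, hpos])⟩

variable [MeasurableSpace S] [MeasurableSingletonClass S]
  [MeasurableSpace A] [MeasurableSingletonClass A]

/-- There is a lower bound for the probability of continuing a history by likely actions. -/
theorem exists_continuation_bound (M : MDP S A) (L : ℕ) : ∃ ε : ℝ≥0∞, ε ≠ 0 ∧
    ∀ (σ : Strategy M) (s : S) (ρ : Path S A) (n : ℕ), ConsistentUpTo M σ s ρ n →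
      (∀ i, n ≤ i → i < n + L → 0 < M.prob (ρ i).1 (ρ i).2 (ρ (i + 1)).1 ∧
        (ρ (i + 1)).2 = likely (σ.act (hist ρ (i + 1)) (ρ (i + 1)).1)) →
      ε * law M σ s (cyl ρ n) ≤ law M σ s (cyl ρ (n + L)) := by
  obtain ⟨η, hη, hmin⟩ := exists_prob_lower_bound M
  set κ : ℚ≥0 := (Fintype.card A : ℚ≥0)⁻¹ with hκ
  have hlik : ∀ d : RatDist A, κ ≤ d.prob (likely d) := by
    intro d
    have h1 := likely_spec d
    have hc : (0 : ℚ≥0) < Fintype.card A := by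
      by_contra h0
      rw [not_lt, nonpos_iff_eq_zero] at h0
      rw [h0, zero_mul] at h1
      exact absurd h1 (by norm_num)
    rw [hκ, inv_le_iff_one_le_mul₀ hc, mul_comm]
    exact h1
  by_cases hκ0 : κ = 0
  · refine ⟨1, one_ne_zero, fun σ s ρ n h _ => ?_⟩
    have : Fintype.card A = 0 := by simpa [hκ] using hκ0
    exact ((Fintype.card_eq_zero_iff.1 this).false (ρ 0).2).elim
  · refine ⟨(ennq η * ennq κ) ^ L, pow_ne_zero _ (mul_ne_zero (ennq_pos.2 hη)
      (ennq_pos.2 (pos_iff_ne_zero.2 hκ0))), fun σ s ρ n h hstep => ?_⟩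
    have : ∀ m ≤ L, (ennq η * ennq κ) ^ m * law M σ s (cyl ρ n) ≤ law M σ s (cyl ρ (n + m)) ∧
        ConsistentUpTo M σ s ρ (n + m) := by
      intro m
      induction m with
      | zero => intro _; simpa using h
      | succ m ih =>
        intro hm
        obtain ⟨ih1, ih2⟩ := ih (by omega)
        obtain ⟨h1, h2⟩ := hstep (n + m) (by omega) (by omega)
        have h3 := σ.act_avail _ _ _ (ih2.act (n + m) le_rfl)
        have h4 := likely_pos (σ.act (hist ρ (n + m + 1)) (ρ (n + m + 1)).1)
        have h5 := hlik (σ.act (hist ρ (n + m + 1)) (ρ (n + m + 1)).1)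
        rw [← h2] at h4 h5
        refine ⟨?_, ih2.init, fun i hi => ?_, fun i hi => ?_⟩
        · rw [← Nat.add_assoc, law_cyl_succ, pow_succ, MDP.next_apply h3]
          calc _ = ((ennq η * ennq κ) ^ m * law M σ s (cyl ρ n)) * (ennq η * ennq κ) := by ring
            _ ≤ _ := mul_le_mul' ih1 (mul_le_mul' (ennq_mono (hmin _ _ _ h1)) (ennq_mono h5))
        · rcases Nat.lt_or_ge i (n + m + 1) with h6 | h6
          · exact ih2.act i (by omega)
          · obtain rfl : i = n + m + 1 := by omega
            exact h4
        · rcases Nat.lt_or_ge i (n + m) with h6 | h6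
          · exact ih2.trans i h6
          · obtain rfl : i = n + m := by omega
            exact h1
    exact (this L le_rfl).1

end

/-! ## Markov decision processes with uniform distributions on lists -/

section
variable {S A X : Type} [Fintype S] [Fintype A] [Fintype X]

/-- The distribution of a uniformly chosen entry of a list. -/
def RatDist.ofList [DecidableEq X] (l : List X) (h : l ≠ []) : RatDist X where
  prob x := l.count x / l.length
  sum_prob := by
    have h1 : ∑ x, l.count x = l.length := by
      simpa using Multiset.sum_count_eq_card (s := Finset.univ) (m := (l : Multiset X)) (by simp)
    have h2 : (l.length : ℚ≥0) ≠ 0 := by simpa using h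
    rw [← Finset.sum_div, ← Nat.cast_sum, h1, div_self h2]

/-- The Dirac distribution. -/
def RatDist.dirac [DecidableEq X] (x : X) : RatDist X := .ofList [x] (by simp)

theorem RatDist.dirac_pos [DecidableEq X] {x y : X} : 0 < (RatDist.dirac x).prob y ↔ y = x := by
  simp only [dirac, ofList, List.count_singleton, List.length_singleton]
  by_cases h : y = x
  · simp [h]
  · simp [h, Ne.symm h]

/-- The MDP in which the successor is chosen uniformly from the list `succ s a`; the action is not
available if this list is empty. -/
def MDP.ofList [DecidableEq S] (succ : S → A → List S) (h : ∀ s, ∃ a, succ s a ≠ []) : MDP S A where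
  trans s a := if h : succ s a = [] then none else some (.ofList (succ s a) h)
  deadlock_free s := by
    obtain ⟨a, ha⟩ := h s
    exact ⟨a, by simp [ha]⟩

variable [DecidableEq S] {succ : S → A → List S} {h : ∀ s, ∃ a, succ s a ≠ []}

theorem MDP.mem_avail_ofList {s : S} {a : A} :
    a ∈ (MDP.ofList succ h).avail s ↔ succ s a ≠ [] := by
  simp only [avail, ofList, Set.mem_ofPred_eq]
  by_cases hs : succ s a = [] <;> simp [hs]

theorem MDP.prob_ofList {s t : S} {a : A} :
    0 < (MDP.ofList succ h).prob s a t ↔ t ∈ succ s a := by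
  simp only [prob, ofList]
  by_cases hs : succ s a = []
  · simp [hs]
  · simp only [hs, dite_false, RatDist.ofList]
    rw [div_pos_iff_of_pos_right (by simpa [List.length_pos_iff] using hs), Nat.cast_pos,
      List.count_pos_iff]

end

/-! ### Enumerations -/

theorem flatMap_finRange {α : Type*} (n : ℕ) (F : Fin n → List α) (f : ℕ → List α)
    (h : ∀ i, F i = f i) : (List.finRange n).flatMap F = (List.range n).flatMap f := by
  rw [← List.map_coe_finRange_eq_range, List.flatMap_map]
  exact List.flatMap_congr fun i _ => h i

theorem flatMap_finRange_mul {α : Type*} (m n : ℕ) (F : Fin (m * n) → List α) :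
    (List.finRange (m * n)).flatMap F = (List.finRange m).flatMap fun i =>
      (List.finRange n).flatMap fun j => F (finProdFinEquiv (i, j)) := by
  have key : ∀ {k : ℕ} {β : Type} (g : Fin k → List β),
      (List.finRange k).flatMap g = (List.ofFn g).flatten := by
    intro k β g
    rw [List.flatMap_def, ← List.ofFn_eq_map]
  have h1 : List.finRange (m * n) = (List.finRange m).flatMap fun i =>
      (List.finRange n).map fun j => finProdFinEquiv (i, j) := by
    rw [key, ← List.ofFn_id, List.ofFn_mul]
    congr 2
    funext i
    rw [← List.ofFn_eq_map]
    congr 1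
    funext j
    ext
    simp [finProdFinEquiv, mul_comm, add_comm]
  rw [h1, List.flatMap_assoc]
  simp only [List.flatMap_map]

/-- Triples of numbers as numbers, in lexicographic order. -/
def tripleEquiv (a b c : ℕ) : Fin a × Fin b × Fin c ≃ Fin (a * (b * c)) :=
  (Equiv.prodCongr (Equiv.refl _) finProdFinEquiv).trans finProdFinEquiv

theorem flatMap_finRange_triple {α : Type*} (a b c : ℕ) (F : Fin (a * (b * c)) → List α) :
    (List.finRange (a * (b * c))).flatMap F = (List.finRange a).flatMap fun i =>
      (List.finRange b).flatMap fun j => (List.finRange c).flatMap fun k =>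
        F (tripleEquiv a b c (i, j, k)) := by
  rw [flatMap_finRange_mul]
  simp only [flatMap_finRange_mul]
  rfl

theorem unaryCode_mul (a b : ℕ) :
    List.replicate (a * b) (some true) =
      (List.range a).flatMap fun _ => List.replicate b (some true) := by
  induction a with
  | zero => simp
  | succ a ih =>
    rw [List.range_succ, List.flatMap_append, ← ih, add_mul, one_mul, List.replicate_add]
    simp

theorem replicate_eq_flatMap {α : Type*} (a : ℕ) (x : α) :
    List.replicate a x = (List.range a).flatMap fun _ => [x] := by
  induction a with
  | zero => simp
  | succ a ih =>
    rw [List.range_succ, List.flatMap_append, ← ih, List.replicate_succ']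
    simp

/-! ## Polynomial time and cellular automata on rings -/

/-- The configuration of a cellular automaton on the ring `ℤ / M` at time `t`. -/
def ringRun {D : Type} {M : ℕ} (loc : D → D → D → D) (c₀ : ZMod M → D) : ℕ → ZMod M → D
  | 0, r => c₀ r
  | t + 1, r => loc (ringRun loc c₀ t (r - 1)) (ringRun loc c₀ t r) (ringRun loc c₀ t (r + 1))

/-- The initial configuration with the word `x` in the cells `0, 1, …`. -/
def ringInit {D : Type} {M : ℕ} (ini : Bool → Option Bool → D) (x : List Bool) (r : ZMod M) : D :=
  ini (decide (r.val = 0)) x[r.val]?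

/-! ### Simulation of a Turing machine by a cellular automaton on a ring. -/

section simulation
open Turing

variable {Γ Q : Type} [Inhabited Γ] [Inhabited Q] (T : TM0.Machine Γ Q) (e : Bool → Γ)

/-- The content of a cell: a tape symbol, with the control state if the head is there; or
`Sum.inr true` for acceptance, or `Sum.inr false`, which never occurs. -/
abbrev Content (Γ Q : Type) := (Option Q × Γ) ⊕ Bool

-- A cell receives the head if a neighbour sends it; with a single head it does not matter which
-- neighbour is examined first. Acceptance spreads to both neighbours in each step, while a machine
-- that halts without accepting is frozen, so that the outcome can be read at a fixed time and
-- place.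
open Classical in
noncomputable def stepCell (acc : Set Q) (l m r : Content Γ Q) : Content Γ Q :=
  if l = .inr true ∨ m = .inr true ∨ r = .inr true then .inr true
  else match m with
    | .inr _ => .inr true
    | .inl (some q, a) =>
      match T q a with
      | none => if q ∈ acc then .inr true else m
      | some (q', .write b) => .inl (some q', b)
      | some (_, .move _) => .inl (none, a)
    | .inl (none, a) =>
      match l, r with
      | .inl (some q, b), r =>
        match T q b with
        | some (q', .move .right) => .inl (some q', a)
        | _ => match r with
          | .inl (some q, b) =>
            match T q b with
            | some (q', .move .left) => .inl (some q', a)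
            | _ => m
          | _ => m
      | _, .inl (some q, b) =>
        match T q b with
        | some (q', .move .left) => .inl (some q', a)
        | _ => m
      | _, _ => m

/-- This reserves `.inr false` as the symbol for giving up. -/
theorem stepCell_ne (acc : Set Q) (l m r : Content Γ Q) : stepCell T acc l m r ≠ .inr false := by
  unfold stepCell
  split
  · simp
  · rename_i h
    push Not at h
    (repeat' split) <;> simp_all

theorem stepCell_acc (acc : Set Q) {l m r : Content Γ Q}
    (h : l = .inr true ∨ m = .inr true ∨ r = .inr true) : stepCell T acc l m r = .inr true := by
  unfold stepCell; rw [if_pos h]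

open Classical in
/-- The content of cell `j` when the head is in cell `h`. -/
noncomputable def cellAt (c : TM0.Cfg Γ Q) (h j : ℤ) : Content Γ Q :=
  .inl (if j = h then some c.q else none, c.Tape.nth (j - h))

/-- The machine model shifts the tape under a fixed head, while the cells of the automaton stay in
place. The absolute position `h` of the head translates between the two. -/
theorem stepCell_cellAt (acc : Set Q) {c c' : TM0.Cfg Γ Q} (hc : TM0.step T c = some c') (h : ℤ) :
    ∃ h', ∀ j, stepCell T acc (cellAt c h (j - 1)) (cellAt c h j) (cellAt c h (j + 1)) =
      cellAt c' h' j := by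
  obtain ⟨q, tp⟩ := c
  simp only [TM0.step, Option.map_eq_some_iff] at hc
  obtain ⟨⟨q', s⟩, hT, rfl⟩ := hc
  replace hT : T q tp.head = some (q', s) := hT
  rcases s with d | b
  · rcases d with _ | _
    · refine ⟨h - 1, fun j => ?_⟩
      simp only [cellAt, Tape.move_left_nth]
      rw [show j - (h - 1) - 1 = j - h by ring]
      by_cases h1 : j = h
      · subst h1
        have h2 : ¬ j = j - 1 := by omega
        simp [stepCell, hT, h2]
      · by_cases h2 : j = h - 1
        · subst h2
          have h3 : ¬ h - 1 - 1 = h := by omega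
          have h4 : h - 1 + 1 = h := by omega
          simp [stepCell, h3, h4, hT]
        · by_cases h3 : j = h + 1
          · subst h3
            have h4 : ¬ h + 1 + 1 = h := by omega
            have h5 : ¬ h + 1 = h - 1 := by omega
            simp [stepCell, h4, hT, h5]
          · have h4 : ¬ j - 1 = h := by omega
            have h5 : ¬ j + 1 = h := by omega
            simp [stepCell, h1, h2, h4, h5]
    · refine ⟨h + 1, fun j => ?_⟩
      simp only [cellAt, Tape.move_right_nth]
      rw [show j - (h + 1) + 1 = j - h by ring]
      by_cases h1 : j = h
      · subst h1
        simp [stepCell, hT]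
      · by_cases h2 : j = h - 1
        · subst h2
          have h3 : ¬ h - 1 - 1 = h := by omega
          have h4 : h - 1 + 1 = h := by omega
          have h5 : ¬ h - 1 = h + 1 := by omega
          simp [stepCell, h3, h4, hT, h5]
        · by_cases h3 : j = h + 1
          · subst h3
            have h4 : ¬ h + 1 + 1 = h := by omega
            simp [stepCell, h4, hT]
          · have h4 : ¬ j - 1 = h := by omega
            have h5 : ¬ j + 1 = h := by omega
            simp [stepCell, h1, h3, h4, h5]
  · refine ⟨h, fun j => ?_⟩
    simp only [cellAt, Tape.write_nth]
    by_cases h1 : j = h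
    · subst h1
      simp [stepCell, hT]
    · have h6 : ¬ j - h = 0 := by omega
      by_cases h2 : j = h - 1
      · subst h2
        have h3 : ¬ h - 1 - 1 = h := by omega
        have h4 : h - 1 + 1 = h := by omega
        simp [stepCell, h3, h4, hT]
      · by_cases h3 : j = h + 1
        · subst h3
          have h4 : ¬ h + 1 + 1 = h := by omega
          simp [stepCell, h4, hT]
        · have h4 : ¬ j - 1 = h := by omega
          have h5 : ¬ j + 1 = h := by omega
          simp [stepCell, h1, h6, h4, h5]

theorem stepCell_halted (acc : Set Q) {c : TM0.Cfg Γ Q} (hc : TM0.step T c = none) (hq : c.q ∉ acc)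
    (h j : ℤ) : stepCell T acc (cellAt c h (j - 1)) (cellAt c h j) (cellAt c h (j + 1)) =
      cellAt c h j := by
  obtain ⟨q, tp⟩ := c
  simp only [TM0.step, Option.map_eq_none_iff] at hc
  replace hc : T q tp.head = none := hc
  simp only [cellAt]
  by_cases h1 : j = h
  · subst h1
    simp [stepCell, hc, hq]
  · by_cases h2 : j = h - 1
    · subst h2
      have h3 : ¬ h - 1 - 1 = h := by omega
      have h4 : h - 1 + 1 = h := by omega
      simp [stepCell, h3, h4, hc]
    · by_cases h3 : j = h + 1
      · subst h3
        have h4 : ¬ h + 1 + 1 = h := by omega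
        simp [stepCell, h4, hc]
      · have h4 : ¬ j - 1 = h := by omega
        have h5 : ¬ j + 1 = h := by omega
        simp [stepCell, h1, h4, h5]

theorem stepCell_accept (acc : Set Q) {c : TM0.Cfg Γ Q} (hc : TM0.step T c = none) (hq : c.q ∈ acc)
    (h : ℤ) : stepCell T acc (cellAt c h (h - 1)) (cellAt c h h) (cellAt c h (h + 1)) =
      .inr true := by
  obtain ⟨q, tp⟩ := c
  simp only [TM0.step, Option.map_eq_none_iff] at hc
  replace hc : T q tp.head = none := hc
  simp [stepCell, cellAt, hc, hq]

def blankCell (Γ Q : Type) [Inhabited Γ] : Content Γ Q := .inl (none, default)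

theorem stepCell_blank (acc : Set Q) : stepCell T acc (blankCell Γ Q) (blankCell Γ Q)
    (blankCell Γ Q) = blankCell Γ Q := by
  simp [stepCell, blankCell]

/-- The ring configuration `R` agrees with the machine configuration `c` with head position `h`,
which is blank outside of `[-t, N + t]`. -/
structure Matches {M : ℕ} (R : ZMod M → Content Γ Q) (c : TM0.Cfg Γ Q) (h : ℤ) (t N p : ℕ) :
    Prop where
  blank : ∀ j : ℤ, j < -t ∨ N + t < j → cellAt c h j = blankCell Γ Q
  agree : ∀ j : ℤ, -(p + 1 : ℤ) ≤ j → j < M - (p + 1) → R (j : ZMod M) = cellAt c h j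

-- The range of representatives grows by one cell on each side, so that it covers the neighbours of
-- all cells. Each additional cell is identified modulo `M` with a cell at the other end, and all of
-- these are blank, since after `t ≤ p` steps the head has not come that far.
variable {T} in
theorem Matches.agree' {M : ℕ} {R : ZMod M → Content Γ Q} {c : TM0.Cfg Γ Q} {h : ℤ} {t N p : ℕ}
    (H : Matches R c h t N p) (ht : t ≤ p) (hM : N + 2 * p + 5 ≤ M) (j : ℤ)
    (h1 : -(p + 2 : ℤ) ≤ j) (h2 : j ≤ M - (p + 1)) : R (j : ZMod M) = cellAt c h j := by
  have e1 : ((-(p + 2 : ℤ) : ℤ) : ZMod M) = ((M - (p + 2 : ℤ) : ℤ) : ZMod M) := by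
    push_cast; simp
  have e2 : ((M - (p + 1 : ℤ) : ℤ) : ZMod M) = ((-(p + 1 : ℤ) : ℤ) : ZMod M) := by
    push_cast; simp
  by_cases h3 : j = -(p + 2 : ℤ)
  · rw [h3, e1, H.agree _ (by omega) (by omega), H.blank _ (by omega), H.blank _ (by omega)]
  · by_cases h4 : j = M - (p + 1 : ℤ)
    · rw [h4, e2, H.agree _ (by omega) (by omega), H.blank _ (by omega), H.blank _ (by omega)]
    · exact H.agree j (by omega) (by omega)

theorem Matches.next {M : ℕ} {acc : Set Q} {R : ZMod M → Content Γ Q} {c c' : TM0.Cfg Γ Q} {h : ℤ}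
    {t N p : ℕ} (H : Matches R c h t N p) (ht : t ≤ p) (hM : N + 2 * p + 5 ≤ M)
    (hc : TM0.step T c = some c') :
    ∃ h', Matches (fun r => stepCell T acc (R (r - 1)) (R r) (R (r + 1))) c' h' (t + 1) N p := by
  obtain ⟨h', hh⟩ := stepCell_cellAt T acc hc h
  refine ⟨h', fun j hj => ?_, fun j h1 h2 => ?_⟩
  · push_cast at hj
    rw [← hh, H.blank _ (by omega), H.blank _ (by omega), H.blank _ (by omega), stepCell_blank]
  · have e1 : (j : ZMod M) - 1 = ((j - 1 : ℤ) : ZMod M) := by push_cast; rfl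
    have e2 : (j : ZMod M) + 1 = ((j + 1 : ℤ) : ZMod M) := by push_cast; rfl
    simp only [e1, e2]
    rw [H.agree' ht hM _ (by omega) (by omega), H.agree' ht hM _ (by omega) (by omega),
      H.agree' ht hM _ (by omega) (by omega), hh]

theorem flip_bind_iterate_none {σ : Type} (f : σ → Option σ) (n : ℕ) :
    (flip Option.bind f)^[n] none = none := by
  induction n with
  | zero => rfl
  | succ n ih => rw [Function.iterate_succ_apply]; exact ih

theorem Matches.run {M : ℕ} {acc : Set Q} {c₀ : ZMod M → Content Γ Q} {N p : ℕ}
    (hM : N + 2 * p + 5 ≤ M) (n : ℕ) : ∀ {t : ℕ} {h : ℤ} {c c' : TM0.Cfg Γ Q}, t + n ≤ p →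
    Matches (ringRun (stepCell T acc) c₀ t) c h t N p →
    (flip Option.bind (TM0.step T))^[n] (some c) = some c' →
    ∃ h', Matches (ringRun (stepCell T acc) c₀ (t + n)) c' h' (t + n) N p := by
  induction n with
  | zero =>
    intro t h c c' _ H hc
    obtain rfl : c = c' := by simpa using hc
    exact ⟨h, H⟩
  | succ n ih =>
    intro t h c c' ht H hc
    rw [Function.iterate_succ_apply] at hc
    have hb : flip Option.bind (TM0.step T) (some c) = TM0.step T c := rfl
    rw [hb] at hc
    cases hs : TM0.step T c with
    | none => rw [hs, flip_bind_iterate_none] at hc; cases hc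
    | some c'' =>
      rw [hs] at hc
      obtain ⟨h', H'⟩ := H.next (acc := acc) T (by omega) hM hs
      obtain ⟨h'', H''⟩ := ih (t := t + 1) (by omega) H' hc
      exact ⟨h'', by rwa [show t + (n + 1) = t + 1 + n by omega]⟩

noncomputable def iniCell (b : Bool) (o : Option Bool) : Content Γ Q :=
  .inl (if b then some default else none, (o.map e).getD default)

theorem matches_init {M : ℕ} (x : List Bool) {p : ℕ} (hM : x.length + 2 * p + 5 ≤ M) :
    Matches (ringInit (iniCell e) x : ZMod M → Content Γ Q) (TM0.init (x.map e)) 0 0 x.length p := by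
  have hnth : ∀ n : ℕ, (Tape.mk₁ (x.map e)).nth n = ((x[n]?).map e).getD default := by
    intro n
    rw [Tape.mk₁, Tape.mk₂, Tape.mk'_nth_nat, ListBlank.nth_mk]
    simp [List.getI_eq_getElem?_getD]
  have hneg : ∀ n : ℕ, (Tape.mk₁ (x.map e)).nth (Int.negSucc n) = default := by
    intro n
    rw [Tape.mk₁, Tape.mk₂]
    change (ListBlank.mk []).nth n = default
    rw [ListBlank.nth_mk]; simp
  have hM0 : NeZero M := ⟨by omega⟩
  refine ⟨fun j hj => ?_, fun j h1 h2 => ?_⟩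
  · have h0 : j ≠ 0 := by omega
    simp only [cellAt, TM0.init, blankCell, sub_zero, if_neg h0]
    congr 2
    rcases j with n | n
    · have h3 : x[n]? = none := by rw [List.getElem?_eq_none_iff]; simp at hj; omega
      have := hnth n
      rw [h3] at this
      simpa using this
    · exact hneg n
  · simp only [cellAt, TM0.init, sub_zero, ringInit, iniCell]
    rcases j with n | n
    · have h3 : ((Int.ofNat n : ℤ) : ZMod M).val = n := by
        simp only [Int.ofNat_eq_natCast, Int.cast_natCast]
        rw [ZMod.val_natCast, Nat.mod_eq_of_lt]
        simp at h2; omega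
      rw [h3]
      have := hnth n
      congr 2
      · by_cases hn : n = 0
        · simp [hn]
        · simp [hn]
      · exact this.symm
    · have h3 : ((Int.negSucc n : ℤ) : ZMod M).val = M - (n + 1) := by
        have : ((Int.negSucc n : ℤ) : ZMod M) = ((M - (n + 1) : ℕ) : ZMod M) := by
          rw [Nat.cast_sub (by simp [Int.negSucc_eq] at h1; omega), Int.cast_negSucc]
          simp
        rw [this, ZMod.val_natCast, Nat.mod_eq_of_lt (by omega)]
      rw [h3]
      have h4 : x[M - (n + 1)]? = none := by
        rw [List.getElem?_eq_none_iff]; simp [Int.negSucc_eq] at h1; omega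
      rw [h4, hneg]
      have h5 : M - (n + 1) ≠ 0 := by simp [Int.negSucc_eq] at h1; omega
      simp [h5]

theorem ringRun_accept_spread {M : ℕ} {acc : Set Q} {c₀ : ZMod M → Content Γ Q} {t : ℕ} {h : ℤ}
    (hh : ringRun (stepCell T acc) c₀ t (h : ZMod M) = .inr true) (k : ℕ) :
    ∀ i : ℤ, |i| ≤ k → ringRun (stepCell T acc) c₀ (t + k) ((h + i : ℤ) : ZMod M) = .inr true := by
  induction k with
  | zero =>
    intro i hi
    have : i = 0 := by simpa using hi
    rw [this, add_zero, add_zero]; exact hh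
  | succ k ih =>
    intro i hi
    rw [← Nat.add_assoc, ringRun]
    apply stepCell_acc
    rw [abs_le] at hi
    push_cast at hi
    by_cases h1 : i = 0
    · right; left; exact ih i (by rw [abs_le]; omega)
    · by_cases h2 : 0 < i
      · left
        have := ih (i - 1) (by rw [abs_le]; omega)
        rw [← this]; congr 1; push_cast; ring
      · right; right
        have := ih (i + 1) (by rw [abs_le]; omega)
        rw [← this]; congr 1; push_cast; ring

/-- The machine halts after `n ≤ p` steps at distance at most `x.length + p` from cell `0`. If it
accepts, there is time for acceptance to reach cell `0`; otherwise the configuration does not change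
any more and contains no acceptance symbol. -/
theorem ringRun_mem_iff {acc : Set Q} {x : List Bool} {M p : ℕ}
    (hM : x.length + 2 * p + 5 ≤ M) {c : TM0.Cfg Γ Q} {n : ℕ} (hn : n ≤ p)
    (hc : (flip Option.bind (TM0.step T))^[n] (some (TM0.init (x.map e))) = some c)
    (hhalt : TM0.step T c = none) :
    c.q ∈ acc ↔ ringRun (stepCell T acc) (ringInit (iniCell e) x : ZMod M → Content Γ Q) (M - 1) 0 =
      .inr true := by
  obtain ⟨h, H⟩ := Matches.run T (acc := acc) hM n (by omega : 0 + n ≤ p) (matches_init e x hM) hc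
  rw [Nat.zero_add] at H
  set R := ringRun (stepCell T acc) (ringInit (iniCell e) x : ZMod M → Content Γ Q) with hR
  replace H : Matches (R n) c h n x.length p := H
  have hbd : -(n : ℤ) ≤ h ∧ h ≤ x.length + n := by
    by_contra hcon
    have := H.blank h (by omega)
    simp [cellAt, blankCell] at this
  constructor
  · intro hq
    have h1 : R (n + 1) (h : ZMod M) = .inr true := by
      have e1 : (h : ZMod M) - 1 = ((h - 1 : ℤ) : ZMod M) := by push_cast; rfl
      have e2 : (h : ZMod M) + 1 = ((h + 1 : ℤ) : ZMod M) := by push_cast; rfl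
      simp only [hR, ringRun]
      simp only [← hR, e1, e2]
      rw [H.agree' hn hM _ (by omega) (by omega), H.agree' hn hM _ (by omega) (by omega),
        H.agree' hn hM _ (by omega) (by omega)]
      exact stepCell_accept T acc hhalt hq h
    have h2 := ringRun_accept_spread T h1 (M - 1 - (n + 1)) (-h) (by rw [abs_le]; omega)
    rw [show n + 1 + (M - 1 - (n + 1)) = M - 1 by omega] at h2
    simpa using h2
  · intro hacc
    by_contra hq
    have hconst : ∀ k, R (n + k) = R n := by
      intro k
      induction k with
      | zero => rfl
      | succ k ih =>
        funext r
        have : R (n + (k + 1)) r = stepCell T acc (R (n + k) (r - 1)) (R (n + k) r)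
          (R (n + k) (r + 1)) := rfl
        rw [this, ih]
        have hM0 : NeZero M := ⟨by omega⟩
        obtain ⟨j, hj1, hj2, rfl⟩ : ∃ j : ℤ, -(p + 1 : ℤ) ≤ j ∧ j < M - (p + 1) ∧ (j : ZMod M) = r := by
          have hv := ZMod.val_lt r
          by_cases hlt : r.val < M - (p + 1)
          · exact ⟨r.val, by omega, by omega, by simp⟩
          · refine ⟨r.val - M, by omega, by omega, by simp⟩
        have e1 : (j : ZMod M) - 1 = ((j - 1 : ℤ) : ZMod M) := by push_cast; rfl
        have e2 : (j : ZMod M) + 1 = ((j + 1 : ℤ) : ZMod M) := by push_cast; rfl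
        rw [e1, e2, H.agree' hn hM _ (by omega) (by omega), H.agree' hn hM _ (by omega) (by omega),
          H.agree' hn hM _ (by omega) (by omega), stepCell_halted T acc hhalt hq]
    have h1 := hconst (M - 1 - n)
    rw [show n + (M - 1 - n) = M - 1 by omega] at h1
    rw [h1] at hacc
    have h2 := H.agree' hn hM 0 (by omega) (by omega)
    rw [Int.cast_zero] at h2
    rw [h2] at hacc
    simp [cellAt] at hacc

end simulation

/-- Languages in polynomial time are decided by cellular automata on rings of polynomial size: the
word is accepted if the cell `0` contains `acc` at time `M - 1`. -/
theorem InP.exists_ring {L : Language Bool} (hL : InP L) :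
    ∃ (g : ℕ) (loc : Fin g → Fin g → Fin g → Fin g) (ini : Bool → Option Bool → Fin g)
      (acc bad : Fin g) (p : Polynomial ℕ), (∀ a b c, loc a b c ≠ bad) ∧ (∀ b o, ini b o ≠ bad) ∧
      ∀ (x : List Bool) (M : ℕ), p.eval x.length ≤ M →
        (x ∈ L ↔ ringRun loc (ringInit ini x : ZMod M → Fin g) (M - 1) 0 = acc) := by
  obtain ⟨Γ, Q, hΓ, hQ, hfΓ, hfQ, T, e, accept, p, -, -, hT⟩ := hL
  obtain ⟨g, ⟨φ⟩⟩ := Finite.exists_equiv_fin (Content Γ Q)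
  refine ⟨g, fun a b c => φ (stepCell T accept (φ.symm a) (φ.symm b) (φ.symm c)),
    fun b o => φ (iniCell e b o), φ (.inr true), φ (.inr false), .X + 2 * p + 5,
    fun a b c h => stepCell_ne _ _ _ _ _ (φ.injective h),
    fun b o h => by have := φ.injective h; simp [iniCell] at this, fun x M hM => ?_⟩
  simp only [Polynomial.eval_add, Polynomial.eval_X, Polynomial.eval_mul, Polynomial.eval_ofNat]
    at hM
  obtain ⟨c, ⟨hc⟩, hhalt, hacc⟩ := hT x
  have h1 := ringRun_mem_iff T e (acc := accept) hM hc.steps_le_m hc.evals_in_steps hhalt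
  rw [← hacc, h1]
  have h2 : ∀ t (r : ZMod M), ringRun (fun a b c => φ (stepCell T accept (φ.symm a) (φ.symm b)
      (φ.symm c))) (ringInit (fun b o => φ (iniCell e b o)) x) t r =
      φ (ringRun (stepCell T accept) (ringInit (iniCell e) x) t r) := by
    intro t
    induction t with
    | zero => intro r; rfl
    | succ t ih => intro r; simp only [ringRun, ih, Equiv.symm_apply_apply]
  rw [h2]
  exact φ.injective.eq_iff.symm

/-! ## Derived operations of the calculus -/

section
variable {X I O : Type} {code : X → List I} {c : ℕ}

theorem IsNum.local_update {d g} (h : IsNum code c d g) (x : X) {e : ℕ → ℕ} {v : ℕ}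
    (he : ∀ i, e i < bnd code c x) (hv : v < bnd code c x) :
    g x (Function.update e d v) = g x e :=
  h.local_eq x (update_bounded he _ hv) he fun i hi => Function.update_of_ne (by omega) _ _

theorem IsNum.const {d} (k : ℕ) (hk : k ≤ c + 1) : IsNum code c d fun _ _ => k := by
  induction k with
  | zero => exact .zero
  | succ k ih =>
    refine (ih (by omega)).succ.congr fun x e _ => Nat.mod_eq_of_lt ?_
    have h1 : ((code x).length + 1).size ≠ 0 := by
      intro h
      have := Nat.size_eq_zero.1 h
      omega
    calc k + 1 < c + 2 := by omega
      _ = (c + 2) ^ 1 := (pow_one _).symm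
      _ ≤ _ := Nat.pow_le_pow_right (by omega) (by omega)

open Classical in
/-- Properties of the instance `x` and of an assignment to the variables below `d`. -/
def IsForm (code : X → List I) (c d : ℕ) (φ : X → (ℕ → ℕ) → Prop) : Prop :=
  IsNum code c d fun x e => if φ x e then 1 else 0

theorem IsNum.isForm {d f} {φ : X → (ℕ → ℕ) → Prop} (h : IsNum code c d f)
    (hf : ∀ x e, (∀ i, e i < bnd code c x) → (f x e ≠ 0 ↔ φ x e)) : IsForm code c d φ :=
  (IsNum.ite h (.const 1 (by omega)) .zero).congr fun x e he => by
    have := hf x e he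
    split_ifs <;> tauto

/-- Case distinction. -/
theorem IsNum.cases {d f g} {φ : X → (ℕ → ℕ) → Prop} [∀ x e, Decidable (φ x e)]
    (h : IsForm code c d φ) (hf : IsNum code c d f) (hg : IsNum code c d g) :
    IsNum code c d fun x e => if φ x e then f x e else g x e :=
  (IsNum.ite h hf hg).congr fun x e _ => by by_cases hp : φ x e <;> simp [hp]

theorem IsOut.cases {d} {F G : X → (ℕ → ℕ) → List O} {φ : X → (ℕ → ℕ) → Prop}
    [∀ x e, Decidable (φ x e)] (h : IsForm code c d φ) (hF : IsOut code c d F)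
    (hG : IsOut code c d G) : IsOut code c d fun x e => if φ x e then F x e else G x e :=
  (IsOut.ite h hF hG).congr fun x e _ => by by_cases hp : φ x e <;> simp [hp]

/-- Let `d'` be a new variable after the first `d` ones. -/
theorem IsNum.insert {d h} (hh : IsNum code c (d + 1) h) :
    IsNum code c (d + 2) fun x e => h x (Function.update e d (e (d + 1))) := by
  have hr := hh.rename (d' := d + 2) (ρ := fun i => if i < d then i else i + 1)
    (fun i hi => by split_ifs <;> omega)
    (fun j => by rw [if_neg (by omega)]; omega)
  refine hr.congr fun x e he => hh.local_eq x (fun i => he _) (update_bounded he _ (he _))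
    fun i hi => ?_
  by_cases hid : i = d
  · subst hid; simp
  · rw [Function.update_of_ne hid]; simp [show i < d by omega]

namespace IsForm

variable {d : ℕ} {φ ψ : X → (ℕ → ℕ) → Prop}

theorem congr (h : IsForm code c d φ)
    (hh : ∀ x e, (∀ i, e i < bnd code c x) → (φ x e ↔ ψ x e)) : IsForm code c d ψ :=
  IsNum.congr h fun x e he => by
    have := hh x e he
    split_ifs <;> tauto

theorem const (p : Prop) : IsForm code c d fun _ _ => p := by
  by_cases hp : p
  · exact (IsNum.const 1 (by omega)).isForm fun x e _ => by simp [hp]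
  · exact IsNum.zero.isForm fun x e _ => by simp [hp]

theorem not (h : IsForm code c d φ) : IsForm code c d fun x e => ¬ φ x e :=
  (IsNum.ite h .zero (.const 1 (by omega))).isForm fun x e _ => by
    by_cases hp : φ x e <;> simp [hp]

theorem and (h : IsForm code c d φ) (h' : IsForm code c d ψ) :
    IsForm code c d fun x e => φ x e ∧ ψ x e :=
  (IsNum.ite h h' .zero).isForm fun x e _ => by by_cases hp : φ x e <;> simp [hp]

theorem or (h : IsForm code c d φ) (h' : IsForm code c d ψ) :
    IsForm code c d fun x e => φ x e ∨ ψ x e :=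
  (IsNum.ite h (.const 1 (by omega)) h').isForm fun x e _ => by
    by_cases hp : φ x e <;> simp [hp]

theorem lt {f g} (hf : IsNum code c d f) (hg : IsNum code c d g) :
    IsForm code c d fun x e => f x e < g x e :=
  (IsNum.bind hf (.bind hg.weaken (.ltVar (a := d) (b := d + 1) (by omega) (by omega)))).isForm
    fun x e he => by
      rw [Function.update_of_ne (by omega), Function.update_self, Function.update_self,
        hg.local_update x he (hf.lt_bnd x he)]
      simp

theorem eq {f g} (hf : IsNum code c d f) (hg : IsNum code c d g) :
    IsForm code c d fun x e => f x e = g x e :=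
  ((lt hf hg).not.and (lt hg hf).not).congr fun x e _ => by omega

theorem sym {f} (p : InSym I → Bool) (hf : IsNum code c d f) :
    IsForm code c d fun x e => p (readInput (code x) (f x e)) = true :=
  (IsNum.bind hf (.symVar (a := d) p (by omega))).isForm fun x e _ => by
    rw [Function.update_self]; simp

/-- Iterate over all candidates with a value that becomes `1` at the first witness. The second
hypothesis says that `H` sees the quantified variable only through its last argument. -/
theorem ex {H : X → (ℕ → ℕ) → ℕ → Prop} (h : IsForm code c (d + 1) fun x e => H x e (e d))
    (hH : ∀ x e v i, H x (Function.update e d v) i ↔ H x e i) :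
    IsForm code c d fun x e => ∃ i < bnd code c x, H x e i := by
  classical
  have h' : IsNum code c (d + 1) fun x e => if H x e (e d) then 1 else 0 := IsNum.congr h
    fun x e _ => by split_ifs <;> rfl
  refine (IsNum.iter .zero (IsNum.ite h'.insert (.const 1 (by omega))
    (.var (a := d) (by omega)))).isForm fun x e he => ?_
  have h2 := two_le_bnd (code := code) (c := c) x
  have key : ∀ i < bnd code c x, ∀ r < bnd code c x,
      (if (if H x (Function.update (Function.update (Function.update e d r) (d + 1) i) d
        (Function.update (Function.update e d r) (d + 1) i (d + 1)))
        (Function.update (Function.update (Function.update e d r) (d + 1) i) d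
        (Function.update (Function.update e d r) (d + 1) i (d + 1)) d) then 1 else 0) ≠ 0 then 1
        else Function.update (Function.update e d r) (d + 1) i d) = if H x e i then 1 else r := by
    intro i hi r hr
    rw [h'.local_eq x (e' := Function.update e d i), Function.update_self, hH,
      Function.update_of_ne (show d ≠ d + 1 by omega), Function.update_self]
    · by_cases hp : H x e i <;> simp [hp]
    · rw [Function.update_self]
      exact update_bounded (update_bounded (update_bounded he _ hr) _ hi) _ hi
    · exact update_bounded he _ hi
    · intro j hj
      rw [Function.update_self]
      by_cases hjd : j = d
      · subst hjd; simp
      · rw [Function.update_of_ne hjd, Function.update_of_ne (by omega), Function.update_of_ne hjd,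
          Function.update_of_ne hjd]
  rw [iterNum_congr (f' := fun i r => if H x e i then 1 else r) (by omega) le_rfl _ key]
  · generalize bnd code c x = M
    clear key h2 he
    induction M with
    | zero => simp [iterNum]
    | succ M ih =>
      simp only [iterNum]
      by_cases hp : H x e M
      · simp only [hp, if_true, ne_eq, one_ne_zero, not_false_iff, true_iff]
        exact ⟨M, by omega, hp⟩
      · simp only [hp, if_false]
        refine ih.trans ?_
        constructor
        · rintro ⟨i, hi, h⟩; exact ⟨i, by omega, h⟩
        · rintro ⟨i, hi, h⟩
          exact ⟨i, by by_contra hc; exact hp (by rwa [show M = i by omega]), h⟩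
  · intro i hi r hr
    rw [key i hi r hr]
    split_ifs <;> omega

end IsForm

theorem IsOut.forRange {d} {F : X → (ℕ → ℕ) → ℕ → List O}
    (h : IsOut code c (d + 1) fun x e => F x e (e d))
    (hF : ∀ x e v i, F x (Function.update e d v) i = F x e i) :
    IsOut code c d fun x e => (List.range (bnd code c x)).flatMap fun i => F x e i :=
  (IsOut.range h).congr fun x e _ => by simp [hF]

theorem IsOut.const {d} (l : List O) : IsOut code c d fun (_ : X) _ => l := by
  induction l with
  | nil => exact .nil
  | cons s l ih => exact (IsOut.emit s).append ih

theorem IsOut.forList {d} {α : Type*} (l : List α) {F : α → X → (ℕ → ℕ) → List O}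
    (h : ∀ a ∈ l, IsOut code c d (F a)) :
    IsOut code c d fun x e => l.flatMap fun a => F a x e := by
  induction l with
  | nil => exact .nil
  | cons a l ih =>
    exact (h a (by simp)).append (ih fun b hb => h b (by simp [hb]))

end

/-- Every polynomial is bounded by some `bnd`. -/
theorem Polynomial.exists_le_pow_size (p : Polynomial ℕ) :
    ∃ c₀, ∀ c ≥ c₀, ∀ n, p.eval n ≤ (c + 2) ^ (n + 1).size := by
  have key : ∀ p : Polynomial ℕ, ∃ k, ∀ n, p.eval n ≤ 2 ^ (k * (n + 1).size) := by
    intro p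
    induction p using Polynomial.induction_on with
    | C a =>
      refine ⟨a, fun n => ?_⟩
      rw [Polynomial.eval_C]
      have h1 : (n + 1).size ≠ 0 := by
        intro h
        have := Nat.size_eq_zero.1 h
        omega
      calc a ≤ 2 ^ a := Nat.lt_two_pow_self.le
        _ ≤ _ := Nat.pow_le_pow_right (by omega) (Nat.le_mul_of_pos_right _ (by omega))
    | add p q hp hq =>
      obtain ⟨k, hk⟩ := hp
      obtain ⟨l, hl⟩ := hq
      refine ⟨k + l + 1, fun n => ?_⟩
      rw [Polynomial.eval_add]
      have h1 : (n + 1).size ≠ 0 := by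
        intro h
        have := Nat.size_eq_zero.1 h
        omega
      have h2 : 2 ^ (k * (n + 1).size) ≤ 2 ^ ((k + l) * (n + 1).size) :=
        Nat.pow_le_pow_right (by omega) (Nat.mul_le_mul_right _ (by omega))
      have h3 : 2 ^ (l * (n + 1).size) ≤ 2 ^ ((k + l) * (n + 1).size) :=
        Nat.pow_le_pow_right (by omega) (Nat.mul_le_mul_right _ (by omega))
      have h4 : 2 ^ ((k + l) * (n + 1).size + 1) ≤ 2 ^ ((k + l + 1) * (n + 1).size) :=
        Nat.pow_le_pow_right (by omega) (by rw [add_mul (k + l) 1]; omega)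
      have := hk n
      have := hl n
      rw [pow_succ] at h4
      omega
    | monomial n a ih =>
      obtain ⟨k, hk⟩ := ih
      refine ⟨k + 1, fun m => ?_⟩
      have h1 := hk m
      have h2 : m ≤ 2 ^ (m + 1).size := ((Nat.lt_succ_self m).trans (Nat.lt_size_self _)).le
      calc _ = (Polynomial.C a * Polynomial.X ^ n).eval m * m := by
            simp [pow_succ, mul_assoc]
        _ ≤ 2 ^ (k * (m + 1).size) * 2 ^ (m + 1).size := Nat.mul_le_mul h1 h2
        _ = _ := by rw [← pow_add, add_mul, one_mul]
  obtain ⟨k, hk⟩ := key p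
  -- The exponent `k` moves into the base: `2 ^ (k * size) = (2 ^ k) ^ size`.
  refine ⟨2 ^ k, fun c hc n => (hk n).trans ?_⟩
  rw [pow_mul]
  exact Nat.pow_le_pow_left (by omega) _

/-! ## Memoryless strategies and memoryless successor choices -/

section
variable {S A : Type} [Fintype S] [Fintype A]

/-- The strategy that always plays the action `f s` in the state `s`. -/
def Strategy.memoryless [DecidableEq A] (M : MDP S A) (f : S → A) (hf : ∀ s, f s ∈ M.avail s) :
    Strategy M where
  act _ s := .dirac (f s)
  act_avail _ s a ha := by
    rw [RatDist.dirac_pos] at ha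
    rw [ha]; exact hf s

variable [MeasurableSpace S] [MeasurableSingletonClass S]
  [MeasurableSpace A] [MeasurableSingletonClass A]

/-- Against every strategy, the successors can be chosen by a memoryless rule. -/
theorem exists_consistent {M : MDP S A} (σ : Strategy M) (s : S) (pick : S → A → S)
    (hp : ∀ s, ∀ a ∈ M.avail s, 0 < M.prob s a (pick s a)) :
    ∃ ρ : Path S A, (∀ n, ConsistentUpTo M σ s ρ n) ∧
      ∀ i, (ρ (i + 1)).1 = pick (ρ i).1 (ρ i).2 := by
  classical
  set f : List (S × A) → S := fun h => match h.getLast? with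
    | none => s
    | some x => pick x.1 x.2 with hf
  have hA : Nonempty A := by
    obtain ⟨a, -⟩ := M.deadlock_free s
    exact ⟨a⟩
  obtain ⟨ρ, -, h⟩ := exists_continuation σ f (fun _ => (s, hA.some)) 0
  have h1 : ∀ i, (ρ i).1 = f (hist ρ i) := fun i => by rw [h i (by omega)]
  have h2 : ∀ i, (ρ (i + 1)).1 = pick (ρ i).1 (ρ i).2 := by
    intro i
    rw [h1, hist_succ]
    simp [hf]
  have h3 : ∀ i, 0 < (σ.act (hist ρ i) (ρ i).1).prob (ρ i).2 := by
    intro i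
    have : (ρ i).2 = likely (σ.act (hist ρ i) (ρ i).1) := by
      rw [h1, h i (by omega)]
    rw [this]; exact likely_pos _
  refine ⟨ρ, fun n => ⟨?_, fun i _ => h3 i, fun i _ => ?_⟩, h2⟩
  · rw [h1]; simp [hf, hist]
  · rw [h2]; exact hp _ _ (σ.act_avail _ _ _ (h3 i))

end

/-! ## The Markov decision process of a cellular automaton on a ring -/

/-- Cyclic predecessor. -/
def cycPred {M : ℕ} (i : Fin M) : Fin M := ⟨(i.val + (M - 1)) % M, Nat.mod_lt _ (Fin.pos i)⟩

/-- Cyclic successor. -/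
def cycSucc {M : ℕ} (i : Fin M) : Fin M := ⟨(i.val + 1) % M, Nat.mod_lt _ (Fin.pos i)⟩

theorem cycPred_val {M : ℕ} (i : Fin M) :
    (cycPred i).val = if i.val = 0 then M - 1 else i.val - 1 := by
  have := i.isLt
  simp only [cycPred]
  split_ifs with h
  · rw [h, Nat.zero_add, Nat.mod_eq_of_lt (by omega)]
  · rw [show i.val + (M - 1) = i.val - 1 + M by omega, Nat.add_mod_right,
      Nat.mod_eq_of_lt (by omega)]

theorem cycSucc_val {M : ℕ} (i : Fin M) :
    (cycSucc i).val = if i.val + 1 = M then 0 else i.val + 1 := by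
  have := i.isLt
  simp only [cycSucc]
  split_ifs with h
  · rw [h, Nat.mod_self]
  · rw [Nat.mod_eq_of_lt (by omega)]

theorem cycPred_cast {M : ℕ} (i : Fin M) : ((cycPred i).val : ZMod M) = (i.val : ZMod M) - 1 := by
  have := i.isLt
  simp only [cycPred, ZMod.natCast_mod]
  rw [Nat.cast_add, Nat.cast_sub (by omega)]
  simp [sub_eq_add_neg]

theorem cycSucc_cast {M : ℕ} (i : Fin M) : ((cycSucc i).val : ZMod M) = (i.val : ZMod M) + 1 := by
  simp [cycSucc, ZMod.natCast_mod]

section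
variable {M g : ℕ} (loc : Fin g → Fin g → Fin g → Fin g) (c₀ : ZMod M → Fin g) (bad : Fin g)

/-- A state `(t, i, γ)` claims that the cell `i` contains `γ` at time `t`. An action justifies the
claim by the contents of three cells at time `t - 1`, one of which is checked next. -/
def ringSucc (s : Fin M × Fin M × Fin g) (a : Fin g × Fin g × Fin g) :
    List (Fin M × Fin M × Fin g) :=
  if a.2.2 = bad then [(s.1, s.2.1, bad)]
  else if s.1.val = 0 then if s.2.2 = c₀ s.2.1.val then [s] else []
  else if loc a.1 a.2.1 a.2.2 = s.2.2 then
    [(cycPred s.1, cycPred s.2.1, a.1), (cycPred s.1, s.2.1, a.2.1),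
      (cycPred s.1, cycSucc s.2.1, a.2.2)]
  else []

def ringMDPSucc (s : Fin (M * (M * g))) (a : Fin (g * (g * g))) : List (Fin (M * (M * g))) :=
  (ringSucc loc c₀ bad ((tripleEquiv M M g).symm s) ((tripleEquiv g g g).symm a)).map
    (tripleEquiv M M g)

theorem ringMDPSucc_giveUp (s : Fin (M * (M * g))) :
    ringMDPSucc loc c₀ bad s (tripleEquiv g g g (bad, bad, bad)) ≠ [] := by
  simp [ringMDPSucc, ringSucc]

def ringMDP : MDP (Fin (M * (M * g))) (Fin (g * (g * g))) :=
  MDP.ofList (ringMDPSucc loc c₀ bad) fun s => ⟨_, ringMDPSucc_giveUp loc c₀ bad s⟩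

/-- The claim of the state is correct. -/
def RingTrue (s : Fin M × Fin M × Fin g) : Prop := s.2.2 = ringRun loc c₀ s.1.val s.2.1.val

variable {loc c₀ bad}

theorem ringSucc_true {s : Fin M × Fin M × Fin g} (hs : RingTrue loc c₀ s) (ht : s.1.val ≠ 0) :
    loc (ringRun loc c₀ (s.1.val - 1) (s.2.1.val - 1)) (ringRun loc c₀ (s.1.val - 1) s.2.1.val)
      (ringRun loc c₀ (s.1.val - 1) (s.2.1.val + 1)) = s.2.2 := by
  rw [hs]
  obtain ⟨t, ht'⟩ := Nat.exists_eq_succ_of_ne_zero ht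
  rw [ht']
  rfl

variable (loc c₀ bad) in
open Classical in
/-- The justification of correct claims. -/
noncomputable def ringChoice (s : Fin M × Fin M × Fin g) : Fin g × Fin g × Fin g :=
  if RingTrue loc c₀ s then
    if s.1.val = 0 then (s.2.2, s.2.2, s.2.2)
    else (ringRun loc c₀ (s.1.val - 1) (s.2.1.val - 1), ringRun loc c₀ (s.1.val - 1) s.2.1.val,
      ringRun loc c₀ (s.1.val - 1) (s.2.1.val + 1))
  else (bad, bad, bad)

theorem ringRun_ne_bad (h1 : ∀ a b c, loc a b c ≠ bad) (h2 : ∀ r, c₀ r ≠ bad) (t : ℕ)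
    (r : ZMod M) : ringRun loc c₀ t r ≠ bad := by
  cases t with
  | zero => exact h2 r
  | succ t => exact h1 _ _ _

theorem ringChoice_avail (s : Fin M × Fin M × Fin g) :
    ringSucc loc c₀ bad s (ringChoice loc c₀ bad s) ≠ [] := by
  unfold ringChoice ringSucc
  by_cases hs : RingTrue loc c₀ s
  · by_cases ht : s.1.val = 0
    · have : s.2.2 = c₀ s.2.1.val := by rw [hs, ht]; rfl
      simp only [hs, ht, this, if_true]
      split_ifs <;> simp
    · simp only [hs, ht, if_true, if_false, ringSucc_true hs ht]
      split_ifs <;> simp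
  · simp [hs]

theorem ringChoice_ne_bad (h1 : ∀ a b c, loc a b c ≠ bad) (h2 : ∀ r, c₀ r ≠ bad)
    {s : Fin M × Fin M × Fin g} (hs : RingTrue loc c₀ s) : (ringChoice loc c₀ bad s).2.2 ≠ bad := by
  unfold ringChoice
  rw [if_pos hs]
  split_ifs
  · rw [hs]; exact ringRun_ne_bad h1 h2 _ _
  · exact ringRun_ne_bad h1 h2 _ _

theorem ringTrue_next (h1 : ∀ a b c, loc a b c ≠ bad) (h2 : ∀ r, c₀ r ≠ bad)
    {s s' : Fin M × Fin M × Fin g} (hs : RingTrue loc c₀ s)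
    (h : s' ∈ ringSucc loc c₀ bad s (ringChoice loc c₀ bad s)) :
    RingTrue loc c₀ s' ∧ s'.1.val = s.1.val - 1 := by
  unfold ringSucc at h
  rw [if_neg (ringChoice_ne_bad h1 h2 hs)] at h
  by_cases ht : s.1.val = 0
  · rw [if_pos ht] at h
    split_ifs at h
    · obtain rfl := List.mem_singleton.1 h
      exact ⟨hs, by omega⟩
    · simp at h
  · rw [if_neg ht] at h
    have hp : (cycPred s.1).val = s.1.val - 1 := by rw [cycPred_val, if_neg ht]
    simp only [ringChoice, hs, ht, if_true, if_false, ringSucc_true hs ht] at h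
    simp only [List.mem_cons, List.not_mem_nil, or_false] at h
    rcases h with rfl | rfl | rfl <;>
      simp only [RingTrue, hp, cycPred_cast, cycSucc_cast, and_self]

/-- A wrong claim has only wrong justifications. -/
theorem exists_not_ringTrue (h1 : ∀ a b c, loc a b c ≠ bad) (h2 : ∀ r, c₀ r ≠ bad)
    {s : Fin M × Fin M × Fin g} (hs : ¬ RingTrue loc c₀ s) {a : Fin g × Fin g × Fin g}
    (ha : ringSucc loc c₀ bad s a ≠ []) : ∃ s' ∈ ringSucc loc c₀ bad s a,
      ¬ RingTrue loc c₀ s' ∧ (s'.2.2 = bad ∨ s'.1.val + 1 = s.1.val) := by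
  by_cases hb : a.2.2 = bad
  · refine ⟨(s.1, s.2.1, bad), by simp [ringSucc, hb], fun h => ?_, Or.inl rfl⟩
    exact ringRun_ne_bad h1 h2 _ _ (Eq.symm h)
  · by_cases ht : s.1.val = 0
    · simp only [ringSucc, hb, ht, if_true, if_false] at ha
      rw [ne_eq, ite_eq_right_iff] at ha
      push Not at ha
      exact absurd (by rw [RingTrue, ht]; exact ha.1) hs
    · have hp : (cycPred s.1).val = s.1.val - 1 := by rw [cycPred_val, if_neg ht]
      simp only [ringSucc, hb, ht, if_false] at ha ⊢
      rw [ne_eq, ite_eq_right_iff] at ha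
      push Not at ha
      rw [if_pos ha.1]
      by_contra! hcon
      have hlt : (cycPred s.1).val + 1 = s.1.val := by omega
      have c1 : RingTrue loc c₀ (cycPred s.1, cycPred s.2.1, a.1) := by
        by_contra hf; exact (hcon _ (by simp) hf).2 hlt
      have c2 : RingTrue loc c₀ (cycPred s.1, s.2.1, a.2.1) := by
        by_contra hf; exact (hcon _ (by simp) hf).2 hlt
      have c3 : RingTrue loc c₀ (cycPred s.1, cycSucc s.2.1, a.2.2) := by
        by_contra hf; exact (hcon _ (by simp) hf).2 hlt
      simp only [RingTrue, hp, cycPred_cast, cycSucc_cast] at c1 c2 c3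
      apply hs
      rw [RingTrue, ← ha.1, c1, c2, c3]
      obtain ⟨t, ht'⟩ := Nat.exists_eq_succ_of_ne_zero ht
      rw [ht']
      rfl

/-- A refuted claim: all that remains is to give up. -/
def Refuted (loc : Fin g → Fin g → Fin g → Fin g) (c₀ : ZMod M → Fin g) (bad : Fin g)
    (s : Fin M × Fin M × Fin g) : Prop :=
  ¬ RingTrue loc c₀ s ∧ (s.2.2 = bad ∨ s.1.val = 0)

/-- No local rule produces `bad`, and a wrong claim about time `0` disagrees with `c₀`; so neither
admits a justification, and only giving up is available. -/
theorem Refuted.next (h1 : ∀ a b c, loc a b c ≠ bad) (h2 : ∀ r, c₀ r ≠ bad)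
    {s s' : Fin M × Fin M × Fin g} (hs : Refuted loc c₀ bad s) {a : Fin g × Fin g × Fin g}
    (h : s' ∈ ringSucc loc c₀ bad s a) : a.2.2 = bad ∧ Refuted loc c₀ bad s' := by
  by_cases hb : a.2.2 = bad
  · simp only [ringSucc, hb, if_true, List.mem_singleton] at h
    subst h
    exact ⟨hb, fun h => ringRun_ne_bad h1 h2 _ _ (Eq.symm h), Or.inl rfl⟩
  · exfalso
    unfold ringSucc at h
    rw [if_neg hb] at h
    by_cases ht : s.1.val = 0
    · rw [if_pos ht] at h
      split_ifs at h with h3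
      · exact hs.1 (by rw [RingTrue, ht]; exact h3)
      · simp at h
    · rw [if_neg ht] at h
      rcases hs.2 with h3 | h3
      · rw [if_neg (by rw [h3]; exact h1 _ _ _)] at h
        simp at h
      · exact ht h3

/-- The strategy that justifies correct claims, and the fate of wrong claims. -/
theorem ringMDP_correct (h1 : ∀ a b c, loc a b c ≠ bad) (h2 : ∀ r, c₀ r ≠ bad)
    (s : Fin M × Fin M × Fin g) (E : Set (Path (Fin (M * (M * g))) (Fin (g * (g * g)))))
    (hE : ∀ ρ, (∃ i, ∀ j ≥ i, (((tripleEquiv M M g).symm (ρ j).1).1.val = 0 ∧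
        ((tripleEquiv M M g).symm (ρ j).1).2.2 = c₀ ((tripleEquiv M M g).symm (ρ j).1).2.1.val) ∧
        ((tripleEquiv g g g).symm (ρ j).2).2.2 ≠ bad) → ρ ∈ E)
    (hE' : ∀ ρ, (∃ i, ∀ j ≥ i, ¬ (((tripleEquiv M M g).symm (ρ j).1).1.val = 0 ∧
        ((tripleEquiv M M g).symm (ρ j).1).2.2 = c₀ ((tripleEquiv M M g).symm (ρ j).1).2.1.val) ∧
        ((tripleEquiv g g g).symm (ρ j).2).2.2 = bad) → ρ ∉ E) :
    (∃ σ : Strategy (ringMDP loc c₀ bad), 1 ≤ σ.prob (tripleEquiv M M g s) E) ↔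
      RingTrue loc c₀ s := by
  classical
  constructor
  · rintro ⟨σ, hσ⟩
    by_contra hs
    -- Chance as the opponent: it examines a wrong component whenever the justification has one.
    set pick : Fin (M * (M * g)) → Fin (g * (g * g)) → Fin (M * (M * g)) := fun s a =>
      if h : ∃ s' ∈ ringMDPSucc loc c₀ bad s a,
          ¬ RingTrue loc c₀ ((tripleEquiv M M g).symm s') ∧
          (((tripleEquiv M M g).symm s').2.2 = bad ∨
            ((tripleEquiv M M g).symm s').1.val + 1 = ((tripleEquiv M M g).symm s).1.val)
      then h.choose
      else if h : ringMDPSucc loc c₀ bad s a ≠ [] then (ringMDPSucc loc c₀ bad s a).head h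
      else s with hpick
    obtain ⟨ρ, hρ, hρ2⟩ := exists_consistent σ (tripleEquiv M M g s) pick (by
      intro s a ha
      rw [ringMDP, MDP.mem_avail_ofList] at ha
      rw [ringMDP, MDP.prob_ofList]
      simp only [hpick]
      split_ifs with h
      · exact h.choose_spec.1
      · exact List.head_mem _)
    have hav : ∀ i, ringSucc loc c₀ bad ((tripleEquiv M M g).symm (ρ i).1)
        ((tripleEquiv g g g).symm (ρ i).2) ≠ [] := by
      intro i
      have := σ.act_avail _ _ _ ((hρ i).act i le_rfl)
      rw [ringMDP, MDP.mem_avail_ofList, ringMDPSucc] at this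
      simpa using this
    -- Either the strategy has been driven to `bad`, or the time of the claim has decreased in every
    -- step. After as many steps as the initial time, the claim is refuted.
    have key : ∀ i, ¬ RingTrue loc c₀ ((tripleEquiv M M g).symm (ρ i).1) ∧
        (((tripleEquiv M M g).symm (ρ i).1).2.2 = bad ∨
          ((tripleEquiv M M g).symm (ρ i).1).1.val + i ≤ s.1.val) := by
      intro i
      induction i with
      | zero =>
        rw [(hρ 0).init, Equiv.symm_apply_apply]
        exact ⟨hs, Or.inr (by omega)⟩
      | succ i ih =>
        have hex : ∃ s' ∈ ringMDPSucc loc c₀ bad (ρ i).1 (ρ i).2,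
            ¬ RingTrue loc c₀ ((tripleEquiv M M g).symm s') ∧
            (((tripleEquiv M M g).symm s').2.2 = bad ∨ ((tripleEquiv M M g).symm s').1.val + 1 =
              ((tripleEquiv M M g).symm (ρ i).1).1.val) := by
          obtain ⟨s', h3, h4⟩ := exists_not_ringTrue h1 h2 ih.1 (hav i)
          refine ⟨tripleEquiv M M g s', List.mem_map_of_mem h3, ?_⟩
          rwa [Equiv.symm_apply_apply]
        have hsp := hex.choose_spec
        have hch : (ρ (i + 1)).1 = hex.choose := by
          rw [hρ2]; simp only [hpick]; rw [dif_pos hex]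
        rw [← hch] at hsp
        refine ⟨hsp.2.1, ?_⟩
        rcases hsp.2.2 with h5 | h5
        · exact Or.inl h5
        · rcases ih.2 with h6 | h6
          · obtain ⟨s', h7, h8⟩ := List.mem_map.1 hsp.1
            left
            have := (Refuted.next h1 h2 ⟨ih.1, Or.inl h6⟩ h7)
            rw [← h8, Equiv.symm_apply_apply]
            simp only [ringSucc, this.1, if_true, List.mem_singleton] at h7
            rw [h7]
          · right; omega
    have hend : Refuted loc c₀ bad ((tripleEquiv M M g).symm (ρ s.1.val).1) := by
      refine ⟨(key _).1, ?_⟩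
      rcases (key s.1.val).2 with h | h
      · exact Or.inl h
      · right; omega
    -- The refutation is complete along a finite history, which has positive probability, and all
    -- its continuations remain refuted.
    refine absurd hσ (not_le.2 (prob_lt_one _ σ _ E ρ s.1.val (hρ _) fun ρ' h3 h4 =>
      hE' ρ' ⟨s.1.val, fun j hj => ?_⟩))
    have hmem : ∀ j, ((tripleEquiv M M g).symm (ρ' (j + 1)).1) ∈
        ringSucc loc c₀ bad ((tripleEquiv M M g).symm (ρ' j).1)
        ((tripleEquiv g g g).symm (ρ' j).2) := by
      intro j
      have := (h4 (j + 1)).trans j (by omega)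
      rw [ringMDP, MDP.prob_ofList, ringMDPSucc] at this
      obtain ⟨s', h5, h6⟩ := List.mem_map.1 this
      rwa [← h6, Equiv.symm_apply_apply]
    have hr : Refuted loc c₀ bad ((tripleEquiv M M g).symm (ρ' j).1) := by
      induction j, hj using Nat.le_induction with
      | base => rw [h3 _ le_rfl]; exact hend
      | succ j _ ih => exact (ih.next h1 h2 (hmem j)).2
    refine ⟨fun h => hr.1 ?_, (hr.next h1 h2 (hmem j)).1⟩
    rw [RingTrue, h.1, h.2]; rfl
  · intro hs
    refine ⟨Strategy.memoryless _ (fun s => tripleEquiv g g g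
      (ringChoice loc c₀ bad ((tripleEquiv M M g).symm s))) fun s => ?_, ?_⟩
    · rw [ringMDP, MDP.mem_avail_ofList, ringMDPSucc]
      simpa using ringChoice_avail _
    · refine (prob_eq_one _ _ _ _ fun ρ hρ => hE ρ ?_).ge
      have ha : ∀ i, (tripleEquiv g g g).symm (ρ i).2 =
          ringChoice loc c₀ bad ((tripleEquiv M M g).symm (ρ i).1) := by
        intro i
        have := (hρ i).act i le_rfl
        rw [Strategy.memoryless, RatDist.dirac_pos] at this
        rw [this, Equiv.symm_apply_apply]
      have key : ∀ i, RingTrue loc c₀ ((tripleEquiv M M g).symm (ρ i).1) ∧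
          ((tripleEquiv M M g).symm (ρ i).1).1.val = s.1.val - i := by
        intro i
        induction i with
        | zero => rw [(hρ 0).init, Equiv.symm_apply_apply]; exact ⟨hs, rfl⟩
        | succ i ih =>
          have := (hρ (i + 1)).trans i (by omega)
          rw [ringMDP, MDP.prob_ofList, ringMDPSucc] at this
          obtain ⟨s', h5, h6⟩ := List.mem_map.1 this
          rw [← h6, Equiv.symm_apply_apply]
          rw [ha] at h5
          obtain ⟨h7, h8⟩ := ringTrue_next h1 h2 ih.1 h5
          exact ⟨h7, by omega⟩
      refine ⟨s.1.val, fun j hj => ?_⟩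
      obtain ⟨k1, k2⟩ := key j
      have k3 : ((tripleEquiv M M g).symm (ρ j).1).1.val = 0 := by omega
      refine ⟨⟨k3, ?_⟩, ?_⟩
      · rw [k1, k3]; rfl
      · rw [ha]; exact ringChoice_ne_bad h1 h2 k1

end

/-! ## Codes -/

theorem ratCode_inv {k : ℕ} (hk : k ≠ 0) : ratCode ((k : ℚ≥0)⁻¹) = natCode 1 ++ natCode k := by
  have h : ((k : ℚ≥0)⁻¹ : ℚ≥0).num = 1 ∧ ((k : ℚ≥0)⁻¹ : ℚ≥0).den = k := by
    have hq : (((k : ℚ≥0)⁻¹ : ℚ≥0) : ℚ) = (k : ℚ)⁻¹ := by push_cast; rfl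
    constructor
    · have h1 := NNRat.num_coe ((k : ℚ≥0)⁻¹)
      rw [hq, Rat.inv_natCast_num_of_pos (by omega)] at h1
      exact_mod_cast h1.symm
    · have h1 := NNRat.den_coe (q := (k : ℚ≥0)⁻¹)
      rw [hq, Rat.inv_natCast_den_of_pos (by omega)] at h1
      exact h1.symm
  rw [ratCode, h.1, h.2]

theorem ratCode_zero : ratCode 0 = natCode 0 ++ natCode 1 := rfl

theorem ratCode_one : ratCode 1 = natCode 1 ++ natCode 1 := rfl

/-- The code of the probabilities of a uniform distribution with `k` outcomes. -/
def uniformCode (k : ℕ) (p : Prop) [Decidable p] : List Sym :=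
  if p then natCode 1 ++ natCode k else natCode 0 ++ natCode 1

theorem ratCode_ofList {X : Type} [Fintype X] [DecidableEq X] {l : List X} (h : l ≠ [])
    (hl : l.Nodup) (x : X) : ratCode ((RatDist.ofList l h).prob x) =
      uniformCode l.length (x ∈ l) := by
  simp only [RatDist.ofList, uniformCode]
  split_ifs with hx
  · rw [List.count_eq_one_of_mem hl hx, Nat.cast_one, one_div,
      ratCode_inv (by simpa using h)]
  · rw [List.count_eq_zero_of_not_mem hx, Nat.cast_zero, zero_div, ratCode_zero]

/-- The code of the value of the transition function at a state and an action. -/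
theorem optionCode_ofList {n m : ℕ} {succ : Fin n → Fin m → List (Fin n)}
    {h : ∀ s, ∃ a, succ s a ≠ []} {s : Fin n} {a : Fin m} (hnd : (succ s a).Nodup) :
    optionCode (fun d => tableCode ratCode d.prob) ((MDP.ofList succ h).trans s a) =
      if succ s a = [] then [some false] else some true :: (List.finRange n).flatMap fun t =>
        uniformCode (succ s a).length (t ∈ succ s a) := by
  simp only [MDP.ofList]
  by_cases hs : succ s a = []
  · simp [hs, optionCode]
  · rw [dif_neg hs, if_neg hs]
    simp only [optionCode, tableCode, ratCode_ofList hs hnd]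

theorem IsOut.uniformCode {X I : Type} {code : X → List I} {c d : ℕ} (k : ℕ)
    {φ : X → (ℕ → ℕ) → Prop} [∀ x e, Decidable (φ x e)] (h : IsForm code c d φ) :
    IsOut code c d fun x e => uniformCode k (φ x e) :=
  .cases h (.const _) (.const _)

/-! ## The queries of a cellular automaton -/

section
variable {g : ℕ} (loc : Fin g → Fin g → Fin g → Fin g)

/-- The probabilities of the successors, all of which are written as `1 / k`. -/
def gridCode (M g k : ℕ) (φ : ℕ → ℕ → Fin g → Prop) [∀ t i γ, Decidable (φ t i γ)] : List Sym :=
  some true :: (List.range M).flatMap fun t => (List.range M).flatMap fun i =>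
    (List.finRange g).flatMap fun γ => uniformCode k (φ t i γ)

/-- The code of the value of the transition function at a state and an action. -/
def ringRowCode (M : ℕ) (ψ : ℕ → Fin g → Prop) [∀ i γ, Decidable (ψ i γ)] (bad : Fin g) (t i : ℕ)
    (γ : Fin g) (a : Fin g × Fin g × Fin g) : List Sym :=
  if a.2.2 = bad then gridCode M g 1 fun t' i' γ' => t' = t ∧ i' = i ∧ γ' = bad
  else if t = 0 then
    if ψ i γ then gridCode M g 1 fun t' i' γ' => t' = t ∧ i' = i ∧ γ' = γ else [some false]
  else if loc a.1 a.2.1 a.2.2 = γ then gridCode M g 3 fun t' i' γ' => (t' + 1) % M = t ∧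
    (((i' + 1) % M = i ∧ γ' = a.1) ∨ (i' = i ∧ γ' = a.2.1) ∨ (i' = (i + 1) % M ∧ γ' = a.2.2))
  else [some false]

theorem eq_cycPred_iff {M : ℕ} (i j : Fin M) : i = cycPred j ↔ (i.val + 1) % M = j.val := by
  have := i.isLt
  have := j.isLt
  rw [Fin.ext_iff, cycPred_val]
  by_cases h : i.val + 1 = M
  · rw [h, Nat.mod_self]; split_ifs <;> omega
  · rw [Nat.mod_eq_of_lt (by omega)]; split_ifs <;> omega

/-- On a ring with at least three cells, a cell and its two neighbours are distinct. Hence the three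
successors have probability exactly `1 / 3` each, and the code of the row is explicit. -/
theorem ringSucc_nodup {M : ℕ} (hM : 3 ≤ M) (c₀ : ZMod M → Fin g) (bad : Fin g)
    (s : Fin M × Fin M × Fin g) (a : Fin g × Fin g × Fin g) :
    (ringSucc loc c₀ bad s a).Nodup := by
  have h1 : cycPred s.2.1 ≠ s.2.1 := by
    have := s.2.1.isLt
    rw [ne_eq, Fin.ext_iff, cycPred_val]; split_ifs <;> omega
  have h2 : s.2.1 ≠ cycSucc s.2.1 := by
    have := s.2.1.isLt
    rw [ne_eq, Fin.ext_iff, cycSucc_val]; split_ifs <;> omega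
  have h3 : cycPred s.2.1 ≠ cycSucc s.2.1 := by
    have := s.2.1.isLt
    rw [ne_eq, Fin.ext_iff, cycSucc_val, cycPred_val]; split_ifs <;> omega
  unfold ringSucc
  split_ifs <;> simp [h1, h2, h3]

theorem gridCode_eq {M k : ℕ} {φ : ℕ → ℕ → Fin g → Prop} [∀ t i γ, Decidable (φ t i γ)]
    {l : List (Fin M × Fin M × Fin g)} (hl : l.length = k)
    (h : ∀ s, s ∈ l ↔ φ s.1 s.2.1 s.2.2) :
    (some true :: (List.finRange (M * (M * g))).flatMap fun t =>
      uniformCode (l.map (tripleEquiv M M g)).length (t ∈ l.map (tripleEquiv M M g))) =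
      gridCode M g k φ := by
  rw [gridCode, flatMap_finRange_triple]
  congr 1
  refine flatMap_finRange _ _ _ fun t => flatMap_finRange _ _ _ fun i => ?_
  refine List.flatMap_congr fun γ _ => ?_
  have := h (t, i, γ)
  simp only [List.length_map, hl]
  unfold uniformCode
  congr 1
  rw [eq_iff_iff, ← this]
  exact List.mem_map_of_injective (tripleEquiv M M g).injective

/-- `ringRowCode` is phrased so that the calculus can evaluate it: the calculus has a successor
modulo `M` but no predecessor, and `ψ` stands for the test of `c₀` on the input. -/
theorem ringRowCode_eq {M : ℕ} (hM : 3 ≤ M) (c₀ : ZMod M → Fin g) (bad : Fin g)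
    {ψ : ℕ → Fin g → Prop} [∀ i γ, Decidable (ψ i γ)]
    (hψ : ∀ (i : Fin M) γ, ψ i γ ↔ γ = c₀ i.val) (t i : Fin M) (γ : Fin g)
    (a : Fin g × Fin g × Fin g) :
    optionCode (fun d => tableCode ratCode d.prob) ((ringMDP loc c₀ bad).trans
      (tripleEquiv M M g (t, i, γ)) (tripleEquiv g g g a)) = ringRowCode loc M ψ bad t i γ a := by
  rw [ringMDP, optionCode_ofList (((ringSucc_nodup loc hM c₀ bad _ _).map
    (tripleEquiv M M g).injective))]
  simp only [ringMDPSucc, Equiv.symm_apply_apply, List.map_eq_nil_iff]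
  by_cases hb : a.2.2 = bad
  · have h1 : ringSucc loc c₀ bad (t, i, γ) a = [(t, i, bad)] := by simp [ringSucc, hb]
    rw [ringRowCode, if_pos hb, h1, if_neg (by simp)]
    refine gridCode_eq rfl fun s => ?_
    rw [List.mem_singleton, Prod.ext_iff, Prod.ext_iff, Fin.ext_iff, Fin.ext_iff]
  · by_cases ht : t.val = 0
    · by_cases hc : ψ i γ
      · have h1 : ringSucc loc c₀ bad (t, i, γ) a = [(t, i, γ)] := by
          simp [ringSucc, hb, ht, (hψ i γ).1 hc]
        rw [ringRowCode, if_neg hb, if_pos ht, if_pos hc, h1, if_neg (by simp)]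
        refine gridCode_eq rfl fun s => ?_
        rw [List.mem_singleton, Prod.ext_iff, Prod.ext_iff, Fin.ext_iff, Fin.ext_iff]
      · have h1 : ringSucc loc c₀ bad (t, i, γ) a = [] := by
          simp only [ringSucc, hb, ht, if_true, if_false]
          rw [if_neg (by rwa [← hψ])]
        rw [ringRowCode, if_neg hb, if_pos ht, if_neg hc, h1, if_pos rfl]
    · by_cases hl : loc a.1 a.2.1 a.2.2 = γ
      · have h1 : ringSucc loc c₀ bad (t, i, γ) a = [(cycPred t, cycPred i, a.1),
            (cycPred t, i, a.2.1), (cycPred t, cycSucc i, a.2.2)] := by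
          simp [ringSucc, hb, ht, hl]
        rw [ringRowCode, if_neg hb, if_neg ht, if_pos hl, h1, if_neg (by simp)]
        refine gridCode_eq rfl fun s => ?_
        simp only [List.mem_cons, List.not_mem_nil, or_false, Prod.ext_iff, eq_cycPred_iff]
        have e1 : s.2.1 = i ↔ s.2.1.val = i.val := Fin.ext_iff
        have e2 : s.2.1 = cycSucc i ↔ s.2.1.val = (i.val + 1) % M := Fin.ext_iff
        rw [e1, e2]
        tauto
      · have h1 : ringSucc loc c₀ bad (t, i, γ) a = [] := by
          simp [ringSucc, hb, ht, hl]
        rw [ringRowCode, if_neg hb, if_neg ht, if_neg hl, h1, if_pos rfl]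

/-- The query for the claim that the cell `0` contains `acc` at time `M - 1`. -/
def ringQuery {M : ℕ} (hM : 3 ≤ M) (c₀ : ZMod M → Fin g) (acc bad : Fin g) : Query where
  n := M * (M * g)
  m := g * (g * g)
  mdp := ringMDP loc c₀ bad
  init := tripleEquiv M M g (⟨M - 1, by omega⟩, ⟨0, by omega⟩, acc)
  threshold := 1
  threshold_le := le_rfl

/-- The code of `ringQuery`. -/
def ringQueryCode (M : ℕ) (ψ : ℕ → Fin g → Prop) [∀ i γ, Decidable (ψ i γ)] (acc bad : Fin g) :
    List Sym :=
  ((List.range M).flatMap fun _ => (List.range M).flatMap fun _ => List.replicate g (some true)) ++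
  ([none] ++ unaryCode (g * (g * g)) ++
  (((List.range M).flatMap fun t => if t = 0 then [] else
    (List.range M).flatMap fun _ => List.replicate g (some true)) ++
  (List.replicate acc (some true) ++ [none] ++ ratCode 1 ++
  (List.range M).flatMap fun t => (List.range M).flatMap fun i => (List.finRange g).flatMap fun γ =>
    (List.finRange (g * (g * g))).flatMap fun a =>
      ringRowCode loc M ψ bad t i γ ((tripleEquiv g g g).symm a))))

theorem tripleEquiv_val {a b c : ℕ} (x : Fin a × Fin b × Fin c) :
    (tripleEquiv a b c x).val = x.1 * (b * c) + (x.2.1 * c + x.2.2) := by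
  simp [tripleEquiv, finProdFinEquiv]
  ring

theorem ringQuery_code {M : ℕ} (hM : 3 ≤ M) (c₀ : ZMod M → Fin g) (acc bad : Fin g)
    {ψ : ℕ → Fin g → Prop} [∀ i γ, Decidable (ψ i γ)]
    (hψ : ∀ (i : Fin M) γ, ψ i γ ↔ γ = c₀ i.val) :
    (ringQuery loc hM c₀ acc bad).code = ringQueryCode loc M ψ acc bad := by
  have h1 : List.replicate (M * (M * g)) (some true) =
      (List.range M).flatMap fun _ => (List.range M).flatMap fun _ =>
        List.replicate g (some true) := by
    rw [unaryCode_mul]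
    refine List.flatMap_congr fun _ _ => ?_
    rw [unaryCode_mul]
  -- A loop of length `M - 1` is expressed as a loop of length `M` that writes nothing in its first
  -- round.
  have h2 : List.replicate ((M - 1) * (M * g)) (some true) =
      (List.range M).flatMap fun t => if t = 0 then [] else
        (List.range M).flatMap fun _ => List.replicate g (some true) := by
    obtain ⟨k, rfl⟩ : ∃ k, M = k + 1 := ⟨M - 1, by omega⟩
    rw [List.range_succ_eq_map, List.flatMap_cons, List.flatMap_map, if_pos rfl, List.nil_append,
      Nat.add_sub_cancel, unaryCode_mul]
    refine List.flatMap_congr fun _ _ => ?_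
    rw [if_neg (by omega), unaryCode_mul, List.range_succ_eq_map]
  have h3 : tableCode (fun row => tableCode (optionCode fun d => tableCode ratCode d.prob) row)
      (ringMDP loc c₀ bad).trans = (List.range M).flatMap fun t => (List.range M).flatMap fun i =>
        (List.finRange g).flatMap fun γ => (List.finRange (g * (g * g))).flatMap fun a =>
          ringRowCode loc M ψ bad t i γ ((tripleEquiv g g g).symm a) := by
    rw [tableCode, flatMap_finRange_triple]
    refine flatMap_finRange _ _ _ fun t => flatMap_finRange _ _ _ fun i => ?_
    refine List.flatMap_congr fun γ _ => ?_
    rw [tableCode]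
    refine List.flatMap_congr fun a _ => ?_
    have := ringRowCode_eq loc hM c₀ bad hψ t i γ ((tripleEquiv g g g).symm a)
    rwa [Equiv.apply_symm_apply] at this
  have h4 : (tripleEquiv M M g (⟨M - 1, by omega⟩, ⟨0, by omega⟩, acc)).val =
      (M - 1) * (M * g) + acc := by
    rw [tripleEquiv_val]; simp
  have h5 : unaryCode ((M - 1) * (M * g) + acc) =
      List.replicate ((M - 1) * (M * g)) (some true) ++ List.replicate acc (some true) ++ [none] := by
    rw [unaryCode, List.replicate_add]
  have h6 : unaryCode (M * (M * g)) = List.replicate (M * (M * g)) (some true) ++ [none] := rfl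
  change unaryCode (M * (M * g)) ++ unaryCode (g * (g * g)) ++
    unaryCode (tripleEquiv M M g (⟨M - 1, by omega⟩, ⟨0, by omega⟩, acc)).val ++ ratCode 1 ++
    tableCode (fun row => tableCode (optionCode fun d => tableCode ratCode d.prob) row)
      (ringMDP loc c₀ bad).trans = _
  rw [ringQueryCode, h3, h4, h5, h6, h1, h2]
  simp only [List.append_assoc]

end

/-! ## Hardness for polynomial time -/

section
variable {X I : Type} {code : X → List I} {c : ℕ} {g : ℕ}

theorem IsOut.gridCode {d : ℕ} (k : ℕ) {φ : X → (ℕ → ℕ) → ℕ → ℕ → Fin g → Prop}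
    [∀ x e t i γ, Decidable (φ x e t i γ)]
    (h : ∀ γ, IsForm code c (d + 2) fun x e => φ x e (e d) (e (d + 1)) γ)
    (h1 : ∀ x e v t i γ, φ x (Function.update e d v) t i γ ↔ φ x e t i γ)
    (h2 : ∀ x e v t i γ, φ x (Function.update e (d + 1) v) t i γ ↔ φ x e t i γ) :
    IsOut code c d fun x e => gridCode (bnd code c x) g k (φ x e) := by
  have : IsOut code c d fun x e => [some true] ++ (List.range (bnd code c x)).flatMap fun t =>
      (List.range (bnd code c x)).flatMap fun i => (List.finRange g).flatMap fun γ =>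
      WindowMDP.uniformCode k (φ x e t i γ) := by
    refine (IsOut.emit (some true)).append (.forRange (F := fun x e t =>
      (List.range (bnd code c x)).flatMap fun i =>
      (List.finRange g).flatMap fun γ => WindowMDP.uniformCode k (φ x e t i γ))
      (.forRange (F := fun x e i => (List.finRange g).flatMap fun γ =>
        WindowMDP.uniformCode k (φ x e (e d) i γ))
      (.forList _ fun γ _ => .uniformCode k (h γ)) ?_) ?_)
    · intro x e v i
      rw [Function.update_of_ne (by omega)]
      simp only [WindowMDP.uniformCode, h2]
    · intro x e v i
      simp only [WindowMDP.uniformCode, h1]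
  exact this

theorem IsOut.ringRowCode (loc : Fin g → Fin g → Fin g → Fin g) {ψ : X → ℕ → Fin g → Prop}
    [∀ x i γ, Decidable (ψ x i γ)] (bad γ : Fin g) (a : Fin g × Fin g × Fin g)
    (hψ : IsForm code c 2 fun x e => ψ x (e 1) γ) :
    IsOut code c 2 fun x e => ringRowCode loc (bnd code c x) (ψ x) bad (e 0) (e 1) γ a := by
  have v : ∀ {d} i, i < d → IsNum code c d fun _ e => e i := fun i hi => .var hi
  refine .cases (.const _) (.gridCode 1 (fun γ' => ?_) ?_ ?_)
    (.cases (.eq (v 0 (by omega)) .zero) (.cases hψ (.gridCode 1 (fun γ' => ?_) ?_ ?_) (.const _))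
      (.cases (.const _) (.gridCode 3 (fun γ' => ?_) ?_ ?_) (.const _)))
  · exact .and (.eq (v 2 (by omega)) (v 0 (by omega)))
      (.and (.eq (v 3 (by omega)) (v 1 (by omega))) (.const _))
  · intros; simp
  · intros; simp
  · exact .and (.eq (v 2 (by omega)) (v 0 (by omega)))
      (.and (.eq (v 3 (by omega)) (v 1 (by omega))) (.const _))
  · intros; simp
  · intros; simp
  · exact .and (.eq (.succ (v 2 (by omega))) (v 0 (by omega)))
      (.or (.and (.eq (.succ (v 3 (by omega))) (v 1 (by omega))) (.const _))
      (.or (.and (.eq (v 3 (by omega)) (v 1 (by omega))) (.const _))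
      (.and (.eq (v 3 (by omega)) (.succ (v 1 (by omega)))) (.const _))))
  · intros; simp
  · intros; simp

theorem IsOut.ringQueryCode (loc : Fin g → Fin g → Fin g → Fin g) {ψ : X → ℕ → Fin g → Prop}
    [∀ x i γ, Decidable (ψ x i γ)] (acc bad : Fin g)
    (hψ : ∀ γ, IsForm code c 2 fun x e => ψ x (e 1) γ) :
    IsOut code c 0 fun x _ => ringQueryCode loc (bnd code c x) (ψ x) acc bad := by
  refine .append (.forRange (.forRange (.const _) ?_) ?_) (.append (.const _) (.append
    (.forRange (.cases (.eq (.var (a := 0) (by omega)) .zero) .nil (.forRange (.const _) ?_)) ?_)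
    (.append (.const _) (.forRange (F := fun x e t =>
      (List.range (bnd code c x)).flatMap fun i => (List.finRange g).flatMap fun γ =>
      (List.finRange (g * (g * g))).flatMap fun a =>
      WindowMDP.ringRowCode loc (bnd code c x) (ψ x) bad t i γ ((tripleEquiv g g g).symm a))
    (.forRange (F := fun x e i => (List.finRange g).flatMap fun γ =>
      (List.finRange (g * (g * g))).flatMap fun a =>
      WindowMDP.ringRowCode loc (bnd code c x) (ψ x) bad (e 0) i γ ((tripleEquiv g g g).symm a))
      (.forList _ fun γ _ => .forList _ fun a _ => .ringRowCode loc bad γ _ (hψ γ)) ?_) ?_))))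
  all_goals intros; simp

/-- The priorities of the states of the Markov decision process of a cellular automaton. -/
theorem IsOut.ringPrio {ψ : X → ℕ → Fin g → Prop} [∀ x i γ, Decidable (ψ x i γ)]
    (hψ : ∀ γ, IsForm code c 2 fun x e => ψ x (e 1) γ) :
    IsOut code c 0 fun x _ => (List.range (bnd code c x)).flatMap fun t =>
      (List.range (bnd code c x)).flatMap fun i => (List.finRange g).flatMap fun γ =>
        unaryCode (if t = 0 ∧ ψ x i γ then 0 else 1) := by
  refine .forRange (.forRange (.forList _ fun γ _ => IsOut.congr (.cases
    (F := fun _ _ => unaryCode 0) (G := fun _ _ => unaryCode 1)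
    (.and (.eq (.var (a := 0) (by omega)) .zero) (hψ γ)) (.const _) (.const _)) ?_) ?_) ?_
  · intro x e _
    split_ifs <;> rfl
  all_goals intros; simp

end

/-- The letter with index `i` stands in the input cell `i + 1`, behind the left end marker. If `i +
1` wraps around to `0`, the left end marker is read; it counts as absence of a letter, which is
correct because the word has ended before. -/
theorem IsForm.ringInit {g c : ℕ} (ini : Bool → Option Bool → Fin g) (γ : Fin g) :
    IsForm (id : List Bool → List Bool) c 2
      fun x e => ini (decide (e 1 = 0)) x[e 1]? = γ := by
  set p : Bool → InSym Bool → Bool := fun b s => match s with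
    | .letter a => decide (ini b (some a) = γ)
    | _ => decide (ini b none = γ) with hp
  have v : IsNum (id : List Bool → List Bool) c 2 fun _ e => e 1 := .var (by omega)
  refine (((IsForm.eq v .zero).and (.sym (p true) v.succ)).or
    ((IsForm.eq v .zero).not.and (.sym (p false) v.succ))).congr
    fun x e he => ?_
  have key : ∀ b, p b (readInput (id x) ((e 1 + 1) % bnd id c x)) = true ↔ ini b x[e 1]? = γ := by
    intro b
    have h1 := he 1
    have h2 := length_lt_bnd (code := (id : List Bool → List Bool)) (c := c) x
    simp only [id] at h2
    by_cases h : e 1 + 1 = bnd id c x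
    · rw [h, Nat.mod_self, List.getElem?_eq_none (by omega)]
      simp [readInput, hp]
    · rw [Nat.mod_eq_of_lt (by omega), readInput, if_neg (by omega), Nat.add_sub_cancel]
      simp only [id]
      cases x[e 1]? <;> simp [hp]
  by_cases h : e 1 = 0
  · simp only [h, true_and, not_true, false_and, or_false, decide_true]
    have := key true
    rwa [h] at this
  · simp only [h, false_and, not_false_iff, true_and, false_or, decide_false]
    exact key false

/-! ### Window objectives on runs with eventually constant priorities or eventually zero or negative
weights. -/

section
variable {S A : Type} {ρ : Path S A}

theorem mem_FW_GWpar_one {p : S → ℕ} (h : ∃ i, ∀ j ≥ i, p (ρ j).1 = 0) :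
    ρ ∈ FW (GWpar p) 1 := by
  obtain ⟨i, hi⟩ := h
  refine ⟨i, fun j => ⟨0, one_pos, ?_, fun k hk => absurd hk (Nat.not_lt_zero _)⟩⟩
  simp only [suffix]
  rw [hi _ (by omega)]
  exact Even.zero

theorem not_mem_FW_GWpar {p : S → ℕ} (h : ∃ i, ∀ j ≥ i, p (ρ j).1 = 1) (lam : ℕ) :
    ρ ∉ FW (GWpar p) lam := by
  rintro ⟨i', h'⟩
  obtain ⟨i, hi⟩ := h
  obtain ⟨l, -, h1, -⟩ := h' i
  simp only [suffix] at h1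
  rw [hi _ (by omega)] at h1
  exact absurd h1 (by decide)

theorem mem_FW_GWmp_one {w : A → ℤ} (h : ∃ i, ∀ j ≥ i, w (ρ j).2 = 0) :
    ρ ∈ FW (GWmp w) 1 := by
  obtain ⟨i, hi⟩ := h
  refine ⟨i, fun j => ⟨0, one_pos, ?_⟩⟩
  simp only [meanPayoff, suffix]
  simp [hi (i + j) (by omega)]

theorem not_mem_FW_GWmp {w : A → ℤ} (h : ∃ i, ∀ j ≥ i, w (ρ j).2 < 0) (lam : ℕ) :
    ρ ∉ FW (GWmp w) lam := by
  rintro ⟨i', h'⟩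
  obtain ⟨i, hi⟩ := h
  obtain ⟨l, -, h1⟩ := h' i
  simp only [suffix, meanPayoff] at h1
  refine absurd h1 (not_le.2 (div_neg_of_neg_of_pos (Finset.sum_neg ?_ (by simp)) (by positivity)))
  intro j _
  exact_mod_cast hi _ (by omega)

end

section
variable {g M : ℕ} (c₀ : ZMod M → Fin g) (bad : Fin g)

/-- Priority `0` for correct claims about time `0`. -/
def ringPrio (s : Fin (M * (M * g))) : ℕ :=
  if ((tripleEquiv M M g).symm s).1.val = 0 ∧
    ((tripleEquiv M M g).symm s).2.2 = c₀ ((tripleEquiv M M g).symm s).2.1.val then 0 else 1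

/-- Weight `-1` for giving up. -/
def ringWeight (a : Fin (g * (g * g))) : ℤ :=
  if ((tripleEquiv g g g).symm a).2.2 = bad then -1 else 0

theorem tableCode_ringPrio {ψ : ℕ → Fin g → Prop} [∀ i γ, Decidable (ψ i γ)]
    (hψ : ∀ (i : Fin M) γ, ψ i γ ↔ γ = c₀ i.val) :
    tableCode unaryCode (ringPrio c₀) = (List.range M).flatMap fun t =>
      (List.range M).flatMap fun i => (List.finRange g).flatMap fun γ =>
        unaryCode (if t = 0 ∧ ψ i γ then 0 else 1) := by
  rw [tableCode, flatMap_finRange_triple]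
  refine flatMap_finRange _ _ _ fun t => flatMap_finRange _ _ _ fun i => ?_
  refine List.flatMap_congr fun γ _ => ?_
  simp only [ringPrio, Equiv.symm_apply_apply, hψ]

end

/-- The ring construction with all that is needed for the reductions. -/
theorem InP.exists_ring_query {L : Language Bool} (hL : InP L) :
    ∃ (c g : ℕ) (loc : Fin g → Fin g → Fin g → Fin g) (acc bad : Fin g)
      (hM : ∀ x, 3 ≤ bnd (id : List Bool → List Bool) c x)
      (c₀ : ∀ x : List Bool, ZMod (bnd (id : List Bool → List Bool) c x) → Fin g)
      (ψ : List Bool → ℕ → Fin g → Prop) (_ : ∀ x i γ, Decidable (ψ x i γ)),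
      (∀ x (i : Fin (bnd (id : List Bool → List Bool) c x)) γ, ψ x i γ ↔ γ = c₀ x i.val) ∧
      (∀ γ, IsForm (id : List Bool → List Bool) c 2 fun x e => ψ x (e 1) γ) ∧
      ∀ x (E : Set (Path (Fin (ringQuery loc (hM x) (c₀ x) acc bad).n)
          (Fin (ringQuery loc (hM x) (c₀ x) acc bad).m))),
        (∀ ρ, (∃ i, ∀ j ≥ i, ringPrio (c₀ x) (ρ j).1 = 0 ∧ ringWeight bad (ρ j).2 = 0) → ρ ∈ E) →
        (∀ ρ, (∃ i, ∀ j ≥ i, ringPrio (c₀ x) (ρ j).1 = 1 ∧ ringWeight bad (ρ j).2 < 0) → ρ ∉ E) →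
        (x ∈ L ↔ ∃ σ : Strategy (ringQuery loc (hM x) (c₀ x) acc bad).mdp,
          ((((ringQuery loc (hM x) (c₀ x) acc bad).threshold : ℝ≥0) : ℝ≥0∞)) ≤
            σ.prob (ringQuery loc (hM x) (c₀ x) acc bad).init E) := by
  obtain ⟨g, loc, ini, acc, bad, p, h1, h2, h3⟩ := hL.exists_ring
  obtain ⟨c, hc⟩ := Polynomial.exists_le_pow_size p
  -- Passing from `c` to `c + 1` makes the base at least `3`, so that the ring has at least three
  -- cells.
  have hM : ∀ x, 3 ≤ bnd (id : List Bool → List Bool) (c + 1) x := by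
    intro x
    have h1 : ((id x : List Bool).length + 1).size ≠ 0 := by
      intro h
      have := Nat.size_eq_zero.1 h
      omega
    calc 3 ≤ (c + 1 + 2) ^ 1 := by rw [pow_one]; omega
      _ ≤ _ := Nat.pow_le_pow_right (by omega) (by omega)
  refine ⟨c + 1, g, loc, acc, bad, hM, fun x => ringInit ini x,
    fun x i γ => ini (decide (i = 0)) x[i]? = γ, fun _ _ _ => inferInstance, fun x i γ => ?_,
    fun γ => .ringInit ini γ, fun x E hE hE' => ?_⟩
  · change _ ↔ γ = ini (decide (((i.val : ℕ) :
      ZMod (bnd (id : List Bool → List Bool) (c + 1) x)).val = 0)) x[((i.val : ℕ) :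
      ZMod (bnd (id : List Bool → List Bool) (c + 1) x)).val]?
    rw [ZMod.val_natCast, Nat.mod_eq_of_lt i.isLt, eq_comm]
  · rw [h3 x _ (hc (c + 1) (by omega) x.length)]
    have h4 := ringMDP_correct (loc := loc) (bad := bad) (c₀ := (ringInit ini x :
      ZMod (bnd (id : List Bool → List Bool) (c + 1) x) → Fin g)) h1 (fun r => h2 _ _)
      (⟨bnd (id : List Bool → List Bool) (c + 1) x - 1, by have := hM x; omega⟩,
        ⟨0, by have := hM x; omega⟩, acc) E
      (fun ρ ⟨i, hi⟩ => hE ρ ⟨i, fun j hj => ⟨if_pos (hi j hj).1, if_neg (hi j hj).2⟩⟩)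
      (fun ρ ⟨i, hi⟩ => hE' ρ ⟨i, fun j hj => ⟨if_neg (hi j hj).1, by
        rw [ringWeight, if_pos (hi j hj).2]; decide⟩⟩)
    rw [RingTrue, eq_comm] at h4
    simp only [Nat.cast_zero] at h4
    refine h4.symm.trans (exists_congr fun σ => ?_)
    have : ((((ringQuery loc (hM x) (ringInit ini x) acc bad).threshold : ℝ≥0) : ℝ≥0∞)) = 1 := by
      simp [ringQuery]
    rw [this]
    rfl

/-- A window of size one is closed exactly by an even priority, so the objective with `λ = 1` asks
for even priorities from some time on. -/
theorem pHard_fixedWindowParity : PHard fixedWindowParity.problem := by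
  intro L hL
  obtain ⟨c, g, loc, acc, bad, hM, c₀, ψ, _, h1, h2, h3⟩ := hL.exists_ring_query
  refine ⟨fun x => (⟨ringQuery loc (hM x) (c₀ x) acc bad, ringPrio (c₀ x), fun s => ?_⟩, 1),
    fun x => h3 x _ (fun ρ ⟨i, hi⟩ => mem_FW_GWpar_one ⟨i, fun j hj => (hi j hj).1⟩)
      (fun ρ ⟨i, hi⟩ => not_mem_FW_GWpar ⟨i, fun j hj => (hi j hj).1⟩ _),
    IsOut.logspaceComputable (((IsOut.ringQueryCode loc acc bad h2).append
      (IsOut.ringPrio h2)).append (.const (unaryCode 1))) fun x => ?_⟩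
  · unfold ringPrio; split_ifs <;> omega
  · rw [← ringQuery_code loc (hM x) (c₀ x) acc bad (h1 x), ← tableCode_ringPrio _ (h1 x)]
    rfl

/-- The size of the windows is irrelevant here: a run that ends in priority `0` satisfies the
objective already for size one, and a run that ends in priority `1` for no size. -/
theorem pHard_boundedWindowParity : PHard boundedWindowParity.problem := by
  intro L hL
  obtain ⟨c, g, loc, acc, bad, hM, c₀, ψ, _, h1, h2, h3⟩ := hL.exists_ring_query
  refine ⟨fun x => ⟨ringQuery loc (hM x) (c₀ x) acc bad, ringPrio (c₀ x), fun s => ?_⟩,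
    fun x => h3 x _ (fun ρ ⟨i, hi⟩ => ⟨1, one_pos, mem_FW_GWpar_one ⟨i, fun j hj => (hi j hj).1⟩⟩)
      (fun ρ ⟨i, hi⟩ => fun h => h.elim fun lam h =>
        not_mem_FW_GWpar ⟨i, fun j hj => (hi j hj).1⟩ lam h.2),
    IsOut.logspaceComputable ((IsOut.ringQueryCode loc acc bad h2).append
      (IsOut.ringPrio h2)) fun x => ?_⟩
  · unfold ringPrio; split_ifs <;> omega
  · rw [← ringQuery_code loc (hM x) (c₀ x) acc bad (h1 x), ← tableCode_ringPrio _ (h1 x)]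
    rfl

/-- Weights belong to actions, so it is the act of giving up, not a wrong claim, that is punished. A
refuted claim leaves no other action. -/
theorem pHard_fixedWindowMeanPayoff : PHard fixedWindowMeanPayoff.problem := by
  intro L hL
  obtain ⟨c, g, loc, acc, bad, hM, c₀, ψ, _, h1, h2, h3⟩ := hL.exists_ring_query
  refine ⟨fun x => (⟨ringQuery loc (hM x) (c₀ x) acc bad, ringWeight bad⟩, 1),
    fun x => h3 x _ (fun ρ ⟨i, hi⟩ => mem_FW_GWmp_one ⟨i, fun j hj => (hi j hj).2⟩)
      (fun ρ ⟨i, hi⟩ => not_mem_FW_GWmp ⟨i, fun j hj => (hi j hj).2⟩ _),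
    IsOut.logspaceComputable (((IsOut.ringQueryCode loc acc bad h2).append
      (.const (tableCode intCode (ringWeight bad)))).append (.const (unaryCode 1))) fun x => ?_⟩
  rw [← ringQuery_code loc (hM x) (c₀ x) acc bad (h1 x)]
  rfl

/-! ### Events that recur almost surely, and windows as sums of weights. -/

section
variable {S A : Type} [Fintype S] [Fintype A] [MeasurableSpace S] [MeasurableSingletonClass S]
  [MeasurableSpace A] [MeasurableSingletonClass A]

/-- Every consistent history can be continued by likely actions and by successors that are chosen
depending on the history. -/
theorem exists_consistent_from {M : MDP S A} (σ : Strategy M) (s : S) {ρ : Path S A} {m : ℕ}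
    (hρ : ConsistentUpTo M σ s ρ m) (pick : List (S × A) → S → A → S)
    (hp : ∀ h s, ∀ a ∈ M.avail s, 0 < M.prob s a (pick h s a)) :
    ∃ ρ' : Path S A, (∀ i ≤ m, ρ' i = ρ i) ∧ (∀ n, ConsistentUpTo M σ s ρ' n) ∧
      (∀ i ≥ m, (ρ' (i + 1)).1 = pick (hist ρ' i) (ρ' i).1 (ρ' i).2) ∧
      ∀ i > m, (ρ' i).2 = likely (σ.act (hist ρ' i) (ρ' i).1) := by
  set f : List (S × A) → S := fun h => match h.getLast? with
    | none => s
    | some x => pick h.dropLast x.1 x.2 with hf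
  obtain ⟨ρ', h0, h⟩ := exists_continuation σ f ρ (m + 1)
  have h1 : ∀ i ≥ m, (ρ' (i + 1)).1 = pick (hist ρ' i) (ρ' i).1 (ρ' i).2 := by
    intro i hi
    rw [h (i + 1) (by omega), hist_succ]
    simp [hf]
  have h2 : ∀ i > m, (ρ' i).2 = likely (σ.act (hist ρ' i) (ρ' i).1) := by
    intro i hi
    have := h i hi
    have h3 : (ρ' i).1 = f (hist ρ' i) := by rw [this]
    rw [h3]; exact congrArg Prod.snd this
  have h3 : ∀ i, 0 < (σ.act (hist ρ' i) (ρ' i).1).prob (ρ' i).2 := by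
    intro i
    rcases Nat.lt_or_ge m i with hi | hi
    · rw [h2 i hi]; exact likely_pos _
    · rw [hist_congr (ρ' := ρ) fun j hj => h0 j (by omega), h0 i (by omega)]
      exact hρ.act i hi
  refine ⟨ρ', fun i hi => h0 i (by omega), fun n => ⟨?_, fun i _ => h3 i, fun i _ => ?_⟩, h1, h2⟩
  · rw [h0 0 (by omega)]; exact hρ.init
  · rcases Nat.lt_or_ge i m with hi | hi
    · rw [h0 i (by omega), h0 (i + 1) (by omega)]
      exact hρ.trans i hi
    · rw [h1 i hi]
      exact hp _ _ _ (σ.act_avail _ _ _ (h3 i))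

/-- An event that can be brought about from every history within `L` steps, against likely actions,
happens infinitely often. -/
theorem law_avoid_eq_zero_of_pick (M : MDP S A) (σ : Strategy M) (s : S) (V : ℕ → Set (Path S A))
    (L : ℕ) (hloc : ∀ n ρ ρ', (∀ i ≤ n + L, ρ i = ρ' i) → ρ ∈ V n → ρ' ∈ V n)
    (pick : List (S × A) → S → A → S)
    (hp : ∀ h s, ∀ a ∈ M.avail s, 0 < M.prob s a (pick h s a))
    (hV : ∀ m ρ, (∀ n, ConsistentUpTo M σ s ρ n) →
      (∀ i ≥ m, (ρ (i + 1)).1 = pick (hist ρ i) (ρ i).1 (ρ i).2) →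
      (∀ i > m, (ρ i).2 = likely (σ.act (hist ρ i) (ρ i).1)) → ρ ∈ V m) :
    law M σ s {ρ | ∃ i₀, ∀ n, i₀ ≤ n → ρ ∉ V n} = 0 := by
  obtain ⟨ε, hε, hb⟩ := exists_continuation_bound M L
  have : {ρ | ∃ i₀, ∀ n, i₀ ≤ n → ρ ∉ V n} = ⋃ i₀, {ρ | ∀ n, i₀ ≤ n → ρ ∉ V n} := by
    ext; simp
  rw [this, measure_iUnion_null_iff]
  intro i₀
  refine law_avoid_eq_zero M σ s V i₀ L ε hε hloc fun m ρ hρ => ?_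
  obtain ⟨ρ', h1, h2, h3, h4⟩ := exists_consistent_from σ s hρ pick hp
  refine ⟨ρ', hV m ρ' h2 h3 h4, h1, ?_⟩
  have hc : cyl ρ m = cyl ρ' m := by
    ext ρ''
    exact forall₂_congr fun i hi => by rw [h1 i hi]
  rw [hc]
  exact hb σ s ρ' m (h2 m) fun i hi _ => ⟨(h2 (i + 1)).trans i (by omega), h4 (i + 1) (by omega)⟩

end

theorem suffix_mem_GWmp {S A : Type} {w : A → ℤ} {ρ : Path S A} {i lam : ℕ} :
    suffix ρ i ∈ GWmp w lam ↔
      ∃ m < lam, 0 ≤ ∑ k ∈ Finset.range (m + 1), w (ρ (i + k)).2 := by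
  refine exists_congr fun m => and_congr_right fun _ => ?_
  rw [meanPayoff, le_div_iff₀ (by positivity), zero_mul]
  exact_mod_cast Iff.rfl

/-! ## A Markov decision process that requires memory -/

section
variable {n : ℕ} [NeZero n]

/-- The only action that is available in a state other than the choice state. -/
def forced (s : Fin (2 * n + 1) × Fin n) : Fin 3 × Fin n :=
  if s.1.val = s.2.val then (1, s.2)
  else if s.1.val = n + 1 + s.2.val then (2, s.2)
  else (0, 0)

/-- A round: a random number `j` is drawn, the phases `0, …, n - 1` follow, with a debt in phase
`j`, then a number `k` is chosen in phase `n`, and the phases `n + 1, …, 2 n` follow, with a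
payment in phase `n + 1 + k`. -/
def memSucc (s : Fin (2 * n + 1) × Fin n) (a : Fin 3 × Fin n) : List (Fin (2 * n + 1) × Fin n) :=
  if h : s.1.val = n then if a.1 = 0 then
    [(⟨n + 1, by have := NeZero.pos n; omega⟩, a.2)] else []
  else if a = forced s then
    if h2 : s.1.val = 2 * n then (List.finRange n).map fun j => (0, j)
    else [(⟨s.1.val + 1, by omega⟩, if s.1.val + 1 = n then 0 else s.2)]
  else []

theorem memSucc_ne_nil (s : Fin (2 * n + 1) × Fin n) : ∃ a, memSucc s a ≠ [] := by
  have hn := NeZero.pos n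
  by_cases h : s.1.val = n
  · exact ⟨(0, 0), by simp [memSucc, h]⟩
  · refine ⟨forced s, ?_⟩
    simp only [memSucc, h, dite_false, if_true]
    split_ifs
    · intro h3
      have := congrArg List.length h3
      simp at this
      omega
    all_goals simp

theorem memSucc_nodup (s : Fin (2 * n + 1) × Fin n) (a : Fin 3 × Fin n) : (memSucc s a).Nodup := by
  have h : ((List.finRange n).map fun j => ((0 : Fin (2 * n + 1)), j)).Nodup :=
    (List.nodup_finRange n).map fun i j h => by simpa using h
  unfold memSucc
  split_ifs
  all_goals first | exact h | simp

/-- The successor `t` of `s` under `a`. -/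
structure MemStep (s : Fin (2 * n + 1) × Fin n) (a : Fin 3 × Fin n) (t : Fin (2 * n + 1) × Fin n) :
    Prop where
  phase : t.1.val = if s.1.val = 2 * n then 0 else s.1.val + 1
  act : s.1.val ≠ n → a = forced s
  choice : s.1.val = n → a.1 = 0 ∧ t.2 = a.2
  forget : s.1.val + 1 = n → t.2 = 0
  keep : s.1.val ≠ n → s.1.val + 1 ≠ n → s.1.val ≠ 2 * n → t.2 = s.2

theorem memStep {s t : Fin (2 * n + 1) × Fin n} {a : Fin 3 × Fin n} (h : t ∈ memSucc s a) :
    MemStep s a t := by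
  have hn := NeZero.pos n
  unfold memSucc at h
  by_cases h1 : s.1.val = n
  · rw [dif_pos h1] at h
    split_ifs at h with h2
    · rw [List.mem_singleton] at h
      subst h
      constructor
      · rw [if_neg (by omega)]; simp [h1]
      · intro h; exact absurd h1 h
      · intro _; exact ⟨h2, rfl⟩
      · intro h; omega
      · intro h; exact absurd h1 h
    · simp at h
  · rw [dif_neg h1] at h
    by_cases h2 : a = forced s
    · rw [if_pos h2] at h
      by_cases h3 : s.1.val = 2 * n
      · rw [dif_pos h3] at h
        obtain ⟨j, -, rfl⟩ := List.mem_map.1 h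
        constructor
        · rw [if_pos h3]; rfl
        · intro _; exact h2
        · intro h; exact absurd h h1
        · intro h; omega
        · intro _ _ h; exact absurd h3 h
      · rw [dif_neg h3, List.mem_singleton] at h
        subst h
        constructor
        · rw [if_neg h3]
        · intro _; exact h2
        · intro h; exact absurd h h1
        · intro h; simp [h]
        · intro _ h _; simp [h]
    · rw [if_neg h2] at h
      simp at h

variable (n) in
def memMDP : MDP (Fin ((2 * n + 1) * n)) (Fin (3 * n)) :=
  MDP.ofList (fun s a => (memSucc (finProdFinEquiv.symm s) (finProdFinEquiv.symm a)).map
    finProdFinEquiv) fun s => by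
      obtain ⟨a, ha⟩ := memSucc_ne_nil (n := n) (finProdFinEquiv.symm s)
      exact ⟨finProdFinEquiv a, by simpa using ha⟩

/-- The states and actions of a path, decoded. -/
def mst (ρ : Path (Fin ((2 * n + 1) * n)) (Fin (3 * n))) (i : ℕ) : Fin (2 * n + 1) × Fin n :=
  finProdFinEquiv.symm (ρ i).1

def mac (ρ : Path (Fin ((2 * n + 1) * n)) (Fin (3 * n))) (i : ℕ) : Fin 3 × Fin n :=
  finProdFinEquiv.symm (ρ i).2

theorem memStep_of_consistent {σ : Strategy (memMDP n)} {s} {ρ} (h : ∀ m, ConsistentUpTo _ σ s ρ m)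
    (i : ℕ) : MemStep (mst ρ i) (mac ρ i) (mst ρ (i + 1)) := by
  have := (h (i + 1)).trans i (by omega)
  rw [memMDP, MDP.prob_ofList] at this
  obtain ⟨t, h1, h2⟩ := List.mem_map.1 this
  apply memStep
  have h3 : mst ρ (i + 1) = t := by rw [mst, ← h2, Equiv.symm_apply_apply]
  rw [h3]
  exact h1

section
variable {ρ : Path (Fin ((2 * n + 1) * n)) (Fin (3 * n))}
  (hρ : ∀ i, MemStep (mst ρ i) (mac ρ i) (mst ρ (i + 1)))
include hρ

theorem mst_before {i d : ℕ} (h : (mst ρ i).1.val + d < n) :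
    (mst ρ (i + d)).1.val = (mst ρ i).1.val + d ∧ (mst ρ (i + d)).2 = (mst ρ i).2 := by
  induction d with
  | zero => exact ⟨rfl, rfl⟩
  | succ d ih =>
    obtain ⟨h1, h2⟩ := ih (by omega)
    have := hρ (i + d)
    refine ⟨?_, ?_⟩
    · rw [← Nat.add_assoc, this.phase, if_neg (by omega), h1]; omega
    · rw [← Nat.add_assoc, this.keep (by omega) (by omega) (by omega), h2]

theorem mst_choice {i d : ℕ} (h : (mst ρ i).1.val + d = n) (hd : 0 < d) :
    (mst ρ (i + d)).1.val = n ∧ (mst ρ (i + d)).2 = 0 := by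
  obtain ⟨d, rfl⟩ := Nat.exists_eq_succ_of_ne_zero hd.ne'
  obtain ⟨h1, h2⟩ := mst_before hρ (i := i) (d := d) (by omega)
  have := hρ (i + d)
  refine ⟨?_, ?_⟩
  · rw [Nat.succ_eq_add_one, ← Nat.add_assoc, this.phase, if_neg (by omega), h1]; omega
  · rw [Nat.succ_eq_add_one, ← Nat.add_assoc, this.forget (by omega)]

theorem mst_after {i d : ℕ} (h : (mst ρ i).1.val = n) (hd : 0 < d) (hd' : d ≤ n) :
    (mst ρ (i + d)).1.val = n + d ∧ (mst ρ (i + d)).2 = (mac ρ i).2 := by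
  induction d with
  | zero => omega
  | succ d ih =>
    have := hρ (i + d)
    rcases Nat.eq_zero_or_pos d with rfl | h0
    · refine ⟨?_, ?_⟩
      · rw [← Nat.add_assoc, this.phase, Nat.add_zero i, if_neg (by omega), h]
      · rw [← Nat.add_assoc, (this.choice h).2, Nat.add_zero i]
    · obtain ⟨h1, h2⟩ := ih h0 (by omega)
      refine ⟨?_, ?_⟩
      · rw [← Nat.add_assoc, this.phase, if_neg (by omega), h1]; omega
      · rw [← Nat.add_assoc, this.keep (by omega) (by omega) (by omega), h2]

end

/-- A window objective of which the windows are closed in time if they do not start with a debt, or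
if the right number is chosen. -/
def Tests (n : ℕ) [NeZero n] (G : Set (Path (Fin ((2 * n + 1) * n)) (Fin (3 * n)))) : Prop :=
  ∀ ρ : Path (Fin ((2 * n + 1) * n)) (Fin (3 * n)),
    (∀ i, MemStep (mst ρ i) (mac ρ i) (mst ρ (i + 1))) → ∀ i,
    suffix ρ i ∈ G ↔ (mst ρ i).1.val = (mst ρ i).2.val →
      (mac ρ (i + (n - (mst ρ i).2.val))).2 = (mst ρ i).2

variable (n) in
/-- Priorities. -/
def memPrio (s : Fin ((2 * n + 1) * n)) : ℕ :=
  if (finProdFinEquiv.symm s).1.val = (finProdFinEquiv.symm s).2.val then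
    2 * (n - (finProdFinEquiv.symm s).2.val) + 1
  else if (finProdFinEquiv.symm s).1.val = n + 1 + (finProdFinEquiv.symm s).2.val then
    2 * (n - (finProdFinEquiv.symm s).2.val)
  else 2 * n + 2

variable (n) in
/-- Weights. -/
def memWeight (a : Fin (3 * n)) : ℤ :=
  if (finProdFinEquiv.symm a).1 = 1 then -((finProdFinEquiv.symm a).2.val + 1)
  else if (finProdFinEquiv.symm a).1 = 2 then (finProdFinEquiv.symm a).2.val + 1
  else 0

/-- The window that opens in phase `j` extends to phase `j + n + 1`, so the payment in phase `n + 1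
+ k` is seen only if `k ≤ j`. Its even priority `2 (n - k)` is below the debt `2 (n - j) + 1` only
if `k ≥ j`. -/
theorem tests_parity : Tests n (GWpar (memPrio n) (n + 2)) := by
  intro ρ hρ i
  have hn := NeZero.pos n
  have hp : ∀ l, memPrio n (suffix ρ i l).1 = if (mst ρ (i + l)).1.val = (mst ρ (i + l)).2.val then
      2 * (n - (mst ρ (i + l)).2.val) + 1
    else if (mst ρ (i + l)).1.val = n + 1 + (mst ρ (i + l)).2.val then
      2 * (n - (mst ρ (i + l)).2.val) else 2 * n + 2 := fun _ => rfl
  by_cases hd : (mst ρ i).1.val = (mst ρ i).2.val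
  · set j := (mst ρ i).2 with hj
    have hjn := j.isLt
    set k := (mac ρ (i + (n - j.val))).2 with hk
    have hkn := k.isLt
    have hc := mst_choice hρ (i := i) (d := n - j.val) (by omega) (by omega)
    have p0 : memPrio n (suffix ρ i 0).1 = 2 * (n - j.val) + 1 := by
      rw [hp, Nat.add_zero i, if_pos hd]
    have p1 : ∀ l, 0 < l → l ≤ n + 1 → memPrio n (suffix ρ i l).1 =
        if j.val + l = n + 1 + k.val then 2 * (n - k.val) else 2 * n + 2 := by
      intro l h1 h2
      rw [hp]
      rcases lt_trichotomy (j.val + l) n with h3 | h3 | h3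
      · obtain ⟨e1, e2⟩ := mst_before hρ (i := i) (d := l) (by omega)
        rw [e1, e2, if_neg (by omega), if_neg (by omega), if_neg (by omega)]
      · obtain ⟨e1, e2⟩ := mst_choice hρ (i := i) (d := l) (by omega) (by omega)
        rw [e1, e2, Fin.val_zero, if_neg (by omega), if_neg (by omega), if_neg (by omega)]
      · obtain ⟨e1, e2⟩ := mst_after hρ (d := l - (n - j.val)) hc.1 (by omega) (by omega)
        rw [show i + (n - j.val) + (l - (n - j.val)) = i + l by omega] at e1 e2
        rw [e1, e2, ← hk, if_neg (by omega)]
        congr 1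
        rw [eq_iff_iff]; omega
    simp only [hd, true_imp_iff]
    constructor
    · rintro ⟨l, h1, h2, h3⟩
      rcases Nat.eq_zero_or_pos l with rfl | h0
      · rw [p0] at h2
        exact absurd h2 (by simp)
      · have := h3 0 h0
        rw [p0, p1 l h0 (by omega)] at this
        split_ifs at this
        · apply Fin.ext; omega
        · omega
    · intro hkj
      refine ⟨n + 1, by omega, ?_, fun l hl => ?_⟩
      · rw [p1 _ (by omega) le_rfl, if_pos (by rw [hkj]; omega)]; simp
      · rw [p1 _ (by omega) le_rfl, if_pos (by rw [hkj]; omega)]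
        rcases Nat.eq_zero_or_pos l with rfl | h0
        · rw [p0, hkj]; omega
        · rw [p1 l h0 (by omega), if_neg (by rw [hkj]; omega)]; omega
  · simp only [hd, false_imp_iff, iff_true]
    refine ⟨0, by omega, ?_, fun k hk => absurd hk (Nat.not_lt_zero _)⟩
    rw [hp, Nat.add_zero i, if_neg hd]
    split_ifs
    · simp
    · exact ⟨n + 1, by omega⟩

/-- The same balance as for parity: the payment `k + 1` comes in time only if `k ≤ j`, and covers
the debt `j + 1` only if `k ≥ j`. As weights sit on actions, the forced actions reveal the phase. -/
theorem tests_meanPayoff : Tests n (GWmp (memWeight n) (n + 2)) := by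
  intro ρ hρ i
  have hn := NeZero.pos n
  have hw : ∀ l, memWeight n (suffix ρ i l).2 = if (mac ρ (i + l)).1 = 1 then
      -((mac ρ (i + l)).2.val + 1 : ℤ)
    else if (mac ρ (i + l)).1 = 2 then ((mac ρ (i + l)).2.val + 1 : ℤ) else 0 := fun _ => rfl
  have hf : ∀ l, (mst ρ (i + l)).1.val ≠ n → memWeight n (suffix ρ i l).2 =
      if (mst ρ (i + l)).1.val = (mst ρ (i + l)).2.val then -((mst ρ (i + l)).2.val + 1 : ℤ)
      else if (mst ρ (i + l)).1.val = n + 1 + (mst ρ (i + l)).2.val then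
        ((mst ρ (i + l)).2.val + 1 : ℤ) else 0 := by
    intro l h
    rw [hw, (hρ (i + l)).act h, forced]
    split_ifs <;> simp_all
  have hg : ∀ l, suffix ρ i ∈ GWmp (memWeight n) l ↔
      ∃ m < l, 0 ≤ ∑ k ∈ Finset.range (m + 1), memWeight n (suffix ρ i k).2 :=
    fun l => suffix_mem_GWmp
  rw [hg]
  by_cases hd : (mst ρ i).1.val = (mst ρ i).2.val
  · set j := (mst ρ i).2 with hj
    have hjn := j.isLt
    set k := (mac ρ (i + (n - j.val))).2 with hk
    have hkn := k.isLt
    have hc := mst_choice hρ (i := i) (d := n - j.val) (by omega) (by omega)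
    have p0 : memWeight n (suffix ρ i 0).2 = -(j.val + 1 : ℤ) := by
      rw [hf _ (by rw [Nat.add_zero i, hd]; omega), Nat.add_zero i, if_pos hd]
    have p1 : ∀ l, 0 < l → l ≤ n + 1 → memWeight n (suffix ρ i l).2 =
        if j.val + l = n + 1 + k.val then (k.val + 1 : ℤ) else 0 := by
      intro l h1 h2
      rcases lt_trichotomy (j.val + l) n with h3 | h3 | h3
      · obtain ⟨e1, e2⟩ := mst_before hρ (i := i) (d := l) (by omega)
        rw [hf _ (by omega), e1, e2, if_neg (by omega), if_neg (by omega), if_neg (by omega)]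
      · obtain ⟨e1, e2⟩ := mst_choice hρ (i := i) (d := l) (by omega) (by omega)
        have := ((hρ (i + l)).choice e1).1
        rw [hw, this, if_neg (by decide), if_neg (by decide), if_neg (by omega)]
      · obtain ⟨e1, e2⟩ := mst_after hρ (d := l - (n - j.val)) hc.1 (by omega) (by omega)
        rw [show i + (n - j.val) + (l - (n - j.val)) = i + l by omega] at e1 e2
        rw [hf _ (by omega), e1, e2, ← hk, if_neg (by omega)]
        congr 1
        rw [eq_iff_iff]; omega
    -- Within the window, the debt and at most one payment are the only nonzero weights.
    have hs : ∀ m ≤ n + 1, ∑ l ∈ Finset.range (m + 1), memWeight n (suffix ρ i l).2 =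
        -(j.val + 1 : ℤ) + if n + 1 + k.val ≤ j.val + m then (k.val + 1 : ℤ) else 0 := by
      intro m hm
      induction m with
      | zero => simp [p0]; omega
      | succ m ih =>
        rw [Finset.sum_range_succ, ih (by omega), p1 (m + 1) (by omega) hm]
        split_ifs <;> omega
    simp only [hd, true_imp_iff]
    constructor
    · rintro ⟨m, h1, h2⟩
      rw [hs m (by omega)] at h2
      split_ifs at h2
      · apply Fin.ext; omega
      · omega
    · intro hkj
      refine ⟨n + 1, by omega, ?_⟩
      rw [hs _ le_rfl, hkj, if_pos (by omega)]; omega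
  · simp only [hd, false_imp_iff, iff_true]
    refine ⟨0, by omega, ?_⟩
    rw [Finset.sum_range_one]
    by_cases hc : (mst ρ i).1.val = n
    · rw [hw, Nat.add_zero i, ((hρ i).choice hc).1]; simp
    · rw [hf 0 hc, Nat.add_zero i, if_neg hd]
      split_ifs <;> omega

end

section
variable {S A Q : Type} [Fintype S] [Fintype A] [Fintype Q] {M : MDP S A}

/-- The memory state of a Mealy machine after `i` steps. -/
def Mealy.memory (μ : Mealy M Q) (q₀ : Q) (h : List (S × A)) : Q :=
  h.foldl (fun q sa => μ.update sa.2 sa.1 q) q₀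

theorem Mealy.memory_succ (μ : Mealy M Q) (q₀ : Q) (ρ : Path S A) (i : ℕ) :
    μ.memory q₀ (hist ρ (i + 1)) = μ.update (ρ i).2 (ρ i).1 (μ.memory q₀ (hist ρ i)) := by
  rw [hist_succ, memory, List.foldl_append]; rfl

end

theorem suffix_suffix {S A : Type} (ρ : Path S A) (i j : ℕ) :
    suffix (suffix ρ i) j = suffix ρ (i + j) := by
  funext k; simp only [suffix, Nat.add_assoc]

/-! ### Memory that suffices and memory that is needed. -/

section
variable {n : ℕ} [NeZero n]

variable (n) in
/-- The machine that remembers the number that was drawn. -/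
def memMealy : Mealy (memMDP n) (Fin n) where
  init := .dirac 0
  act s q := if (finProdFinEquiv.symm s).1.val = n then .dirac (finProdFinEquiv (0, q))
    else .dirac (finProdFinEquiv (forced (finProdFinEquiv.symm s)))
  update _ s q := if (finProdFinEquiv.symm s).1.val < n then (finProdFinEquiv.symm s).2 else q
  act_avail s q a ha := by
    have hn := NeZero.pos n
    rw [memMDP, MDP.mem_avail_ofList, ne_eq, List.map_eq_nil_iff]
    by_cases h : (finProdFinEquiv.symm s).1.val = n
    · rw [if_pos h, RatDist.dirac_pos] at ha
      rw [ha, Equiv.symm_apply_apply]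
      unfold memSucc
      rw [dif_pos h, if_pos rfl]
      simp
    · rw [if_neg h, RatDist.dirac_pos] at ha
      rw [ha, Equiv.symm_apply_apply]
      simp only [memSucc, h, dite_false, if_true]
      by_cases h2 : (finProdFinEquiv.symm s).1.val = 2 * n
      · rw [dif_pos h2, List.map_eq_nil_iff, List.finRange_eq_nil_iff]; omega
      · rw [dif_neg h2]; simp

theorem memMealy_prob {GW : ℕ → Set (Path (Fin ((2 * n + 1) * n)) (Fin (3 * n)))} {lam : ℕ}
    (hG : Tests n (GW lam)) (s : Fin ((2 * n + 1) * n)) :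
    (memMealy n).prob s (FW GW lam) = 1 := by
  have h1 : ∀ q, ((memMealy n).strategy q).prob s (FW GW lam) = 1 := by
    intro q
    refine prob_eq_one _ _ _ _ fun ρ hρ => ⟨0, fun i => ?_⟩
    have hstep := memStep_of_consistent hρ
    rw [suffix_suffix, Nat.zero_add, hG ρ hstep]
    intro hd
    have hjn := (mst ρ i).2.isLt
    have hmem : ∀ d, d + 1 ≤ n - (mst ρ i).2.val →
        (memMealy n).memory q (hist ρ (i + (d + 1))) = (mst ρ i).2 := by
      intro d hdn
      obtain ⟨e1, e2⟩ := mst_before hstep (i := i) (d := d) (by omega)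
      rw [← Nat.add_assoc, Mealy.memory_succ]
      change (if (mst ρ (i + d)).1.val < n then (mst ρ (i + d)).2 else _) = _
      rw [if_pos (by omega), e2]
    obtain ⟨d, hd'⟩ : ∃ d, n - (mst ρ i).2.val = d + 1 :=
      Nat.exists_eq_succ_of_ne_zero (by omega)
    have hm := hmem d (by omega)
    rw [← hd'] at hm
    have hc := mst_choice hstep (i := i) (d := n - (mst ρ i).2.val) (by omega) (by omega)
    have ha := (hρ (i + (n - (mst ρ i).2.val))).act _ le_rfl
    change 0 < (if (mst ρ (i + (n - (mst ρ i).2.val))).1.val = n then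
      RatDist.dirac (finProdFinEquiv (0, (memMealy n).memory q
        (hist ρ (i + (n - (mst ρ i).2.val))))) else _ : RatDist (Fin (3 * n))).prob _ at ha
    rw [if_pos hc.1, RatDist.dirac_pos, hm] at ha
    rw [mac, ha, Equiv.symm_apply_apply]
  simp only [Mealy.prob, h1, mul_one]
  exact RatDist.sum_ennreal _

/-- The memory state when the choice is made, if the number `j` is drawn in memory state `q`. -/
def memoryAfter {Q : Type} [Fintype Q] (μ : Mealy (memMDP n) Q) (j : Fin n) (q : Q) : ℕ → Q
  | 0 => q
  | d + 1 => if h : d < 2 * n + 1 then μ.update (finProdFinEquiv (forced (⟨d, h⟩, j)))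
      (finProdFinEquiv (⟨d, h⟩, j)) (memoryAfter μ j q d) else q

/-- From a memory state `q` at the time of the draw, two numbers lead to the same memory state at
the time of the choice, as there are more numbers than memory states. The likely answer is therefore
wrong for one of them, called `bad q`. Drawing it and answering likely has a probability that is
bounded below in every round, so infinitely many windows stay open too long, almost surely. -/
theorem memory_prob_eq_zero {Q : Type} [Fintype Q] (μ : Mealy (memMDP n) Q)
    (hQ : Fintype.card Q < n) {GW : ℕ → Set (Path (Fin ((2 * n + 1) * n)) (Fin (3 * n)))} {lam : ℕ}
    (hG : Tests n (GW lam)) (s : Fin ((2 * n + 1) * n)) : μ.prob s (FW GW lam) = 0 := by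
  classical
  have hn := NeZero.pos n
  refine Finset.sum_eq_zero fun q₀ _ => ?_
  convert mul_zero _
  have hbad : ∀ q : Q, ∃ j : Fin n, (finProdFinEquiv.symm (likely (μ.act
      (finProdFinEquiv ((⟨n, by omega⟩ : Fin (2 * n + 1)), (0 : Fin n)))
      (memoryAfter μ j q n)))).2 ≠ j := by
    intro q
    obtain ⟨j, j', h1, h2⟩ := Fintype.exists_ne_map_eq_of_card_lt (fun j => memoryAfter μ j q n)
      (by simpa using hQ)
    by_contra! hcon
    apply h1
    have h3 := hcon j
    rw [h2] at h3
    exact h3.symm.trans (hcon j')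
  choose bad hbad using hbad
  set pick : List (Fin ((2 * n + 1) * n) × Fin (3 * n)) → Fin ((2 * n + 1) * n) → Fin (3 * n) →
    Fin ((2 * n + 1) * n) := fun h s a =>
      if hs : memSucc (finProdFinEquiv.symm s) (finProdFinEquiv.symm a) = [] then s
      else if (finProdFinEquiv.symm s).1.val = 2 * n then
        -- The draw is aimed at the memory state after the current step, in which the new round
        -- begins.
        finProdFinEquiv (0, bad (μ.update a s (μ.memory q₀ h)))
      else finProdFinEquiv ((memSucc (finProdFinEquiv.symm s) (finProdFinEquiv.symm a)).head hs)
    with hpick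
  -- A debt whose window is not closed in time. At most `2 n` steps complete the running round, and
  -- the debt and the choice follow within `2 n` further steps, so a block of `5 n` steps is long
  -- enough.
  set V : ℕ → Set (Path (Fin ((2 * n + 1) * n)) (Fin (3 * n))) := fun m =>
    {ρ | ∃ i ≥ m, i + n ≤ m + 5 * n ∧ (mst ρ i).1.val = (mst ρ i).2.val ∧
      (mac ρ (i + (n - (mst ρ i).2.val))).2 ≠ (mst ρ i).2} with hVdef
  have hnull := law_avoid_eq_zero_of_pick (memMDP n) (μ.strategy q₀) s V (5 * n) ?_ pick ?_ ?_
  · refine measure_mono_null_ae ?_ hnull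
    filter_upwards [ae_consistent (memMDP n) (μ.strategy q₀) s] with ρ hρ hE
    obtain ⟨-, i₀, h⟩ := hE
    refine ⟨i₀, fun m hm => ?_⟩
    rintro ⟨i, hi, -, h1, h2⟩
    have := h (i - i₀)
    rw [suffix_suffix, show i₀ + (i - i₀) = i by omega,
      hG ρ (memStep_of_consistent hρ)] at this
    exact h2 (this h1)
  · rintro m ρ ρ' h ⟨i, h1, h2, h3, h4⟩
    have e1 : mst ρ' i = mst ρ i := by rw [mst, mst, h i (by omega)]
    refine ⟨i, h1, h2, by rw [e1]; exact h3, ?_⟩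
    rw [e1]
    have e2 : mac ρ' (i + (n - (mst ρ i).2.val)) = mac ρ (i + (n - (mst ρ i).2.val)) := by
      rw [mac, mac, h _ (by omega)]
    rwa [e2]
  · intro h s a ha
    rw [memMDP, MDP.mem_avail_ofList, ne_eq, List.map_eq_nil_iff] at ha
    rw [memMDP, MDP.prob_ofList]
    simp only [hpick, ha, dite_false]
    by_cases h2 : (finProdFinEquiv.symm s).1.val = 2 * n
    · rw [if_pos h2]
      refine List.mem_map_of_mem ?_
      unfold memSucc at ha ⊢
      rw [dif_neg (by omega)] at ha ⊢
      by_cases h3 : finProdFinEquiv.symm a = forced (finProdFinEquiv.symm s)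
      · rw [if_pos h3, dif_pos h2]
        exact List.mem_map.2 ⟨_, List.mem_finRange _, rfl⟩
      · rw [if_neg h3] at ha; exact absurd rfl ha
    · rw [if_neg h2]
      exact List.mem_map_of_mem (List.head_mem _)
  · intro m ρ hρ hp hl
    have hstep := memStep_of_consistent hρ
    have hph : ∀ d, (mst ρ m).1.val + d ≤ 2 * n → (mst ρ (m + d)).1.val = (mst ρ m).1.val + d := by
      intro d
      induction d with
      | zero => intro _; rfl
      | succ d ih =>
        intro hd
        rw [← Nat.add_assoc, (hstep (m + d)).phase, if_neg (by have := ih (by omega); omega),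
          ih (by omega)]
        omega
    have hlt := (mst ρ m).1.isLt
    set i₁ := m + (2 * n - (mst ρ m).1.val) with hi₁
    have h1 : (mst ρ i₁).1.val = 2 * n := by rw [hi₁, hph _ (by omega)]; omega
    set j := bad (μ.memory q₀ (hist ρ (i₁ + 1))) with hj
    have h2 : mst ρ (i₁ + 1) = (0, j) := by
      have h3 : (ρ i₁).2 ∈ (memMDP n).avail (ρ i₁).1 :=
        (μ.strategy q₀).act_avail _ _ _ ((hρ i₁).act i₁ le_rfl)
      rw [memMDP, MDP.mem_avail_ofList, ne_eq, List.map_eq_nil_iff] at h3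
      rw [mst, hp i₁ (by omega)]
      simp only [hpick, h3, dite_false]
      have h4 : (finProdFinEquiv.symm (ρ i₁).1).1.val = 2 * n := h1
      rw [if_pos h4, Equiv.symm_apply_apply, hj, Mealy.memory_succ]
    have h0 : (mst ρ (i₁ + 1)).1.val = 0 := by rw [h2]; rfl
    have hj2 : (mst ρ (i₁ + 1)).2 = j := by rw [h2]
    -- Between the draw and the choice all actions are forced, so the memory at the choice is a
    -- function of the number and the memory at the draw.
    have hmem : ∀ d ≤ n, μ.memory q₀ (hist ρ (i₁ + 1 + d)) =
        memoryAfter μ j (μ.memory q₀ (hist ρ (i₁ + 1))) d := by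
      intro d
      induction d with
      | zero => intro _; rfl
      | succ d ih =>
        intro hd
        obtain ⟨e1, e2⟩ := mst_before hstep (i := i₁ + 1) (d := d) (by omega)
        rw [← Nat.add_assoc, Mealy.memory_succ, ih (by omega), memoryAfter, dif_pos (by omega)]
        have e3 : mst ρ (i₁ + 1 + d) = (⟨d, by omega⟩, j) := by
          apply Prod.ext
          · apply Fin.ext; rw [e1, h0]; simp
          · rw [e2, hj2]
        have e4 := (hstep (i₁ + 1 + d)).act (by rw [e1, h0]; omega)
        rw [← e3, ← e4, mst, mac, Equiv.apply_symm_apply, Equiv.apply_symm_apply]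
    have hjn := j.isLt
    obtain ⟨e1, e2⟩ : (mst ρ (i₁ + 1 + j.val)).1.val = j.val ∧ (mst ρ (i₁ + 1 + j.val)).2 = j := by
      obtain ⟨e1, e2⟩ := mst_before hstep (i := i₁ + 1) (d := j.val) (by omega)
      exact ⟨by omega, by rw [e2, hj2]⟩
    refine ⟨i₁ + 1 + j.val, by omega, by omega, by rw [e1, e2], ?_⟩
    rw [e2, show i₁ + 1 + j.val + (n - j.val) = i₁ + 1 + n by omega]
    have e3 : mst ρ (i₁ + 1 + n) = (⟨n, by omega⟩, 0) := by
      obtain ⟨e3, e4⟩ := mst_choice hstep (i := i₁ + 1) (d := n) (by omega) hn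
      exact Prod.ext (Fin.ext e3) e4
    have e4 : (ρ (i₁ + 1 + n)).1 = finProdFinEquiv ((⟨n, by omega⟩ : Fin (2 * n + 1)), 0) := by
      rw [← e3, mst, Equiv.apply_symm_apply]
    have e5 := hl (i₁ + 1 + n) (by omega)
    change _ = likely (μ.act (ρ (i₁ + 1 + n)).1 (μ.memory q₀ (hist ρ (i₁ + 1 + n)))) at e5
    rw [mac, e5, e4, hmem n le_rfl]
    exact hbad _

end

/-! ## Lengths of codes -/

theorem natCode_length_le (k : ℕ) : (natCode k).length ≤ k + 1 := by
  have h : k.size ≤ k := Nat.size_le.2 Nat.lt_two_pow_self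
  simp only [natCode, List.length_append, List.length_map, List.length_singleton]
  rw [Nat.size_eq_bits_len]
  omega

theorem unaryCode_length (k : ℕ) : (unaryCode k).length = k + 1 := by
  simp [unaryCode]

theorem uniformCode_length_le (k : ℕ) (p : Prop) [Decidable p] :
    (uniformCode k p).length ≤ k + 4 := by
  have h0 := natCode_length_le 0
  have h1 := natCode_length_le 1
  have h2 := natCode_length_le k
  unfold uniformCode
  split_ifs <;> simp only [List.length_append] <;> omega

theorem tableCode_length_le {X : Type} {n : ℕ} {f : X → List Sym} {g : Fin n → X} {B : ℕ}
    (h : ∀ i, (f (g i)).length ≤ B) : (tableCode f g).length ≤ n * B := by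
  rw [tableCode, List.length_flatMap]
  calc _ ≤ ((List.finRange n).map fun i => (f (g i)).length).length • B :=
        List.sum_le_card_nsmul _ _ fun x hx => by
          obtain ⟨i, -, rfl⟩ := List.mem_map.1 hx
          exact h i
    _ = n * B := by simp

section
variable (n : ℕ) [NeZero n]

/-- The query for the Markov decision process that requires memory. -/
def memQuery : Query where
  n := (2 * n + 1) * n
  m := 3 * n
  mdp := memMDP n
  init := finProdFinEquiv (0, 0)
  threshold := 1
  threshold_le := le_rfl

theorem memQuery_code_length_ge : n ≤ (memQuery n).code.length := by
  have h : (memQuery n).code.length ≥ (unaryCode ((2 * n + 1) * n)).length := by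
    simp only [Query.code, List.length_append, memQuery]
    omega
  rw [unaryCode_length] at h
  have : 1 * n ≤ (2 * n + 1) * n := Nat.mul_le_mul_right _ (by omega)
  omega

theorem memMDP_row_length (s : Fin ((2 * n + 1) * n)) (a : Fin (3 * n)) :
    (optionCode (fun d => tableCode ratCode d.prob) ((memMDP n).trans s a)).length ≤
      1 + (2 * n + 1) * n * (n + 4) := by
  have hn := NeZero.pos n
  rw [memMDP, optionCode_ofList ((memSucc_nodup _ _).map (Equiv.injective _))]
  split_ifs with h
  · simp
  · have hl : ((memSucc (finProdFinEquiv.symm s) (finProdFinEquiv.symm a)).map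
        finProdFinEquiv).length ≤ n := by
      rw [List.length_map]
      unfold memSucc
      split_ifs <;> simp <;> omega
    rw [List.length_cons, add_comm]
    refine Nat.add_le_add_left (tableCode_length_le (f := id) (g := fun t => uniformCode _ (t ∈ _))
      fun t => (uniformCode_length_le _ _).trans (by omega)) _

/-- Only some polynomial bound matters; for `n ≥ 2` all constants are absorbed into powers of `n`.
-/
theorem memQuery_code_length_le (hn : 2 ≤ n) : (memQuery n).code.length ≤ n ^ 18 := by
  have h1 : 2 * n + 1 ≤ n ^ 3 := by nlinarith [Nat.mul_le_mul hn hn]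
  have h2 : (2 * n + 1) * n ≤ n ^ 4 := by
    rw [pow_succ]; exact Nat.mul_le_mul_right _ h1
  have h3 : 3 * n ≤ n ^ 3 := by nlinarith [Nat.mul_le_mul hn hn]
  have h4 : n + 4 ≤ n ^ 3 := by nlinarith [Nat.mul_le_mul hn hn]
  have hpos : ∀ k, 1 ≤ n ^ k := fun k => Nat.one_le_pow _ _ (by omega)
  have h5 : 1 + (2 * n + 1) * n * (n + 4) ≤ n ^ 8 := by
    calc 1 + (2 * n + 1) * n * (n + 4) ≤ n ^ 7 + n ^ 4 * n ^ 3 :=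
          Nat.add_le_add (hpos 7) (Nat.mul_le_mul h2 h4)
      _ = 2 * n ^ 7 := by rw [← pow_add]; ring
      _ ≤ n * n ^ 7 := Nat.mul_le_mul_right _ hn
      _ = n ^ 8 := by ring
  have h6 : (tableCode (fun row => tableCode (optionCode fun d => tableCode ratCode d.prob) row)
      (memMDP n).trans).length ≤ n ^ 15 := by
    calc _ ≤ (2 * n + 1) * n * (3 * n * n ^ 8) := tableCode_length_le fun s =>
          tableCode_length_le fun a => (memMDP_row_length n s a).trans h5
      _ ≤ n ^ 4 * (n ^ 3 * n ^ 8) := Nat.mul_le_mul h2 (Nat.mul_le_mul_right _ h3)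
      _ = n ^ 15 := by ring
  have h7 : (memQuery n).code.length = ((2 * n + 1) * n + 1) + (3 * n + 1) + 1 + 4 +
      (tableCode (fun row => tableCode (optionCode fun d => tableCode ratCode d.prob) row)
      (memMDP n).trans).length := by
    have h8 : (ratCode 1).length = 4 := by rw [ratCode_one]; simp [natCode]
    have h9 : ((memQuery n).init : ℕ) = 0 := by simp [memQuery]
    simp only [Query.code, List.length_append, unaryCode_length]
    rw [h9]
    change _ + _ + _ + (ratCode 1).length + _ = _
    rw [h8]
    rfl
  have h8 : n ^ 4 ≤ n ^ 15 := Nat.pow_le_pow_right (by omega) (by omega)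
  have h9 : n ^ 3 ≤ n ^ 15 := Nat.pow_le_pow_right (by omega) (by omega)
  have h10 : 7 * n ^ 15 ≤ n ^ 18 := by
    have : 7 ≤ n ^ 3 := by
      calc 7 ≤ 2 ^ 3 := by norm_num
        _ ≤ n ^ 3 := Nat.pow_le_pow_left hn 3
    calc 7 * n ^ 15 ≤ n ^ 3 * n ^ 15 := Nat.mul_le_mul_right _ this
      _ = n ^ 18 := by ring
  have h11 : 8 ≤ n ^ 15 := by
    calc 8 ≤ 2 ^ 15 := by norm_num
      _ ≤ n ^ 15 := Nat.pow_le_pow_left hn 15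
  omega

end

/-- Exactly `n` memory states are sufficient and necessary, and `n ≤ N ≤ n ^ k` turns this into
bounds in terms of the size `N` of the instance. Query and objective are compared as a dependent
pair, so that one argument serves both classes of objectives. -/
theorem memory_necessary {F : ThresholdClass} (k : ℕ)
    (h : ∀ (n : ℕ) [NeZero n], 2 ≤ n → ∃ (x : F.Inst) (GW : _) (lam : ℕ),
      (⟨F.query x, F.objective x⟩ : Σ q : Query, Set (Path (Fin q.n) (Fin q.m))) =
        ⟨memQuery n, FW GW lam⟩ ∧ Tests n (GW lam) ∧ n ≤ (F.code x).length ∧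
      (F.code x).length ≤ n ^ k) : F.PolyMemoryNecessary := by
  have key : ∀ (n : ℕ) [NeZero n] (GW : ℕ → Set (Path (Fin ((2 * n + 1) * n)) (Fin (3 * n))))
      (lam N : ℕ), Tests n (GW lam) → n ≤ N → N ≤ n ^ k →
      ∀ y : Σ q : Query, Set (Path (Fin q.n) (Fin q.m)), y = ⟨memQuery n, FW GW lam⟩ →
      (∃ (Q : Type) (_ : Fintype Q) (σ : Mealy y.1.mdp Q),
        (((y.1.threshold : ℝ≥0) : ℝ≥0∞)) ≤ σ.prob y.1.init y.2 ∧ Fintype.card Q ≤ N ^ (k + 1)) ∧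
      ∀ (Q : Type) (_ : Fintype Q) (σ : Mealy y.1.mdp Q),
        (((y.1.threshold : ℝ≥0) : ℝ≥0∞)) ≤ σ.prob y.1.init y.2 → N ≤ Fintype.card Q ^ (k + 1) := by
    rintro n _ GW lam N hT h1 h2 y rfl
    have ht : ((((memQuery n).threshold : ℝ≥0) : ℝ≥0∞)) = 1 := by
      simp [memQuery]
    dsimp only
    rw [ht]
    constructor
    · refine ⟨Fin n, inferInstance, memMealy n, (memMealy_prob hT _).ge, ?_⟩
      rw [Fintype.card_fin]
      exact h1.trans (Nat.le_self_pow (by omega) _)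
    · intro Q _ μ hμ
      have hc : n ≤ Fintype.card Q := by
        by_contra hc
        have := memory_prob_eq_zero μ (not_le.1 hc) hT (memQuery n).init
        exact absurd (hμ.trans this.le) (by simp)
      have hpos := NeZero.pos n
      calc N ≤ n ^ k := h2
        _ ≤ (Fintype.card Q) ^ k := Nat.pow_le_pow_left hc _
        _ ≤ _ := Nat.pow_le_pow_right (by omega) (by omega)
  refine ⟨k + 1, fun N => ?_⟩
  have hn : 2 ≤ max N 2 := by omega
  have : NeZero (max N 2) := ⟨by omega⟩
  obtain ⟨x, GW, lam, hx, hT, h1, h2⟩ := h (max N 2) hn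
  exact ⟨x, by omega, key (max N 2) GW lam _ hT h1 h2 _ hx⟩

theorem polyMemoryNecessary_fixedWindowParity : fixedWindowParity.PolyMemoryNecessary := by
  refine memory_necessary 20 fun n _ hn => ?_
  refine ⟨(⟨memQuery n, memPrio n, fun s => ?_⟩, ⟨n + 2, by omega⟩), GWpar (memPrio n), n + 2, rfl,
    tests_parity, ?_, ?_⟩
  · change memPrio n s ≤ (2 * n + 1) * n + 1
    have : memPrio n s ≤ 2 * n + 2 := by unfold memPrio; split_ifs <;> omega
    nlinarith
  · have := memQuery_code_length_ge n
    simp only [fixedWindowParity, ParityQuery.code, List.length_append]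
    omega
  · have h1 := memQuery_code_length_le n hn
    have h2 : (tableCode unaryCode (memPrio n)).length ≤ (2 * n + 1) * n * (2 * n + 3) :=
      tableCode_length_le fun s => by
        rw [unaryCode_length]
        have : memPrio n s ≤ 2 * n + 2 := by unfold memPrio; split_ifs <;> omega
        omega
    change ((memQuery n).code ++ tableCode unaryCode (memPrio n) ++
      unaryCode (n + 2)).length ≤ n ^ 20
    simp only [List.length_append, unaryCode_length]
    have h3 : (2 * n + 1) * n * (2 * n + 3) + (n + 3) ≤ n ^ 18 := by
      calc _ ≤ n ^ 3 * n * n ^ 3 + n ^ 3 := by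
            have h1 : 2 * n + 1 ≤ n ^ 3 := by nlinarith [Nat.mul_le_mul hn hn]
            have h2 : 2 * n + 3 ≤ n ^ 3 := by nlinarith [Nat.mul_le_mul hn hn]
            exact Nat.add_le_add (Nat.mul_le_mul (Nat.mul_le_mul_right _ h1) h2) (by omega)
        _ ≤ n ^ 7 + n ^ 7 := Nat.add_le_add (by ring_nf; rfl) (Nat.pow_le_pow_right (by omega) (by omega))
        _ = 2 * n ^ 7 := by ring
        _ ≤ n * n ^ 7 := Nat.mul_le_mul_right _ hn
        _ = n ^ 8 := by ring
        _ ≤ n ^ 18 := Nat.pow_le_pow_right (by omega) (by omega)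
    calc _ ≤ 2 * n ^ 18 := by omega
      _ ≤ n * n ^ 18 := Nat.mul_le_mul_right _ hn
      _ = n ^ 19 := by ring
      _ ≤ n ^ 20 := Nat.pow_le_pow_right (by omega) (by omega)

theorem polyMemoryNecessary_fixedWindowMeanPayoff :
    fixedWindowMeanPayoff.PolyMemoryNecessary := by
  refine memory_necessary 20 fun n _ hn => ?_
  refine ⟨(⟨memQuery n, memWeight n⟩, ⟨n + 2, by omega⟩), GWmp (memWeight n), n + 2, rfl,
    tests_meanPayoff, ?_, ?_⟩
  · have := memQuery_code_length_ge n
    simp only [fixedWindowMeanPayoff, WeightQuery.code, List.length_append]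
    omega
  · have h1 := memQuery_code_length_le n hn
    have h2 : (tableCode intCode (memWeight n)).length ≤ 3 * n * (n + 3) :=
      tableCode_length_le fun a => by
        have h3 := natCode_length_le (memWeight n a).natAbs
        have h4 : (memWeight n a).natAbs ≤ n := by
          have := (finProdFinEquiv.symm a : Fin 3 × Fin n).2.isLt
          unfold memWeight; split_ifs <;> omega
        simp only [intCode, List.length_cons]
        omega
    change ((memQuery n).code ++ tableCode intCode (memWeight n) ++
      unaryCode (n + 2)).length ≤ n ^ 20
    simp only [List.length_append, unaryCode_length]
    have h3 : 3 * n * (n + 3) + (n + 3) ≤ n ^ 18 := by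
      calc _ ≤ n ^ 3 * n ^ 3 + n ^ 3 := by
            have h1 : 3 * n ≤ n ^ 3 := by nlinarith [Nat.mul_le_mul hn hn]
            have h2 : n + 3 ≤ n ^ 3 := by nlinarith [Nat.mul_le_mul hn hn]
            exact Nat.add_le_add (Nat.mul_le_mul h1 h2) h2
        _ ≤ n ^ 6 + n ^ 6 := Nat.add_le_add (by ring_nf; rfl) (Nat.pow_le_pow_right (by omega) (by omega))
        _ = 2 * n ^ 6 := by ring
        _ ≤ n * n ^ 6 := Nat.mul_le_mul_right _ hn
        _ = n ^ 7 := by ring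
        _ ≤ n ^ 18 := Nat.pow_le_pow_right (by omega) (by omega)
    calc _ ≤ 2 * n ^ 18 := by omega
      _ ≤ n * n ^ 18 := Nat.mul_le_mul_right _ hn
      _ = n ^ 19 := by ring
      _ ≤ n ^ 20 := Nat.pow_le_pow_right (by omega) (by omega)

/-! ## Energies in mean-payoff games -/

namespace MeanPayoffGame

variable (G : MeanPayoffGame)

/-- In the vertex `u`, the energy `c` suffices to go on with the energies `F`. -/
def Enough (F : Fin G.n → ℕ) (u : Fin G.n) (c : ℕ) : Prop :=
  if G.owner u = true then ∃ v w, G.edge u v = some w ∧ (F v : ℤ) ≤ c + w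
  else ∀ v w, G.edge u v = some w → (F v : ℤ) ≤ c + w

/-- The least energy that suffices in `u`, or `cap`. -/
noncomputable def lift (cap : ℕ) (F : Fin G.n → ℕ) (u : Fin G.n) : ℕ :=
  sInf {c | cap ≤ c ∨ G.Enough F u c}

/-- The energies that suffice for `k` steps, or `cap`. -/
noncomputable def energy (cap : ℕ) : ℕ → Fin G.n → ℕ
  | 0 => fun _ => 0
  | k + 1 => G.lift cap (energy cap k)

variable {G} {cap : ℕ} {F F' : Fin G.n → ℕ} {u : Fin G.n}

theorem lift_le_cap : G.lift cap F u ≤ cap := Nat.sInf_le (Or.inl le_rfl)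

theorem enough_lift (h : G.lift cap F u < cap) : G.Enough F u (G.lift cap F u) := by
  have : G.lift cap F u ∈ {c | cap ≤ c ∨ G.Enough F u c} := Nat.sInf_mem ⟨cap, Or.inl le_rfl⟩
  rcases this with h' | h'
  · omega
  · exact h'

theorem not_enough {c : ℕ} (h : c < G.lift cap F u) : ¬ G.Enough F u c := fun h' =>
  Nat.notMem_of_lt_sInf h (Or.inr h')

theorem lift_mono (h : ∀ v, F v ≤ F' v) : G.lift cap F u ≤ G.lift cap F' u := by
  by_cases hc : G.lift cap F' u < cap
  · refine Nat.sInf_le (Or.inr ?_)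
    have := enough_lift hc
    unfold Enough at this ⊢
    split_ifs at this ⊢
    · obtain ⟨v, w, h1, h2⟩ := this
      exact ⟨v, w, h1, le_trans (by exact_mod_cast h v) h2⟩
    · intro v w h1
      exact le_trans (by exact_mod_cast h v) (this v w h1)
  · exact lift_le_cap.trans (not_lt.1 hc)

theorem energy_le_succ (k : ℕ) (u : Fin G.n) : G.energy cap k u ≤ G.energy cap (k + 1) u := by
  induction k generalizing u with
  | zero => exact Nat.zero_le _
  | succ k ih => exact lift_mono ih

theorem energy_mono {k l : ℕ} (h : k ≤ l) (u : Fin G.n) : G.energy cap k u ≤ G.energy cap l u :=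
  monotone_nat_of_le_succ (f := fun k => G.energy cap k u) (fun k => energy_le_succ k u) h

theorem energy_le_cap (k : ℕ) (u : Fin G.n) : G.energy cap k u ≤ cap := by
  cases k with
  | zero => exact Nat.zero_le _
  | succ k => exact lift_le_cap

/-- As long as the energies change, their sum increases by at least one, and it never exceeds `G.n *
cap`. -/
theorem exists_stable (cap : ℕ) :
    ∃ k ≤ G.n * cap, G.energy cap (k + 1) = G.energy cap k := by
  by_contra! h
  have : ∀ k ≤ G.n * cap + 1, k ≤ ∑ u, G.energy cap k u := by
    intro k
    induction k with
    | zero => intro _; exact Nat.zero_le _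
    | succ k ih =>
      intro hk
      refine lt_of_le_of_lt (ih (by omega)) ?_
      obtain ⟨u, hu⟩ := Function.ne_iff.1 (h k (by omega))
      exact Finset.sum_lt_sum (fun u _ => energy_le_succ k u)
        ⟨u, Finset.mem_univ _, lt_of_le_of_ne (energy_le_succ k u) (Ne.symm hu)⟩
  have h1 := this _ le_rfl
  have h2 : ∑ u, G.energy cap (G.n * cap + 1) u ≤ ∑ _u : Fin G.n, cap :=
    Finset.sum_le_sum fun u _ => energy_le_cap _ u
  rw [Finset.sum_const, Finset.card_univ, Fintype.card_fin, smul_eq_mul] at h2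
  omega

/-- Pigeonhole principle: the `n + 1` intervals `(i W, (i + 1) W]` are disjoint, and there are only
`n` values. -/
theorem exists_gap {n : ℕ} (F : Fin n → ℕ) (W : ℕ) :
    ∃ i ≤ n, ∀ u, F u ≤ i * W ∨ (i + 1) * W < F u := by
  by_contra! h
  have h' : ∀ i : Fin (n + 1), ∃ u, i.val * W < F u ∧ F u ≤ (i.val + 1) * W :=
    fun i => h i.val (by omega)
  choose f hf using h'
  obtain ⟨i, j, hij, hfij⟩ := Fintype.exists_ne_map_eq_of_card_lt f (by simp)
  have key : ∀ i j : Fin (n + 1), i < j → f i ≠ f j := by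
    intro i j hij hfij
    have h1 := (hf i).2
    have h2 := (hf j).1
    rw [hfij] at h1
    have : (i.val + 1) * W ≤ j.val * W := Nat.mul_le_mul_right _ hij
    omega
  rcases lt_or_gt_of_ne hij with h1 | h1
  · exact key i j h1 hfij
  · exact key j i h1 hfij.symm

/-- The vertices are split by their energies: those below the threshold `B` have a potential, and
those above force a loss of energy. -/
structure Split (G : MeanPayoffGame) (W : ℕ) where
  F : ℕ → Fin G.n → ℕ
  depth : ℕ
  B : ℕ
  depth_le : depth ≤ G.n * ((G.n + 1) * W)
  F_le : ∀ k u, F k u ≤ (G.n + 1) * W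
  F_zero : ∀ u, F 0 u = 0
  F_mono : ∀ k ≤ depth, ∀ u, F k u ≤ F depth u
  lt_B : W < B
  gap : ∀ u, B ≤ F depth u ∨ F depth u + W < B
  high : ∀ k u, 0 < F (k + 1) u → if G.owner u = true
    then ∀ v w, G.edge u v = some w → (F (k + 1) u + w : ℤ) ≤ F k v
    else ∃ v w, G.edge u v = some w ∧ (F (k + 1) u + w : ℤ) ≤ F k v
  low : ∀ u, F depth u < B → if G.owner u = true
    then ∃ v w, G.edge u v = some w ∧ F depth v < B ∧ (F depth v : ℤ) ≤ F depth u + w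
    else ∀ v w, G.edge u v = some w → F depth v < B ∧ (F depth v : ℤ) ≤ F depth u + w

/-- The threshold is the upper end of an interval of length `W` without energies. A move that
respects the energies raises them by at most `W`, so it cannot lead across this gap from below. The
vertices below also lie below the truncation, where the energies are genuine. -/
theorem exists_split (G : MeanPayoffGame) {W : ℕ}
    (hW : ∀ u v w, G.edge u v = some w → |w| ≤ W) : Nonempty (Split G W) := by
  set cap := (G.n + 1) * W with hcap
  obtain ⟨k, hk, hst⟩ := exists_stable (G := G) cap
  obtain ⟨i, hi, hgap⟩ := exists_gap (G.energy cap k) W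
  refine ⟨⟨G.energy cap, k, (i + 1) * W + 1, hk, energy_le_cap, fun _ => rfl,
    fun l hl u => energy_mono hl u, ?_, fun u => ?_, fun l u hu => ?_, fun u hu => ?_⟩⟩
  · rw [add_mul, one_mul]; omega
  · have := hgap u
    rw [add_mul, one_mul] at *
    omega
  -- One unit less than the least sufficient energy is insufficient. For integers this is the
  -- required inequality, and truncation does no harm in this direction.
  · have hne : ¬ G.Enough (G.energy cap l) u (G.energy cap (l + 1) u - 1) :=
      not_enough (cap := cap) (Nat.sub_lt hu one_pos)
    unfold Enough at hne
    split_ifs at hne ⊢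
    · push Not at hne
      intro v w h1
      have := hne v w h1
      omega
    · push Not at hne
      obtain ⟨v, w, h1, h2⟩ := hne
      exact ⟨v, w, h1, by omega⟩
  · have h1 : G.energy cap k u ≤ i * W := by
      have := hgap u
      omega
    have h2 : i * W ≤ G.n * W := Nat.mul_le_mul_right _ hi
    have hlow : ∀ v w, G.edge u v = some w → (G.energy cap k v : ℤ) ≤ G.energy cap k u + w →
        G.energy cap k v < (i + 1) * W + 1 := by
      intro v w h3 h4
      have h5 := le_abs_self w
      have h6 := hW u v w h3
      rw [add_mul, one_mul]
      have : (G.energy cap k v : ℤ) ≤ (i * W : ℕ) + W := by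
        have : (G.energy cap k u : ℤ) ≤ (i * W : ℕ) := by exact_mod_cast h1
        linarith
      have : G.energy cap k v ≤ i * W + W := by exact_mod_cast this
      omega
    -- For `W = 0` the truncation is at `0`, so stationary energies carry no information; but then
    -- all weights vanish.
    by_cases hW0 : W = 0
    · subst hW0
      have h3 : ∀ v, G.energy cap k v = 0 := fun v => by
        have := energy_le_cap (cap := cap) k v
        simp [hcap] at this
        omega
      have h4 : ∀ v w, G.edge u v = some w → w = 0 := fun v w h => by
        have := hW u v w h
        simpa using this
      simp only [h3]
      split_ifs
      · obtain ⟨v, hv⟩ := G.deadlock_free u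
        obtain ⟨w, hw⟩ := Option.isSome_iff_exists.1 hv
        exact ⟨v, w, hw, by omega, by simp [h4 v w hw]⟩
      · intro v w hw
        exact ⟨by omega, by simp [h4 v w hw]⟩
    · have hc : cap = G.n * W + W := by rw [hcap, add_mul, one_mul]
      have h3 : G.energy cap k u < cap := by omega
      have h4 : G.Enough (G.energy cap k) u (G.energy cap k u) := by
        have h5 : G.energy cap k u = G.lift cap (G.energy cap k) u := (congrFun hst u).symm
        have := enough_lift (G := G) (cap := cap) (F := G.energy cap k) (u := u) (by omega)
        rwa [← h5] at this
      unfold Enough at h4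
      split_ifs at h4 ⊢
      · obtain ⟨v, w, h5, h6⟩ := h4
        exact ⟨v, w, h5, hlow v w h5 h6, h6⟩
      · intro v w h5
        exact ⟨hlow v w h5 (h4 v w h5), h4 v w h5⟩

/-! ### Tracking the loss of energy -/

namespace Split

variable {W : ℕ} (P : Split G W)

/-- The moves of player 2 that realize the loss of energy. -/
noncomputable def best (u : Fin G.n) (k : ℕ) : Fin G.n := by
  classical exact
    if h : ∃ v w, G.edge u v = some w ∧ (P.F k u + w : ℤ) ≤ P.F (k - 1) v then h.choose
    else (G.deadlock_free u).choose

/-- The tracker `(k, s, r)`: within `k` steps, the sum `s` of the weights becomes negative; this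
has happened `r` times. -/
def track (m : ℕ × ℤ × ℕ) (w : ℤ) : ℕ × ℤ × ℕ :=
  if m.2.1 + w < 0 then (P.depth, 0, m.2.2 + 1) else (m.1 - 1, m.2.1 + w, m.2.2)

/-- The tracker is on the way to a negative sum. -/
structure OnTrack (u : Fin G.n) (m : ℕ × ℤ × ℕ) : Prop where
  le_depth : m.1 ≤ P.depth
  nonneg : 0 ≤ m.2.1
  le_F : P.B + m.2.1 ≤ P.F m.1 u

variable {P}

theorem OnTrack.start {u : Fin G.n} (h : P.B ≤ P.F P.depth u) (r : ℕ) :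
    P.OnTrack u (P.depth, 0, r) :=
  ⟨le_rfl, le_rfl, by simpa using h⟩

/-- The energies for zero steps are zero and thus below the threshold. So the countdown cannot
expire: the sum must become negative before. -/
theorem OnTrack.pos {u : Fin G.n} {m : ℕ × ℤ × ℕ} (h : P.OnTrack u m) : 0 < m.1 := by
  by_contra hc
  have h0 : m.1 = 0 := by omega
  have h1 := h.le_F
  rw [h0, P.F_zero] at h1
  have := h.nonneg
  have := P.lt_B
  simp at h1
  omega

theorem OnTrack.F_pos {u : Fin G.n} {m : ℕ × ℤ × ℕ} (h : P.OnTrack u m) : 0 < P.F m.1 u := by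
  have h1 := h.le_F
  have := h.nonneg
  have := P.lt_B
  omega

theorem OnTrack.le_cap {u : Fin G.n} {m : ℕ × ℤ × ℕ} (h : P.OnTrack u m) :
    m.2.1 ≤ (G.n + 1) * W := by
  have h1 := h.le_F
  have h2 := P.F_le m.1 u
  have : (P.F m.1 u : ℤ) ≤ ((G.n + 1) * W : ℕ) := by exact_mod_cast h2
  push_cast at this
  omega

theorem OnTrack.best_spec {u : Fin G.n} {m : ℕ × ℤ × ℕ} (h : P.OnTrack u m)
    (hu : ¬ G.owner u = true) : ∃ w, G.edge u (P.best u m.1) = some w ∧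
      (P.F m.1 u + w : ℤ) ≤ P.F (m.1 - 1) (P.best u m.1) := by
  obtain ⟨k, hk⟩ := Nat.exists_eq_succ_of_ne_zero h.pos.ne'
  have h1 := P.high k u (by rw [← Nat.succ_eq_add_one, ← hk]; exact h.F_pos)
  rw [if_neg hu] at h1
  have h2 : ∃ v w, G.edge u v = some w ∧ (P.F m.1 u + w : ℤ) ≤ P.F (m.1 - 1) v := by
    rw [hk]; exact h1
  have h3 : P.best u m.1 = h2.choose := by
    unfold best; rw [dif_pos h2]
  rw [h3]
  exact h2.choose_spec

/-- Every move transfers its weight to the energies for one step less. When the sum becomes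
negative, the energy at `v` is still at least `B - W`, because a single weight is at least `-W`.
Nothing lies in the gap, so the energy for `depth` steps is at least `B`, and the tracker can be
started anew. -/
theorem OnTrack.step (hW : ∀ u v w, G.edge u v = some w → |w| ≤ W) {u v : Fin G.n} {w : ℤ}
    {m : ℕ × ℤ × ℕ} (h : P.OnTrack u m) (he : G.edge u v = some w)
    (hv : G.owner u = true ∨ v = P.best u m.1) : P.OnTrack v (P.track m w) := by
  have h1 : (P.F m.1 u + w : ℤ) ≤ P.F (m.1 - 1) v := by
    by_cases hu : G.owner u = true
    · obtain ⟨k, hk⟩ := Nat.exists_eq_succ_of_ne_zero h.pos.ne'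
      have h1 := P.high k u (by rw [← Nat.succ_eq_add_one, ← hk]; exact h.F_pos)
      rw [if_pos hu] at h1
      rw [hk]
      exact h1 v w he
    · rcases hv with hv | hv
      · exact absurd hv hu
      · obtain ⟨w', h2, h3⟩ := h.best_spec hu
        rw [← hv] at h2 h3
        rw [he] at h2
        obtain rfl := Option.some.inj h2
        exact h3
  have h2 := h.le_F
  have h3 := h.nonneg
  have h4 := h.le_depth
  unfold track
  split_ifs with hs
  · apply OnTrack.start
    have h5 := P.F_mono (m.1 - 1) (by omega) v
    have h6 := (abs_le.1 (hW u v w he)).1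
    rcases P.gap v with h7 | h7
    · exact h7
    · exfalso; omega
  · exact ⟨by simp only; omega, by simp only; omega, by simp only; omega⟩

end Split

end MeanPayoffGame

/-! ## Mean-payoff games and energies -/

namespace MeanPayoffGame

variable {G : MeanPayoffGame} {W : ℕ}

/-- The sum of the first `k` weights of a play. -/
def total (G : MeanPayoffGame) (π : ℕ → Fin G.n) (k : ℕ) : ℤ :=
  ∑ i ∈ Finset.range k, (G.edge (π i) (π (i + 1))).getD 0

theorem value_eq (π : ℕ → Fin G.n) :
    G.value π = liminf (fun k : ℕ => (G.total π k : ℝ) / k) atTop := by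
  simp only [value, total, Int.cast_sum]

theorem abs_getD_le (hW : ∀ u v w, G.edge u v = some w → |w| ≤ W) (u v : Fin G.n) :
    |(G.edge u v).getD 0| ≤ W := by
  cases h : G.edge u v with
  | none => simp
  | some w => exact hW u v w h

theorem abs_total_le (hW : ∀ u v w, G.edge u v = some w → |w| ≤ W) (π : ℕ → Fin G.n) (k : ℕ) :
    |G.total π k| ≤ k * W := by
  calc |G.total π k| ≤ ∑ i ∈ Finset.range k, |(G.edge (π i) (π (i + 1))).getD 0| :=
        Finset.abs_sum_le_sum_abs _ _
    _ ≤ ∑ _i ∈ Finset.range k, (W : ℤ) := Finset.sum_le_sum fun i _ => abs_getD_le hW _ _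
    _ = k * W := by simp

theorem abs_average_le (hW : ∀ u v w, G.edge u v = some w → |w| ≤ W) (π : ℕ → Fin G.n) (k : ℕ) :
    |(G.total π k : ℝ) / k| ≤ W := by
  rcases Nat.eq_zero_or_pos k with rfl | hk
  · simp
  · have hk' : (0 : ℝ) < k := by exact_mod_cast hk
    rw [abs_div, abs_of_pos hk', div_le_iff₀ hk', mul_comm]
    exact_mod_cast abs_total_le hW π k

theorem value_nonneg (hW : ∀ u v w, G.edge u v = some w → |w| ≤ W) {π : ℕ → Fin G.n} {C : ℤ}
    (h : ∀ k, -C ≤ G.total π k) : 0 ≤ G.value π := by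
  have ht : Tendsto (fun k : ℕ => (-C : ℝ) / k) atTop (nhds 0) :=
    tendsto_const_div_atTop_nhds_zero_nat _
  rw [value_eq, ← ht.liminf_eq]
  refine liminf_le_liminf (Eventually.of_forall fun k => ?_) ht.isBoundedUnder_ge ?_
  · refine div_le_div_of_nonneg_right ?_ (Nat.cast_nonneg _)
    exact_mod_cast h k
  · exact (isBoundedUnder_of ⟨(W : ℝ), fun k => (abs_le.1 (abs_average_le hW π k)).2⟩ :
      IsBoundedUnder (· ≤ ·) atTop _).isCoboundedUnder_ge

/-- A loss of one unit per `D` steps, up to a constant, keeps the limit of the averages at or below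
`-1 / D`. -/
theorem value_neg (hW : ∀ u v w, G.edge u v = some w → |w| ≤ W) {π : ℕ → Fin G.n} {C : ℤ} {D : ℕ}
    (hD : 0 < D) (h : ∀ k : ℕ, D * G.total π k ≤ C - k) : G.value π < 0 := by
  have hD' : (0 : ℝ) < D := by exact_mod_cast hD
  have ht : Tendsto (fun k : ℕ => ((C : ℝ) / D) / k + -(1 / D : ℝ)) atTop (nhds (0 + -(1 / D))) :=
    (tendsto_const_div_atTop_nhds_zero_nat _).add tendsto_const_nhds
  have hneg : (0 : ℝ) + -(1 / D) < 0 := by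
    rw [zero_add, neg_lt_zero]; positivity
  refine lt_of_le_of_lt ?_ hneg
  rw [value_eq, ← ht.liminf_eq]
  refine liminf_le_liminf ?_ ?_ ht.isCoboundedUnder_ge
  · filter_upwards [eventually_gt_atTop 0] with k hk
    have hk' : (0 : ℝ) < k := by exact_mod_cast hk
    have h1 : (D * G.total π k : ℝ) ≤ C - k := by exact_mod_cast h k
    have h2 : (G.total π k : ℝ) ≤ (C - k) / D := by
      rw [le_div_iff₀ hD']; linarith
    calc (G.total π k : ℝ) / k ≤ ((C - k) / D) / k := div_le_div_of_nonneg_right h2 hk'.le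
      _ = _ := by field_simp; ring
  · exact isBoundedUnder_of ⟨(-W : ℝ), fun k => (abs_le.1 (abs_average_le hW π k)).1⟩

namespace Split

variable (P : Split G W)

/-- The moves of player 1 that respect the energies. -/
noncomputable def safe (u : Fin G.n) : Fin G.n := by
  classical exact
    if h : ∃ v w, G.edge u v = some w ∧ P.F P.depth v < P.B ∧
      (P.F P.depth v : ℤ) ≤ P.F P.depth u + w then h.choose
    else (G.deadlock_free u).choose

theorem safe_edge (u : Fin G.n) : (G.edge u (P.safe u)).isSome := by
  unfold safe
  split_ifs with h
  · obtain ⟨w, hw, -⟩ := h.choose_spec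
    rw [hw]; rfl
  · exact (G.deadlock_free u).choose_spec

variable {P}

theorem low_step {u v : Fin G.n} {w : ℤ} (h : P.F P.depth u < P.B) (he : G.edge u v = some w)
    (hv : G.owner u = true → v = P.safe u) :
    P.F P.depth v < P.B ∧ (P.F P.depth v : ℤ) ≤ P.F P.depth u + w := by
  have h1 := P.low u h
  split_ifs at h1 with hu
  · have h2 : P.safe u = h1.choose := by unfold safe; rw [dif_pos h1]
    obtain ⟨w', h3, h4⟩ := h1.choose_spec
    rw [← h2, ← hv hu, he] at h3
    obtain rfl := Option.some.inj h3
    rwa [← h2, ← hv hu] at h4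
  · exact h1 v w he

/-- Initial energy plus total weight dominates the current energy, which is nonnegative; so the
totals are bounded below. -/
theorem yes_of_low (hW : ∀ u v w, G.edge u v = some w → |w| ≤ W)
    (h : P.F P.depth G.init < P.B) : ∃ τ : G.Strategy, ∀ π, τ.Consistent π → 0 ≤ G.value π := by
  refine ⟨⟨fun _ u => P.safe u, fun _ u _ => P.safe_edge u⟩, fun π hπ => ?_⟩
  obtain ⟨h0, h1, h2⟩ := hπ
  have key : ∀ i, P.F P.depth (π i) < P.B ∧
      (P.F P.depth (π i) : ℤ) ≤ P.F P.depth G.init + G.total π i := by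
    intro i
    induction i with
    | zero => rw [h0]; exact ⟨h, by simp [total]⟩
    | succ i ih =>
      obtain ⟨w, hw⟩ := Option.isSome_iff_exists.1 (h1 i)
      obtain ⟨h3, h4⟩ := low_step ih.1 hw (h2 i)
      refine ⟨h3, ?_⟩
      have h5 : G.total π (i + 1) = G.total π i + w := by
        rw [total, Finset.sum_range_succ, hw]; rfl
      rw [h5]
      linarith [ih.2]
  refine value_nonneg hW (C := P.F P.depth G.init) fun k => ?_
  have := (key k).2
  omega

/-- The play against a strategy of player 1, with its history and a tracker. -/
noncomputable def play (P : Split G W) (τ : G.Strategy) :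
    ℕ → List (Fin G.n) × Fin G.n × (ℕ × ℤ × ℕ)
  | 0 => ([], G.init, (P.depth, 0, 0))
  | i + 1 =>
    let x := play P τ i
    let v := if G.owner x.2.1 = true then τ.choose x.1 x.2.1 else P.best x.2.1 x.2.2.1
    (x.1 ++ [x.2.1], v, P.track x.2.2 ((G.edge x.2.1 v).getD 0))

theorem not_yes_of_high (hW : ∀ u v w, G.edge u v = some w → |w| ≤ W)
    (h : P.B ≤ P.F P.depth G.init) (τ : G.Strategy) :
    ∃ π, τ.Consistent π ∧ G.value π < 0 := by
  set π : ℕ → Fin G.n := fun i => (P.play τ i).2.1 with hπ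
  set m : ℕ → ℕ × ℤ × ℕ := fun i => (P.play τ i).2.2 with hm
  have hhist : ∀ i, (P.play τ i).1 = List.ofFn fun j : Fin i => π j := by
    intro i
    induction i with
    | zero => simp [play]
    | succ i ih =>
      rw [List.ofFn_succ_last]
      simp only [play, ih]
      rfl
  have hnext : ∀ i, π (i + 1) = if G.owner (π i) = true then
      τ.choose (List.ofFn fun j : Fin i => π j) (π i) else P.best (π i) (m i).1 := by
    intro i
    rw [← hhist]; rfl
  have hmnext : ∀ i, m (i + 1) = P.track (m i) ((G.edge (π i) (π (i + 1))).getD 0) :=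
    fun i => rfl
  have hedge : ∀ i, P.OnTrack (π i) (m i) → (G.edge (π i) (π (i + 1))).isSome ∧
      (G.owner (π i) = true ∨ π (i + 1) = P.best (π i) (m i).1) := by
    intro i hi
    rw [hnext]
    split_ifs with hu
    · exact ⟨τ.choose_edge _ _ hu, Or.inl hu⟩
    · obtain ⟨w, hw, -⟩ := hi.best_spec hu
      rw [hw]
      exact ⟨rfl, Or.inr rfl⟩
  -- Each of the `r` restarts of the tracker has cost at least one unit, and the time between two
  -- restarts is at most `depth`.
  have key : ∀ i, P.OnTrack (π i) (m i) ∧ G.total π i ≤ (m i).2.1 - (m i).2.2 ∧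
      i + (m i).1 ≤ ((m i).2.2 + 1) * P.depth := by
    intro i
    induction i with
    | zero => exact ⟨.start h 0, by simp [total, hm, play], by simp [hm, play]⟩
    | succ i ih =>
      obtain ⟨h1, h2, h3⟩ := ih
      obtain ⟨h4, h5⟩ := hedge i h1
      obtain ⟨w, hw⟩ := Option.isSome_iff_exists.1 h4
      have h6 : G.total π (i + 1) = G.total π i + w := by
        rw [total, Finset.sum_range_succ, hw]; rfl
      have h7 := hmnext i
      rw [hw, Option.getD_some] at h7
      refine ⟨h7 ▸ h1.step hW hw h5, ?_⟩
      have hp := h1.pos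
      rw [h6, h7]
      unfold track
      split_ifs with hs
      · refine ⟨by push_cast; omega, ?_⟩
        simp only
        rw [add_mul _ 1, one_mul]
        omega
      · exact ⟨by simp only; omega, by simp only; omega⟩
  have hpos : 0 < P.depth := (key 0).1.pos
  refine ⟨π, ⟨rfl, fun i => (hedge i (key i).1).1, fun i hi => ?_⟩,
    value_neg hW (C := P.depth * ((G.n + 1) * W) + P.depth) hpos fun k => ?_⟩
  · rw [hnext, if_pos hi]
  · obtain ⟨h1, h2, h3⟩ := key k
    have h4 := h1.le_cap
    have h5 : (k : ℤ) ≤ ((m k).2.2 + 1) * P.depth := by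
      have : k ≤ ((m k).2.2 + 1) * P.depth := by omega
      exact_mod_cast this
    have h6 : (P.depth : ℤ) * G.total π k ≤ P.depth * ((G.n + 1) * W - (m k).2.2) :=
      mul_le_mul_of_nonneg_left (by omega) (by positivity)
    linarith

theorem yes_iff (P : Split G W) (hW : ∀ u v w, G.edge u v = some w → |w| ≤ W) :
    meanPayoffGames.yes G ↔ P.F P.depth G.init < P.B := by
  refine ⟨fun ⟨τ, hτ⟩ => ?_, yes_of_low hW⟩
  by_contra h
  obtain ⟨π, h1, h2⟩ := not_yes_of_high hW (not_lt.1 h) τ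
  exact absurd (hτ π h1) (not_le.2 h2)

end Split

end MeanPayoffGame

/-! ## Markov decision processes for mean-payoff games -/

namespace MeanPayoffGame

variable (G : MeanPayoffGame)

/-- The phase `0` of a state `(u, v, i)`: player 1 chooses a successor of `u`, or a random
successor of `u` is searched, starting with `v`. Phase `1`: the token moves along the edge from `u`
to `v`, or the game is started anew, which is phase `2`. -/
def moves (s a : Fin G.n × Fin G.n × Fin 3) : List (Fin G.n × Fin G.n × Fin 3) :=
  if s.2.2 = 0 ∧ G.owner s.1 = true then
    if a.1 = s.1 ∧ a.2.2 = 0 ∧ (G.edge s.1 a.2.1).isSome then [(s.1, a.2.1, 1)] else []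
  else if a = s then
    if s.2.2 = 0 then
      if (G.edge s.1 s.2.1).isSome then [(s.1, s.2.1, 1), (s.1, cycSucc s.2.1, 0)]
      else [(s.1, cycSucc s.2.1, 0)]
    else if s.2.2 = 1 then [(s.2.1, ⟨0, Fin.pos s.1⟩, 0), (s.1, s.2.1, 2)]
    else [(G.init, ⟨0, Fin.pos s.1⟩, 0)]
  else []

/-- The weights of the actions, where `K` is a large number. -/
def moveWeight (K : ℕ) (a : Fin G.n × Fin G.n × Fin 3) : ℤ :=
  if a.2.2 = 0 then 3 else if a.2.2 = 1 then K * (G.edge a.1 a.2.1).getD 0 else K * K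

/-- An available action. -/
def goodMove (f : Fin G.n → Fin G.n) (s : Fin G.n × Fin G.n × Fin 3) : Fin G.n × Fin G.n × Fin 3 :=
  if s.2.2 = 0 ∧ G.owner s.1 = true then (s.1, f s.1, 0) else s

theorem moves_goodMove {f : Fin G.n → Fin G.n} (hf : ∀ u, (G.edge u (f u)).isSome) (s) :
    G.moves s (G.goodMove f s) ≠ [] := by
  unfold moves goodMove
  by_cases h : s.2.2 = 0 ∧ G.owner s.1 = true
  · simp [h, hf]
  · simp only [h, if_false, if_true]
    split_ifs <;> simp

theorem moves_nodup (s a) : (G.moves s a).Nodup := by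
  unfold moves
  split_ifs <;> simp

/-- `moves` on numbers. -/
def moveSucc (s a : Fin (G.n * (G.n * 3))) : List (Fin (G.n * (G.n * 3))) :=
  (G.moves ((tripleEquiv _ _ _).symm s) ((tripleEquiv _ _ _).symm a)).map (tripleEquiv _ _ _)

theorem exists_moveSucc (s : Fin (G.n * (G.n * 3))) : ∃ a, G.moveSucc s a ≠ [] := by
  refine ⟨tripleEquiv _ _ _ (G.goodMove (fun u => (G.deadlock_free u).choose)
    ((tripleEquiv _ _ _).symm s)), ?_⟩
  simpa [moveSucc] using G.moves_goodMove (fun u => (G.deadlock_free u).choose_spec) _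

def toMDP : MDP (Fin (G.n * (G.n * 3))) (Fin (G.n * (G.n * 3))) :=
  MDP.ofList G.moveSucc G.exists_moveSucc

/-- The state in which the game starts. -/
def start : Fin G.n × Fin G.n × Fin 3 := (G.init, ⟨0, Fin.pos G.init⟩, 0)

def weight (K : ℕ) (a : Fin (G.n * (G.n * 3))) : ℤ := G.moveWeight K ((tripleEquiv _ _ _).symm a)

variable {G}

/-- The state and the action at time `i`, decoded. -/
def stateAt (ρ : Path (Fin (G.n * (G.n * 3))) (Fin (G.n * (G.n * 3)))) (i : ℕ) :
    Fin G.n × Fin G.n × Fin 3 := (tripleEquiv _ _ _).symm (ρ i).1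

def actionAt (ρ : Path (Fin (G.n * (G.n * 3))) (Fin (G.n * (G.n * 3)))) (i : ℕ) :
    Fin G.n × Fin G.n × Fin 3 := (tripleEquiv _ _ _).symm (ρ i).2

theorem stateAt_succ {σ : WindowMDP.Strategy G.toMDP} {s ρ} (h : ∀ n, ConsistentUpTo _ σ s ρ n) (i : ℕ) :
    stateAt ρ (i + 1) ∈ G.moves (stateAt ρ i) (actionAt ρ i) := by
  have := (h (i + 1)).trans i (by omega)
  rw [toMDP, MDP.prob_ofList] at this
  obtain ⟨t, h1, h2⟩ := List.mem_map.1 this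
  have h3 : stateAt ρ (i + 1) = t := by rw [stateAt, ← h2, Equiv.symm_apply_apply]
  rw [h3]
  exact h1

theorem weight_at (K : ℕ) (ρ : Path (Fin (G.n * (G.n * 3))) (Fin (G.n * (G.n * 3)))) (i : ℕ) :
    G.weight K (ρ i).2 = G.moveWeight K (actionAt ρ i) := rfl

variable {W : ℕ} (P : Split G W)

/-! ### The potential of the states below the threshold -/

namespace Split

/-- The states that are reached from below the threshold. -/
def Below (s : Fin G.n × Fin G.n × Fin 3) : Prop :=
  (s.2.2 ≠ 2 → P.F P.depth s.1 < P.B) ∧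
    (s.2.2 = 1 → (G.edge s.1 s.2.1).isSome ∧ (G.owner s.1 = true → s.2.1 = P.safe s.1))

/-- The constants leave a surplus of at least one in every step. The weight `3` of phase `0` pays
for the increment `2` of phase `1` and for the surplus. Moving along an edge releases the `2`. A new
start earns `K * K`, which covers `K` times the energy of the initial vertex. -/
def potential (K : ℕ) (s : Fin G.n × Fin G.n × Fin 3) : ℤ :=
  if s.2.2 = 0 then K * P.F P.depth s.1 else if s.2.2 = 1 then K * P.F P.depth s.1 + 2 else 1

theorem below_step {K : ℕ} (hK : (G.n + 1) * W ≤ K) (h0 : P.F P.depth G.init < P.B)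
    {s a t : Fin G.n × Fin G.n × Fin 3} (hs : P.Below s) (ht : t ∈ G.moves s a)
    (ha : a = G.goodMove P.safe s) :
    P.Below t ∧ P.potential K t + 1 ≤ P.potential K s + G.moveWeight K a := by
  obtain ⟨u, v, k⟩ := s
  subst ha
  unfold moves goodMove at ht
  unfold goodMove
  by_cases h : k = 0 ∧ G.owner u = true
  · obtain ⟨rfl, ho⟩ := h
    have hs1 := hs.1 (by simp)
    simp [ho, P.safe_edge] at ht
    subst ht
    simp [Below, potential, moveWeight, ho, P.safe_edge, hs1]
  · simp only [h, if_false, if_true] at ht ⊢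
    by_cases hk0 : k = 0
    · subst hk0
      have ho : G.owner u = false := by simpa using h
      have hs1 := hs.1 (by simp)
      simp only [if_true] at ht
      split_ifs at ht with he
      · simp only [List.mem_cons, List.not_mem_nil, or_false] at ht
        rcases ht with rfl | rfl
        · simp [Below, potential, moveWeight, ho, he, hs1]
        · simp [Below, potential, moveWeight, hs1]
      · simp only [List.mem_cons, List.not_mem_nil, or_false] at ht
        subst ht
        simp [Below, potential, moveWeight, hs1]
    · by_cases hk1 : k = 1
      · subst hk1
        have hs1 := hs.1 (by simp)
        obtain ⟨hs2, hs3⟩ := hs.2 rfl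
        obtain ⟨w, hw⟩ := Option.isSome_iff_exists.1 hs2
        obtain ⟨h1, h2⟩ := low_step hs1 hw hs3
        simp only at hs1 hw h1 h2
        have h3 : (K : ℤ) * P.F P.depth v ≤ K * P.F P.depth u + K * w := by
          rw [← mul_add]; exact mul_le_mul_of_nonneg_left h2 (by positivity)
        simp at ht
        rcases ht with rfl | rfl
        · simp [Below, potential, moveWeight, hw, h1]
          omega
        · have h4 : (0 : ℤ) ≤ K * P.F P.depth v := by positivity
          simp [Below, potential, moveWeight, hw]
          omega
      · have hk2 : k = 2 := by omega
        subst hk2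
        simp at ht
        subst ht
        have h1 : (P.F P.depth G.init : ℤ) ≤ K := by exact_mod_cast (P.F_le _ _).trans hK
        have h2 : (K : ℤ) * P.F P.depth G.init ≤ K * K :=
          mul_le_mul_of_nonneg_left h1 (by positivity)
        simp [Below, potential, moveWeight, h0]
        omega

/-- The potential lies between `0` and `K * ((G.n + 1) * W) + 2`, and weights exceed its decrease by
one in every step. So every window closes within one step more than this range, whatever chance
does. -/
theorem exists_strategy {K : ℕ} (hK : (G.n + 1) * W ≤ K) (h0 : P.F P.depth G.init < P.B) :
    ∃ σ : WindowMDP.Strategy G.toMDP,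
      σ.prob (tripleEquiv _ _ _ G.start) (BW (GWmp (G.weight K))) = 1 := by
  refine ⟨WindowMDP.Strategy.memoryless _ (fun s => tripleEquiv _ _ _
    (G.goodMove P.safe ((tripleEquiv _ _ _).symm s))) fun s => ?_, ?_⟩
  · rw [toMDP, MDP.mem_avail_ofList, moveSucc]
    simpa using G.moves_goodMove P.safe_edge _
  refine prob_eq_one _ _ _ _ fun ρ hρ => ⟨K * ((G.n + 1) * W) + 3, by omega, 0, fun i => ?_⟩
  have ha : ∀ i, actionAt ρ i = G.goodMove P.safe (stateAt ρ i) := by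
    intro i
    have := (hρ i).act i le_rfl
    rw [WindowMDP.Strategy.memoryless, RatDist.dirac_pos] at this
    rw [actionAt, this, Equiv.symm_apply_apply]
    rfl
  have key : ∀ i, P.Below (stateAt ρ i) := by
    intro i
    induction i with
    | zero =>
      rw [stateAt, (hρ 0).init, Equiv.symm_apply_apply]
      exact ⟨fun _ => h0, fun h => by simp [start] at h⟩
    | succ i ih => exact (P.below_step hK h0 ih (stateAt_succ hρ i) (ha i)).1
  have hsum : ∀ i l, P.potential K (stateAt ρ (i + l)) + l ≤ P.potential K (stateAt ρ i) +
      ∑ k ∈ Finset.range l, G.weight K (ρ (i + k)).2 := by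
    intro i l
    induction l with
    | zero => simp
    | succ l ih =>
      have := (P.below_step hK h0 (key (i + l)) (stateAt_succ hρ (i + l)) (ha (i + l))).2
      rw [Finset.sum_range_succ, weight_at K ρ (i + l), ← add_assoc]
      push_cast
      omega
  have hub : ∀ s, P.potential K s ≤ K * ((G.n + 1) * W) + 2 := by
    intro s
    have h1 : (P.F P.depth s.1 : ℤ) ≤ (G.n + 1) * W := by exact_mod_cast P.F_le _ _
    have h2 : (K : ℤ) * P.F P.depth s.1 ≤ K * ((G.n + 1) * W) :=
      mul_le_mul_of_nonneg_left h1 (by positivity)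
    have h3 : (0 : ℤ) ≤ K * P.F P.depth s.1 := by positivity
    unfold potential
    split_ifs <;> omega
  have hlb : ∀ s, 0 ≤ P.potential K s := by
    intro s
    have h3 : (0 : ℤ) ≤ K * P.F P.depth s.1 := by positivity
    unfold potential
    split_ifs <;> omega
  rw [suffix_suffix, suffix_mem_GWmp]
  refine ⟨K * ((G.n + 1) * W) + 2, by omega, ?_⟩
  have h1 := hsum (0 + i) (K * ((G.n + 1) * W) + 2 + 1)
  have h2 := hub (stateAt ρ (0 + i))
  have h3 := hlb (stateAt ρ (0 + i + (K * ((G.n + 1) * W) + 2 + 1)))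
  push_cast at h1
  omega

end Split

end MeanPayoffGame

/-- If all windows that start before time `n` are closed within `lam` steps, then the total weight
at time `n` is not much below zero. -/
theorem neg_le_sum_of_windows {w : ℕ → ℤ} {lam n : ℕ} {C : ℤ} (hC : ∀ i, -C ≤ w i) (hC0 : 0 ≤ C)
    (h : ∀ i < n, ∃ m < lam, 0 ≤ ∑ k ∈ Finset.range (m + 1), w (i + k)) {i d : ℕ}
    (hd : i + d = n) : -(lam * C) ≤ ∑ k ∈ Finset.range d, w (i + k) := by
  induction d using Nat.strong_induction_on generalizing i with
  | _ d ih =>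
    rcases Nat.eq_zero_or_pos d with rfl | h0
    · simp; positivity
    · obtain ⟨m, h1, h2⟩ := h i (by omega)
      by_cases hm : m + 1 ≤ d
      · obtain ⟨e, rfl⟩ := Nat.exists_eq_add_of_le hm
        rw [Finset.sum_range_add]
        have := ih e (by omega) (i := i + (m + 1)) (by omega)
        simp only [← add_assoc] at this ⊢ h2
        linarith
      -- This window closes only after time `n`, so fewer than `lam` steps remain, each of which
      -- costs at most `C`.
      · have h3 : ∑ _k ∈ Finset.range d, -C ≤ ∑ k ∈ Finset.range d, w (i + k) :=
          Finset.sum_le_sum fun k _ => hC _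
        simp only [Finset.sum_const, Finset.card_range, nsmul_eq_mul] at h3
        have h4 : (d : ℤ) * C ≤ lam * C :=
          mul_le_mul_of_nonneg_right (by exact_mod_cast by omega) hC0
        linarith

namespace MeanPayoffGame

variable {G : MeanPayoffGame} {W : ℕ} (P : Split G W)

namespace Split

/-! ### Forcing a loss from above the threshold -/

/-- The tracker after an action. -/
def trackMove (m : ℕ × ℤ × ℕ) (s : Fin G.n × Fin G.n × Fin 3) : ℕ × ℤ × ℕ :=
  if s.2.2 = 0 then m
  else if s.2.2 = 1 then P.track m ((G.edge s.1 s.2.1).getD 0)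
  else (P.depth, 0, 0)

/-- The tracker is on the way to a negative sum, and the moves of player 2 realize it. -/
def OnCourse (s : Fin G.n × Fin G.n × Fin 3) (m : ℕ × ℤ × ℕ) : Prop :=
  P.OnTrack s.1 m ∧
    ((s.2.2 = 0 ∧ (G.owner s.1 = true ∨ s.2.1 ≤ P.best s.1 m.1)) ∨
    (s.2.2 = 1 ∧ (G.edge s.1 s.2.1).isSome ∧ (G.owner s.1 = true ∨ s.2.1 = P.best s.1 m.1)))

open Classical in
/-- The successors that keep on course, or lead to a new start of the game. -/
noncomputable def steer (m : ℕ × ℤ × ℕ) (s a : Fin G.n × Fin G.n × Fin 3) :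
    Fin G.n × Fin G.n × Fin 3 :=
  if s.2.2 = 0 then
    if G.owner s.1 = true then (s.1, a.2.1, 1)
    else if if P.OnCourse s m then s.2.1 = P.best s.1 m.1 else (G.edge s.1 s.2.1).isSome then
      (s.1, s.2.1, 1)
    else (s.1, cycSucc s.2.1, 0)
  else if s.2.2 = 1 then
    if P.OnCourse s m then (s.2.1, ⟨0, Fin.pos s.1⟩, 0) else (s.1, s.2.1, 2)
  else (G.init, ⟨0, Fin.pos s.1⟩, 0)

theorem steer_mem {m : ℕ × ℤ × ℕ} {s a : Fin G.n × Fin G.n × Fin 3} (h : G.moves s a ≠ []) :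
    P.steer m s a ∈ G.moves s a := by
  unfold moves at h ⊢
  unfold steer
  by_cases h0 : s.2.2 = 0
  · by_cases ho : G.owner s.1 = true
    · simp only [h0, ho, and_self, if_true] at h ⊢
      split_ifs at h ⊢ with h1
      · simp
      · simp at h
    · have e : a = s := by
        by_contra hne
        simp [h0, ho, hne] at h
      simp only [h0, ho, and_false, if_true, if_false, e, Bool.false_eq_true]
      by_cases he : (G.edge s.1 s.2.1).isSome
      · rw [if_pos he]
        split_ifs <;> simp
      · rw [if_neg he, if_neg, List.mem_singleton]
        split_ifs with hc
        · intro hb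
          obtain ⟨w, hw, -⟩ := hc.1.best_spec ho
          rw [hb, hw] at he
          exact he rfl
        · exact he
  · simp only [h0, false_and, if_false] at h ⊢
    split_ifs at h ⊢ <;> simp_all

/-- The number of steps in which the token moves or, if `target` is a successor, is about to. -/
def rank (target : Fin G.n) (s : Fin G.n × Fin G.n × Fin 3) : ℕ :=
  if s.2.2 = 0 then
    if G.owner s.1 = true then 2 else target.val - s.2.1.val + 2
  else 1

theorem rank_le (target : Fin G.n) (s) : rank target s ≤ G.n + 2 := by
  have := target.isLt
  unfold rank
  split_ifs <;> omega

/-- Chance passes over candidates until the search meets the best successor. The search starts at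
the least vertex and on course has not passed the target, so it arrives without wrapping around;
`rank` bounds the waiting time. -/
theorem onCourse_step (hW : ∀ u v w, G.edge u v = some w → |w| ≤ W) {K : ℕ}
    {s a : Fin G.n × Fin G.n × Fin 3} {m : ℕ × ℤ × ℕ} (h : P.OnCourse s m)
    (ha : P.steer m s a ∈ G.moves s a) :
    P.OnCourse (P.steer m s a) (P.trackMove m s) ∧
      ((s.2.2 = 0 ∧ P.trackMove m s = m ∧ G.moveWeight K a = 3 ∧
        rank (P.best (P.steer m s a).1 m.1) (P.steer m s a) + 1 ≤ rank (P.best s.1 m.1) s) ∨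
      (s.2.2 = 1 ∧ ∃ w, P.trackMove m s = P.track m w ∧ G.moveWeight K a = K * w)) := by
  obtain ⟨u, v, k⟩ := s
  obtain ⟨h1, ⟨h2, h3⟩ | ⟨h2, h3, h4⟩⟩ := id h
  · simp only at h1 h2 h3
    subst h2
    by_cases ho : G.owner u = true
    · have e1 : P.steer m (u, v, 0) a = (u, a.2.1, 1) := by simp [steer, ho]
      rw [e1] at ha ⊢
      simp only [moves, ho, and_self, if_true] at ha
      split_ifs at ha with h5
      · simp [trackMove, OnCourse, h1, ho, h5, moveWeight, rank]
      · simp at ha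
    · have hv : v ≤ P.best u m.1 := by simpa [ho] using h3
      have e2 : G.moveWeight K a = 3 := by
        have e3 : a = (u, v, 0) := by
          by_contra hne
          simp [moves, ho, hne] at ha
        rw [e3]; rfl
      by_cases hb : v = P.best u m.1
      · have e1 : P.steer m (u, v, 0) a = (u, v, 1) := by simp [steer, ho, h, ← hb]
        rw [e1]
        obtain ⟨w, hw, -⟩ := h1.best_spec ho
        refine ⟨⟨h1, Or.inr ⟨rfl, ?_, Or.inr hb⟩⟩, Or.inl ⟨rfl, rfl, e2, ?_⟩⟩
        · simp only [hb, hw]; rfl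
        · simp [rank, ho]
      · have e1 : P.steer m (u, v, 0) a = (u, cycSucc v, 0) := by simp [steer, ho, h, hb]
        rw [e1]
        have hlt : v.val < (P.best u m.1).val := by
          rw [Fin.le_def] at hv
          rw [Fin.ext_iff] at hb
          omega
        have := (P.best u m.1).isLt
        have e3 : (cycSucc v).val = v.val + 1 := by rw [cycSucc_val, if_neg (by omega)]
        refine ⟨⟨h1, Or.inl ⟨rfl, Or.inr ?_⟩⟩, Or.inl ⟨rfl, rfl, e2, ?_⟩⟩
        · change (cycSucc v).val ≤ (P.best u m.1).val
          omega
        · simp only [rank, ho, if_true, e3]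
          simp
          omega
  · simp only at h1 h2 h3 h4
    subst h2
    have e1 : P.steer m (u, v, 1) a = (v, ⟨0, Fin.pos u⟩, 0) := by simp [steer, h]
    have e3 : a = (u, v, 1) := by
      by_contra hne
      simp [moves, hne] at ha
    obtain ⟨w, hw⟩ := Option.isSome_iff_exists.1 h3
    have e4 : P.trackMove m (u, v, 1) = P.track m w := by simp [trackMove, hw]
    rw [e1, e4, e3]
    refine ⟨⟨h1.step hW hw h4, Or.inl ⟨rfl, Or.inr ?_⟩⟩, Or.inr ⟨rfl, w, rfl, ?_⟩⟩
    · rw [Fin.le_def]; exact Nat.zero_le _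
    · simp [moveWeight, hw]

/-- The distance to a new start of the game. -/
noncomputable def restartDist (s : Fin G.n × Fin G.n × Fin 3) : ℕ :=
  if s.2.2 = 0 then
    if G.owner s.1 = true then 3
    else if s.2.1 ≤ (G.deadlock_free s.1).choose then
      3 + ((G.deadlock_free s.1).choose.val - s.2.1.val)
    else 3 + ((G.deadlock_free s.1).choose.val + G.n - s.2.1.val)
  else if s.2.2 = 1 then 2
  else 1

theorem restartDist_le (s : Fin G.n × Fin G.n × Fin 3) : restartDist s ≤ G.n + 3 := by
  have := s.2.1.isLt
  have := (G.deadlock_free s.1).choose.isLt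
  simp only [restartDist, Fin.le_def]
  split_ifs <;> omega

theorem restartDist_pos (s : Fin G.n × Fin G.n × Fin 3) : 0 < restartDist s := by
  unfold restartDist
  split_ifs <;> omega

/-- Off course, chance accepts the first successor that the search meets and then starts the game
anew instead of moving the token. -/
theorem restartDist_step {s : Fin G.n × Fin G.n × Fin 3} {m : ℕ × ℤ × ℕ} (h : ¬ P.OnCourse s m)
    (a) (h2 : s.2.2 ≠ 2) : restartDist (P.steer m s a) < restartDist s := by
  obtain ⟨u, v, k⟩ := s
  simp only at h2
  by_cases h0 : k = 0
  · subst h0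
    by_cases ho : G.owner u = true
    · simp [steer, restartDist, ho]
    · by_cases he : (G.edge u v).isSome
      · have e1 : P.steer m (u, v, 0) a = (u, v, 1) := by simp [steer, ho, h, he]
        rw [e1]
        simp only [restartDist, ho]
        simp
        split_ifs <;> omega
      · have e1 : P.steer m (u, v, 0) a = (u, cycSucc v, 0) := by simp [steer, ho, h, he]
        rw [e1]
        have h3 : v ≠ (G.deadlock_free u).choose := by
          intro h3
          rw [h3] at he
          exact he (G.deadlock_free u).choose_spec
        simp only [restartDist, ho, if_true]
        rw [ne_eq, Fin.ext_iff] at h3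
        simp only [Fin.le_def, cycSucc_val]
        have h4 := (G.deadlock_free u).choose.isLt
        have h5 := v.isLt
        simp only [Bool.false_eq_true, if_false]
        split_ifs <;> omega
  · have h1 : k = 1 := by omega
    subst h1
    have e1 : P.steer m (u, v, 1) a = (u, v, 2) := by simp [steer, h]
    rw [e1]
    simp [restartDist]

section
variable {P} {x a : ℕ → Fin G.n × Fin G.n × Fin 3} {m : ℕ → ℕ × ℤ × ℕ} {i₀ : ℕ}

/-- Some state within the next steps is on course. -/
theorem exists_onCourse (h0 : P.B ≤ P.F P.depth G.init)
    (hx : ∀ i ≥ i₀, x (i + 1) = P.steer (m i) (x i) (a i))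
    (hm : ∀ i, m (i + 1) = P.trackMove (m i) (x i)) :
    ∃ i ≥ i₀, i ≤ i₀ + (G.n + 3) ∧ P.OnCourse (x i) (m i) := by
  have key : ∀ d, ∀ i ≥ i₀, restartDist (x i) ≤ d →
      ∃ j ≥ i, j ≤ i + d ∧ P.OnCourse (x j) (m j) := by
    intro d
    induction d with
    | zero => intro i _ h; have := restartDist_pos (x i); omega
    | succ d ih =>
      intro i hi h
      by_cases hc : P.OnCourse (x i) (m i)
      · exact ⟨i, le_rfl, by omega, hc⟩
      · by_cases h2 : (x i).2.2 = 2
        · refine ⟨i + 1, by omega, by omega, ?_⟩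
          have e1 : x (i + 1) = (G.init, ⟨0, Fin.pos G.init⟩, 0) := by
            rw [hx i hi]; simp [steer, h2]
          have e2 : m (i + 1) = (P.depth, 0, 0) := by
            rw [hm i]; simp [trackMove, h2]
          rw [e1, e2]
          exact ⟨.start h0 0, Or.inl ⟨rfl, Or.inr (by rw [Fin.le_def]; exact Nat.zero_le _)⟩⟩
        · have := restartDist_step P hc (a i) h2
          rw [← hx i hi] at this
          obtain ⟨j, h3, h4, h5⟩ := ih (i + 1) (by omega) (by omega)
          exact ⟨j, by omega, by omega, h5⟩
  obtain ⟨j, h1, h2, h3⟩ := key _ i₀ le_rfl (restartDist_le _)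
  exact ⟨j, h1, h2, h3⟩

/-- On course, the total weight decreases. -/
theorem total_le (hW : ∀ u v w, G.edge u v = some w → |w| ≤ W) {K : ℕ}
    (hK : 4 * (P.depth * (G.n + 2)) ≤ K)
    (hx : ∀ i ≥ i₀, x (i + 1) = P.steer (m i) (x i) (a i))
    (hm : ∀ i, m (i + 1) = P.trackMove (m i) (x i))
    (ha : ∀ i, x (i + 1) ∈ G.moves (x i) (a i)) (h0 : P.OnCourse (x i₀) (m i₀)) (t : ℕ) :
    ∑ k ∈ Finset.range t, G.moveWeight K (a (i₀ + k)) ≤ K * ((G.n + 1) * W + 1) - t := by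
  -- With `r` the number of negative sums since time `i₀`, each of them costs at least `K`, and
  -- waiting earns `3` per step. The elapsed time is at most `(r + 1) * depth * (G.n + 2)`, the last
  -- factor accounting for the search. As `K` is at least four times `depth * (G.n + 2)`, the losses
  -- outweigh the earnings by the elapsed time, up to a constant.
  have key : ∀ t, P.OnCourse (x (i₀ + t)) (m (i₀ + t)) ∧
      ∑ k ∈ Finset.range t, G.moveWeight K (a (i₀ + k)) ≤
        K * ((m (i₀ + t)).2.1 - ((m (i₀ + t)).2.2 - (m i₀).2.2)) + 3 * t ∧
      (t + ((m (i₀ + t)).1 - 1) * (G.n + 2) +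
        rank (P.best (x (i₀ + t)).1 (m (i₀ + t)).1) (x (i₀ + t)) : ℤ) ≤
        ((m (i₀ + t)).2.2 - (m i₀).2.2 + 1) * (P.depth * (G.n + 2)) := by
    intro t
    induction t with
    | zero =>
      refine ⟨h0, ?_, ?_⟩
      · have := h0.1.nonneg
        simp only [Finset.range_zero, Finset.sum_empty, Nat.add_zero, sub_self, sub_zero]
        positivity
      · have h1 := rank_le (P.best (x i₀).1 (m i₀).1) (x i₀)
        have h2 : ((m i₀).1 : ℤ) * (G.n + 2) ≤ P.depth * (G.n + 2) :=
          mul_le_mul_of_nonneg_right (by exact_mod_cast h0.1.le_depth) (by positivity)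
        simp only [Nat.add_zero, sub_self, zero_add, one_mul, Nat.cast_zero, sub_mul]
        omega
    | succ t ih =>
      obtain ⟨h1, h2, h3⟩ := ih
      have hxt := hx (i₀ + t) (by omega)
      have hmt := hm (i₀ + t)
      have hat := ha (i₀ + t)
      rw [hxt] at hat
      obtain ⟨h4, h5⟩ := P.onCourse_step hW (K := K) h1 hat
      rw [← hxt, ← hmt] at h4
      rw [← hxt, ← hmt] at h5
      rw [Finset.sum_range_succ, ← add_assoc i₀ t 1]
      refine ⟨h4, ?_⟩
      rcases h5 with ⟨-, e1, e2, e3⟩ | ⟨e0, w, e1, e2⟩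
      · rw [e2, e1]
        push_cast
        exact ⟨by linarith, by omega⟩
      · rw [e2]
        have hr : rank (P.best (x (i₀ + t)).1 (m (i₀ + t)).1) (x (i₀ + t)) = 1 := by
          simp [rank, e0]
        have hr' := rank_le (P.best (x (i₀ + t + 1)).1 (m (i₀ + t + 1)).1) (x (i₀ + t + 1))
        rw [hr] at h3
        have hp := h1.1.pos
        have hD : (0 : ℤ) ≤ ((m (i₀ + t)).1 - 1) * (G.n + 2) :=
          mul_nonneg (by omega) (by positivity)
        rw [e1] at hr' ⊢
        unfold track at hr' ⊢
        split_ifs at hr' ⊢ with hs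
        · simp only at hr' ⊢
          push_cast
          constructor
          · have h6 : (K : ℤ) * ((m (i₀ + t)).2.1 + w) ≤ K * (-1) :=
              mul_le_mul_of_nonneg_left (by omega) (by positivity)
            linarith
          · have hr2 : (rank (P.best (x (i₀ + t + 1)).1 P.depth) (x (i₀ + t + 1)) : ℤ) ≤
                G.n + 2 := by exact_mod_cast hr'
            push_cast at h3
            linarith
        · simp only at hr' ⊢
          push_cast [Nat.cast_sub (show 1 ≤ (m (i₀ + t)).1 by omega)]
          constructor
          · linarith
          · have hr2 : (rank (P.best (x (i₀ + t + 1)).1 ((m (i₀ + t)).1 - 1))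
                (x (i₀ + t + 1)) : ℤ) ≤ G.n + 2 := by exact_mod_cast hr'
            push_cast at h3
            linarith
  obtain ⟨h1, h2, h3⟩ := key t
  have hp := h1.1.pos
  have hD : (0 : ℤ) ≤ ((m (i₀ + t)).1 - 1) * (G.n + 2) := mul_nonneg (by omega) (by positivity)
  set r : ℤ := (m (i₀ + t)).2.2 - (m i₀).2.2 with hr
  have h4 : (t : ℤ) ≤ (r + 1) * (P.depth * (G.n + 2)) := by
    have : (0 : ℤ) ≤ rank (P.best (x (i₀ + t)).1 (m (i₀ + t)).1) (x (i₀ + t)) := by positivity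
    linarith
  have hpos : (0 : ℤ) < P.depth * (G.n + 2) := by
    have := h1.1.le_depth
    have : (0 : ℤ) < P.depth := by exact_mod_cast (by omega)
    positivity
  have h5 : 0 ≤ r + 1 := by
    by_contra hc
    have : (r + 1) * (P.depth * (G.n + 2) : ℤ) < 0 := mul_neg_of_neg_of_pos (not_le.1 hc) hpos
    omega
  have h6 : (r + 1) * (4 * (P.depth * (G.n + 2)) : ℤ) ≤ (r + 1) * K :=
    mul_le_mul_of_nonneg_left (by exact_mod_cast hK) h5
  have h7 : (K : ℤ) * (m (i₀ + t)).2.1 ≤ K * ((G.n + 1) * W) :=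
    mul_le_mul_of_nonneg_left h1.1.le_cap (by positivity)
  linarith

end

/-- Above the threshold, almost no run satisfies a fixed window objective. -/
theorem law_FW_eq_zero (hW : ∀ u v w, G.edge u v = some w → |w| ≤ W) {K : ℕ}
    (hK : 4 * (P.depth * (G.n + 2)) ≤ K) (h0 : P.B ≤ P.F P.depth G.init)
    (σ : WindowMDP.Strategy G.toMDP) (lam : ℕ) :
    law G.toMDP σ (tripleEquiv _ _ _ G.start) (FW (GWmp (G.weight K)) lam) = 0 := by
  classical
  have hC : ∀ a, -((K * W : ℕ) : ℤ) ≤ G.moveWeight K a := by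
    intro a
    have h1 : (0 : ℤ) ≤ (K * W : ℕ) := by positivity
    have h2 : (K : ℤ) * (-W) ≤ K * (G.edge a.1 a.2.1).getD 0 :=
      mul_le_mul_of_nonneg_left (abs_le.1 (abs_getD_le hW _ _)).1 (by positivity)
    have h3 : (0 : ℤ) ≤ K * K := by positivity
    unfold moveWeight
    split_ifs
    · omega
    · push_cast at h2 ⊢; linarith
    · omega
  -- After this many steps on course the total is below `-(lam * (K * W))`, which
  -- `neg_le_sum_of_windows` excludes if all windows close within `lam` steps.
  set Z := K * ((G.n + 1) * W + 1) + lam * (K * W) + 1 with hZ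
  set V : ℕ → Set (Path (Fin (G.n * (G.n * 3))) (Fin (G.n * (G.n * 3)))) := fun n =>
    {ρ | ∃ i ≥ n, i + lam ≤ n + (G.n + 3 + Z + lam) ∧
      ∀ l < lam, ∑ k ∈ Finset.range (l + 1), G.weight K (ρ (i + k)).2 < 0} with hV
  refine measure_mono_null (t := {ρ | ∃ i₀, ∀ n, i₀ ≤ n → ρ ∉ V n}) ?_ ?_
  · rintro ρ ⟨i₀, h⟩
    refine ⟨i₀, fun n hn ⟨i, h1, _, h2⟩ => ?_⟩
    have h3 := h (i - i₀)
    rw [suffix_suffix, suffix_mem_GWmp] at h3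
    obtain ⟨l, h4, h5⟩ := h3
    rw [show i₀ + (i - i₀) = i by omega] at h5
    exact absurd (h2 l h4) (not_lt.2 h5)
  -- The tracker is computed from the whole history, so that the choices of chance are functions of
  -- the history.
  set mem : List (Fin (G.n * (G.n * 3)) × Fin (G.n * (G.n * 3))) → ℕ × ℤ × ℕ := fun h =>
    h.foldl (fun m y => P.trackMove m ((tripleEquiv _ _ _).symm y.1)) (P.depth, 0, 0) with hmem
  refine law_avoid_eq_zero_of_pick _ _ _ V (G.n + 3 + Z + lam) ?_ (fun h s a => tripleEquiv _ _ _
    (P.steer (mem h) ((tripleEquiv _ _ _).symm s) ((tripleEquiv _ _ _).symm a))) ?_ ?_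
  · rintro n ρ ρ' h ⟨i, h1, h2, h3⟩
    refine ⟨i, h1, h2, fun l hl => ?_⟩
    have e : ∑ k ∈ Finset.range (l + 1), G.weight K (ρ (i + k)).2 =
        ∑ k ∈ Finset.range (l + 1), G.weight K (ρ' (i + k)).2 :=
      Finset.sum_congr rfl fun k hk => by
        rw [h (i + k) (by have := Finset.mem_range.1 hk; omega)]
    rw [← e]
    exact h3 l hl
  · intro h s a ha
    rw [toMDP, MDP.mem_avail_ofList, moveSucc, ne_eq, List.map_eq_nil_iff] at ha
    rw [toMDP, MDP.prob_ofList]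
    exact List.mem_map_of_mem (P.steer_mem ha)
  · intro n ρ hρ hpick _
    have hx : ∀ i ≥ n, stateAt ρ (i + 1) =
        P.steer (mem (hist ρ i)) (stateAt ρ i) (actionAt ρ i) := by
      intro i hi
      rw [stateAt, hpick i hi, Equiv.symm_apply_apply]
      rfl
    have hm : ∀ i, mem (hist ρ (i + 1)) = P.trackMove (mem (hist ρ i)) (stateAt ρ i) := by
      intro i
      simp only [hmem]
      rw [hist_succ, List.foldl_append]
      rfl
    obtain ⟨j, h1, h2, h3⟩ := exists_onCourse h0 hx hm
    have h4 := total_le hW hK (fun i hi => hx i (by omega)) hm (stateAt_succ hρ) h3 Z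
    by_contra hc
    have h6 := neg_le_sum_of_windows (w := fun i => G.weight K (ρ (j + i)).2) (lam := lam) (n := Z)
      (C := (K * W : ℕ)) (fun i => hC _) (by positivity) (fun i hi => by
        by_contra hcl
        push Not at hcl
        refine hc ⟨j + i, by omega, by omega, fun l hl => ?_⟩
        simpa only [add_assoc] using hcl l hl) (i := 0) (d := Z) (by omega)
    simp only [Nat.zero_add] at h6
    have h7 : ∑ k ∈ Finset.range Z, G.weight K (ρ (j + k)).2 =
      ∑ k ∈ Finset.range Z, G.moveWeight K (actionAt ρ (j + k)) := rfl
    rw [h7] at h6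
    rw [hZ] at h4
    push_cast at h4 h6
    rw [← hZ] at h4
    linarith

theorem prob_BW_eq_zero (hW : ∀ u v w, G.edge u v = some w → |w| ≤ W) {K : ℕ}
    (hK : 4 * (P.depth * (G.n + 2)) ≤ K) (h0 : P.B ≤ P.F P.depth G.init)
    (σ : WindowMDP.Strategy G.toMDP) :
    σ.prob (tripleEquiv _ _ _ G.start) (BW (GWmp (G.weight K))) = 0 := by
  refine measure_mono_null (t := ⋃ lam, FW (GWmp (G.weight K)) lam) ?_
    (measure_iUnion_null fun lam => P.law_FW_eq_zero hW hK h0 σ lam)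
  rintro ρ ⟨-, lam, -, h⟩
  exact Set.mem_iUnion.2 ⟨lam, h⟩

end Split

/-- The game is won by player 1 if and only if the bounded window objective can be satisfied almost
surely. -/
theorem yes_iff_toMDP (hW : ∀ u v w, G.edge u v = some w → |w| ≤ W) {K : ℕ}
    (hK : (G.n + 1) * W ≤ K) (hK' : 4 * (G.n * ((G.n + 1) * W) * (G.n + 2)) ≤ K) :
    meanPayoffGames.yes G ↔ ∃ σ : WindowMDP.Strategy G.toMDP,
      1 ≤ σ.prob (tripleEquiv _ _ _ G.start) (BW (GWmp (G.weight K))) := by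
  obtain ⟨P⟩ := exists_split G hW
  rw [P.yes_iff hW]
  constructor
  · intro h
    obtain ⟨σ, hσ⟩ := P.exists_strategy hK h
    exact ⟨σ, hσ.ge⟩
  · rintro ⟨σ, hσ⟩
    by_contra h
    have h1 : 4 * (P.depth * (G.n + 2)) ≤ K :=
      (Nat.mul_le_mul_left 4 (Nat.mul_le_mul_right _ P.depth_le)).trans hK'
    rw [P.prob_BW_eq_zero hW h1 (not_lt.1 h) σ] at hσ
    exact absurd hσ (by simp)

end MeanPayoffGame

/-! ## Arithmetic and scanning in logarithmic space -/

section
variable {X I O : Type} {code : X → List I} {c : ℕ}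

namespace IsNum

variable {d : ℕ} {f g : X → (ℕ → ℕ) → ℕ}

theorem at0 {N : X → ℕ} (h : IsNum code c 0 fun x _ => N x) : IsNum code c d fun x _ => N x := by
  induction d with
  | zero => exact h
  | succ d ih => exact ih.weaken

/-- Substitution: a function is treated once, with its arguments in the first variables, and then
applied to any terms by binding these to fresh variables. -/
theorem at1 {R : X → ℕ → ℕ} (h : IsNum code c 1 fun x e => R x (e 0)) (hf : IsNum code c d f) :
    IsNum code c d fun x e => R x (f x e) :=
  (IsNum.bind hf (h.rename (d' := d + 1) (ρ := fun j => d + j) (fun i hi => by omega)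
    fun j => by omega)).congr fun x e _ => by simp

theorem at2 {R : X → ℕ → ℕ → ℕ} (h : IsNum code c 2 fun x e => R x (e 0) (e 1))
    (hf : IsNum code c d f) (hg : IsNum code c d g) :
    IsNum code c d fun x e => R x (f x e) (g x e) :=
  (IsNum.bind hf (.bind hg.weaken (h.rename (d' := d + 2) (ρ := fun j => d + j)
    (fun i hi => by omega) fun j => by omega))).congr fun x e he => by
      simp [hg.local_update x he (hf.lt_bnd x he)]

/-- Iteration of a function of the counter and the current value. -/
theorem fold {H : X → (ℕ → ℕ) → ℕ → ℕ → ℕ} (hg : IsNum code c d g)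
    (h : IsNum code c (d + 2) fun x e => H x e (e (d + 1)) (e d))
    (h1 : ∀ x e v i r, H x (Function.update e d v) i r = H x e i r)
    (h2 : ∀ x e v i r, H x (Function.update e (d + 1) v) i r = H x e i r) :
    IsNum code c d fun x e => iterNum (H x e) (bnd code c x) (g x e) :=
  (IsNum.iter hg h).congr fun x e _ => by
    congr 1
    funext i r
    simp [h1, h2]

end IsNum

namespace IsForm

variable {d : ℕ} {f g : X → (ℕ → ℕ) → ℕ}

theorem at2 {R : X → ℕ → ℕ → Prop} (h : IsForm code c 2 fun x e => R x (e 0) (e 1))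
    (hf : IsNum code c d f) (hg : IsNum code c d g) :
    IsForm code c d fun x e => R x (f x e) (g x e) := by
  classical
  exact IsNum.congr (IsNum.at2 (R := fun x i j => if R x i j then 1 else 0)
    (IsNum.congr h fun x e _ => by congr) hf hg) fun x e _ => by congr

/-- `f = g + 1`, where `g + 1` may exceed the bound for the numbers. -/
theorem eqSucc (hf : IsNum code c d f) (hg : IsNum code c d g) :
    IsForm code c d fun x e => f x e = g x e + 1 :=
  ((IsForm.eq hf .zero).not.and (.eq hf hg.succ)).congr fun x e he => by
    have h1 := hf.lt_bnd x he
    have h2 := hg.lt_bnd x he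
    by_cases h : g x e + 1 = bnd code c x
    · rw [h, Nat.mod_self]; omega
    · rw [Nat.mod_eq_of_lt (by omega)]; omega

/-- The letter at a position of the input. -/
theorem letter [DecidableEq I] (s : I) (hf : IsNum code c d f) :
    IsForm code c d fun x e => (code x)[f x e]? = some s := by
  refine (IsForm.sym (fun y => match y with
    | .letter a => decide (a = s)
    | _ => false) hf.succ).congr fun x e he => ?_
  have h1 := hf.lt_bnd x he
  have h2 := length_lt_bnd (code := code) (c := c) x
  by_cases h : f x e + 1 = bnd code c x
  · rw [h, Nat.mod_self, List.getElem?_eq_none (by omega)]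
    simp [readInput]
  · rw [Nat.mod_eq_of_lt (by omega), readInput, if_neg (by omega), Nat.add_sub_cancel]
    cases (code x)[f x e]? <;> simp

end IsForm

namespace IsNum

variable {d : ℕ} {f g : X → (ℕ → ℕ) → ℕ}

/-- The number with a given property. -/
theorem the {R : X → ℕ → ℕ → Prop} {f : X → ℕ → ℕ}
    (h : IsForm code c 2 fun x e => R x (e 0) (e 1))
    (h2 : ∀ x, ∀ q < bnd code c x,
      f x q < bnd code c x ∧ ∀ i < bnd code c x, R x q i ↔ i = f x q) :
    IsNum code c 1 fun x e => f x (e 0) := by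
  classical
  refine (IsNum.fold .zero (H := fun x e i r => if R x (e 0) i then i else r)
    (.cases (.at2 h (.var (a := 0) (by omega)) (.var (a := 2) (by omega)))
      (.var (a := 2) (by omega)) (.var (a := 1) (by omega))) (fun _ _ _ _ _ => by simp)
    (fun _ _ _ _ _ => by simp)).congr fun x e he => ?_
  obtain ⟨h3, h4⟩ := h2 x (e 0) (he 0)
  have key : ∀ m ≤ bnd code c x, iterNum (fun i r => if R x (e 0) i then i else r) m 0 =
      if f x (e 0) < m then f x (e 0) else 0 := by
    intro m hm
    induction m with
    | zero => rfl
    | succ m ih =>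
      simp only [iterNum, ih (by omega), h4 m (by omega)]
      split_ifs <;> omega
  rw [key _ le_rfl, if_pos h3]

/-- Loops of the calculus always run through the whole range, so a guard lets only the first `b`
rounds have an effect. -/
theorem iterNum_add {M : ℕ} (a b m : ℕ) :
    iterNum (fun i r => if i < b then (r + 1) % M else r) m a % M = (a + min m b) % M := by
  induction m with
  | zero => simp [iterNum]
  | succ m ih =>
    simp only [iterNum]
    split_ifs with h
    · rw [min_eq_left (by omega)] at ih ⊢
      rw [Nat.mod_mod, Nat.add_mod, ih, ← Nat.add_mod, Nat.add_assoc]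
    · rw [ih, min_eq_right (by omega), min_eq_right (by omega)]

/-- Addition, modulo the bound for the numbers. -/
theorem add (hf : IsNum code c d f) (hg : IsNum code c d g) :
    IsNum code c d fun x e => (f x e + g x e) % bnd code c x := by
  refine at2 (R := fun x a b => (a + b) % bnd code c x) ?_ hf hg
  have h := IsNum.fold (d := 2) (code := code) (c := c) (.var (a := 0) (by omega))
    (H := fun x e i r => if i < e 1 then (r + 1) % bnd code c x else r)
    (.cases (.lt (.var (a := 3) (by omega)) (.var (a := 1) (by omega)))
      (.succ (.var (a := 2) (by omega))) (.var (a := 2) (by omega))) (fun _ _ _ _ _ => by simp)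
    (fun _ _ _ _ _ => by simp)
  refine h.congr fun x e he => ?_
  have h1 := iterNum_add (M := bnd code c x) (e 0) (e 1) (bnd code c x)
  rw [Nat.mod_eq_of_lt (h.lt_bnd x he)] at h1
  rw [h1, min_eq_right (he 1).le]

theorem iterNum_mul {M : ℕ} (a b m : ℕ) :
    iterNum (fun i r => if i < a then (r + b) % M else r) m 0 % M = (min m a * b) % M := by
  induction m with
  | zero => simp [iterNum]
  | succ m ih =>
    simp only [iterNum]
    split_ifs with h
    · rw [min_eq_left (by omega)] at ih ⊢
      rw [Nat.mod_mod, Nat.add_mod, ih, ← Nat.add_mod, add_mul, one_mul]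
    · rw [ih, min_eq_right (by omega), min_eq_right (by omega)]

/-- Multiplication, modulo the bound for the numbers. -/
theorem mul (hf : IsNum code c d f) (hg : IsNum code c d g) :
    IsNum code c d fun x e => (f x e * g x e) % bnd code c x := by
  refine at2 (R := fun x a b => (a * b) % bnd code c x) ?_ hf hg
  have h := IsNum.fold (d := 2) (code := code) (c := c) .zero
    (H := fun x e i r => if i < e 0 then (r + e 1) % bnd code c x else r)
    (.cases (.lt (.var (a := 3) (by omega)) (.var (a := 0) (by omega)))
      (.add (.var (a := 2) (by omega)) (.var (a := 1) (by omega))) (.var (a := 2) (by omega)))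
    (fun _ _ _ _ _ => by simp) (fun _ _ _ _ _ => by simp)
  refine h.congr fun x e he => ?_
  have h1 := iterNum_mul (M := bnd code c x) (e 0) (e 1) (bnd code c x)
  rw [Nat.mod_eq_of_lt (h.lt_bnd x he)] at h1
  rw [h1, min_eq_right (he 0).le]

end IsNum

theorem IsOut.forBelow {d : ℕ} {N : X → ℕ} (hN : IsNum code c 0 fun x _ => N x)
    {F : X → (ℕ → ℕ) → ℕ → List O} (h : IsOut code c (d + 1) fun x e => F x e (e d))
    (hF : ∀ x e v i, F x (Function.update e d v) i = F x e i) :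
    IsOut code c d fun x e => (List.range (N x)).flatMap fun i => F x e i := by
  refine (IsOut.forRange (F := fun x e i => if i < N x then F x e i else [])
    (.cases (.lt (.var (by omega)) hN.at0) h .nil) fun x e v i => by simp only [hF]).congr
    fun x e he => ?_
  have h1 : N x < bnd code c x := hN.lt_bnd x he
  obtain ⟨k, hk⟩ := Nat.exists_eq_add_of_le h1.le
  rw [hk, List.range_add, List.flatMap_append]
  have h2 : (List.map (fun x_1 => N x + x_1) (List.range k)).flatMap
      (fun i => if i < N x then F x e i else []) = [] := by
    simp [List.flatMap_map]
  rw [h2, List.append_nil]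
  exact List.flatMap_congr fun i hi => if_pos (List.mem_range.1 hi)

/-! ### Words that end with a separator -/

/-- The first position from `q` on without a bit. -/
def wordEnd (l : List Sym) (q : ℕ) : ℕ := q + ((l.drop q).takeWhile Option.isSome).length

theorem wordEnd_eq {l : List Sym} {q : ℕ} {w : List Bool} {r : List Sym}
    (h : l.drop q = w.map some ++ none :: r) : wordEnd l q = q + w.length := by
  have : ((w.map some ++ none :: r).takeWhile Option.isSome).length = w.length := by
    clear h
    induction w with
    | nil => simp
    | cons a w ih => simpa using ih
  rw [wordEnd, h, this]

theorem wordEnd_spec (l : List Sym) (q : ℕ) (b : Bool) : l[wordEnd l q]? ≠ some (some b) ∧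
    ∀ i, q ≤ i → i < wordEnd l q → ∃ b, l[i]? = some (some b) := by
  have key : ∀ (l : List Sym), l[(l.takeWhile Option.isSome).length]? ≠ some (some b) ∧
      ∀ i < (l.takeWhile Option.isSome).length, ∃ b, l[i]? = some (some b) := by
    intro l
    induction l with
    | nil => simp
    | cons a l ih =>
      cases a with
      | none => simp
      | some a =>
        simp only [List.takeWhile_cons, Option.isSome_some, if_true, List.length_cons]
        refine ⟨by simpa using ih.1, fun i hi => ?_⟩
        cases i with
        | zero => exact ⟨a, rfl⟩
        | succ i => simpa using ih.2 i (by omega)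
  obtain ⟨h1, h2⟩ := key (l.drop q)
  constructor
  · rw [wordEnd]
    rwa [List.getElem?_drop] at h1
  · intro i hi hi'
    obtain ⟨b, hb⟩ := h2 (i - q) (by rw [wordEnd] at hi'; omega)
    rw [List.getElem?_drop, show q + (i - q) = i by omega] at hb
    exact ⟨b, hb⟩

theorem wordEnd_lt {l : List Sym} {q M : ℕ} (h : l.length < M) (hq : q < M) :
    wordEnd l q < M := by
  have := (List.takeWhile_prefix (p := Option.isSome) (l := l.drop q)).length_le
  rw [List.length_drop] at this
  rw [wordEnd]
  omega

/-- The end of a word is the first position from `q` on that holds no bit, a property with a bounded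
quantifier, so it can be found by search. -/
theorem IsNum.wordEnd {code : X → List Sym} {d : ℕ} {f : X → (ℕ → ℕ) → ℕ}
    (hf : IsNum code c d f) : IsNum code c d fun x e => wordEnd (code x) (f x e) := by
  refine at1 (R := fun x q => WindowMDP.wordEnd (code x) q) (IsNum.the (R := fun x q i => ¬ i < q ∧
    (¬ (code x)[i]? = some (some true) ∧ ¬ (code x)[i]? = some (some false)) ∧
    ¬ ∃ j < bnd code c x, ¬ j < q ∧ j < i ∧
      (¬ (code x)[j]? = some (some true) ∧ ¬ (code x)[j]? = some (some false))) ?_ ?_) hf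
  · have v : ∀ {d} i, i < d → IsNum code c d fun _ e => e i := fun i hi => .var hi
    have hb : ∀ {d f}, IsNum code c d f → IsForm code c d fun x e =>
        ¬ (code x)[f x e]? = some (some true) ∧ ¬ (code x)[f x e]? = some (some false) :=
      fun h => .and (.not (.letter _ h)) (.not (.letter _ h))
    refine .and (.not (.lt (v 1 (by omega)) (v 0 (by omega)))) (.and (hb (v 1 (by omega)))
      (.not (.ex (H := fun x e j => ¬ j < e 0 ∧ j < e 1 ∧ (¬ (code x)[j]? = some (some true) ∧
        ¬ (code x)[j]? = some (some false)))
      (.and (.not (.lt (v 2 (by omega)) (v 0 (by omega))))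
        (.and (.lt (v 2 (by omega)) (v 1 (by omega))) (hb (v 2 (by omega))))) ?_)))
    intros; simp
  · intro x q hq
    have h1 := wordEnd_lt (l := code x) (M := bnd code c x) (by have := length_lt_bnd (code := code) (c := c) x; omega) hq
    refine ⟨h1, fun i hi => ?_⟩
    have h2 : q ≤ WindowMDP.wordEnd (code x) q := Nat.le_add_right _ _
    have h3 := fun b => wordEnd_spec (code x) q b
    constructor
    · rintro ⟨h4, h5, h6⟩
      by_contra hne
      rcases lt_or_gt_of_ne hne with h7 | h7
      · obtain ⟨b, hb⟩ := (h3 true).2 i (by omega) h7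
        cases b
        · exact h5.2 hb
        · exact h5.1 hb
      · exact h6 ⟨_, h1, by omega, h7, (h3 true).1, (h3 false).1⟩
    · rintro rfl
      refine ⟨by omega, ⟨(h3 true).1, (h3 false).1⟩, ?_⟩
      rintro ⟨j, -, h4, h5, h6⟩
      obtain ⟨b, hb⟩ := (h3 true).2 j (by omega) h5
      cases b
      · exact h6.2 hb
      · exact h6.1 hb

end

/-! ## The codes of the Markov decision processes for mean-payoff games -/

/-- The code of the transition function for `MeanPayoffGame.toMDP` at a state and an action. -/
def moveRowCode (n init : ℕ) (ow : ℕ → Prop) (ed : ℕ → ℕ → Prop) [∀ u, Decidable (ow u)]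
    [∀ u v, Decidable (ed u v)] (k k' : Fin 3) (u v u' v' : ℕ) : List Sym :=
  if k = 0 ∧ ow u then
    if u' = u ∧ k' = 0 ∧ ed u v' then gridCode n 3 1 fun t i γ => t = u ∧ i = v' ∧ γ = 1
    else [some false]
  else if u' = u ∧ v' = v ∧ k' = k then
    if k = 0 then
      if ed u v then gridCode n 3 2 fun t i γ => (t = u ∧ i = v ∧ γ = 1) ∨
        (t = u ∧ ((v + 1 = n ∧ i = 0) ∨ (¬ v + 1 = n ∧ i = v + 1)) ∧ γ = 0)
      else gridCode n 3 1 fun t i γ =>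
        t = u ∧ ((v + 1 = n ∧ i = 0) ∨ (¬ v + 1 = n ∧ i = v + 1)) ∧ γ = 0
    else if k = 1 then gridCode n 3 2 fun t i γ =>
      (t = v ∧ i = 0 ∧ γ = 0) ∨ (t = u ∧ i = v ∧ γ = 2)
    else gridCode n 3 1 fun t i γ => t = init ∧ i = 0 ∧ γ = 0
  else [some false]

/-- The calculus counts modulo `bnd` and not modulo `n`, so wrapping around is expressed by a case
distinction. -/
theorem eq_cycSucc_iff {n : ℕ} (i v : Fin n) :
    i = cycSucc v ↔ (v.val + 1 = n ∧ i.val = 0) ∨ (¬ v.val + 1 = n ∧ i.val = v.val + 1) := by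
  rw [Fin.ext_iff, cycSucc_val]
  split_ifs with h <;> simp [h]

theorem Fin.prod_eq_iff {n m : ℕ} {s : Fin n × Fin n × Fin m} {u v : Fin n} {k : Fin m} :
    s = (u, v, k) ↔ s.1.val = u.val ∧ s.2.1.val = v.val ∧ s.2.2 = k := by
  rw [Prod.ext_iff, Prod.ext_iff, Fin.ext_iff, Fin.ext_iff]

namespace MeanPayoffGame

variable (G : MeanPayoffGame) {ow : ℕ → Prop} {ed : ℕ → ℕ → Prop} [∀ u, Decidable (ow u)]
  [∀ u v, Decidable (ed u v)]

theorem moveRowCode_eq (how : ∀ u : Fin G.n, ow u ↔ G.owner u = true)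
    (hed : ∀ u v : Fin G.n, ed u v ↔ (G.edge u v).isSome) (s a : Fin G.n × Fin G.n × Fin 3) :
    optionCode (fun d => tableCode ratCode d.prob) (G.toMDP.trans (tripleEquiv _ _ _ s)
      (tripleEquiv _ _ _ a)) =
    moveRowCode G.n G.init ow ed s.2.2 a.2.2 s.1 s.2.1 a.1 a.2.1 := by
  obtain ⟨u, v, k⟩ := s
  obtain ⟨u', v', k'⟩ := a
  rw [toMDP, optionCode_ofList ((G.moves_nodup _ _).map (tripleEquiv _ _ _).injective)]
  simp only [moveSucc, Equiv.symm_apply_apply, List.map_eq_nil_iff]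
  have key : ∀ (l : List (Fin G.n × Fin G.n × Fin 3)) (k : ℕ) (φ : ℕ → ℕ → Fin 3 → Prop)
      [∀ t i γ, Decidable (φ t i γ)], l.length = k → k ≠ 0 → (∀ s, s ∈ l ↔ φ s.1 s.2.1 s.2.2) →
      (if l = [] then [some false] else some true ::
        (List.finRange (G.n * (G.n * 3))).flatMap fun t =>
        uniformCode (l.map (tripleEquiv G.n G.n 3)).length (t ∈ l.map (tripleEquiv G.n G.n 3))) =
      gridCode G.n 3 k φ := by
    intro l k φ _ hl hk h
    rw [if_neg (by rintro rfl; exact hk hl.symm)]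
    exact gridCode_eq hl h
  unfold moves moveRowCode
  simp only [how, hed, Fin.prod_eq_iff, ← Fin.ext_iff]
  by_cases h1 : k = 0 ∧ G.owner u = true
  · simp only [if_pos h1]
    by_cases h2 : u' = u ∧ k' = 0 ∧ (G.edge u v').isSome = true
    · simp only [if_pos h2]
      exact key _ _ _ rfl one_ne_zero fun s => by
        rw [List.mem_singleton, Fin.prod_eq_iff]
    · simp only [if_neg h2, if_true]
  · simp only [if_neg h1]
    by_cases h2 : u' = u ∧ v' = v ∧ k' = k
    · simp only [if_pos h2]
      by_cases h3 : k = 0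
      · simp only [if_pos h3]
        by_cases h4 : (G.edge u v).isSome = true
        · simp only [if_pos h4]
          exact key _ _ _ rfl two_ne_zero fun s => by
            rw [List.mem_cons, List.mem_singleton, Fin.prod_eq_iff, Fin.prod_eq_iff,
              ← eq_cycSucc_iff, ← Fin.ext_iff (a := s.2.1) (b := cycSucc v)]
        · simp only [if_neg h4]
          exact key _ _ _ rfl one_ne_zero fun s => by
            rw [List.mem_singleton, Fin.prod_eq_iff,
              ← eq_cycSucc_iff, ← Fin.ext_iff (a := s.2.1) (b := cycSucc v)]
      · simp only [if_neg h3]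
        by_cases h4 : k = 1
        · simp only [if_pos h4]
          exact key _ _ _ rfl two_ne_zero fun s => by
            rw [List.mem_cons, List.mem_singleton, Fin.prod_eq_iff, Fin.prod_eq_iff]
        · simp only [if_neg h4]
          exact key _ _ _ rfl one_ne_zero fun s => by
            rw [List.mem_singleton, Fin.prod_eq_iff]
    · simp only [if_neg h2, if_true]

/-- The query for a game. -/
def toQuery (K : ℕ) : WeightQuery where
  n := G.n * (G.n * 3)
  m := G.n * (G.n * 3)
  mdp := G.toMDP
  init := tripleEquiv _ _ _ G.start
  threshold := 1
  threshold_le := le_rfl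
  weight := G.weight K

end MeanPayoffGame

/-- The code of `MeanPayoffGame.toQuery`. -/
def gameQueryCode (n init : ℕ) (ow : ℕ → Prop) (ed : ℕ → ℕ → Prop) [∀ u, Decidable (ow u)]
    [∀ u v, Decidable (ed u v)] (wt : Fin 3 → ℕ → ℕ → List Sym) : List Sym :=
  ((List.range n).flatMap fun _ => (List.range n).flatMap fun _ => List.replicate 3 (some true)) ++
  ([none] ++
  (((List.range n).flatMap fun _ => (List.range n).flatMap fun _ => List.replicate 3 (some true)) ++
  ([none] ++
  (((List.range init).flatMap fun _ => (List.range n).flatMap fun _ =>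
    List.replicate 3 (some true)) ++
  (([none] ++ ratCode 1) ++
  (((List.range n).flatMap fun u => (List.range n).flatMap fun v =>
    (List.finRange 3).flatMap fun k => (List.range n).flatMap fun u' =>
    (List.range n).flatMap fun v' => (List.finRange 3).flatMap fun k' =>
      moveRowCode n init ow ed k k' u v u' v') ++
  (List.range n).flatMap fun u => (List.range n).flatMap fun v =>
    (List.finRange 3).flatMap fun k => wt k u v))))))

theorem MeanPayoffGame.toQuery_code (G : MeanPayoffGame) (K : ℕ) {ow : ℕ → Prop} {ed : ℕ → ℕ → Prop}
    [∀ u, Decidable (ow u)] [∀ u v, Decidable (ed u v)] {wt : Fin 3 → ℕ → ℕ → List Sym}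
    (how : ∀ u : Fin G.n, ow u ↔ G.owner u = true)
    (hed : ∀ u v : Fin G.n, ed u v ↔ (G.edge u v).isSome)
    (hwt : ∀ k (u v : Fin G.n), wt k u v = intCode (G.moveWeight K (u, v, k))) :
    (G.toQuery K).code = gameQueryCode G.n G.init ow ed wt := by
  have h1 : ∀ m, List.replicate (m * (G.n * 3)) (some true) =
      (List.range m).flatMap fun _ => (List.range G.n).flatMap fun _ =>
        List.replicate 3 (some true) := by
    intro m
    rw [unaryCode_mul]
    refine List.flatMap_congr fun _ _ => ?_
    rw [unaryCode_mul]
  have h2 : (tripleEquiv _ _ _ G.start).val = G.init * (G.n * 3) := by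
    rw [tripleEquiv_val]; simp [start]
  have h3 : tableCode (fun row => tableCode (optionCode fun d => tableCode ratCode d.prob) row)
      G.toMDP.trans = (List.range G.n).flatMap fun u => (List.range G.n).flatMap fun v =>
        (List.finRange 3).flatMap fun k => (List.range G.n).flatMap fun u' =>
        (List.range G.n).flatMap fun v' => (List.finRange 3).flatMap fun k' =>
          moveRowCode G.n G.init ow ed k k' u v u' v' := by
    rw [tableCode, flatMap_finRange_triple]
    refine flatMap_finRange _ _ _ fun u => flatMap_finRange _ _ _ fun v => ?_
    refine List.flatMap_congr fun k _ => ?_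
    rw [tableCode, flatMap_finRange_triple]
    refine flatMap_finRange _ _ _ fun u' => flatMap_finRange _ _ _ fun v' => ?_
    exact List.flatMap_congr fun k' _ => G.moveRowCode_eq how hed (u, v, k) (u', v', k')
  have h4 : tableCode intCode (G.weight K) = (List.range G.n).flatMap fun u =>
      (List.range G.n).flatMap fun v => (List.finRange 3).flatMap fun k => wt k u v := by
    rw [tableCode, flatMap_finRange_triple]
    refine flatMap_finRange _ _ _ fun u => flatMap_finRange _ _ _ fun v => ?_
    refine List.flatMap_congr fun k _ => ?_
    rw [hwt, weight, Equiv.symm_apply_apply]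
  change unaryCode (G.n * (G.n * 3)) ++ unaryCode (G.n * (G.n * 3)) ++
    unaryCode (tripleEquiv _ _ _ G.start).val ++ ratCode 1 ++
    tableCode (fun row => tableCode (optionCode fun d => tableCode ratCode d.prob) row)
      G.toMDP.trans ++ tableCode intCode (G.weight K) = _
  rw [h2, h3, h4]
  simp only [unaryCode, h1, gameQueryCode, List.append_assoc]

/-! ### Reading the code of a game -/

/-- The position after an optional integer. -/
def nextEntry (l : List Sym) (q : ℕ) : ℕ :=
  if l[q]? = some (some true) then wordEnd l q + 1
  else if l[q]? = some (some false) then q + 1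
  else q

/-- The position of the `k`-th optional integer from the position `b` on. -/
def entryPos (l : List Sym) (b : ℕ) : ℕ → ℕ
  | 0 => b
  | k + 1 => nextEntry l (entryPos l b k)

theorem getElem?_of_drop {α : Type*} {l r : List α} {q : ℕ} {a : α} (h : l.drop q = a :: r) :
    l[q]? = some a := by
  have := List.getElem?_drop (xs := l) (i := q) (j := 0)
  rw [h] at this
  simpa using this.symm

theorem drop_add_of_drop {α : Type*} {l r s : List α} {q : ℕ} (h : l.drop q = r ++ s) :
    l.drop (q + r.length) = s := by
  rw [← List.drop_drop, h, List.drop_left]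

/-- Tag, sign and digits form one word that ends at the separator, whereas an absent weight is a
single bit without a separator. This is why `nextEntry` branches on the tag. -/
theorem optionCode_some (z : ℤ) : optionCode intCode (some z) =
    (true :: decide (z < 0) :: z.natAbs.bits).map some ++ [none] := rfl

theorem drop_nextEntry {l r : List Sym} {q : ℕ} {o : Option ℤ}
    (h : l.drop q = optionCode intCode o ++ r) : l.drop (nextEntry l q) = r := by
  cases o with
  | none =>
    have h1 : l[q]? = some (some false) := getElem?_of_drop (r := r) (by rw [h]; rfl)
    rw [nextEntry, if_neg (by rw [h1]; simp), if_pos h1]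
    exact drop_add_of_drop (r := [some false]) h
  | some z =>
    have h1 : l[q]? = some (some true) := getElem?_of_drop (by rw [h]; rfl)
    rw [optionCode_some, List.append_assoc] at h
    rw [nextEntry, if_pos h1, wordEnd_eq (r := r) h, add_assoc]
    rw [← List.append_assoc] at h
    have := drop_add_of_drop h
    simpa using this

theorem drop_entryPos {l : List Sym} {b : ℕ} {es : List (Option ℤ)}
    (h : l.drop b = es.flatMap (optionCode intCode)) {k : ℕ} (hk : k ≤ es.length) :
    l.drop (entryPos l b k) = (es.drop k).flatMap (optionCode intCode) := by
  induction k with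
  | zero => exact h
  | succ k ih =>
    have h1 := ih (by omega)
    rw [List.drop_eq_getElem_cons (show k < es.length by omega), List.flatMap_cons] at h1
    exact drop_nextEntry h1

namespace MeanPayoffGame

variable (G : MeanPayoffGame)

/-- The code of a game. -/
def gameCode : List Sym := meanPayoffGames.code G

/-- The position of the weights in the code of a game. -/
def base : ℕ := G.n + 1 + G.init + 1 + G.n

theorem drop_zero_code : ∃ r, (G.gameCode).drop 0 =
    (List.replicate G.n true).map some ++ none :: r ∧ (G.gameCode).drop (G.n + 1) =
    (List.replicate G.init.val true).map some ++ none :: r.drop (G.init + 1) := by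
  refine ⟨unaryCode G.init ++ (tableCode (fun b => [some b]) G.owner ++
    tableCode (fun row => tableCode (optionCode intCode) row) G.edge), ?_, ?_⟩
  · rw [List.map_replicate]
    simp [gameCode, meanPayoffGames, unaryCode]
  · have h : (unaryCode G.n).length = G.n + 1 := by simp [unaryCode]
    have h' : (unaryCode G.init).length = G.init + 1 := by simp [unaryCode]
    have h1 : G.gameCode = unaryCode G.n ++ (unaryCode G.init ++
      (tableCode (fun b => [some b]) G.owner ++
      tableCode (fun row => tableCode (optionCode intCode) row) G.edge)) := by
      simp [gameCode, meanPayoffGames]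
    rw [h1, ← h, List.drop_left, ← h', List.drop_left, List.map_replicate]
    simp [unaryCode]

theorem wordEnd_zero : wordEnd (G.gameCode) 0 = G.n := by
  obtain ⟨r, h, -⟩ := G.drop_zero_code
  rw [wordEnd_eq h]
  simp

theorem wordEnd_succ : wordEnd (G.gameCode) (G.n + 1) = G.n + 1 + G.init := by
  obtain ⟨r, -, h⟩ := G.drop_zero_code
  rw [wordEnd_eq h]
  simp

theorem tableCode_owner : tableCode (fun b => [some b]) G.owner = (List.ofFn G.owner).map some := by
  rw [tableCode, ← List.map_eq_flatMap, List.ofFn_eq_map, List.map_map]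
  rfl

theorem drop_owner : (G.gameCode).drop (G.n + 1 + G.init + 1) =
    (List.ofFn G.owner).map some ++
      tableCode (fun row => tableCode (optionCode intCode) row) G.edge := by
  have h : (unaryCode G.n ++ unaryCode G.init).length = G.n + 1 + G.init + 1 := by
    simp [unaryCode]; omega
  have h1 : G.gameCode = (unaryCode G.n ++ unaryCode G.init) ++
      (tableCode (fun b => [some b]) G.owner ++
      tableCode (fun row => tableCode (optionCode intCode) row) G.edge) := by
    simp [gameCode, meanPayoffGames]
  rw [← h, h1, List.drop_left, tableCode_owner]

theorem getElem?_owner (u : Fin G.n) :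
    (G.gameCode)[G.n + 1 + G.init + 1 + u]? = some (some (G.owner u)) := by
  rw [← List.getElem?_drop, drop_owner, List.getElem?_append_left (by simp)]
  simp

/-- The weights in lexicographic order. -/
def entries : List (Option ℤ) :=
  (List.finRange (G.n * G.n)).map fun i =>
    G.edge (finProdFinEquiv.symm i).1 (finProdFinEquiv.symm i).2

theorem drop_base : (G.gameCode).drop G.base =
    G.entries.flatMap (optionCode intCode) := by
  have := drop_add_of_drop G.drop_owner
  rw [List.length_map, List.length_ofFn] at this
  rw [base, this, entries, List.flatMap_map, flatMap_finRange_mul]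
  simp only [Equiv.symm_apply_apply]
  rfl

theorem length_entries : G.entries.length = G.n * G.n := by simp [entries]

theorem drop_edge (u v : Fin G.n) : ∃ r, (G.gameCode).drop
    (entryPos (G.gameCode) G.base (u * G.n + v)) =
      optionCode intCode (G.edge u v) ++ r := by
  have h : u.val * G.n + v.val < G.n * G.n := by
    have h1 := u.isLt
    have h2 := v.isLt
    calc u.val * G.n + v.val < u.val * G.n + G.n := by omega
      _ = (u.val + 1) * G.n := by ring
      _ ≤ _ := Nat.mul_le_mul_right _ h1
  rw [drop_entryPos G.drop_base (by rw [length_entries]; omega),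
    List.drop_eq_getElem_cons (by rw [length_entries]; omega), List.flatMap_cons]
  refine ⟨(G.entries.drop (u * G.n + v + 1)).flatMap (optionCode intCode), ?_⟩
  congr 2
  have h3 : (⟨u.val * G.n + v.val, h⟩ : Fin (G.n * G.n)) = finProdFinEquiv (u, v) := by
    ext; simp [finProdFinEquiv]; ring
  simp [entries, h3, -finProdFinEquiv_symm_apply]

/-- Every entry of the table of weights takes at least one symbol. Hence the index of an edge fits
into a register. -/
theorem mul_self_le : G.n * G.n ≤ (G.gameCode).length := by
  have h1 := congrArg List.length G.drop_base
  have h2 : ∀ es : List (Option ℤ), es.length ≤ (es.flatMap (optionCode intCode)).length := by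
    intro es
    induction es with
    | nil => simp
    | cons o es ih =>
      rw [List.flatMap_cons, List.length_append, List.length_cons]
      have : 1 ≤ (optionCode intCode o).length := by cases o <;> simp [optionCode]
      omega
  have h3 := h2 G.entries
  rw [← h1, length_entries, List.length_drop] at h3
  omega

theorem base_le : G.base ≤ (G.gameCode).length := by
  have h1 := congrArg List.length G.drop_owner
  rw [List.length_append, List.length_map, List.length_ofFn, List.length_drop] at h1
  have h2 := Fin.pos G.init
  unfold base
  omega

/-- The binary digits of the weight are a segment of the code. -/
theorem weight_lt {u v : Fin G.n} {w : ℤ} (h : G.edge u v = some w) :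
    |w| ≤ (2 ^ (G.gameCode).length : ℕ) := by
  obtain ⟨r, hr⟩ := G.drop_edge u v
  have h1 := congrArg List.length hr
  rw [h, optionCode_some, List.length_drop] at h1
  simp only [List.length_append, List.length_map, List.length_cons] at h1
  rw [Int.abs_eq_natAbs]
  have h2 : w.natAbs.bits.length = w.natAbs.size := Nat.size_eq_bits_len _
  have h3 := Nat.lt_size_self w.natAbs
  have h4 : 2 ^ w.natAbs.size ≤ 2 ^ (G.gameCode).length :=
    Nat.pow_le_pow_right (by omega) (by omega)
  exact_mod_cast (h3.trans_le h4).le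

end MeanPayoffGame

/-! ### Writing the weights -/

/-- With the least significant digit first, a factor `2 ^ M` means `M` zeros in front. Scaled
weights are thus written without any arithmetic on numbers that exceed the registers. -/
theorem bits_two_pow_mul (M : ℕ) {m : ℕ} (hm : m ≠ 0) :
    (2 ^ M * m).bits = List.replicate M false ++ m.bits := by
  induction M with
  | zero => simp
  | succ M ih =>
    rw [pow_succ, mul_comm (2 ^ M), mul_assoc, Nat.bit0_bits _ (by positivity), ih,
      List.replicate_succ, List.cons_append]

/-- The code of an optional integer at the position `q`, multiplied by `2 ^ M`. -/
def scaledCode (l : List Sym) (M q : ℕ) : List Sym :=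
  if l[q]? = some (some true) then
    (if l[(q + 1) % M]? = some (some true) then [some true] else [some false]) ++
    -- The number zero has no digits at all, and must not be given zeros in front.
    ((if wordEnd l q = ((q + 1) % M + 1) % M then [] else
      (List.range M).flatMap fun _ => [some false]) ++
    (((List.range M).flatMap fun i => if (q + 1) % M < i ∧ i < wordEnd l q then
      (if l[i]? = some (some true) then [some true] else [some false]) else []) ++ [none]))
  else [some false, none]

theorem flatMap_range_bits {l r : List Sym} {a M : ℕ} {w : List Bool}
    (h : l.drop (a + 1) = w.map some ++ r) (hM : a + 1 + w.length ≤ M) :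
    ((List.range M).flatMap fun i => if a < i ∧ i < a + 1 + w.length then
      (if l[i]? = some (some true) then [some true] else [some false]) else []) = w.map some := by
  obtain ⟨k, rfl⟩ := Nat.exists_eq_add_of_le hM
  rw [List.range_add, List.flatMap_append, List.range_add, List.flatMap_append]
  have h1 : (List.range (a + 1)).flatMap (fun i => if a < i ∧ i < a + 1 + w.length then
      (if l[i]? = some (some true) then [some true] else [some false]) else []) = [] := by
    rw [List.flatMap_eq_nil_iff]
    intro i hi
    rw [if_neg (by have := List.mem_range.1 hi; omega)]
  have h2 : ((List.range k).map (a + 1 + w.length + ·)).flatMap (fun i =>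
      if a < i ∧ i < a + 1 + w.length then
      (if l[i]? = some (some true) then [some true] else [some false]) else []) = [] := by
    rw [List.flatMap_eq_nil_iff]
    intro i hi
    obtain ⟨j, -, rfl⟩ := List.mem_map.1 hi
    rw [if_neg (by omega)]
  have h3 : ((List.range w.length).map (a + 1 + ·)).flatMap (fun i =>
      if a < i ∧ i < a + 1 + w.length then
      (if l[i]? = some (some true) then [some true] else [some false]) else []) = w.map some := by
    rw [List.flatMap_map, ← List.map_coe_finRange_eq_range, List.flatMap_map]
    calc _ = (List.finRange w.length).flatMap fun i => [some w[i]] := by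
          refine List.flatMap_congr fun i _ => ?_
          have h4 : l[a + 1 + i.val]? = some (some w[i]) := by
            rw [← List.getElem?_drop, h, List.getElem?_append_left (by simp)]
            simp
          rw [if_pos (by omega), h4]
          cases w[i] <;> simp
      _ = _ := by
          rw [← List.map_eq_flatMap]
          refine List.ext_getElem (by simp) fun i _ _ => by simp
  rw [h1, h2, h3]
  simp

theorem scaledCode_eq {l r : List Sym} {M q : ℕ} {o : Option ℤ}
    (h : l.drop q = optionCode intCode o ++ r) (hM : l.length < M) :
    scaledCode l M q = intCode ((2 ^ M : ℕ) * o.getD 0) := by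
  cases o with
  | none =>
    have h1 : l[q]? = some (some false) := getElem?_of_drop (r := r) (by rw [h]; rfl)
    rw [scaledCode, if_neg (by rw [h1]; simp)]
    simp [intCode, natCode]
  | some z =>
    have h1 : l[q]? = some (some true) := getElem?_of_drop (by rw [h]; rfl)
    have h2 : l.drop (q + 1) = some (decide (z < 0)) :: (z.natAbs.bits.map some ++ none :: r) := by
      refine drop_add_of_drop (r := [some true]) ?_
      rw [h, optionCode_some]; simp
    have h3 : l.drop (q + 1 + 1) = z.natAbs.bits.map some ++ none :: r :=
      drop_add_of_drop (r := [some (decide (z < 0))]) h2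
    have h4 : wordEnd l q = q + 1 + 1 + z.natAbs.bits.length := by
      rw [wordEnd_eq (r := r) (w := true :: decide (z < 0) :: z.natAbs.bits)
        (by rw [h, optionCode_some]; simp)]
      simp; omega
    have h5 := congrArg List.length h3
    simp only [List.length_drop, List.length_append, List.length_cons, List.length_map] at h5
    have h6 := getElem?_of_drop h2
    rw [scaledCode, if_pos h1, Nat.mod_eq_of_lt (show q + 1 < M by omega),
      Nat.mod_eq_of_lt (show q + 1 + 1 < M by omega), h4, flatMap_range_bits h3 (by omega), h6,
      ← replicate_eq_flatMap]
    have h7 : (if (some (some (decide (z < 0))) : Option Sym) = some (some true) then [some true]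
        else [some false]) = [some (decide (z < 0))] := by
      by_cases hz : z < 0 <;> simp [hz]
    rw [h7, intCode, natCode, Option.getD_some, Int.natAbs_mul, Int.natAbs_natCast]
    have h8 : decide (((2 ^ M : ℕ) : ℤ) * z < 0) = decide (z < 0) := by
      have : (0 : ℤ) < (2 ^ M : ℕ) := by positivity
      rw [decide_eq_decide, mul_neg_iff]
      constructor
      · rintro (h | h)
        · exact h.2
        · omega
      · intro h; exact Or.inl ⟨this, h⟩
    rw [h8]
    by_cases hz : z = 0
    · subst hz; simp
    · have hz' : z.natAbs ≠ 0 := by omega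
      have hb : z.natAbs.bits.length ≠ 0 := by
        rw [Nat.size_eq_bits_len]
        intro h; exact hz' (Nat.size_eq_zero.1 h)
      rw [if_neg (by omega), bits_two_pow_mul _ hz']
      simp

/-- The codes of the weights for a game with the code `l`, where the weights start at `b`. -/
def moveWeightCode (l : List Sym) (M n b : ℕ) (k : Fin 3) (u v : ℕ) : List Sym :=
  if k = 0 then intCode 3
  else if k = 1 then scaledCode l M (entryPos l b ((u * n % M + v) % M))
  else [some false] ++ (((List.range M).flatMap fun _ => [some false]) ++
    (((List.range M).flatMap fun _ => [some false]) ++ [some true, none]))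

namespace MeanPayoffGame

variable (G : MeanPayoffGame)

theorem index_eq {M : ℕ} (hM : G.gameCode.length < M) (u v : Fin G.n) :
    (u * G.n % M + v) % M = u * G.n + v := by
  have h1 := u.isLt
  have h2 := v.isLt
  have h3 := G.mul_self_le
  have h4 : u.val * G.n + v.val < M := by
    calc u.val * G.n + v.val < u.val * G.n + G.n := by omega
      _ = (u.val + 1) * G.n := by ring
      _ ≤ G.n * G.n := Nat.mul_le_mul_right _ h1
      _ < M := by omega
  rw [Nat.mod_eq_of_lt (a := u.val * G.n) (by omega), Nat.mod_eq_of_lt h4]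

theorem moveWeightCode_eq {M : ℕ} (hM : G.gameCode.length < M) (k : Fin 3)
    (u v : Fin G.n) : moveWeightCode G.gameCode M G.n G.base k u v =
      intCode (G.moveWeight (2 ^ M) (u, v, k)) := by
  unfold moveWeightCode moveWeight
  simp only [G.index_eq hM]
  split_ifs with h1 h2
  · rfl
  · obtain ⟨r, hr⟩ := G.drop_edge u v
    exact scaledCode_eq hr hM
  · have h3 : (((2 ^ M : ℕ) : ℤ) * (2 ^ M : ℕ)) = ((2 ^ M * (2 ^ M * 1) : ℕ) : ℤ) := by
      push_cast; ring
    rw [h3, intCode, natCode, Int.natAbs_natCast, bits_two_pow_mul _ (by positivity),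
      bits_two_pow_mul _ one_ne_zero, ← replicate_eq_flatMap]
    have h4 : decide (((2 ^ M * (2 ^ M * 1) : ℕ) : ℤ) < 0) = false := by
      rw [decide_eq_false_iff_not]; omega
    rw [h4]
    simp

end MeanPayoffGame

/-! ### The reduction -/

theorem IsOut.gridCodeBelow {X I : Type} {code : X → List I} {c d g : ℕ} {N : X → ℕ}
    (hN : IsNum code c 0 fun x _ => N x) (k : ℕ) {φ : X → (ℕ → ℕ) → ℕ → ℕ → Fin g → Prop}
    [∀ x e t i γ, Decidable (φ x e t i γ)]
    (h : ∀ γ, IsForm code c (d + 2) fun x e => φ x e (e d) (e (d + 1)) γ)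
    (h1 : ∀ x e v t i γ, φ x (Function.update e d v) t i γ ↔ φ x e t i γ)
    (h2 : ∀ x e v t i γ, φ x (Function.update e (d + 1) v) t i γ ↔ φ x e t i γ) :
    IsOut code c d fun x e => WindowMDP.gridCode (N x) g k (φ x e) := by
  have : IsOut code c d fun x e => [some true] ++ (List.range (N x)).flatMap fun t =>
      (List.range (N x)).flatMap fun i => (List.finRange g).flatMap fun γ =>
      WindowMDP.uniformCode k (φ x e t i γ) := by
    refine (IsOut.emit (some true)).append (.forBelow hN (F := fun x e t =>
      (List.range (N x)).flatMap fun i =>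
      (List.finRange g).flatMap fun γ => WindowMDP.uniformCode k (φ x e t i γ))
      (.forBelow hN (F := fun x e i => (List.finRange g).flatMap fun γ =>
        WindowMDP.uniformCode k (φ x e (e d) i γ))
      (.forList _ fun γ _ => .uniformCode k (h γ)) ?_) ?_)
    · intro x e v i
      rw [Function.update_of_ne (by omega)]
      simp only [WindowMDP.uniformCode, h2]
    · intro x e v i
      simp only [WindowMDP.uniformCode, h1]
  exact this

/-! ### Positions of the entries in the code of a game. -/

section
variable {X : Type} {code : X → List Sym} {c d : ℕ} {f : X → (ℕ → ℕ) → ℕ}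

theorem IsNum.nextEntry (hf : IsNum code c d f) :
    IsNum code c d fun x e => nextEntry (code x) (f x e) :=
  (IsNum.cases (.letter (some true) hf) hf.wordEnd.succ
    (.cases (.letter (some false) hf) hf.succ hf)).congr fun x e he => by
      have h0 := length_lt_bnd (code := code) (c := c) x
      unfold WindowMDP.nextEntry
      split_ifs with h1 h2
      · have h3 := (List.getElem?_eq_some_iff.1 h1).1
        have := wordEnd_lt (Nat.lt_succ_self _) (by omega : f x e < (code x).length + 1)
        exact Nat.mod_eq_of_lt (by omega)
      · have h3 := (List.getElem?_eq_some_iff.1 h2).1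
        exact Nat.mod_eq_of_lt (by omega)
      · rfl

theorem IsNum.entryPos {b : X → ℕ} (hb : IsNum code c 0 fun x _ => b x) (hf : IsNum code c d f) :
    IsNum code c d fun x e => entryPos (code x) (b x) (f x e) := by
  refine at1 (R := fun x k => WindowMDP.entryPos (code x) (b x) k) ?_ hf
  refine (IsNum.fold (d := 1) hb.at0
    (H := fun x e i r => if i < e 0 then WindowMDP.nextEntry (code x) r else r)
    (.cases (.lt (.var (a := 2) (by omega)) (.var (a := 0) (by omega)))
      (.nextEntry (.var (a := 1) (by omega))) (.var (a := 1) (by omega)))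
    (fun _ _ _ _ _ => by simp) (fun _ _ _ _ _ => by simp)).congr fun x e he => ?_
  have key : ∀ m, iterNum (fun i r => if i < e 0 then WindowMDP.nextEntry (code x) r else r) m
      (b x) = WindowMDP.entryPos (code x) (b x) (min m (e 0)) := by
    intro m
    induction m with
    | zero => simp [iterNum, WindowMDP.entryPos]
    | succ m ih =>
      simp only [iterNum, ih]
      split_ifs with h
      · rw [min_eq_left (by omega), min_eq_left (by omega)]; rfl
      · rw [min_eq_right (by omega), min_eq_right (by omega)]
  rw [key, min_eq_right (he 0).le]

end

namespace MeanPayoffGame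

variable {c d : ℕ} {f g : MeanPayoffGame → (ℕ → ℕ) → ℕ}

theorem isNum_n : IsNum gameCode c d fun G _ => G.n :=
  ((IsNum.zero (d := d)).wordEnd).congr fun G _ _ => G.wordEnd_zero

theorem isNum_end : IsNum gameCode c d fun G _ => G.n + 1 + G.init :=
  (isNum_n.succ.wordEnd).congr fun G _ _ => by
    have h1 := G.base_le
    have h2 := length_lt_bnd (code := gameCode) (c := c) G
    unfold base at h1
    rw [Nat.mod_eq_of_lt (by omega)]
    exact G.wordEnd_succ

theorem isNum_owner (hf : IsNum gameCode c d f) :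
    IsNum gameCode c d fun G e =>
      (G.n + 1 + G.init + 1 + f G e) % bnd gameCode c G :=
  (isNum_end.succ.add hf).congr fun G _ _ => by rw [Nat.mod_add_mod]

theorem isNum_base : IsNum gameCode c d fun G _ => G.base :=
  (isNum_owner isNum_n).congr fun G _ _ => by
    have h1 := G.base_le
    have h2 := length_lt_bnd (code := gameCode) (c := c) G
    unfold base at h1 ⊢
    exact Nat.mod_eq_of_lt (by omega)

/-- Instead of a subtraction, the initial vertex is searched as the number that leads from the
position `G.n + 1` to the end of its unary word. -/
theorem isNum_init : IsNum gameCode c 0 fun G _ => (G.init : ℕ) := by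
  refine IsNum.at1 (f := fun _ _ => 0) (R := fun (G : MeanPayoffGame) _ => (G.init : ℕ)) (IsNum.the
    (f := fun (G : MeanPayoffGame) _ => (G.init : ℕ)) (R := fun G _ i =>
    (G.n + 1 + i) % bnd gameCode c G = G.n + 1 + G.init) ?_ ?_) .zero
  · refine .eq ((isNum_n.succ.add (.var (a := 1) (by omega))).congr fun G _ _ => ?_) isNum_end
    rw [Nat.mod_add_mod]
  · intro G q _
    have h1 := G.base_le
    have h2 := length_lt_bnd (code := gameCode) (c := c) G
    unfold base at h1
    refine ⟨by omega, fun i hi => ⟨fun h => ?_, fun h => ?_⟩⟩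
    · by_cases hc : G.n + 1 + i < bnd gameCode c G
      · rw [Nat.mod_eq_of_lt hc] at h; omega
      -- A sum that wraps around is smaller than `G.n + 1`, so it yields no second solution.
      · rw [Nat.mod_eq_sub_mod (by omega), Nat.mod_eq_of_lt (by omega)] at h
        omega
    · rw [h, Nat.mod_eq_of_lt (by omega)]

/-- The position of the weight of an edge. -/
def edgePos (c : ℕ) (G : MeanPayoffGame) (u v : ℕ) : ℕ :=
  entryPos G.gameCode G.base
    ((u * G.n % bnd gameCode c G + v) % bnd gameCode c G)

theorem isNum_edgePos (hf : IsNum gameCode c d f)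
    (hg : IsNum gameCode c d g) :
    IsNum gameCode c d fun G e => edgePos c G (f G e) (g G e) :=
  .entryPos isNum_base (.add (.mul hf isNum_n) hg)

/-- The owner and the edges, as they are read in the code. -/
def OwnerBit (c : ℕ) (G : MeanPayoffGame) (u : ℕ) : Prop :=
  G.gameCode[(G.n + 1 + G.init + 1 + u) % bnd gameCode c G]? =
    some (some true)

def EdgeBit (c : ℕ) (G : MeanPayoffGame) (u v : ℕ) : Prop :=
  G.gameCode[edgePos c G u v]? = some (some true)

instance (G : MeanPayoffGame) (u : ℕ) : Decidable (OwnerBit c G u) :=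
  inferInstanceAs (Decidable (_ = _))

instance (G : MeanPayoffGame) (u v : ℕ) : Decidable (EdgeBit c G u v) :=
  inferInstanceAs (Decidable (_ = _))

theorem ownerBit_iff (G : MeanPayoffGame) (u : Fin G.n) :
    OwnerBit c G u ↔ G.owner u = true := by
  have h1 := G.base_le
  have h2 := length_lt_bnd (code := gameCode) (c := c) G
  have h3 := u.isLt
  unfold base at h1
  rw [OwnerBit, Nat.mod_eq_of_lt (by omega), getElem?_owner]
  simp

theorem edgeBit_iff (G : MeanPayoffGame) (u v : Fin G.n) :
    EdgeBit c G u v ↔ (G.edge u v).isSome := by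
  have h2 := length_lt_bnd (code := gameCode) (c := c) G
  obtain ⟨r, hr⟩ := G.drop_edge u v
  rw [EdgeBit, edgePos, G.index_eq (by omega)]
  cases h : G.edge u v with
  | none =>
    rw [h] at hr
    rw [getElem?_of_drop (a := some false) (r := r) (by rw [hr]; rfl)]
    simp
  | some w =>
    rw [h] at hr
    rw [getElem?_of_drop (a := some true) (by rw [hr]; rfl)]
    simp

theorem isForm_ownerBit (hf : IsNum gameCode c d f) :
    IsForm gameCode c d fun G e => OwnerBit c G (f G e) :=
  .letter (some true) (isNum_owner hf)

theorem isForm_edgeBit (hf : IsNum gameCode c d f)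
    (hg : IsNum gameCode c d g) :
    IsForm gameCode c d fun G e => EdgeBit c G (f G e) (g G e) :=
  .letter (some true) (isNum_edgePos hf hg)

theorem isOut_moveRowCode (k k' : Fin 3) : IsOut gameCode c 4 fun G e =>
    moveRowCode G.n G.init (OwnerBit c G) (EdgeBit c G) k k' (e 0) (e 1) (e 2) (e 3) := by
  have v : ∀ {d} i, i < d → IsNum gameCode c d fun _ e => e i := fun i hi => .var hi
  have hc : IsForm gameCode c 6 fun G e =>
      (e 1 + 1 = G.n ∧ e 5 = 0) ∨ (¬ e 1 + 1 = G.n ∧ e 5 = e 1 + 1) := by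
    have h : IsForm gameCode c 6 fun G e => e 1 + 1 = G.n :=
      (IsForm.eqSucc isNum_n (v 1 (by omega))).congr fun G e _ => eq_comm
    exact .or (.and h (.eq (v 5 (by omega)) .zero))
      (.and h.not (.eqSucc (v 5 (by omega)) (v 1 (by omega))))
  refine .cases (.and (.const _) (isForm_ownerBit (v 0 (by omega))))
    (.cases (.and (.eq (v 2 (by omega)) (v 0 (by omega))) (.and (.const _)
      (isForm_edgeBit (v 0 (by omega)) (v 3 (by omega))))) (.gridCodeBelow isNum_n 1
        (fun γ => .and (.eq (v 4 (by omega)) (v 0 (by omega)))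
        (.and (.eq (v 5 (by omega)) (v 3 (by omega))) (.const _))) ?_ ?_) (.const _))
    (.cases (.and (.eq (v 2 (by omega)) (v 0 (by omega)))
      (.and (.eq (v 3 (by omega)) (v 1 (by omega))) (.const _)))
      (.cases (.const _) (.cases (isForm_edgeBit (v 0 (by omega)) (v 1 (by omega)))
        (.gridCodeBelow isNum_n 2 (fun γ => .or (.and (.eq (v 4 (by omega)) (v 0 (by omega)))
          (.and (.eq (v 5 (by omega)) (v 1 (by omega))) (.const _)))
          (.and (.eq (v 4 (by omega)) (v 0 (by omega))) (.and hc (.const _)))) ?_ ?_)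
        (.gridCodeBelow isNum_n 1 (fun γ => .and (.eq (v 4 (by omega)) (v 0 (by omega)))
          (.and hc (.const _))) ?_ ?_))
      (.cases (.const _) (.gridCodeBelow isNum_n 2 (fun γ =>
          .or (.and (.eq (v 4 (by omega)) (v 1 (by omega)))
          (.and (.eq (v 5 (by omega)) .zero) (.const _)))
          (.and (.eq (v 4 (by omega)) (v 0 (by omega)))
          (.and (.eq (v 5 (by omega)) (v 1 (by omega))) (.const _)))) ?_ ?_)
        (.gridCodeBelow isNum_n 1 (fun γ => .and (.eq (v 4 (by omega)) isNum_init.at0)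
          (.and (.eq (v 5 (by omega)) .zero) (.const _))) ?_ ?_))) (.const _))
  all_goals intros; simp

theorem isOut_scaledCode (hf : IsNum gameCode c d f) :
    IsOut gameCode c d fun G e =>
      scaledCode G.gameCode (bnd gameCode c G) (f G e) := by
  have hv : IsNum gameCode c (d + 1) fun _ e => e d := .var (by omega)
  have h : IsOut gameCode c (d + 1) fun G e => scaledCode G.gameCode (bnd gameCode c G) (e d) := by
    refine .cases (.letter _ hv) (.append (.cases (.letter _ hv.succ) (.const _) (.const _))
      (.append (.cases (.eq hv.wordEnd hv.succ.succ) .nil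
        (.forRange (.const _) fun _ _ _ _ => rfl)) (.append (.forRange
        (F := fun G e i => if (e d + 1) % bnd gameCode c G < i ∧ i < wordEnd G.gameCode (e d) then
          (if G.gameCode[i]? = some (some true) then [some true] else [some false]) else [])
        (.cases (.and (.lt hv.weaken.succ (.var (a := d + 1) (by omega)))
          (.lt (.var (a := d + 1) (by omega)) hv.weaken.wordEnd))
          (.cases (.letter _ (.var (a := d + 1) (by omega))) (.const _) (.const _)) .nil) ?_)
        (.const _)))) (.const _)
    intro G e v i
    rw [Function.update_of_ne (by omega)]
  exact (IsOut.bind hf h).congr fun G e _ => by rw [Function.update_self]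

theorem isOut_moveWeightCode (k : Fin 3) : IsOut gameCode c 2 fun G e =>
    moveWeightCode G.gameCode (bnd gameCode c G) G.n G.base k
      (e 0) (e 1) := by
  have hz : IsOut gameCode c 2 fun G _ =>
      (List.range (bnd gameCode c G)).flatMap fun _ => [some false] :=
    .forRange (.const _) fun _ _ _ _ => rfl
  exact .cases (.const _) (.const _) (.cases (.const _)
    (isOut_scaledCode (isNum_edgePos (.var (by omega)) (.var (by omega))))
    ((IsOut.const _).append (hz.append (hz.append (.const _)))))

theorem isOut_gameQueryCode : IsOut gameCode c 0 fun G _ =>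
    gameQueryCode G.n G.init (OwnerBit c G) (EdgeBit c G)
      (moveWeightCode G.gameCode (bnd gameCode c G) G.n G.base) := by
  have h1 : IsOut gameCode c 0 fun G _ => (List.range G.n).flatMap fun _ =>
      (List.range G.n).flatMap fun _ => List.replicate 3 (some true) :=
    .forBelow isNum_n (.forBelow isNum_n (.const _) fun _ _ _ _ => rfl) fun _ _ _ _ => rfl
  have h2 : IsOut gameCode c 0 fun G _ => (List.range G.init).flatMap fun _ =>
      (List.range G.n).flatMap fun _ => List.replicate 3 (some true) :=
    .forBelow isNum_init (.forBelow isNum_n (.const _) fun _ _ _ _ => rfl) fun _ _ _ _ => rfl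
  refine h1.append ((IsOut.const _).append (h1.append ((IsOut.const _).append (.append
    h2 ((IsOut.const _).append (.append ?_ ?_))))))
  · refine .forBelow isNum_n (F := fun G e u => (List.range G.n).flatMap fun v =>
      (List.finRange 3).flatMap fun k => (List.range G.n).flatMap fun u' =>
      (List.range G.n).flatMap fun v' => (List.finRange 3).flatMap fun k' =>
      moveRowCode G.n G.init (OwnerBit c G) (EdgeBit c G) k k' u v u' v')
      (.forBelow isNum_n (F := fun G e v =>
      (List.finRange 3).flatMap fun k => (List.range G.n).flatMap fun u' =>
      (List.range G.n).flatMap fun v' => (List.finRange 3).flatMap fun k' =>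
      moveRowCode G.n G.init (OwnerBit c G) (EdgeBit c G) k k' (e 0) v u' v')
      (.forList _ fun k _ => .forBelow isNum_n (F := fun G e u' =>
      (List.range G.n).flatMap fun v' => (List.finRange 3).flatMap fun k' =>
      moveRowCode G.n G.init (OwnerBit c G) (EdgeBit c G) k k' (e 0) (e 1) u' v')
      (.forBelow isNum_n (F := fun G e v' => (List.finRange 3).flatMap fun k' =>
      moveRowCode G.n G.init (OwnerBit c G) (EdgeBit c G) k k' (e 0) (e 1) (e 2) v')
      (.forList _ fun k' _ => isOut_moveRowCode k k') ?_) ?_) ?_) ?_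
    all_goals intros; simp
  · refine .forBelow isNum_n (F := fun G e u => (List.range G.n).flatMap fun v =>
      (List.finRange 3).flatMap fun k => moveWeightCode G.gameCode
        (bnd gameCode c G) G.n G.base k u v)
      (.forBelow isNum_n (F := fun G e v => (List.finRange 3).flatMap fun k =>
        moveWeightCode G.gameCode (bnd gameCode c G) G.n G.base k (e 0) v)
      (.forList _ fun k _ => isOut_moveWeightCode k) ?_) ?_
    all_goals intros; simp

end MeanPayoffGame

/-- The factor `K` is two to the power `bnd`. Only its exponent has to be in the polynomial range of
the loops, while `K` itself exceeds the bounds of `yes_iff_toMDP`, which are exponential in the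
length of the code. -/
theorem meanPayoffGames_reduce : LogspaceReduces meanPayoffGames boundedWindowMeanPayoff.problem := by
  -- For a code of length `N`, weights are at most `2 ^ N`, and `n`, `n + 1` and `n + 2` are at most
  -- `2 ^ (N + 1)`. With the factor `4`, the lower bound required of `K` is at most `2 ^ (4 N + 5)`.
  obtain ⟨c, hc⟩ := Polynomial.exists_le_pow_size (4 * Polynomial.X + 5)
  have hM : ∀ G : MeanPayoffGame, 4 * G.gameCode.length + 5 ≤ bnd MeanPayoffGame.gameCode c G := by
    intro G
    unfold bnd
    have := hc c le_rfl G.gameCode.length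
    simpa using this
  refine ⟨fun G : MeanPayoffGame => G.toQuery (2 ^ bnd MeanPayoffGame.gameCode c G), fun G : MeanPayoffGame => ?_,
    IsOut.logspaceComputable MeanPayoffGame.isOut_gameQueryCode fun G : MeanPayoffGame =>
      (MeanPayoffGame.toQuery_code G _ (MeanPayoffGame.ownerBit_iff G)
        (MeanPayoffGame.edgeBit_iff G) fun k u v => MeanPayoffGame.moveWeightCode_eq G ?_ k u v).symm⟩
  · have h1 := hM G
    set N := G.gameCode.length with hN
    have h2 : G.n + 2 ≤ 2 ^ (N + 1) := by
      have h3 := MeanPayoffGame.base_le G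
      have h4 : N + 1 < 2 ^ (N + 1) := Nat.lt_two_pow_self
      unfold MeanPayoffGame.base at h3
      omega
    have h3 := MeanPayoffGame.yes_iff_toMDP (G := G) (W := 2 ^ N)
      (K := 2 ^ bnd MeanPayoffGame.gameCode c G) (fun u v w h => MeanPayoffGame.weight_lt G h) ?_ ?_
    · refine h3.trans (exists_congr fun σ => ?_)
      have h4 : (((1 : ℚ≥0) : ℝ≥0) : ℝ≥0∞) = 1 := by simp
      change _ ↔ (((1 : ℚ≥0) : ℝ≥0) : ℝ≥0∞) ≤ _
      rw [h4]
      rfl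
    · calc (G.n + 1) * 2 ^ N ≤ 2 ^ (N + 1) * 2 ^ N :=
            Nat.mul_le_mul_right _ (by omega)
        _ = 2 ^ (N + 1 + N) := (pow_add _ _ _).symm
        _ ≤ _ := Nat.pow_le_pow_right (by omega) (by omega)
    · calc _ ≤ 4 * (2 ^ (N + 1) * (2 ^ (N + 1) * 2 ^ N) * 2 ^ (N + 1)) := by
            refine Nat.mul_le_mul_left _ (Nat.mul_le_mul (Nat.mul_le_mul (by omega)
              (Nat.mul_le_mul_right _ (by omega))) h2)
        _ = 2 ^ (4 * N + 5) := by ring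
        _ ≤ _ := Nat.pow_le_pow_right (by omega) h1
  · have := hM G
    omega

end WindowMDP

theorem theorem6p4 :
    (PHard fixedWindowParity.problem ∧ PHard fixedWindowMeanPayoff.problem ∧
      fixedWindowParity.PolyMemoryNecessary ∧ fixedWindowMeanPayoff.PolyMemoryNecessary) ∧
    PHard boundedWindowParity.problem ∧
    LogspaceReduces meanPayoffGames boundedWindowMeanPayoff.problem := by
  exact ⟨⟨pHard_fixedWindowParity, pHard_fixedWindowMeanPayoff,
    polyMemoryNecessary_fixedWindowParity, polyMemoryNecessary_fixedWindowMeanPayoff⟩,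
    pHard_boundedWindowParity, meanPayoffGames_reduce⟩
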